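/- Let $\mathfrak g$ be a finite-dimensional complex Lie superalgebra with an even supersymmetric invariant nondegenerate bilinear form $(\cdot|\cdot)$ and a $\mathbb Z$-grading $\mathfrak g=\bigoplus_{k=-d}^{d}\mathfrak g_k$ ($d>0$) by sub-superspaces such that $(\mathfrak g_k|\mathfrak g_l)=0$ for $k+l\ne0$. Let $\mathfrak n\subset\mathfrak g_{>0}$ be a homogeneous subalgebra, $\mathfrak m\subset\mathfrak n$ a homogeneous $\mathfrak n$-submodule, $\mathfrak b=\mathfrak m^{\perp}$, and let $f\in\mathfrak g_{-i}$, $s\in\mathfrak g_j$ ($1\le i,j\le d$) be odd elements such that: $\mathfrak g_{\ge i}\subset\mathfrak m$; $[f,\mathfrak n]\subset\mathfrak b$; $\operatorname{ad}f|_{\mathfrak n}$ is injective; $[s,\mathfrak n]=0$; and, with $\Lambda=f+zs$ and $\Lambda^2=\frac12[\Lambda,\Lambda]$, $\hat{\mathfrak g}:=\mathfrak g((z^{-1}))=\mathcal K\oplus\operatorname{im}\operatorname{ad}\Lambda^2$, where $\mathcal K=\ker\operatorname{ad}\Lambda^2$. Let $\mathcal Z$ be the center of $\mathcal K$. Let $(q^t)_{t\in\tilde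 I}$, $(q_t)_{t\in\tilde I}$ be homogeneous bases of $\mathfrak g$ with $(q^t|q_{t'})=\delta_{t,t'}$, and $J\subset I\subset\tilde I$ with $\mathfrak b=\operatorname{span}\{q^t\}_{t\in I}$, $[f,\mathfrak n]=\operatorname{span}\{q^t\}_{t\in J}$; put $\mathfrak b_-=\operatorname{span}\{q_t\}_{t\in I}$. Let $\mathcal P(\bar{\mathfrak g})=S(\mathbb C[D]\otimes\bar{\mathfrak g})$ ($\bar{\mathfrak g}$ is $\mathfrak g$ with reversed parity, $D$ an odd derivation), with the two supersymmetric Poisson vertex algebra brackets determined by $\{\bar a_\chi\bar b\}_1=(-1)^{p(a)}(\overline{[a,b]}+\chi(a|b))$ and $\{\bar a_\chi\bar b\}_2=(-1)^{p(a)+1}(s|[a,b])$. Let $\mathcal I_{f,\mathfrak m}$ be the differential ideal generated by $\bar m-(f|m)$, $m\in\mathfrak m$, so that $\mathcal P(\bar{\mathfrak g})/\mathcal I_{f,\mathfrak m}\simeq\mathcal P:=S(\mathbb C[D]\otimes\bar{\mathfrak b}_-)$, and let $$\mathcal W=\mathcal W(\mathfrak g,\mathfrak n,\mathfrak m,f)=\{a\in\mathcal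 P:\ \{\bar n_\chi a\}_1\in\mathcal I_{f,\mathfrak m}[\chi]\ \text{for all } n\in\mathfrak n\},$$ with the brackets $\{a_\chi b\}^{\mathcal W}_{k}=\{a_\chi b\}_k \bmod \mathcal I_{f,\mathfrak m}$, $k=1,2$. Then there are an even $N\in\mathfrak n\otimes\mathcal P$ and $w_t\in\mathcal P$ ($t\in I\setminus J$), of parity $p(q^t)+1$, with $$e^{\operatorname{ad}N}\Big(D+\sum_{t\in I}q^t\otimes\bar q_t+f\otimes1\Big)=D+\sum_{t\in I\setminus J}q^t\otimes w_t+f\otimes1 ,$$ and, for $\mathcal L^c=D+\sum_{t\in I\setminus J}q^t\otimes w_t+\Lambda\otimes1$ and $\mathcal P_w$ the differential superalgebra generated by the $w_t$, there are an even $T\in\operatorname{im}\operatorname{ad}\Lambda^2\otimes\mathcal P_w$ of positive degree ($z$ having degree $-i-j$; the tensor product being completed) and $H\in\mathcal K\otimes\mathcal P_w$ with $e^{\operatorname{ad}T}\frac12[\mathcal L^c,\mathcal L^c]=D^2+H+\Lambda^2\otimes1$, and $K$ with $e^{\operatorname{ad}T}\mathcal L^c=D+K+\Lambda\otimes1$.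 For $C\in\mathcal Z$ put $h_C=(K|C\otimes1)$. For all such data, $w_t\in\mathcal W$ and $h_C\in\mathcal W$, the super Hamiltonian flows $$\frac{d\phi}{dt_C}=\{h_C{}_\chi\phi\}_1^{\mathcal W}\big|_{\chi=0},\qquad \phi\in\mathcal W\quad(\text{in particular }\phi=w_t,\ t\in I\setminus J),\qquad C\in\mathcal Z,$$ preserve $\mathcal W$, and: 1. they are pairwise compatible: for $C,C'\in\mathcal Z$ of parities $p,q$, $\frac{d}{dt_C}\frac{d}{dt_{C'}}=(-1)^{pq}\frac{d}{dt_{C'}}\frac{d}{dt_C}$ on $\mathcal W$; 2. all $\int h_{C'}$, $C'\in\mathcal Z$, are integrals of motion of each of them: $\{h_C{}_\chi h_{C'}\}_1^{\mathcal W}|_{\chi=0}\in D\mathcal W$ for all $C,C'\in\mathcal Z$; 3. they are bi-Hamiltonian: for $C\in\mathcal Z$ one has $zC\in\mathcal Z$ and $\{h_C{}_\chi\phi\}_1^{\mathcal W}|_{\chi=0}=\{h_{zC}{}_\chi\phi\}_2^{\mathcal W}|_{\chi=0}$ for all $\phi\in\mathcal W$, in particular for $\phi=w_t$, $t\in I\setminus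 J$. -/

import Mathlib

open scoped TensorProduct

noncomputable section

namespace SuperDS

/-- The sign `(-1)^p` attached to a parity `p`. -/
def sgn (p : ZMod 2) : ℂ := if p = 0 then 1 else -1

theorem sgn_add (p q : ZMod 2) : sgn (p + q) = sgn p * sgn q := by
  have h : ∀ a : ZMod 2, a = 0 ∨ a = 1 := by decide
  have h2 : (1 + 1 : ZMod 2) = 0 := by decide
  rcases h p with rfl | rfl <;> rcases h q with rfl | rfl <;> simp [sgn, h2]

theorem sgn_mul_self (p : ZMod 2) : sgn p * sgn p = 1 := by
  unfold sgn; split_ifs <;> norm_num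

/-! ### Free supercommutative algebras -/

/-- The relations `x y = (-1)^{p(x)p(y)} y x` between generators of parities `ε`
(over `ℂ` they force `x ^ 2 = 0` for odd `x`). -/
inductive SuperComm {X : Type*} (ε : X → ZMod 2) : FreeAlgebra ℂ X → FreeAlgebra ℂ X → Prop
  | swap (x y : X) : SuperComm ε (FreeAlgebra.ι ℂ x * FreeAlgebra.ι ℂ y)
      (sgn (ε x * ε y) • (FreeAlgebra.ι ℂ y * FreeAlgebra.ι ℂ x))

/-- The free unital associative supercommutative superalgebra over `ℂ` on generators `x : X`
of parity `ε x`. -/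
def SuperPoly {X : Type*} (ε : X → ZMod 2) : Type _ := RingQuot (SuperComm ε)

namespace SuperPoly

variable {X : Type*} (ε : X → ZMod 2)

instance : Ring (SuperPoly ε) := inferInstanceAs (Ring (RingQuot (SuperComm ε)))

instance : Algebra ℂ (SuperPoly ε) := inferInstanceAs (Algebra ℂ (RingQuot (SuperComm ε)))

/-- The generator `x`. -/
def gen (x : X) : SuperPoly ε := RingQuot.mkAlgHom ℂ (SuperComm ε) (FreeAlgebra.ι ℂ x)

theorem gen_mul_gen (x y : X) :
    gen ε x * gen ε y = sgn (ε x * ε y) • (gen ε y * gen ε x) := by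
  have h := RingQuot.mkAlgHom_rel ℂ (SuperComm.swap (ε := ε) x y)
  rw [map_smul, map_mul, map_mul] at h
  exact h

/-- Universal property: supercommuting values of the generators define an algebra morphism. -/
def lift {B : Type*} [Ring B] [Algebra ℂ B] (v : X → B)
    (h : ∀ x y, v x * v y = sgn (ε x * ε y) • (v y * v x)) : SuperPoly ε →ₐ[ℂ] B :=
  RingQuot.liftAlgHom ℂ ⟨FreeAlgebra.lift ℂ v, by
    rintro _ _ ⟨x, y⟩
    simpa using h x y⟩

theorem lift_gen {B : Type*} [Ring B] [Algebra ℂ B] (v : X → B)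
    (h : ∀ x y, v x * v y = sgn (ε x * ε y) • (v y * v x)) (x : X) :
    lift ε v h (gen ε x) = v x := by
  have := RingQuot.liftAlgHom_mkAlgHom_apply ℂ (FreeAlgebra.lift ℂ v) (s := SuperComm ε) (by
    rintro _ _ ⟨x, y⟩
    simpa using h x y) (FreeAlgebra.ι ℂ x)
  rw [FreeAlgebra.lift_ι_apply] at this
  exact this

theorem induction {P : SuperPoly ε → Prop} (halg : ∀ c : ℂ, P (algebraMap ℂ _ c))
    (hgen : ∀ x, P (gen ε x)) (hmul : ∀ a b, P a → P b → P (a * b))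
    (hadd : ∀ a b, P a → P b → P (a + b)) (a : SuperPoly ε) : P a := by
  obtain ⟨a, rfl⟩ := RingQuot.mkAlgHom_surjective ℂ (SuperComm ε) a
  induction a using FreeAlgebra.induction with
  | grade0 r => rw [AlgHom.commutes]; exact halg r
  | grade1 x => exact hgen x
  | mul a b ha hb => rw [map_mul]; exact hmul _ _ ha hb
  | add a b ha hb => rw [map_add]; exact hadd _ _ ha hb

/-- The parity automorphism `a ↦ (-1)^{p(a)} a`. -/
def parityAut : SuperPoly ε →ₐ[ℂ] SuperPoly ε :=
  lift ε (fun x => sgn (ε x) • gen ε x) fun x y => by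
    rw [smul_mul_smul_comm, smul_mul_smul_comm, gen_mul_gen ε x y, smul_smul, smul_smul,
      mul_comm (sgn (ε y))]
    congr 1
    ring

theorem parityAut_gen (x : X) : parityAut ε (gen ε x) = sgn (ε x) • gen ε x :=
  lift_gen ε _ _ x

theorem parityAut_parityAut (a : SuperPoly ε) : parityAut ε (parityAut ε a) = a := by
  induction a using induction with
  | halg c => simp
  | hgen x => rw [parityAut_gen, map_smul, parityAut_gen, smul_smul, sgn_mul_self, one_smul]
  | hmul a b ha hb => rw [map_mul, map_mul, ha, hb]
  | hadd a b ha hb => rw [map_add, map_add, ha, hb]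

/-- The even (`p = 0`) or odd (`p = 1`) component of an element. -/
def component (p : ZMod 2) : SuperPoly ε →ₗ[ℂ] SuperPoly ε :=
  (1 / 2 : ℂ) • (LinearMap.id + sgn p • (parityAut ε).toLinearMap)

theorem parityAut_component (p : ZMod 2) (a : SuperPoly ε) :
    parityAut ε (component ε p a) = sgn p • component ε p a := by
  have h := sgn_mul_self p
  simp only [component, LinearMap.smul_apply, LinearMap.add_apply, LinearMap.id_apply,
    AlgHom.toLinearMap_apply, map_smul, map_add, parityAut_parityAut, smul_add, smul_smul]
  rw [show sgn p * (1 / 2 * sgn p) = 1 / 2 by linear_combination (1 / 2 : ℂ) * h,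
    mul_comm (sgn p), add_comm]

theorem mul_gen (a : SuperPoly ε) (y : X) :
    a * gen ε y = gen ε y * (if ε y = 0 then a else parityAut ε a) := by
  induction a using induction with
  | halg c => split_ifs <;> simp [Algebra.commutes c (gen ε y)]
  | hgen x =>
    rw [gen_mul_gen]
    split_ifs with h
    · simp [h, sgn]
    · have hy : ε y = 1 := by
        revert h; generalize ε y = p; revert p; decide
      rw [parityAut_gen, hy, mul_one, mul_smul_comm]
  | hmul a b ha hb =>
    rw [mul_assoc, hb, ← mul_assoc, ha, mul_assoc]
    split_ifs <;> simp
  | hadd a b ha hb =>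
    rw [add_mul, ha, hb, ← mul_add]
    split_ifs <;> simp

theorem component_mul_gen (p : ZMod 2) (a : SuperPoly ε) (y : X) :
    component ε p a * gen ε y = sgn (p * ε y) • (gen ε y * component ε p a) := by
  rw [mul_gen]
  split_ifs with h
  · simp [h, sgn]
  · have hy : ε y = 1 := by
      revert h; generalize ε y = p; revert p; decide
    rw [parityAut_component, hy, mul_one, mul_smul_comm]

/-- The matrix `[[σ^p(x), δ x], [0, x]]`, where `σ` is the parity automorphism. -/
def derMatrix (p : ZMod 2) (δ : X → SuperPoly ε) (x : X) :
    Matrix (Fin 2) (Fin 2) (SuperPoly ε) :=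
  !![sgn (p * ε x) • gen ε x, component ε (p + ε x) (δ x); 0, gen ε x]

theorem derMatrix_comm (p : ZMod 2) (δ : X → SuperPoly ε) (x y : X) :
    derMatrix ε p δ x * derMatrix ε p δ y
      = sgn (ε x * ε y) • (derMatrix ε p δ y * derMatrix ε p δ x) := by
  have e1 : ∀ x y : X, sgn (p * ε x) • gen ε x * component ε (p + ε y) (δ y)
      = sgn (ε x * ε y) • (component ε (p + ε y) (δ y) * gen ε x) := by
    intro x y
    rw [component_mul_gen, smul_mul_assoc, smul_smul]
    congr 1
    rw [add_mul, sgn_add, mul_comm (ε y) (ε x), mul_left_comm, sgn_mul_self, mul_one]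
  ext i j
  fin_cases i <;> fin_cases j
  · simp only [derMatrix, Matrix.mul_apply, Fin.sum_univ_two]
    simp only [Fin.zero_eta, Fin.isValue, Matrix.of_apply, Matrix.cons_val', Matrix.cons_val_zero,
      Matrix.cons_val_one, Matrix.cons_val_fin_one, mul_zero, add_zero, Matrix.smul_apply,
      Matrix.mul_apply, Fin.sum_univ_two, smul_mul_smul_comm]
    rw [gen_mul_gen ε x y, mul_comm (sgn (p * ε y)), smul_comm]
  · simp only [derMatrix, Matrix.mul_apply, Fin.sum_univ_two]
    simp only [Fin.zero_eta, Fin.mk_one, Fin.isValue, Matrix.of_apply, Matrix.cons_val',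
      Matrix.cons_val_zero, Matrix.cons_val_one, Matrix.cons_val_fin_one, Matrix.smul_apply,
      Matrix.mul_apply, Fin.sum_univ_two]
    rw [e1 x y, e1 y x, smul_add, smul_smul, mul_comm (ε y) (ε x), sgn_mul_self, one_smul,
      add_comm]
  · simp [derMatrix, Matrix.mul_apply, Fin.sum_univ_two]
  · simp only [derMatrix, Matrix.mul_apply, Fin.sum_univ_two]
    simp only [Fin.mk_one, Fin.isValue, Matrix.of_apply, Matrix.cons_val',
      Matrix.cons_val_zero, Matrix.cons_val_one, Matrix.cons_val_fin_one, zero_mul, zero_add,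
      Matrix.smul_apply, Matrix.mul_apply, Fin.sum_univ_two]
    rw [gen_mul_gen ε x y]

/-- The superderivation of parity `p`, `d (a b) = d a * b + (-1)^{p p(a)} a * d b`, whose value on
each generator `x` is (the component of parity `p + ε x` of) `δ x`. -/
def superDer (p : ZMod 2) (δ : X → SuperPoly ε) : SuperPoly ε →ₗ[ℂ] SuperPoly ε :=
  (Matrix.entryLinearMap ℂ (SuperPoly ε) (0 : Fin 2) (1 : Fin 2)).comp
    (lift ε (derMatrix ε p δ) (derMatrix_comm ε p δ)).toLinearMap

end SuperPoly

/-! ### Differential polynomials and `χ`-brackets -/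

section DiffPoly

variable {ι : Type*} (ε : ι → ZMod 2)

/-- Superdifferential polynomials in variables `u_t` of parity `ε t`: the generator `(t, n)` is
`u_t^{(n)} = D^n u_t`, of parity `ε t + n`. -/
abbrev DiffPoly : Type _ := SuperPoly (fun x : ι × ℕ => ε x.1 + (x.2 : ZMod 2))

/-- `u_t^{(n)}`. -/
def jet (t : ι) (n : ℕ) : DiffPoly ε := SuperPoly.gen _ (t, n)

/-- The odd derivation `D`, `D u_t^{(n)} = u_t^{(n+1)}`. -/
def D : DiffPoly ε →ₗ[ℂ] DiffPoly ε :=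
  SuperPoly.superDer _ 1 fun x => jet ε x.1 (x.2 + 1)

/-- The operator `D + χ` on `χ`-polynomials `∑ χ^n a_n`, written as sequences `n ↦ a_n`; since
`D χ + χ D = -2 χ²`, one has `(D + χ) χ^n a = (-1)^n (χ^n D a + χ^{n+1} a)`. -/
def chiD : (ℕ → DiffPoly ε) →ₗ[ℂ] (ℕ → DiffPoly ε) where
  toFun x n := match n with
    | 0 => D ε (x 0)
    | n + 1 => (-1 : ℂ) ^ (n + 1) • D ε (x (n + 1)) + (-1 : ℂ) ^ n • x n
  map_add' x y := by
    funext n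
    cases n <;> simp only [Pi.add_apply, map_add, smul_add]
    abel
  map_smul' c x := by
    funext n
    cases n <;> simp only [Pi.smul_apply, map_smul, smul_add, RingHom.id_apply]
    rw [smul_comm c, smul_comm c]

/-- Given the values `v j = {a_χ u_j}` (coefficients of powers of `χ`) for an `a` of parity `p`,
the `n`-th coefficient of `b ↦ {a_χ b}`. It is determined by sesquilinearity,
`{a_χ D b} = (-1)^{p+1} (D + χ) {a_χ b}`, and by the Leibniz rule
`{a_χ b c} = {a_χ b} c + (-1)^{p(b)p(c)} {a_χ c} b`, which says that the `n`-th coefficient is a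
superderivation of parity `p + n + 1`. -/
def leibnizExt (p : ZMod 2) (v : ι → ℕ → DiffPoly ε) (n : ℕ) : DiffPoly ε →ₗ[ℂ] DiffPoly ε :=
  SuperPoly.superDer _ (p + (n : ZMod 2) + 1)
    fun x => sgn ((p + 1) * (x.2 : ZMod 2)) • ((chiD ε ^ x.2) (v x.1)) n

/-- The `χ`-bracket with values `{u_i _χ u_j} = ∑ χ^n c i j n` on generators: `chiBracket ε c a b n`
is the coefficient of `χ^n` in `{a_χ b}`. First `{u_j _χ a}` is given by `leibnizExt`, then
`{a_χ u_j} = (-1)^{p(a)p(u_j)} ∑_n (-χ-D)^n (u_j)_{(n)} a` by skew-symmetry, and `{a_χ b}` by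
`leibnizExt` again. -/
def chiBracket (c : ι → ι → ℕ → DiffPoly ε) (a b : DiffPoly ε) (n : ℕ) : DiffPoly ε :=
  ∑ p : ZMod 2,
    leibnizExt ε p
      (fun j k => sgn (p * ε j) • ∑ᶠ m : ℕ, (-1 : ℂ) ^ m •
        ((chiD ε ^ m) (Pi.single 0 (leibnizExt ε (ε j) (c j) m (SuperPoly.component _ p a)))) k)
      n b

/-- The differential ideal generated by a set. -/
def diffIdeal (S : Set (DiffPoly ε)) : Submodule ℂ (DiffPoly ε) :=
  sInf {I | S ⊆ I ∧ (∀ a, ∀ x ∈ I, a * x ∈ I ∧ x * a ∈ I) ∧ ∀ x ∈ I, D ε x ∈ I}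

end DiffPoly

/-! ### Laurent series in `z⁻¹` -/

section Laurent

variable {M M' M'' : Type*} [AddCommGroup M] [Module ℂ M] [AddCommGroup M'] [Module ℂ M']
  [AddCommGroup M''] [Module ℂ M'']

/-- `M((z⁻¹))`: families `n ↦ x_n` of coefficients of `z^n` vanishing for large `n`. -/
def Laurent (M : Type*) [AddCommGroup M] [Module ℂ M] : Submodule ℂ (ℤ → M) where
  carrier := {x | ∃ N : ℤ, ∀ n, N < n → x n = 0}
  zero_mem' := ⟨0, fun _ _ => rfl⟩
  add_mem' := by
    rintro x y ⟨a, ha⟩ ⟨b, hb⟩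
    exact ⟨max a b, fun n hn => by
      simp [ha n (lt_of_le_of_lt (le_max_left _ _) hn),
        hb n (lt_of_le_of_lt (le_max_right _ _) hn)]⟩
  smul_mem' := by
    rintro c x ⟨a, ha⟩
    exact ⟨a, fun n hn => by simp [ha n hn]⟩

namespace Laurent

/-- Apply a linear map to all coefficients. -/
def map (g : M →ₗ[ℂ] M') : Laurent M →ₗ[ℂ] Laurent M' where
  toFun x := ⟨fun n => g (x.1 n), by
    obtain ⟨N, hN⟩ := x.2
    exact ⟨N, fun n hn => by simp [hN n hn]⟩⟩
  map_add' x y := by ext n; simp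
  map_smul' c x := by ext n; simp

/-- `a ↦ a z^k`. -/
def single (k : ℤ) : M →ₗ[ℂ] Laurent M where
  toFun a := ⟨Pi.single k a, k, fun n hn => Pi.single_eq_of_ne (M := fun _ => M) hn.ne' a⟩
  map_add' x y := by ext n; simp [Pi.single_add]
  map_smul' c x := by ext n; simp [Pi.single_smul]

/-- Multiplication by `z`. -/
def zMul (x : Laurent M) : Laurent M :=
  ⟨fun n => x.1 (n - 1), by
    obtain ⟨N, hN⟩ := x.2
    exact ⟨N + 1, fun n hn => hN _ (by linarith)⟩⟩

theorem conv_finite (B : M →ₗ[ℂ] M' →ₗ[ℂ] M'') (x : Laurent M) (y : Laurent M') (n : ℤ) :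
    (Function.support fun k => B (x.1 k) (y.1 (n - k))).Finite := by
  obtain ⟨a, ha⟩ := x.2
  obtain ⟨b, hb⟩ := y.2
  refine (Set.finite_Icc (n - b) a).subset fun k hk => ?_
  rw [Function.mem_support] at hk
  constructor
  · by_contra h
    exact hk (by rw [hb _ (by linarith), map_zero])
  · by_contra h
    exact hk (by rw [ha _ (by linarith), map_zero, LinearMap.zero_apply])

/-- The extension of a bilinear map to Laurent series:
`(∑ x_k z^k, ∑ y_l z^l) ↦ ∑ B(x_k, y_l) z^{k+l}`. -/
def conv (B : M →ₗ[ℂ] M' →ₗ[ℂ] M'') : Laurent M →ₗ[ℂ] Laurent M' →ₗ[ℂ] Laurent M'' :=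
  LinearMap.mk₂ ℂ
    (fun x y => ⟨fun n => ∑ᶠ k, B (x.1 k) (y.1 (n - k)), by
      obtain ⟨a, ha⟩ := x.2
      obtain ⟨b, hb⟩ := y.2
      refine ⟨a + b, fun n hn => finsum_eq_zero_of_forall_eq_zero fun k => ?_⟩
      by_cases h : a < k
      · rw [ha k h, map_zero, LinearMap.zero_apply]
      · rw [hb (n - k) (by linarith), map_zero]⟩)
    (fun x x' y => by
      ext n
      simpa using finsum_add_distrib (conv_finite B x y n) (conv_finite B x' y n))
    (fun c x y => by
      ext n
      simpa using (smul_finsum' c (conv_finite B x y n)).symm)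
    (fun x y y' => by
      ext n
      simpa using finsum_add_distrib (conv_finite B x y n) (conv_finite B x y' n))
    (fun c x y => by
      ext n
      simpa using (smul_finsum' c (conv_finite B x y n)).symm)

end Laurent

end Laurent

/-! ### Lie superalgebras -/

/-- The component of index `k` of a vector, for a direct sum decomposition. -/
def gradeComp {κ 𝔤 : Type*} [DecidableEq κ] [AddCommGroup 𝔤] [Module ℂ 𝔤]
    {G : κ → Submodule ℂ 𝔤} (h : DirectSum.IsInternal G) (k : κ) : 𝔤 →ₗ[ℂ] 𝔤 :=
  (G k).subtype ∘ₗ DirectSum.component ℂ κ (fun k => G k) k ∘ₗ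
    (LinearEquiv.ofBijective (DirectSum.coeLinearMap G) h).symm.toLinearMap

theorem gradeComp_mem {κ 𝔤 : Type*} [DecidableEq κ] [AddCommGroup 𝔤] [Module ℂ 𝔤]
    {G : κ → Submodule ℂ 𝔤} (h : DirectSum.IsInternal G) (k : κ) (a : 𝔤) :
    gradeComp h k a ∈ G k := by
  simp [gradeComp]

theorem sum_gradeComp {κ 𝔤 : Type*} [DecidableEq κ] [Fintype κ] [AddCommGroup 𝔤] [Module ℂ 𝔤]
    {G : κ → Submodule ℂ 𝔤} (h : DirectSum.IsInternal G) (a : 𝔤) :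
    ∑ k, gradeComp h k a = a := by
  classical
  obtain ⟨x, rfl⟩ := h.2 a
  have hx : (LinearEquiv.ofBijective (DirectSum.coeLinearMap G) h).symm
      (DirectSum.coeLinearMap G x) = x :=
    (LinearEquiv.ofBijective (DirectSum.coeLinearMap G) h).symm_apply_apply x
  have h1 : ∀ k, gradeComp h k (DirectSum.coeLinearMap G x) = (x k : 𝔤) := fun k => by
    simp only [gradeComp, LinearMap.comp_apply, LinearEquiv.coe_coe, hx]
    rfl
  have h2 : DirectSum.coeLinearMap G x = ∑ k, (x k : 𝔤) := by
    rw [DirectSum.coeLinearMap_eq_dfinsuppSum]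
    exact DFinsupp.sum_eq_sum_fintype _ (fun _ => rfl)
  have h3 : ∑ k, gradeComp h k (DirectSum.coeLinearMap G x) = DirectSum.coeLinearMap G x := by
    rw [h2]
    exact Finset.sum_congr rfl fun k _ => by rw [← h2, h1]
  exact h3

/-- A Lie superalgebra structure on a complex vector space. -/
structure LieSuper (𝔤 : Type*) [AddCommGroup 𝔤] [Module ℂ 𝔤] where
  /-- The even part `part 0` and the odd part `part 1`. -/
  part : ZMod 2 → Submodule ℂ 𝔤
  internal : DirectSum.IsInternal part
  /-- The Lie bracket. -/
  br : 𝔤 →ₗ[ℂ] 𝔤 →ₗ[ℂ] 𝔤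
  br_mem : ∀ p q, ∀ a ∈ part p, ∀ b ∈ part q, br a b ∈ part (p + q)
  skew : ∀ p q, ∀ a ∈ part p, ∀ b ∈ part q, br a b = -(sgn (p * q) • br b a)
  jacobi : ∀ p q, ∀ a ∈ part p, ∀ b ∈ part q, ∀ c,
    br a (br b c) = br (br a b) c + sgn (p * q) • br b (br a c)

/-- A `ℤ`-graded Lie superalgebra with a form `(·|·)` and the data `𝔫, 𝔪, f, s` of a super
Drinfeld-Sokolov reduction, together with dual homogeneous bases `q^t`, `q_t`, `t : ι`, such that
`𝔟 = 𝔪^⊥ = span {q^t | t ∈ I}` and `[f, 𝔫] = span {q^t | t ∈ J}`. Then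
`𝔟₋ = span {q_t | t ∈ I}` is a homogeneous complement of `𝔪 = span {q_t | t ∉ I}`, and
`V = span {q^t | t ∈ I \ J}` is one of `[f, 𝔫]` in `𝔟`. -/
structure DSData (𝔤 ι : Type*) [AddCommGroup 𝔤] [Module ℂ 𝔤] [Fintype ι] [DecidableEq ι]
    extends LieSuper 𝔤 where
  /-- The `ℤ`-grading, by subsuperspaces. -/
  deg : ℤ → Submodule ℂ 𝔤
  deg_internal : DirectSum.IsInternal deg
  deg_part : ∀ k, ∀ a ∈ deg k, ∀ p, gradeComp internal p a ∈ deg k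
  br_deg : ∀ k l, ∀ a ∈ deg k, ∀ b ∈ deg l, br a b ∈ deg (k + l)
  d : ℤ
  d_pos : 0 < d
  deg_range : ∀ k, d < |k| → deg k = ⊥
  /-- The bilinear form: even, supersymmetric, invariant, nondegenerate, of degree `0`. -/
  form : 𝔤 →ₗ[ℂ] 𝔤 →ₗ[ℂ] ℂ
  form_even : ∀ p q, p ≠ q → ∀ a ∈ part p, ∀ b ∈ part q, form a b = 0
  form_symm : ∀ p q, ∀ a ∈ part p, ∀ b ∈ part q, form a b = sgn (p * q) * form b a
  form_invariant : ∀ a b c, form (br a b) c = form a (br b c)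
  form_nondegenerate : ∀ a, (∀ b, form a b = 0) → a = 0
  form_deg : ∀ k l, k + l ≠ 0 → ∀ a ∈ deg k, ∀ b ∈ deg l, form a b = 0
  /-- The homogeneous subalgebra `𝔫 ⊆ 𝔤_{>0}`. -/
  𝔫 : Submodule ℂ 𝔤
  𝔫_part : ∀ a ∈ 𝔫, ∀ p, gradeComp internal p a ∈ 𝔫
  𝔫_deg : ∀ a ∈ 𝔫, ∀ k, gradeComp deg_internal k a ∈ 𝔫
  𝔫_pos : 𝔫 ≤ ⨆ k ∈ Set.Ioi (0 : ℤ), deg k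
  𝔫_br : ∀ a ∈ 𝔫, ∀ b ∈ 𝔫, br a b ∈ 𝔫
  /-- The homogeneous `𝔫`-submodule `𝔪 ⊆ 𝔫`. -/
  𝔪 : Submodule ℂ 𝔤
  𝔪_part : ∀ a ∈ 𝔪, ∀ p, gradeComp internal p a ∈ 𝔪
  𝔪_deg : ∀ a ∈ 𝔪, ∀ k, gradeComp deg_internal k a ∈ 𝔪
  𝔪_le : 𝔪 ≤ 𝔫
  𝔪_br : ∀ a ∈ 𝔫, ∀ b ∈ 𝔪, br a b ∈ 𝔪
  i : ℤ
  i_pos : 0 < i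
  i_le : i ≤ d
  j : ℤ
  j_pos : 0 < j
  j_le : j ≤ d
  f : 𝔤
  f_odd : f ∈ part 1
  f_deg : f ∈ deg (-i)
  s : 𝔤
  s_odd : s ∈ part 1
  s_deg : s ∈ deg j
  /-- `𝔤_{≥ i} ⊆ 𝔪`. -/
  deg_ge_le : ∀ k, i ≤ k → deg k ≤ 𝔪
  /-- `[f, 𝔫] ⊆ 𝔟`, where `𝔟` is the orthogonal of `𝔪`. -/
  br_f_perp : ∀ a ∈ 𝔫, ∀ b ∈ 𝔪, form (br f a) b = 0
  /-- `ad f` is injective on `𝔫`. -/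
  br_f_inj : ∀ a ∈ 𝔫, br f a = 0 → a = 0
  /-- `[s, 𝔫] = 0`. -/
  br_s : ∀ a ∈ 𝔫, br s a = 0
  /-- `ad Λ²` is semisimple on `𝔤((z⁻¹))`: its kernel and its image are complementary. Here
  `Λ = f + z s` and `Λ² = [Λ, Λ] / 2`. -/
  semisimple :
    let Λ : Laurent 𝔤 := Laurent.single 0 f + Laurent.single 1 s
    let adΛ2 : Laurent 𝔤 →ₗ[ℂ] Laurent 𝔤 := Laurent.conv br ((1 / 2 : ℂ) • Laurent.conv br Λ Λ)
    IsCompl (LinearMap.ker adΛ2) (LinearMap.range adΛ2)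
  /-- The basis `q^t`. -/
  qUp : Module.Basis ι ℂ 𝔤
  /-- The dual basis `q_t`. -/
  qLow : Module.Basis ι ℂ 𝔤
  dual : ∀ t t', form (qUp t) (qLow t') = if t = t' then 1 else 0
  /-- The parity of `q^t`. -/
  par : ι → ZMod 2
  qUp_part : ∀ t, qUp t ∈ part (par t)
  qUp_deg : ∀ t, ∃ k, qUp t ∈ deg k
  I : Finset ι
  J : Finset ι
  J_le : J ⊆ I
  span_I : ∀ x, x ∈ Submodule.span ℂ (qUp '' I) ↔ ∀ y ∈ 𝔪, form x y = 0
  span_J : Submodule.span ℂ (qUp '' J) = 𝔫.map (br f)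

namespace DSData

variable {𝔤 ι : Type*} [AddCommGroup 𝔤] [Module ℂ 𝔤] [Fintype ι] [DecidableEq ι]
  (S : DSData 𝔤 ι)

/-! #### The affine SUSY PVA and the generalized W-algebra -/

/-- The parity of `\bar q_t`. -/
def barPar (t : ι) : ZMod 2 := S.par t + 1

/-- The differential superalgebra `𝒫(\bar 𝔤) = S(ℂ[D] ⊗ \bar 𝔤)`, with variables `\bar q_t`. -/
abbrev Aff : Type _ := DiffPoly S.barPar

/-- The odd derivation `D` of `𝒫(\bar 𝔤)`. -/
def D : S.Aff →ₗ[ℂ] S.Aff := SuperDS.D S.barPar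

/-- `a ↦ \bar a`. -/
def bar : 𝔤 →ₗ[ℂ] S.Aff := S.qLow.constr ℂ fun t => jet S.barPar t 0

/-- `{\bar a_χ \bar b}_1 = (-1)^{p(a)} (\overline{[a,b]} + χ (a|b))` for `a = q_t`, `b = q_t'`. -/
def c₁ (t t' : ι) (n : ℕ) : S.Aff :=
  match n with
  | 0 => sgn (S.par t) • S.bar (S.br (S.qLow t) (S.qLow t'))
  | 1 => sgn (S.par t) • algebraMap ℂ S.Aff (S.form (S.qLow t) (S.qLow t'))
  | _ => 0

/-- `{\bar a_χ \bar b}_2 = (-1)^{p(a)+1} (s|[a,b])` for `a = q_t`, `b = q_t'`. -/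
def c₂ (t t' : ι) (n : ℕ) : S.Aff :=
  match n with
  | 0 => sgn (S.par t + 1) • algebraMap ℂ S.Aff (S.form S.s (S.br (S.qLow t) (S.qLow t')))
  | _ => 0

/-- The coefficient of `χ^n` in `{a_χ b}_1`. -/
def affBr₁ (a b : S.Aff) (n : ℕ) : S.Aff := chiBracket S.barPar S.c₁ a b n

/-- The coefficient of `χ^n` in `{a_χ b}_2`. -/
def affBr₂ (a b : S.Aff) (n : ℕ) : S.Aff := chiBracket S.barPar S.c₂ a b n

/-- The differential ideal generated by `\bar m - (f|m)`, `m ∈ 𝔪`. -/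
def ideal : Submodule ℂ S.Aff :=
  diffIdeal S.barPar {x | ∃ m ∈ S.𝔪, x = S.bar m - algebraMap ℂ S.Aff (S.form S.f m)}

/-- The subalgebra `𝒫 = S(ℂ[D] ⊗ \bar 𝔟₋)`, which maps isomorphically onto the quotient of
`𝒫(\bar 𝔤)` by `S.ideal`. -/
def P : Subalgebra ℂ S.Aff := Algebra.adjoin ℂ {x | ∃ t ∈ S.I, ∃ n, x = jet S.barPar t n}

theorem qLow_part (t : ι) (p : ZMod 2) (h : p ≠ S.par t) :
    gradeComp S.internal p (S.qLow t) = 0 := by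
  have huniv : ∀ p : ZMod 2, (Finset.univ : Finset (ZMod 2)) = {p, p + 1} := by decide
  have hne : ∀ p : ZMod 2, p ≠ p + 1 := by decide
  have hform : ∀ u, S.form (S.qUp u) (gradeComp S.internal p (S.qLow t)) = 0 := by
    intro u
    by_cases hu : S.par u = p
    · have hut : u ≠ t := fun e => h (by rw [← hu, e])
      have h2 := S.dual u t
      rw [if_neg hut, ← sum_gradeComp S.internal (S.qLow t), huniv p, Finset.sum_pair (hne p),
        map_add, S.form_even (S.par u) (p + 1) (by rw [hu]; exact hne p) _ (S.qUp_part u) _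
          (gradeComp_mem _ _ _), add_zero] at h2
      exact h2
    · exact S.form_even _ _ hu _ (S.qUp_part u) _ (gradeComp_mem _ _ _)
  have hb : ∀ b, S.form b (gradeComp S.internal p (S.qLow t)) = 0 := by
    intro b
    rw [← S.qUp.sum_repr b, map_sum, LinearMap.sum_apply]
    refine Finset.sum_eq_zero fun u _ => ?_
    rw [map_smul, LinearMap.smul_apply, hform, smul_zero]
  apply S.form_nondegenerate
  intro b
  rw [← sum_gradeComp S.internal b, map_sum]
  refine Finset.sum_eq_zero fun q _ => ?_
  rw [S.form_symm p q _ (gradeComp_mem _ _ _) _ (gradeComp_mem _ _ _), hb, mul_zero]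

theorem form_f_qLow (t : ι) (h : S.par t ≠ 1) : S.form S.f (S.qLow t) = 0 := by
  rw [← sum_gradeComp S.internal (S.qLow t), map_sum]
  refine Finset.sum_eq_zero fun p _ => ?_
  by_cases hp : p = 1
  · rw [hp, S.qLow_part t 1 (Ne.symm h), map_zero]
  · exact S.form_even 1 p (Ne.symm hp) _ S.f_odd _ (gradeComp_mem _ _ _)

/-- The values of `reduce` on the variables. -/
def reduceVal (x : ι × ℕ) : S.Aff :=
  if x.1 ∈ S.I then jet S.barPar x.1 x.2
  else if x.2 = 0 then algebraMap ℂ S.Aff (S.form S.f (S.qLow x.1)) else 0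

theorem reduceVal_comm (x y : ι × ℕ) : S.reduceVal x * S.reduceVal y
    = sgn ((S.barPar x.1 + x.2) * (S.barPar y.1 + y.2)) • (S.reduceVal y * S.reduceVal x) := by
  have hz : ∀ x : ι × ℕ, x.1 ∉ S.I → S.reduceVal x = 0 ∨
      (S.barPar x.1 + (x.2 : ZMod 2) = 0 ∧ ∃ c : ℂ, S.reduceVal x = algebraMap ℂ S.Aff c) := by
    intro x hx
    unfold reduceVal
    rw [if_neg hx]
    split_ifs with h0
    · by_cases h1 : S.par x.1 = 1
      · right
        refine ⟨?_, _, rfl⟩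
        rw [h0, barPar, h1]
        decide
      · left
        rw [S.form_f_qLow _ h1, map_zero]
    · left; rfl
  by_cases hx : x.1 ∈ S.I
  · by_cases hy : y.1 ∈ S.I
    · unfold reduceVal
      rw [if_pos hx, if_pos hy]
      exact SuperPoly.gen_mul_gen _ x y
    · rcases hz y hy with h | ⟨h, c, hc⟩
      · simp [h]
      · rw [h, hc, mul_zero, Algebra.commutes]
        simp [sgn]
  · rcases hz x hx with h | ⟨h, c, hc⟩
    · simp [h]
    · rw [h, hc, zero_mul, Algebra.commutes]
      simp [sgn]

/-- The projection `𝒫(\bar 𝔤) → 𝒫(\bar 𝔤) / S.ideal ≃ 𝒫`: it is the identity on `𝒫` and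
substitutes `D^n (f|m)` for `D^n \bar m`, `m ∈ 𝔪`. -/
def reduce : S.Aff →ₐ[ℂ] S.Aff := SuperPoly.lift _ S.reduceVal S.reduceVal_comm

/-- The generalized W-algebra `𝒲(𝔤, 𝔫, 𝔪, f)`, as a subspace of `𝒫`: the `a ∈ 𝒫` with
`{\bar n_χ a}_1 ∈ ideal[χ]` for all `n ∈ 𝔫`. -/
def W : Set S.Aff := {a | a ∈ S.P ∧ ∀ n ∈ S.𝔫, ∀ k, S.affBr₁ (S.bar n) a k ∈ S.ideal}

/-- The coefficient of `χ^n` in the first reduced bracket `{a_χ b}_1^𝒲`, as an element of `𝒫`. -/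
def wBr₁ (a b : S.Aff) (n : ℕ) : S.Aff := S.reduce (S.affBr₁ a b n)

/-- The coefficient of `χ^n` in the second reduced bracket `{a_χ b}_2^𝒲`, as an element of `𝒫`. -/
def wBr₂ (a b : S.Aff) (n : ℕ) : S.Aff := S.reduce (S.affBr₂ a b n)

/-! #### The superalgebras `𝔤 ⊗ 𝒫(\bar 𝔤)` and `𝔤((z⁻¹)) ⊗ 𝒫(\bar 𝔤)` -/

/-- `𝔤 ⊗ 𝒫(\bar 𝔤)`. -/
abbrev GA : Type _ := 𝔤 ⊗[ℂ] S.Aff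

/-- The parity automorphism `a ↦ (-1)^{p(a)} a` of `𝔤`. -/
def gParity : 𝔤 →ₗ[ℂ] 𝔤 := gradeComp S.internal 0 - gradeComp S.internal 1

/-- The parity automorphism of `𝔤 ⊗ 𝒫(\bar 𝔤)`. -/
def tParity : S.GA →ₗ[ℂ] S.GA :=
  TensorProduct.map S.gParity (SuperPoly.parityAut _).toLinearMap

/-- The extension `(a ⊗ u, b ⊗ v) ↦ (-1)^{p(b)p(u)} B(a, b) ⊗ u v` of a bilinear map `B`. -/
def tensorExt {M : Type*} [AddCommGroup M] [Module ℂ M] (B : 𝔤 →ₗ[ℂ] 𝔤 →ₗ[ℂ] M) :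
    S.GA →ₗ[ℂ] S.GA →ₗ[ℂ] M ⊗[ℂ] S.Aff :=
  TensorProduct.map₂ (B.compl₂ (gradeComp S.internal 0)) (LinearMap.mul ℂ S.Aff) +
  TensorProduct.map₂ (B.compl₂ (gradeComp S.internal 1))
    ((LinearMap.mul ℂ S.Aff).comp (SuperPoly.parityAut _).toLinearMap)

/-- `𝔤((z⁻¹)) ⊗ 𝒫(\bar 𝔤)`, completed: Laurent series in `z⁻¹` with coefficients in
`𝔤 ⊗ 𝒫(\bar 𝔤)`. -/
abbrev LGA : Type _ := Laurent S.GA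

/-- The Lie superbracket `[a z^m ⊗ u, b z^n ⊗ v] = (-1)^{p(b)p(u)} [a,b] z^{m+n} ⊗ u v`. -/
def lBr : S.LGA →ₗ[ℂ] S.LGA →ₗ[ℂ] S.LGA := Laurent.conv (S.tensorExt S.br)

/-- The bilinear form `(a z^m ⊗ u | b z^n ⊗ v) = (-1)^{p(b)p(u)} δ_{m+n,0} (a|b) u v`. -/
def lForm (x y : S.LGA) : S.Aff :=
  TensorProduct.lid ℂ S.Aff ((Laurent.conv (S.tensorExt S.form) x y).1 0)

/-- `[D, a z^m ⊗ u] = (-1)^{p(a)} a z^m ⊗ D u`. -/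
def lD : S.LGA →ₗ[ℂ] S.LGA := Laurent.map (TensorProduct.map S.gParity S.D)

/-- The parity automorphism of `𝔤((z⁻¹)) ⊗ 𝒫(\bar 𝔤)`. -/
def lParity : S.LGA →ₗ[ℂ] S.LGA := Laurent.map S.tParity

/-- `x ↦ x ⊗ 1`. -/
def tensorOne : Laurent 𝔤 →ₗ[ℂ] S.LGA :=
  Laurent.map ((TensorProduct.mk ℂ 𝔤 S.Aff).flip 1)

/-- The part `ℂ D ⊕ ℂ D² ⊕ (𝔤((z⁻¹)) ⊗ 𝒫(\bar 𝔤))` of `ℂ[D] ⋉ (𝔤((z⁻¹)) ⊗ 𝒫(\bar 𝔤))`, a Lie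
superalgebra; the triple `(c, e, x)` stands for `c D + e D² + x`. -/
abbrev Lax : Type _ := ℂ × ℂ × S.LGA

/-- The Lie superbracket on operators `c D + e D² + x`: `[D, D] = 2 D²`, `[D, D²] = 0`,
`[D, x] = lD x`, `[x, D] = -(-1)^{p(x)} [D, x]`, `[D², x] = lD (lD x) = -[x, D²]`. -/
def laxBr (A B : S.Lax) : S.Lax :=
  (0, 2 * A.1 * B.1,
    S.lBr A.2.2 B.2.2 + A.1 • S.lD B.2.2 - B.1 • S.lD (S.lParity A.2.2)
      + A.2.1 • S.lD (S.lD B.2.2) - B.2.1 • S.lD (S.lD A.2.2))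

/-- `B = e^{ad T} A = ∑ (ad T)^m A / m!`, the sum being finite in each power of `z`. -/
def IsExpAd (T : S.LGA) (A B : S.Lax) : Prop :=
  B.1 = A.1 ∧ B.2.1 = A.2.1 ∧ ∀ n : ℤ,
    (Function.support fun m : ℕ => ((S.laxBr (0, 0, T))^[m] A).2.2.1 n).Finite ∧
    B.2.2.1 n = ∑ᶠ m : ℕ, ((m.factorial : ℂ)⁻¹) • ((S.laxBr (0, 0, T))^[m] A).2.2.1 n

/-- The subspace `U ⊗ R` of `𝔤 ⊗ 𝒫(\bar 𝔤)`. -/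
def tens (U : Submodule ℂ 𝔤) (R : Submodule ℂ S.Aff) : Submodule ℂ S.GA :=
  Submodule.map₂ (TensorProduct.mk ℂ 𝔤 S.Aff) U R

/-- The completed subspace `U ⊗ R` of `𝔤((z⁻¹)) ⊗ 𝒫(\bar 𝔤)`, for `U ⊆ 𝔤((z⁻¹))`: all coefficients
lie in `𝔤 ⊗ R`, and contracting the second factor with any linear functional of `𝒫(\bar 𝔤)` gives
an element of `U`. -/
def lTens (U : Submodule ℂ (Laurent 𝔤)) (R : Submodule ℂ S.Aff) : Set S.LGA :=
  {x | (∀ n, x.1 n ∈ S.tens ⊤ R) ∧ ∀ ℓ : S.Aff →ₗ[ℂ] ℂ,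
    Laurent.map ((TensorProduct.rid ℂ 𝔤).toLinearMap ∘ₗ TensorProduct.map LinearMap.id ℓ) x ∈ U}

/-- Elements of positive degree of `𝔤((z⁻¹)) ⊗ 𝒫(\bar 𝔤)`, where `z` has degree `-i-j` and
`𝒫(\bar 𝔤)` has degree `0`. -/
def lPos : Set S.LGA :=
  {x | ∀ n : ℤ, x.1 n ∈ ⨆ k ∈ {k : ℤ | 0 < k - (S.i + S.j) * n}, S.tens (S.deg k) ⊤}

/-! #### The hierarchy -/

/-- `Λ = f + z s`. -/
def Λ : Laurent 𝔤 := Laurent.single 0 S.f + Laurent.single 1 S.s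

/-- `Λ² = [Λ, Λ] / 2`. -/
def Λsq : Laurent 𝔤 := (1 / 2 : ℂ) • Laurent.conv S.br S.Λ S.Λ

/-- `𝒦 = ker ad Λ²`. -/
def kerΛ : Submodule ℂ (Laurent 𝔤) := LinearMap.ker (Laurent.conv S.br S.Λsq)

/-- `im ad Λ²`. -/
def imΛ : Submodule ℂ (Laurent 𝔤) := LinearMap.range (Laurent.conv S.br S.Λsq)

/-- The center `𝒵` of `𝒦`. -/
def Z : Set (Laurent 𝔤) := {C | C ∈ S.kerΛ ∧ ∀ x ∈ S.kerΛ, Laurent.conv S.br C x = 0}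

/-- `C ∈ 𝔤((z⁻¹))` has parity `p`. -/
def HasParity (p : ZMod 2) (C : Laurent 𝔤) : Prop := ∀ n, C.1 n ∈ S.part p

/-- The universal element `𝒬_u = ∑_{t ∈ I} q^t ⊗ \bar q_t`. -/
def Qu : S.GA := ∑ t ∈ S.I, S.qUp t ⊗ₜ jet S.barPar t 0

/-- `∑_{t ∈ I \ J} q^t ⊗ w_t`. -/
def Qw (w : ι → S.Aff) : S.GA := ∑ t ∈ S.I \ S.J, S.qUp t ⊗ₜ w t

/-- The differential superalgebra generated by the `w_t`, `t ∈ I \ J`. -/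
def Pw (w : ι → S.Aff) : Subalgebra ℂ S.Aff :=
  Algebra.adjoin ℂ {x | ∃ t ∈ S.I \ S.J, ∃ n, x = (S.D ^ n) (w t)}

/-- The Lax operator `ℒ(𝒬) = D + 𝒬 + f ⊗ 1`. -/
def laxOp (Q : S.GA) : S.Lax := (1, 0, Laurent.single 0 Q + S.tensorOne (Laurent.single 0 S.f))

/-- The Lax operator `ℒ_s(𝒬) = D + 𝒬 + Λ ⊗ 1`. -/
def laxOpS (Q : S.GA) : S.Lax := (1, 0, Laurent.single 0 Q + S.tensorOne S.Λ)

/-- The canonical form `𝒬_u^c = ∑_{t ∈ I \ J} q^t ⊗ w_t` of the universal Lax operator and its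
dressing: `e^{ad N} ℒ(𝒬_u) = ℒ(𝒬_u^c)` with `N ∈ (𝔫 ⊗ 𝒫)_0`, and, for `ℒ^c = ℒ_s(𝒬_u^c)`,
`e^{ad T} [ℒ^c, ℒ^c] / 2 = D² + H + Λ² ⊗ 1` and `e^{ad T} ℒ^c = D + K + Λ ⊗ 1`,
where `T ∈ im ad Λ² ⊗ 𝒫_w` is even of positive degree and `H ∈ ker ad Λ² ⊗ 𝒫_w`, with `𝒫_w` the
differential superalgebra generated by the `w_t`. -/
structure Dressing where
  N : S.GA
  N_mem : N ∈ S.tens S.𝔫 (Subalgebra.toSubmodule S.P)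
  N_even : S.tParity N = N
  w : ι → S.Aff
  w_mem : ∀ t ∈ S.I \ S.J, w t ∈ S.P
  w_parity : ∀ t ∈ S.I \ S.J, SuperPoly.parityAut _ (w t) = sgn (S.barPar t) • w t
  gauge : S.IsExpAd (Laurent.single 0 N) (S.laxOp S.Qu) (S.laxOp (S.Qw w))
  T : S.LGA
  T_mem : T ∈ S.lTens S.imΛ (Subalgebra.toSubmodule (S.Pw w))
  T_even : S.lParity T = T
  T_pos : T ∈ S.lPos
  H : S.LGA
  H_mem : H ∈ S.lTens S.kerΛ (Subalgebra.toSubmodule (S.Pw w))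
  dress_sq : S.IsExpAd T
    ((1 / 2 : ℂ) • S.laxBr (S.laxOpS (S.Qw w)) (S.laxOpS (S.Qw w))) (0, 1, H + S.tensorOne S.Λsq)
  K : S.LGA
  dress : S.IsExpAd T (S.laxOpS (S.Qw w)) (1, 0, K + S.tensorOne S.Λ)

variable {S}

/-- The Hamiltonian density `h_C = (K^c | C ⊗ 1)`. -/
def Dressing.h (R : S.Dressing) (C : Laurent 𝔤) : S.Aff := S.lForm R.K (S.tensorOne C)

/-- The super Hamiltonian flow `d φ / d t_C = {∫ h_C _χ φ}_1^𝒲 |_{χ = 0}`. -/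
def Dressing.flow₁ (R : S.Dressing) (C : Laurent 𝔤) (φ : S.Aff) : S.Aff := S.wBr₁ (R.h C) φ 0

/-- The super Hamiltonian flow `{∫ h_C _χ φ}_2^𝒲 |_{χ = 0}` for the second bracket. -/
def Dressing.flow₂ (R : S.Dressing) (C : Laurent 𝔤) (φ : S.Aff) : S.Aff := S.wBr₂ (R.h C) φ 0

end DSData

end SuperDS

end

/-!
The generalized W-algebra is realized as an algebra of gauge invariants, and the flows as
isospectral deformations of the universal Lax operator `D + 𝒬_u + Λ`, where
`𝒬_u = ∑_{t ∈ I} q^t ⊗ \bar q_t`. All operators live in the semidirect product `FLie.Op` of a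
complete filtered Lie superalgebra, here `𝔤((z⁻¹)) ⊗ 𝒫(\bar 𝔤)`, with the superderivations of its
coefficients, on which `e^{ad T}` is an automorphism for every even `T` of positive degree.

*Existence.* The canonical form and the dressing are found by successive approximation
(`FLie.exists_normalForm`): in each degree the decomposition `𝔟 = V ⊕ [f, 𝔫]`, respectively
`𝔤((z⁻¹)) = 𝒦 ⊕ im ad Λ²`, says which part of the next term can be removed
(`exists_canonical`, `exists_dress`).

*Gauge invariance.* For `n ∈ 𝔫` the bracket `{\bar n_χ φ}_1` modulo the ideal is `∑ χ^k 𝔡_k φ` with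
superderivations `𝔡_k` of `𝒫`, so that `𝒲` is the space of elements of `𝒫` annihilated by all `𝔡_k`
(`mem_W_iff`). On `𝒬_u` these act as the infinitesimal gauge transformation by `n`
(`isGauge_fam`): `𝔡_0 + n` commutes with the Lax operator, and `𝔡_1` measures the failure of `𝔡_0`
to commute with `D`. Since `ad f` is injective on `𝔫` with image complementary to `V`, the
canonical form is unique (`canonical_unique`), hence the `w_t` are gauge invariant
(`gauge_w`), and so are the densities `h_C`, which are made of the `w_t`. The same argument shows
that the resolvents `E = e^{-ad N} e^{-ad T} (C ⊗ 1)` are moved by gauge transformations only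
through the adjoint action (`gauge_res`).

*The flows.* The resolvents commute with the Lax operator (`lax_res`), because `C` is central in
`𝒦` and the matrix part of the dressed Lax operator lies in `𝒦`: whatever commutes with its square
`D² + H + Λ²` has matrix part in `𝒦` (`mem_kerSub_of_commute_square`). Invariance of the bilinear
form under conjugation turns a variation of `h_C` into the pairing of `E` with the variation of
`𝒬_u` (`evol_h`, `finsum_chiDer_h`); in other words, `E` is the variational derivative of `h_C`.
This gives the Hamiltonian flows on `𝒬_u` for both brackets (`ham₁_Qu`, `ham₂_Qu`). They differ
from the derivation `X_C` with `X_C 𝒬_u = [E_{-1}, s]` by gauge transformations by elements of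
`𝔪 ⊗ 𝒫`, which act trivially on `𝒲` (`gaugeDer_W`). As the resolvent of `z C` is `z E`, the first
flow of `C` and the second flow of `z C` both are `X_C` on `𝒲` (`flow₁_eq`, `flow₂_zMul_eq`).

*Commutation and integrals.* With `E_+` the part of `E` polynomial in `z`, the operator `X_C + E_+`
commutes with the Lax operator (`obr_flowOp_lax`), so that its dressing is `X_C + R_C` with `R_C` in
`𝒦`. Hence `X_C E' = -[E_+, E']` for every resolvent `E'` (`flowDer_res`). Together with
`[E, E'] = 0` this gives `[E_+, E']_{-1} = -[E, E'_+]_{-1}`, which is the supercommutation of `X_C`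
and `X_{C'}` on `𝒬_u` (`flowDer_comm`). Pairing the dressed zero curvature equation with `C' ⊗ 1`
exhibits `X_C h_{C'}` as a total derivative (`flowDer_h`), whose primitive is again gauge invariant
(`mem_W_of_D`).

These arguments are carried out for homogeneous `C`; general elements of `𝒵` are sums of their
components of parity `0` and `1`, which lie in `𝒵` as well (`parPart_mem_Z`).
-/

noncomputable section

namespace SuperDS

/-! ### Signs and parities -/

theorem zmod2_cases (p : ZMod 2) : p = 0 ∨ p = 1 := by revert p; decide

@[simp] theorem sgn_zero : sgn 0 = 1 := if_pos rfl

@[simp] theorem sgn_one : sgn 1 = -1 := if_neg (by decide)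

theorem sgn_ne_zero (p : ZMod 2) : sgn p ≠ 0 := by
  rcases zmod2_cases p with rfl | rfl <;> simp

theorem sgn_natCast (n : ℕ) : sgn (n : ZMod 2) = (-1) ^ n := by
  induction n with
  | zero => simp
  | succ n ih => rw [Nat.cast_succ, sgn_add, ih, sgn_one, pow_succ]

/-- `-1 = 1` in `ZMod 2`, in the form used for parities. -/
theorem par_add_self (p : ZMod 2) : p + p = 0 := by revert p; decide

theorem par_mul_self (p : ZMod 2) : p * p = p := by revert p; decide

namespace SuperPoly

variable {X : Type*} (ε : X → ZMod 2)

variable {ε} in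
/-- `a` is homogeneous of parity `p`. -/
def IsPar (p : ZMod 2) (a : SuperPoly ε) : Prop := parityAut ε a = sgn p • a

variable {ε}

theorem isPar_gen (x : X) : IsPar (ε x) (gen ε x) := parityAut_gen ε x

theorem isPar_algebraMap (c : ℂ) : IsPar 0 (algebraMap ℂ (SuperPoly ε) c) := by
  simp [IsPar]

theorem isPar_one : IsPar 0 (1 : SuperPoly ε) := by simp [IsPar]

theorem isPar_zero (p : ZMod 2) : IsPar p (0 : SuperPoly ε) := by simp [IsPar]

theorem IsPar.add {p : ZMod 2} {a b : SuperPoly ε} (ha : IsPar p a) (hb : IsPar p b) :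
    IsPar p (a + b) := by
  unfold IsPar at *; rw [map_add, ha, hb, smul_add]

theorem IsPar.smul {p : ZMod 2} {a : SuperPoly ε} (c : ℂ) (ha : IsPar p a) : IsPar p (c • a) := by
  unfold IsPar at *; rw [map_smul, ha, smul_comm]

theorem IsPar.mul {p q : ZMod 2} {a b : SuperPoly ε} (ha : IsPar p a) (hb : IsPar q b) :
    IsPar (p + q) (a * b) := by
  unfold IsPar at *; rw [map_mul, ha, hb, smul_mul_smul_comm, sgn_add]

theorem IsPar.sum {κ : Type*} {p : ZMod 2} (s : Finset κ) {a : κ → SuperPoly ε}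
    (ha : ∀ k ∈ s, IsPar p (a k)) : IsPar p (∑ k ∈ s, a k) := by
  unfold IsPar at *; rw [map_sum, Finset.smul_sum]; exact Finset.sum_congr rfl ha

theorem isPar_component (p : ZMod 2) (a : SuperPoly ε) : IsPar p (component ε p a) :=
  parityAut_component ε p a

theorem component_of_isPar {p : ZMod 2} {a : SuperPoly ε} (ha : IsPar p a) (q : ZMod 2) :
    component ε q a = if q = p then a else 0 := by
  simp only [component, LinearMap.smul_apply, LinearMap.add_apply, LinearMap.id_apply,
    AlgHom.toLinearMap_apply]
  rw [ha]
  rcases zmod2_cases p with rfl | rfl <;> rcases zmod2_cases q with rfl | rfl <;>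
    simp [← two_smul ℂ, smul_smul]

theorem IsPar.component_eq {p : ZMod 2} {a : SuperPoly ε} (ha : IsPar p a) :
    component ε p a = a := by rw [component_of_isPar ha, if_pos rfl]

theorem sum_univ_zmod2 {M : Type*} [AddCommMonoid M] (g : ZMod 2 → M) :
    ∑ p : ZMod 2, g p = g 0 + g 1 := by
  rw [show (Finset.univ : Finset (ZMod 2)) = {0, 1} by decide, Finset.sum_pair (by decide)]

theorem component_add_component (a : SuperPoly ε) :
    component ε 0 a + component ε 1 a = a := by
  simp only [component, LinearMap.smul_apply, LinearMap.add_apply, LinearMap.id_apply,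
    AlgHom.toLinearMap_apply, sgn_zero, sgn_one]
  module

/-- The automorphism `σ^p`, where `σ` is the parity automorphism. -/
def tw (p : ZMod 2) : SuperPoly ε →ₐ[ℂ] SuperPoly ε :=
  if p = 0 then AlgHom.id ℂ _ else parityAut ε

theorem IsPar.tw {q : ZMod 2} {a : SuperPoly ε} (ha : IsPar q a) (p : ZMod 2) :
    tw p a = sgn (p * q) • a := by
  rcases zmod2_cases p with rfl | rfl
  · simp [SuperPoly.tw]
  · simpa [SuperPoly.tw, IsPar] using ha

theorem tw_tw (p q : ZMod 2) (a : SuperPoly ε) : tw p (tw q a) = tw (p + q) a := by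
  rcases zmod2_cases p with rfl | rfl <;> rcases zmod2_cases q with rfl | rfl <;>
    simp [SuperPoly.tw, parityAut_parityAut, par_add_self]

theorem tw_parityAut (p : ZMod 2) (a : SuperPoly ε) :
    tw p (parityAut ε a) = parityAut ε (tw p a) := by
  rcases zmod2_cases p with rfl | rfl <;> simp [SuperPoly.tw]

/-- Supercommutativity: moving a homogeneous element of parity `p` to the right. -/
theorem IsPar.mul_eq_tw {p : ZMod 2} {a : SuperPoly ε} (ha : IsPar p a) (b : SuperPoly ε) :
    a * b = SuperPoly.tw p b * a := by
  induction b using induction with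
  | halg c => rw [AlgHom.commutes]; exact (Algebra.commutes c a).symm
  | hgen y =>
    unfold IsPar at ha
    rw [mul_gen, (isPar_gen y).tw, ha]
    rcases zmod2_cases (ε y) with h | h <;> simp [h]
  | hmul b c hb hc => rw [map_mul, ← mul_assoc, hb, mul_assoc, hc, mul_assoc]
  | hadd b c hb hc => rw [mul_add, hb, hc, map_add, add_mul]

theorem IsPar.mul_comm' {p : ZMod 2} {a : SuperPoly ε} (ha : IsPar p a) {q : ZMod 2}
    {b : SuperPoly ε} (hb : IsPar q b) : a * b = sgn (p * q) • (b * a) := by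
  rw [ha.mul_eq_tw, hb.tw, smul_mul_assoc]

/-! ### Superderivations -/

/-- Superderivations of parity `p`. -/
structure IsSDer (p : ZMod 2) (d : SuperPoly ε →ₗ[ℂ] SuperPoly ε) : Prop where
  par : ∀ a, parityAut ε (d a) = sgn p • d (parityAut ε a)
  leib : ∀ a b, d (a * b) = d a * b + tw p a * d b

namespace IsSDer

variable {p q : ZMod 2} {d e : SuperPoly ε →ₗ[ℂ] SuperPoly ε}

theorem isPar (hd : IsSDer p d) {a : SuperPoly ε} (ha : IsPar q a) : IsPar (p + q) (d a) := by
  unfold IsPar at *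
  rw [hd.par, ha, map_smul, smul_smul, sgn_add]

theorem leib' (hd : IsSDer p d) {a : SuperPoly ε} (ha : IsPar q a) (b : SuperPoly ε) :
    d (a * b) = d a * b + sgn (p * q) • (a * d b) := by
  rw [hd.leib, ha.tw, smul_mul_assoc]

theorem one (hd : IsSDer p d) : d 1 = 0 := by
  have h := hd.leib 1 1
  simpa using h

theorem algebraMap (hd : IsSDer p d) (c : ℂ) : d (algebraMap ℂ _ c) = 0 := by
  rw [Algebra.algebraMap_eq_smul_one, map_smul, hd.one, smul_zero]

/-- A superderivation which vanishes on a set of elements vanishes on the subalgebra they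
generate. -/
theorem eqOn_adjoin (hd : IsSDer p d) (he : IsSDer p e) {s : Set (SuperPoly ε)}
    (h : ∀ a ∈ s, d a = e a) {a : SuperPoly ε} (ha : a ∈ Algebra.adjoin ℂ s) : d a = e a := by
  induction ha using Algebra.adjoin_induction with
  | mem a ha => exact h a ha
  | algebraMap c => rw [hd.algebraMap, he.algebraMap]
  | add a b _ _ ha hb => rw [map_add, map_add, ha, hb]
  | mul a b _ _ ha hb => rw [hd.leib, he.leib, ha, hb]

theorem zero (p : ZMod 2) : IsSDer p (0 : SuperPoly ε →ₗ[ℂ] SuperPoly ε) :=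
  ⟨by simp, by simp⟩

theorem ext_gen (hd : IsSDer p d) (he : IsSDer p e) (h : ∀ x, d (gen ε x) = e (gen ε x)) :
    d = e := by
  ext a
  induction a using induction with
  | halg c => rw [hd.algebraMap, he.algebraMap]
  | hgen x => exact h x
  | hmul a b ha hb => rw [hd.leib, he.leib, ha, hb]
  | hadd a b ha hb => rw [map_add, map_add, ha, hb]

theorem add (hd : IsSDer p d) (he : IsSDer p e) : IsSDer p (d + e) :=
  ⟨fun a => by simp [hd.par, he.par], fun a b => by
    simp only [LinearMap.add_apply, hd.leib, he.leib, add_mul, mul_add]; abel⟩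

theorem smul (c : ℂ) (hd : IsSDer p d) : IsSDer p (c • d) :=
  ⟨fun a => by simp [hd.par, smul_comm c], fun a b => by
    simp only [LinearMap.smul_apply, hd.leib, smul_add, smul_mul_assoc, mul_smul_comm]⟩

theorem tw_comm (hd : IsSDer p d) (r : ZMod 2) (a : SuperPoly ε) :
    tw r (d a) = sgn (r * p) • d (tw r a) := by
  rcases zmod2_cases r with rfl | rfl
  · simp [SuperPoly.tw]
  · simpa [SuperPoly.tw] using hd.par a

/-- The supercommutator of two superderivations. -/
theorem supercomm (hd : IsSDer p d) (he : IsSDer q e) :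
    IsSDer (p + q) (d ∘ₗ e - sgn (p * q) • e ∘ₗ d) := by
  constructor
  · intro a
    simp only [LinearMap.sub_apply, LinearMap.smul_apply, LinearMap.comp_apply, map_sub, map_smul,
      hd.par, he.par, smul_sub, smul_smul, sgn_add]
    congr 2
    ring
  · intro a b
    simp only [LinearMap.sub_apply, LinearMap.smul_apply, LinearMap.comp_apply, hd.leib, he.leib,
      map_add, hd.tw_comm, he.tw_comm, tw_tw, sub_mul, mul_sub, smul_add, smul_mul_assoc,
      mul_smul_comm, smul_smul, mul_comm q p, sgn_mul_self, one_smul, add_comm q p]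
    abel

end IsSDer

/-- The diagonal of the matrix representation that defines a superderivation is `a` up to sign, and
its off-diagonal entry is the superderivation itself; multiplicativity is the Leibniz rule. -/
theorem lift_derMatrix (p : ZMod 2) (δ : X → SuperPoly ε) (a : SuperPoly ε) :
    lift ε (derMatrix ε p δ) (derMatrix_comm ε p δ) a = !![tw p a, superDer ε p δ a; 0, a] := by
  have h01 : ∀ a, lift ε (derMatrix ε p δ) (derMatrix_comm ε p δ) a 0 1 = superDer ε p δ a :=
    fun a => rfl
  have h : ∀ a, lift ε (derMatrix ε p δ) (derMatrix_comm ε p δ) a 0 0 = tw p a ∧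
      lift ε (derMatrix ε p δ) (derMatrix_comm ε p δ) a 1 0 = 0 ∧
      lift ε (derMatrix ε p δ) (derMatrix_comm ε p δ) a 1 1 = a := by
    intro a
    induction a using induction with
    | halg c =>
      rw [AlgHom.commutes, AlgHom.commutes]
      simp [Matrix.algebraMap_matrix_apply]
    | hgen x =>
      rw [lift_gen, (isPar_gen x).tw]
      simp [derMatrix]
    | hmul a b ha hb =>
      obtain ⟨h1, h2, h3⟩ := ha
      obtain ⟨k1, k2, k3⟩ := hb
      simp [Matrix.mul_apply, h1, h2, h3, k1, k2, k3]
    | hadd a b ha hb => simp [ha, hb]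
  obtain ⟨h1, h2, h3⟩ := h a
  rw [← h01]
  ext i j
  fin_cases i <;> fin_cases j <;> simp [h1, h2, h3]

theorem superDer_gen (p : ZMod 2) (δ : X → SuperPoly ε) (x : X) :
    superDer ε p δ (gen ε x) = component ε (p + ε x) (δ x) := by
  change lift ε (derMatrix ε p δ) (derMatrix_comm ε p δ) (gen ε x) 0 1 = _
  rw [lift_gen]
  simp [derMatrix]

theorem superDer_gen' (p : ZMod 2) (δ : X → SuperPoly ε) (x : X) (h : IsPar (p + ε x) (δ x)) :
    superDer ε p δ (gen ε x) = δ x := by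
  rw [superDer_gen, h.component_eq]

theorem isSDer_superDer (p : ZMod 2) (δ : X → SuperPoly ε) : IsSDer p (superDer ε p δ) := by
  have hl : ∀ a b, superDer ε p δ (a * b) = superDer ε p δ a * b + tw p a * superDer ε p δ b := by
    intro a b
    have h := congrFun (congrFun (map_mul (lift ε (derMatrix ε p δ) (derMatrix_comm ε p δ)) a b) 0)
      1
    simp only [lift_derMatrix] at h
    simpa [Matrix.mul_apply, add_comm] using h
  refine ⟨fun a => ?_, hl⟩
  induction a using induction with
  | halg c =>
    have h1 : superDer ε p δ 1 = 0 := by simpa using hl 1 1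
    simp [Algebra.algebraMap_eq_smul_one, h1]
  | hgen x =>
    rw [parityAut_gen, map_smul, superDer_gen, isPar_component, smul_smul, sgn_add]
  | hmul a b ha hb =>
    rw [hl, map_mul, hl, map_add, map_mul, map_mul, ha, hb, tw_parityAut, smul_mul_assoc,
      mul_smul_comm, smul_add]
  | hadd a b ha hb => rw [map_add, map_add, map_add, ha, hb, map_add, smul_add]

theorem superDer_smul (p : ZMod 2) (c : ℂ) (δ : X → SuperPoly ε) :
    superDer ε p (c • δ) = c • superDer ε p δ :=
  (isSDer_superDer p _).ext_gen ((isSDer_superDer p _).smul c) fun x => by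
    simp [superDer_gen]

end SuperPoly

section DiffPolyLemmas

open SuperPoly

variable {ι : Type*} {ε : ι → ZMod 2}

/-! ### Differential polynomials and `χ`-brackets -/

theorem isPar_jet (t : ι) (n : ℕ) : IsPar (ε t + n) (jet ε t n) :=
  isPar_gen (ε := fun x : ι × ℕ => ε x.1 + (x.2 : ZMod 2)) (t, n)

theorem isSDer_D : IsSDer 1 (D ε) := isSDer_superDer _ _

theorem D_jet (t : ι) (n : ℕ) : D ε (jet ε t n) = jet ε t (n + 1) := by
  refine superDer_gen' (ε := fun x : ι × ℕ => ε x.1 + (x.2 : ZMod 2)) 1 _ (t, n) ?_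
  convert isPar_jet (ε := ε) t (n + 1) using 1
  push_cast; ring

theorem D_pow_jet (t : ι) (n : ℕ) : (D ε ^ n) (jet ε t 0) = jet ε t n := by
  induction n with
  | zero => simp
  | succ n ih => rw [pow_succ', Module.End.mul_apply, ih, D_jet]

theorem chiD_zero (x : ℕ → DiffPoly ε) : chiD ε x 0 = D ε (x 0) := rfl

theorem chiD_succ (x : ℕ → DiffPoly ε) (n : ℕ) :
    chiD ε x (n + 1) = (-1 : ℂ) ^ (n + 1) • D ε (x (n + 1)) + (-1 : ℂ) ^ n • x n := rfl

theorem isPar_D {p : ZMod 2} {a : DiffPoly ε} (ha : IsPar p a) : IsPar (1 + p) (D ε a) :=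
  isSDer_D.isPar ha

theorem isPar_chiD {e : ZMod 2} {y : ℕ → DiffPoly ε} (hy : ∀ i : ℕ, IsPar (e + i) (y i)) (i : ℕ) :
    IsPar (e + 1 + i) (chiD ε y i) := by
  cases i with
  | zero =>
    rw [chiD_zero]
    convert isPar_D (hy 0) using 1
    ring
  | succ n =>
    rw [chiD_succ]
    refine IsPar.add (IsPar.smul _ ?_) (IsPar.smul _ ?_)
    · convert isPar_D (hy (n + 1)) using 1
      push_cast; ring
    · convert hy n using 1
      push_cast
      rw [show e + 1 + ((n : ZMod 2) + 1) = e + n + (1 + 1) by ring, par_add_self, add_zero]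

theorem isPar_chiD_pow {e : ZMod 2} {y : ℕ → DiffPoly ε} (hy : ∀ i : ℕ, IsPar (e + i) (y i))
    (m i : ℕ) : IsPar (e + m + i) ((chiD ε ^ m) y i) := by
  induction m generalizing i with
  | zero => simpa using hy i
  | succ m ih =>
    rw [pow_succ', Module.End.mul_apply]
    convert isPar_chiD ih i using 1
    push_cast; ring

theorem chiD_pow_zero (y : ℕ → DiffPoly ε) (m : ℕ) : (chiD ε ^ m) y 0 = (D ε ^ m) (y 0) := by
  induction m with
  | zero => simp
  | succ m ih =>
    rw [pow_succ', pow_succ', Module.End.mul_apply, Module.End.mul_apply, chiD_zero, ih]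

theorem chiD_support {y : ℕ → DiffPoly ε} {N : ℕ} (hy : ∀ n, N ≤ n → y n = 0) (n : ℕ)
    (hn : N + 1 ≤ n) : chiD ε y n = 0 := by
  obtain ⟨n, rfl⟩ : ∃ k, n = k + 1 := ⟨n - 1, by omega⟩
  rw [chiD_succ, hy _ (by omega), hy _ (by omega)]
  simp

theorem chiD_pow_support {y : ℕ → DiffPoly ε} {N : ℕ} (hy : ∀ n, N ≤ n → y n = 0) (m : ℕ) :
    ∀ n, N + m ≤ n → (chiD ε ^ m) y n = 0 := by
  induction m with
  | zero => simpa using hy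
  | succ m ih =>
    intro n hn
    rw [pow_succ', Module.End.mul_apply]
    exact chiD_support ih n (by omega)

/-- A family of superderivations `F n` of parity `π + n` such that `b ↦ ∑ χ^n F n b` intertwines
`D` with `(-1)^π (D + χ)`. -/
structure IsChiDer (π : ZMod 2) (F : ℕ → DiffPoly ε →ₗ[ℂ] DiffPoly ε) : Prop where
  der : ∀ n : ℕ, IsSDer (π + n) (F n)
  map_D : ∀ n b, F n (D ε b) = sgn π • chiD ε (fun m => F m b) n

/-- Superderivations of parity `π` which supercommute with `D`. -/
structure IsEvol (π : ZMod 2) (F : DiffPoly ε →ₗ[ℂ] DiffPoly ε) : Prop where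
  der : IsSDer π F
  map_D : ∀ b, F (D ε b) = sgn π • D ε (F b)

theorem IsChiDer.isEvol {π : ZMod 2} {F : ℕ → DiffPoly ε →ₗ[ℂ] DiffPoly ε} (hF : IsChiDer π F) :
    IsEvol π (F 0) :=
  ⟨by simpa using hF.der 0, fun b => hF.map_D 0 b⟩

theorem IsChiDer.map_D_succ {π : ZMod 2} {F : ℕ → DiffPoly ε →ₗ[ℂ] DiffPoly ε}
    (hF : IsChiDer π F) (n : ℕ) (b : DiffPoly ε) :
    F (n + 1) (D ε b) = sgn (π + (n + 1 : ℕ)) • D ε (F (n + 1) b) + sgn (π + n) • F n b := by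
  rw [hF.map_D, chiD_succ, smul_add, smul_smul, smul_smul, sgn_add, sgn_add, sgn_natCast,
    sgn_natCast]

/-- The differential subalgebra generated by a set. -/
def diffAlg (G : Set (DiffPoly ε)) : Subalgebra ℂ (DiffPoly ε) :=
  Algebra.adjoin ℂ {x | ∃ g ∈ G, ∃ n, x = (D ε ^ n) g}

theorem D_pow_mem_diffAlg {G : Set (DiffPoly ε)} {g : DiffPoly ε} (hg : g ∈ G) (n : ℕ) :
    (D ε ^ n) g ∈ diffAlg G := Algebra.subset_adjoin ⟨g, hg, n, rfl⟩

theorem IsEvol.eqOn {π : ZMod 2} {E F : DiffPoly ε →ₗ[ℂ] DiffPoly ε} (hE : IsEvol π E)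
    (hF : IsEvol π F) {G : Set (DiffPoly ε)} (h : ∀ g ∈ G, E g = F g) {a : DiffPoly ε}
    (ha : a ∈ diffAlg G) : E a = F a := by
  refine hE.der.eqOn_adjoin hF.der ?_ ha
  rintro _ ⟨g, hg, n, rfl⟩
  induction n with
  | zero => exact h g hg
  | succ n ih => rw [pow_succ', Module.End.mul_apply, hE.map_D, hF.map_D, ih]

theorem IsChiDer.eqOn {π : ZMod 2} {E F : ℕ → DiffPoly ε →ₗ[ℂ] DiffPoly ε} (hE : IsChiDer π E)
    (hF : IsChiDer π F) {G : Set (DiffPoly ε)} (h : ∀ g ∈ G, ∀ n, E n g = F n g) {a : DiffPoly ε}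
    (ha : a ∈ diffAlg G) (n : ℕ) : E n a = F n a := by
  refine (hE.der n).eqOn_adjoin (hF.der n) ?_ ha
  rintro _ ⟨g, hg, m, rfl⟩
  induction m generalizing n with
  | zero => exact h g hg n
  | succ m ih =>
    rw [pow_succ', Module.End.mul_apply, hE.map_D, hF.map_D, funext ih]

theorem IsChiDer.zero (π : ZMod 2) :
    IsChiDer π (fun _ => (0 : DiffPoly ε →ₗ[ℂ] DiffPoly ε)) :=
  ⟨fun n => IsSDer.zero _, fun n b => by cases n <;> simp [chiD_zero, chiD_succ]⟩

/-- The values `v j = ∑ χ^i v j i` have the parity of `{a_χ u_j}` for `a` of parity `π + 1`. -/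
def ValPar (π : ZMod 2) (v : ι → ℕ → DiffPoly ε) : Prop :=
  ∀ j, ∀ i : ℕ, IsPar (π + ε j + i) (v j i)

theorem isSDer_leibnizExt (p : ZMod 2) (v : ι → ℕ → DiffPoly ε) (n : ℕ) :
    IsSDer (p + n + 1) (leibnizExt ε p v n) := isSDer_superDer _ _

theorem leibnizExt_jet {p : ZMod 2} {v : ι → ℕ → DiffPoly ε} (hv : ValPar (p + 1) v) (n : ℕ) (j : ι)
    (m : ℕ) : leibnizExt ε p v n (jet ε j m) = sgn ((p + 1) * m) • (chiD ε ^ m) (v j) n := by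
  refine superDer_gen' (ε := fun x : ι × ℕ => ε x.1 + (x.2 : ZMod 2)) _ _ (j, m) (IsPar.smul _ ?_)
  convert isPar_chiD_pow (hv j) m n using 1
  dsimp only
  ring

theorem leibnizExt_jet_zero {p : ZMod 2} {v : ι → ℕ → DiffPoly ε} (hv : ValPar (p + 1) v) (n : ℕ)
    (j : ι) : leibnizExt ε p v n (jet ε j 0) = v j n := by
  rw [leibnizExt_jet hv]; simp

/-- Sesquilinearity. Both sides of the relation with `D` are superderivations, so that it is enough
to compare them on the jets. -/
theorem isChiDer_leibnizExt {p : ZMod 2} {v : ι → ℕ → DiffPoly ε} (hv : ValPar (p + 1) v) :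
    IsChiDer (p + 1) (leibnizExt ε p v) := by
  have hd : ∀ n : ℕ, IsSDer (p + 1 + n) (leibnizExt ε p v n) := fun n => by
    convert isSDer_leibnizExt p v n using 1
    ring
  refine ⟨hd, fun n b => ?_⟩
  have hjet : ∀ (n : ℕ) (j : ι) (m : ℕ), leibnizExt ε p v n (D ε (jet ε j m))
      = sgn (p + 1) • chiD ε (fun k => leibnizExt ε p v k (jet ε j m)) n := by
    intro n j m
    rw [D_jet, leibnizExt_jet hv, funext fun k => leibnizExt_jet hv k j m]
    have h2 : (fun k => sgn ((p + 1) * (m : ZMod 2)) • (chiD ε ^ m) (v j) k)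
        = sgn ((p + 1) * (m : ZMod 2)) • (chiD ε ^ m) (v j) := rfl
    rw [h2, map_smul, pow_succ', Module.End.mul_apply, Pi.smul_apply, smul_smul, ← sgn_add]
    congr 2
    push_cast; ring
  cases n with
  | zero =>
    have h1 := (hd 0).supercomm (isSDer_D (ε := ε))
    have h2 : leibnizExt ε p v 0 ∘ₗ D ε - sgn ((p + 1 + (0 : ℕ)) * 1) • D ε ∘ₗ leibnizExt ε p v 0
        = 0 := by
      refine h1.ext_gen (IsSDer.zero _) fun x => ?_
      have h3 := hjet 0 x.1 x.2
      rw [chiD_zero] at h3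
      simp only [LinearMap.sub_apply, LinearMap.smul_apply, LinearMap.comp_apply]
      change leibnizExt ε p v 0 (D ε (jet ε x.1 x.2)) - sgn ((p + 1 + (0 : ℕ)) * 1) •
        D ε (leibnizExt ε p v 0 (jet ε x.1 x.2)) = 0
      rw [h3]
      simp
    have h3 := LinearMap.congr_fun h2 b
    simp only [LinearMap.sub_apply, LinearMap.smul_apply, LinearMap.comp_apply,
      LinearMap.zero_apply, sub_eq_zero] at h3
    rw [h3, chiD_zero]
    simp
  | succ n =>
    have h1 := (hd (n + 1)).supercomm (isSDer_D (ε := ε))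
    have hpar : p + 1 + ((n + 1 : ℕ) : ZMod 2) + 1 = p + 1 + n := by
      push_cast
      rw [show p + 1 + ((n : ZMod 2) + 1) + 1 = p + 1 + n + (1 + 1) by ring, par_add_self, add_zero]
    rw [hpar] at h1
    have h2 : leibnizExt ε p v (n + 1) ∘ₗ D ε
        - sgn ((p + 1 + (n + 1 : ℕ)) * 1) • D ε ∘ₗ leibnizExt ε p v (n + 1)
        = sgn (p + 1 + n) • leibnizExt ε p v n := by
      refine h1.ext_gen ((hd n).smul _) fun x => ?_
      have h3 := hjet (n + 1) x.1 x.2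
      rw [chiD_succ] at h3
      simp only [LinearMap.sub_apply, LinearMap.smul_apply, LinearMap.comp_apply]
      change leibnizExt ε p v (n + 1) (D ε (jet ε x.1 x.2)) - sgn ((p + 1 + (n + 1 : ℕ)) * 1) •
        D ε (leibnizExt ε p v (n + 1) (jet ε x.1 x.2)) = sgn (p + 1 + n) •
          leibnizExt ε p v n (jet ε x.1 x.2)
      rw [h3, smul_add, smul_smul, smul_smul, mul_one, sgn_add (p + 1), sgn_add (p + 1),
        sgn_natCast, sgn_natCast]
      abel
    have h3 := LinearMap.congr_fun h2 b
    simp only [LinearMap.sub_apply, LinearMap.smul_apply, LinearMap.comp_apply,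
      sub_eq_iff_eq_add'] at h3
    rw [h3, chiD_succ, smul_add, smul_smul, smul_smul, mul_one, sgn_add (p + 1), sgn_add (p + 1),
        sgn_natCast, sgn_natCast]

theorem leibnizExt_eventually {p : ZMod 2} {v : ι → ℕ → DiffPoly ε} (hv : ValPar (p + 1) v) {N : ℕ}
    (hN : ∀ j, ∀ n, N ≤ n → v j n = 0) (a : DiffPoly ε) :
    ∃ M, ∀ n, M ≤ n → leibnizExt ε p v n a = 0 := by
  induction a using SuperPoly.induction with
  | halg c => exact ⟨0, fun n _ => (isSDer_leibnizExt p v n).algebraMap c⟩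
  | hgen x =>
    refine ⟨N + x.2, fun n hn => ?_⟩
    have h := leibnizExt_jet hv n x.1 x.2
    rw [chiD_pow_support (hN x.1) x.2 n hn, smul_zero] at h
    exact h
  | hmul a b ha hb =>
    obtain ⟨M, hM⟩ := ha
    obtain ⟨M', hM'⟩ := hb
    refine ⟨max M M', fun n hn => ?_⟩
    rw [(isSDer_leibnizExt p v n).leib, hM n (le_trans (le_max_left _ _) hn),
      hM' n (le_trans (le_max_right _ _) hn)]
    simp
  | hadd a b ha hb =>
    obtain ⟨M, hM⟩ := ha
    obtain ⟨M', hM'⟩ := hb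
    refine ⟨max M M', fun n hn => ?_⟩
    rw [map_add, hM n (le_trans (le_max_left _ _) hn), hM' n (le_trans (le_max_right _ _) hn),
      add_zero]

theorem leibnizExt_smul (p : ZMod 2) (c : ℂ) (v : ι → ℕ → DiffPoly ε) (n : ℕ) :
    leibnizExt ε p (c • v) n = c • leibnizExt ε p v n := by
  rw [leibnizExt, leibnizExt, ← superDer_smul]
  congr 1
  funext x
  simp only [Pi.smul_apply, map_smul]
  rw [smul_comm]

theorem leibnizExt_zero (p : ZMod 2) (n : ℕ) :
    leibnizExt ε p (0 : ι → ℕ → DiffPoly ε) n = 0 := by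
  have h := leibnizExt_smul p 0 (0 : ι → ℕ → DiffPoly ε) n
  rwa [zero_smul, zero_smul] at h

end DiffPolyLemmas

/-! ### Exponentials in complete filtered spaces -/

/-- A decreasing, exhaustive, separated and complete filtration indexed by `ℤ`. -/
structure Filt (V : Type*) [AddCommGroup V] [Module ℂ V] where
  /-- The subspace of elements of order at least `k`. -/
  F : ℤ → Submodule ℂ V
  anti : Antitone F
  exh : ∀ x, ∃ k, x ∈ F k
  sep : ∀ x, (∀ k, x ∈ F k) → x = 0
  complete : ∀ (k : ℤ) (x : ℕ → V), (∀ m : ℕ, x m ∈ F (k + m)) →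
    ∃ y, ∀ n : ℕ, y - ∑ m ∈ Finset.range n, x m ∈ F (k + n)

namespace Filt

variable {V V₁ V₂ : Type*} [AddCommGroup V] [Module ℂ V] [AddCommGroup V₁] [Module ℂ V₁]
  [AddCommGroup V₂] [Module ℂ V₂] (𝓕 : Filt V) (𝓕₁ : Filt V₁) (𝓕₂ : Filt V₂)

theorem mono {k l : ℤ} (h : k ≤ l) {x : V} (hx : x ∈ 𝓕.F l) : x ∈ 𝓕.F k := 𝓕.anti h hx

/-- The series `∑ x m` converges to `y`. -/
def HasSer (x : ℕ → V) (y : V) : Prop :=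
  ∀ k, ∃ n₀, ∀ n, n₀ ≤ n → y - ∑ m ∈ Finset.range n, x m ∈ 𝓕.F k

variable {𝓕 𝓕₁ 𝓕₂}

theorem HasSer.unique {x : ℕ → V} {y y' : V} (h : 𝓕.HasSer x y) (h' : 𝓕.HasSer x y') : y = y' := by
  rw [← sub_eq_zero]
  refine 𝓕.sep _ fun k => ?_
  obtain ⟨n, hn⟩ := h k
  obtain ⟨n', hn'⟩ := h' k
  have h1 := (𝓕.F k).sub_mem (hn (max n n') (le_max_left _ _)) (hn' (max n n') (le_max_right _ _))
  rwa [sub_sub_sub_cancel_right] at h1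

theorem exists_hasSer {k : ℤ} {x : ℕ → V} (hx : ∀ m : ℕ, x m ∈ 𝓕.F (k + m)) :
    ∃ y, 𝓕.HasSer x y := by
  obtain ⟨y, hy⟩ := 𝓕.complete k x hx
  refine ⟨y, fun l => ⟨(l - k).toNat, fun n hn => 𝓕.mono ?_ (hy n)⟩⟩
  have := Int.self_le_toNat (l - k)
  have : ((l - k).toNat : ℤ) ≤ n := by exact_mod_cast hn
  linarith

theorem HasSer.add {x x' : ℕ → V} {y y' : V} (h : 𝓕.HasSer x y) (h' : 𝓕.HasSer x' y') :
    𝓕.HasSer (fun m => x m + x' m) (y + y') := by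
  intro k
  obtain ⟨n, hn⟩ := h k
  obtain ⟨n', hn'⟩ := h' k
  refine ⟨max n n', fun m hm => ?_⟩
  rw [Finset.sum_add_distrib, add_sub_add_comm]
  exact (𝓕.F k).add_mem (hn m (le_trans (le_max_left _ _) hm))
    (hn' m (le_trans (le_max_right _ _) hm))

theorem HasSer.map {x : ℕ → V₁} {y : V₁} (h : 𝓕₁.HasSer x y) (g : V₁ →ₗ[ℂ] V₂) {c : ℤ}
    (hg : ∀ k, ∀ v ∈ 𝓕₁.F k, g v ∈ 𝓕₂.F (k + c)) : 𝓕₂.HasSer (fun m => g (x m)) (g y) := by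
  intro k
  obtain ⟨n, hn⟩ := h (k - c)
  refine ⟨n, fun m hm => ?_⟩
  have h1 := hg _ _ (hn m hm)
  rwa [map_sub, map_sum, sub_add_cancel] at h1

/-- `S` is closed for the topology given by the filtration. -/
def IsClosed (𝓕 : Filt V) (S : Submodule ℂ V) : Prop :=
  ∀ x, (∀ k, ∃ y ∈ S, x - y ∈ 𝓕.F k) → x ∈ S

theorem isClosed_F (k : ℤ) : 𝓕.IsClosed (𝓕.F k) := fun x hx => by
  obtain ⟨y, hy, hxy⟩ := hx k
  simpa using (𝓕.F k).add_mem hxy hy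

theorem isClosed_ker (g : V₁ →ₗ[ℂ] V₂) {c : ℤ}
    (hg : ∀ k, ∀ v ∈ 𝓕₁.F k, g v ∈ 𝓕₂.F (k + c)) : 𝓕₁.IsClosed (LinearMap.ker g) := by
  intro x hx
  rw [LinearMap.mem_ker]
  refine 𝓕₂.sep _ fun k => ?_
  obtain ⟨y, hy, hxy⟩ := hx (k - c)
  have h := hg _ _ hxy
  rw [map_sub, LinearMap.mem_ker.1 hy, sub_zero] at h
  simpa using h

theorem IsClosed.inf {S S' : Submodule ℂ V} (h : 𝓕.IsClosed S) (h' : 𝓕.IsClosed S') :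
    𝓕.IsClosed (S ⊓ S') := fun x hx =>
  ⟨h x fun k => by obtain ⟨y, hy, hk⟩ := hx k; exact ⟨y, hy.1, hk⟩,
   h' x fun k => by obtain ⟨y, hy, hk⟩ := hx k; exact ⟨y, hy.2, hk⟩⟩

/-- The operator `U` raises the filtration by one. -/
def Raises (𝓕 : Filt V) (U : V →ₗ[ℂ] V) : Prop := ∀ k, ∀ x ∈ 𝓕.F k, U x ∈ 𝓕.F (k + 1)

theorem Raises.pow {U : V →ₗ[ℂ] V} (hU : 𝓕.Raises U) {k : ℤ} {x : V} (hx : x ∈ 𝓕.F k) (m : ℕ) :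
    (U ^ m) x ∈ 𝓕.F (k + m) := by
  induction m with
  | zero => simpa using hx
  | succ m ih =>
    rw [pow_succ', Module.End.mul_apply]
    have := hU _ _ ih
    rwa [Nat.cast_succ, ← add_assoc]

/-- The terms of the exponential series. -/
def expTerm (U : V →ₗ[ℂ] V) (x : V) (m : ℕ) : V := ((m.factorial : ℂ)⁻¹) • (U ^ m) x

theorem expTerm_mem {U : V →ₗ[ℂ] V} (hU : 𝓕.Raises U) {k : ℤ} {x : V} (hx : x ∈ 𝓕.F k) (m : ℕ) :
    expTerm U x m ∈ 𝓕.F (k + m) := Submodule.smul_mem _ _ (hU.pow hx m)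

theorem expTerm_succ (U : V →ₗ[ℂ] V) (x : V) (m : ℕ) :
    ((m + 1 : ℕ) : ℂ) • expTerm U x (m + 1) = U (expTerm U x m) := by
  rw [expTerm, expTerm, map_smul, pow_succ', Module.End.mul_apply, smul_smul]
  congr 1
  rw [Nat.factorial_succ, Nat.cast_mul, mul_inv, ← mul_assoc,
    mul_inv_cancel₀ (Nat.cast_ne_zero.2 (Nat.succ_ne_zero m)), one_mul]

/-- `y = e^U x`. -/
def HasExp (𝓕 : Filt V) (U : V →ₗ[ℂ] V) (x y : V) : Prop := 𝓕.HasSer (expTerm U x) y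

theorem exists_hasExp {U : V →ₗ[ℂ] V} (hU : 𝓕.Raises U) (x : V) : ∃ y, 𝓕.HasExp U x y := by
  obtain ⟨k, hk⟩ := 𝓕.exh x
  exact exists_hasSer (k := k) fun m => expTerm_mem hU hk m

theorem HasExp.add {U : V →ₗ[ℂ] V} {x x' y y' : V} (h : 𝓕.HasExp U x y) (h' : 𝓕.HasExp U x' y') :
    𝓕.HasExp U (x + x') (y + y') := by
  have h1 := HasSer.add h h'
  have h2 : (fun m => expTerm U x m + expTerm U x' m) = expTerm U (x + x') := by
    funext m; simp [expTerm]
  rwa [h2] at h1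

theorem HasExp.smul {U : V →ₗ[ℂ] V} {x y : V} (c : ℂ) (h : 𝓕.HasExp U x y) :
    𝓕.HasExp U (c • x) (c • y) := by
  have h1 := HasSer.map (𝓕₂ := 𝓕) h (c • LinearMap.id) (c := 0)
    (fun k v hv => by simpa using Submodule.smul_mem _ c hv)
  have h2 : (fun m => (c • LinearMap.id : V →ₗ[ℂ] V) (expTerm U x m)) = expTerm U (c • x) := by
    funext m; simp [expTerm]
  rwa [h2] at h1

/-- The operator `e^U`. -/
def exp (𝓕 : Filt V) (U : V →ₗ[ℂ] V) (hU : 𝓕.Raises U) : V →ₗ[ℂ] V where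
  toFun x := (exists_hasExp hU x).choose
  map_add' x y := (exists_hasExp hU (x + y)).choose_spec.unique
    ((exists_hasExp hU x).choose_spec.add (exists_hasExp hU y).choose_spec)
  map_smul' c x := (exists_hasExp hU (c • x)).choose_spec.unique
    ((exists_hasExp hU x).choose_spec.smul c)

theorem hasExp_exp {U : V →ₗ[ℂ] V} (hU : 𝓕.Raises U) (x : V) : 𝓕.HasExp U x (𝓕.exp U hU x) :=
  (exists_hasExp hU x).choose_spec

theorem hasExp_iff {U : V →ₗ[ℂ] V} (hU : 𝓕.Raises U) (x y : V) :
    𝓕.HasExp U x y ↔ 𝓕.exp U hU x = y :=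
  ⟨fun h => (hasExp_exp hU x).unique h, fun h => h ▸ hasExp_exp hU x⟩

theorem exp_sub_mem {U : V →ₗ[ℂ] V} (hU : 𝓕.Raises U) {k : ℤ} {x : V} (hx : x ∈ 𝓕.F k) :
    𝓕.exp U hU x - x ∈ 𝓕.F (k + 1) := by
  obtain ⟨n, hn⟩ := hasExp_exp hU x (k + 1)
  have h := hn (n + 1) (Nat.le_succ n)
  rw [Finset.sum_range_succ', show expTerm U x 0 = x by simp [expTerm]] at h
  have h2 : ∑ m ∈ Finset.range n, expTerm U x (m + 1) ∈ 𝓕.F (k + 1) :=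
    Submodule.sum_mem _ fun m _ => 𝓕.mono (by push_cast; linarith) (expTerm_mem hU hx (m + 1))
  have h3 := (𝓕.F (k + 1)).add_mem h h2
  convert h3 using 1
  abel

theorem exp_of_eq_zero {U : V →ₗ[ℂ] V} (hU : 𝓕.Raises U) {x : V} (hx : U x = 0) :
    𝓕.exp U hU x = x := by
  rw [← hasExp_iff]
  intro k
  refine ⟨1, fun n hn => ?_⟩
  obtain ⟨n, rfl⟩ : ∃ m, n = m + 1 := ⟨n - 1, by omega⟩
  rw [Finset.sum_range_succ', Finset.sum_eq_zero]
  · simp [expTerm]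
  · intro m _
    rw [expTerm, pow_succ, Module.End.mul_apply, hx, map_zero, smul_zero]

theorem exp_injective {U : V →ₗ[ℂ] V} (hU : 𝓕.Raises U) {x : V} (h : 𝓕.exp U hU x = 0) :
    x = 0 := by
  obtain ⟨k, hk⟩ := 𝓕.exh x
  have key : ∀ n : ℕ, x ∈ 𝓕.F (k + n) := by
    intro n
    induction n with
    | zero => simpa using hk
    | succ n ih =>
      have h1 := exp_sub_mem hU ih
      rw [h, zero_sub, neg_mem_iff] at h1
      rwa [Nat.cast_succ, ← add_assoc]
  refine 𝓕.sep _ fun l => 𝓕.mono ?_ (key (l - k).toNat)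
  have := Int.self_le_toNat (l - k)
  linarith

theorem exp_surjective {U : V →ₗ[ℂ] V} (hU : 𝓕.Raises U) (y : V) : ∃ x, 𝓕.exp U hU x = y := by
  -- The inverse is the geometric series in `1 - e^U`.
  set E : V →ₗ[ℂ] V := 𝓕.exp U hU with hE
  let G : V →ₗ[ℂ] V := LinearMap.id - E
  have hR : 𝓕.Raises G := fun k x hx => by
    have h := (𝓕.F (k + 1)).neg_mem (exp_sub_mem hU hx)
    simpa [G] using h
  obtain ⟨k, hk⟩ := 𝓕.exh y
  obtain ⟨x, hx⟩ := exists_hasSer (𝓕 := 𝓕) (k := k) fun m => hR.pow hk m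
  refine ⟨x, ?_⟩
  have h1 : 𝓕.HasSer (fun m => (G ^ m) y) (y + G x) := by
    have h2 := HasSer.map (𝓕₂ := 𝓕) hx G (c := 1) hR
    intro l
    obtain ⟨n₀, hn⟩ := h2 l
    refine ⟨n₀ + 1, fun n h => ?_⟩
    obtain ⟨n, rfl⟩ : ∃ m, n = m + 1 := ⟨n - 1, by omega⟩
    rw [Finset.sum_range_succ']
    have h3 := hn n (by omega)
    simp only [← Module.End.mul_apply, ← pow_succ'] at h3
    convert h3 using 1
    rw [pow_zero, Module.End.one_apply]
    abel
  have h2 := hx.unique h1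
  simp only [G, LinearMap.sub_apply, LinearMap.id_apply] at h2
  have h3 : y - E x = 0 := by
    have h4 : x + (y - E x) = x := by rw [add_sub_left_comm]; exact h2.symm
    exact add_eq_left.1 h4
  exact (sub_eq_zero.1 h3).symm

/-- The divided-power Leibniz rule. -/
theorem expTerm_bilin {U : V →ₗ[ℂ] V} {U₁ : V₁ →ₗ[ℂ] V₁} {U₂ : V₂ →ₗ[ℂ] V₂}
    (β : V₁ →ₗ[ℂ] V₂ →ₗ[ℂ] V) {S₁ : Submodule ℂ V₁} {S₂ : Submodule ℂ V₂}
    (h₁ : ∀ x ∈ S₁, U₁ x ∈ S₁) (h₂ : ∀ x ∈ S₂, U₂ x ∈ S₂)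
    (h : ∀ x ∈ S₁, ∀ y ∈ S₂, U (β x y) = β (U₁ x) y + β x (U₂ y)) {x : V₁} (hx : x ∈ S₁) {y : V₂}
    (hy : y ∈ S₂) (m : ℕ) : expTerm U (β x y) m
      = ∑ ij ∈ Finset.HasAntidiagonal.antidiagonal m,
        β (expTerm U₁ x ij.1) (expTerm U₂ y ij.2) := by
  have e₁ : ∀ m, expTerm U₁ x m ∈ S₁ := fun m => S₁.smul_mem _ (by
    induction m with
    | zero => simpa using hx
    | succ m ih => rw [pow_succ', Module.End.mul_apply]; exact h₁ _ ih)
  have e₂ : ∀ m, expTerm U₂ y m ∈ S₂ := fun m => S₂.smul_mem _ (by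
    induction m with
    | zero => simpa using hy
    | succ m ih => rw [pow_succ', Module.End.mul_apply]; exact h₂ _ ih)
  induction m with
  | zero => simp [expTerm]
  | succ m ih =>
    -- Multiplied by `m + 1 = i + j`, the terms of the right-hand side become the derivative of
    -- those of order `m`.
    have hne : ((m + 1 : ℕ) : ℂ) ≠ 0 := Nat.cast_ne_zero.2 (Nat.succ_ne_zero m)
    refine smul_right_injective V hne ?_
    dsimp only
    rw [expTerm_succ, ih, map_sum, Finset.smul_sum]
    have h3 : ∀ ij ∈ Finset.HasAntidiagonal.antidiagonal (m + 1), ((m + 1 : ℕ) : ℂ) •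
        β (expTerm U₁ x ij.1) (expTerm U₂ y ij.2) = (ij.1 : ℂ) • β (expTerm U₁ x ij.1)
          (expTerm U₂ y ij.2) + (ij.2 : ℂ) • β (expTerm U₁ x ij.1) (expTerm U₂ y ij.2) := by
      intro ij hij
      rw [← add_smul, ← Finset.HasAntidiagonal.mem_antidiagonal.1 hij, Nat.cast_add]
    rw [Finset.sum_congr rfl h3, Finset.sum_add_distrib]
    rw [Finset.Nat.sum_antidiagonal_succ (f := fun ij : ℕ × ℕ => (ij.1 : ℂ) •
      β (expTerm U₁ x ij.1) (expTerm U₂ y ij.2)), Finset.Nat.sum_antidiagonal_succ'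
      (f := fun ij : ℕ × ℕ => (ij.2 : ℂ) • β (expTerm U₁ x ij.1) (expTerm U₂ y ij.2))]
    simp only [Nat.cast_zero, zero_smul, zero_add]
    rw [← Finset.sum_add_distrib]
    refine Finset.sum_congr rfl fun ij _ => ?_
    rw [h _ (e₁ _) _ (e₂ _), ← expTerm_succ, ← expTerm_succ]
    simp

/-- The Cauchy product of convergent series. -/
theorem HasSer.bilin {x : ℕ → V₁} {y : ℕ → V₂} {X : V₁} {Y : V₂} (hX : 𝓕₁.HasSer x X)
    (hY : 𝓕₂.HasSer y Y) {a b : ℤ} (ha : ∀ m : ℕ, x m ∈ 𝓕₁.F (a + m))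
    (hb : ∀ m : ℕ, y m ∈ 𝓕₂.F (b + m)) (β : V₁ →ₗ[ℂ] V₂ →ₗ[ℂ] V)
    (hβ : ∀ k l, ∀ u ∈ 𝓕₁.F k, ∀ v ∈ 𝓕₂.F l, β u v ∈ 𝓕.F (k + l)) :
    𝓕.HasSer (fun m => ∑ ij ∈ Finset.HasAntidiagonal.antidiagonal m, β (x ij.1) (y ij.2))
      (β X Y) := by
  intro k
  obtain ⟨n₁, h₁⟩ := hX (k - b)
  obtain ⟨n₂, h₂⟩ := hY (k - a)
  obtain ⟨c, hc⟩ := 𝓕₁.exh X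
  obtain ⟨n₃, h₃⟩ := hY (k - c)
  set N : ℕ := (k - a - b).toNat
  have hN : k - a - b ≤ N := Int.self_le_toNat _
  refine ⟨n₁ + n₃ + N, fun n hn => ?_⟩
  have hy0 : ∀ n : ℕ, ∑ m ∈ Finset.range n, y m ∈ 𝓕₂.F b := fun n =>
    Submodule.sum_mem _ fun m _ => 𝓕₂.mono (by linarith [Nat.cast_nonneg (α := ℤ) m]) (hb m)
  -- Partial sums of the factors against the limits.
  have e1 : β X Y - β (∑ m ∈ Finset.range n, x m) (∑ m ∈ Finset.range n, y m) ∈ 𝓕.F k := by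
    have h4 := hβ _ _ _ hc _ (h₃ n (by omega))
    have h5 := hβ _ _ _ (h₁ n (by omega)) _ (hy0 n)
    have h6 := (𝓕.F k).add_mem (𝓕.mono (by linarith) h4) (𝓕.mono (by linarith) h5)
    convert h6 using 1
    simp only [map_sub, LinearMap.sub_apply]
    abel
  -- The square of indices minus the triangle consists of terms of high order.
  have e2 : β (∑ m ∈ Finset.range n, x m) (∑ m ∈ Finset.range n, y m)
      - ∑ m ∈ Finset.range n, ∑ ij ∈ Finset.HasAntidiagonal.antidiagonal m, β (x ij.1) (y ij.2)
        ∈ 𝓕.F k := by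
    have h4 : ∑ m ∈ Finset.range n,
        ∑ ij ∈ Finset.HasAntidiagonal.antidiagonal m, β (x ij.1) (y ij.2)
        = ∑ ij ∈ (Finset.range n ×ˢ Finset.range n) with ij.1 + ij.2 < n, β (x ij.1) (y ij.2) := by
      rw [Finset.sum_sigma']
      refine Finset.sum_bij' (fun s _ => s.2) (fun ij _ => ⟨ij.1 + ij.2, ij⟩) ?_ ?_ ?_ ?_ ?_
      · rintro ⟨m, i, j⟩ h
        simp only [Finset.mem_sigma, Finset.mem_range, Finset.HasAntidiagonal.mem_antidiagonal] at h
        simp only [Finset.mem_filter, Finset.mem_product, Finset.mem_range]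
        omega
      · rintro ⟨i, j⟩ h
        simp only [Finset.mem_filter, Finset.mem_product, Finset.mem_range] at h
        simp [h.2]
      · rintro ⟨m, i, j⟩ h
        simp only [Finset.mem_sigma, Finset.mem_range, Finset.HasAntidiagonal.mem_antidiagonal] at h
        obtain ⟨_, rfl⟩ := h
        rfl
      · rintro ⟨i, j⟩ h; rfl
      · rintro ⟨m, i, j⟩ h; rfl
    have h5 : β (∑ m ∈ Finset.range n, x m) (∑ m ∈ Finset.range n, y m)
        = ∑ ij ∈ Finset.range n ×ˢ Finset.range n, β (x ij.1) (y ij.2) := by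
      rw [Finset.sum_product]
      simp only [map_sum, LinearMap.sum_apply]
      exact Finset.sum_comm
    rw [h4, h5, ← Finset.sum_filter_add_sum_filter_not _ (fun ij : ℕ × ℕ => ij.1 + ij.2 < n),
      add_sub_cancel_left]
    refine Submodule.sum_mem _ fun ij hij => 𝓕.mono ?_ (hβ _ _ _ (ha _) _ (hb _))
    have h6 := (Finset.mem_filter.1 hij).2
    have h7 : (N : ℤ) ≤ ij.1 + ij.2 := by exact_mod_cast (by omega : N ≤ ij.1 + ij.2)
    linarith
  have := (𝓕.F k).add_mem e1 e2
  rwa [sub_add_sub_cancel] at this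

/-- If the operators `U` act by derivations with respect to a bilinear map, then their exponentials
preserve it. -/
theorem exp_bilin {U : V →ₗ[ℂ] V} {U₁ : V₁ →ₗ[ℂ] V₁} {U₂ : V₂ →ₗ[ℂ] V₂} (hU : 𝓕.Raises U)
    (hU₁ : 𝓕₁.Raises U₁) (hU₂ : 𝓕₂.Raises U₂) (β : V₁ →ₗ[ℂ] V₂ →ₗ[ℂ] V)
    (hβ : ∀ k l, ∀ u ∈ 𝓕₁.F k, ∀ v ∈ 𝓕₂.F l, β u v ∈ 𝓕.F (k + l))
    {S₁ : Submodule ℂ V₁} {S₂ : Submodule ℂ V₂}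
    (h₁ : ∀ x ∈ S₁, U₁ x ∈ S₁) (h₂ : ∀ x ∈ S₂, U₂ x ∈ S₂)
    (h : ∀ x ∈ S₁, ∀ y ∈ S₂, U (β x y) = β (U₁ x) y + β x (U₂ y)) {x : V₁} (hx : x ∈ S₁) {y : V₂}
    (hy : y ∈ S₂) : 𝓕.exp U hU (β x y) = β (𝓕₁.exp U₁ hU₁ x) (𝓕₂.exp U₂ hU₂ y) := by
  rw [← hasExp_iff]
  obtain ⟨a, ha⟩ := 𝓕₁.exh x
  obtain ⟨b, hb⟩ := 𝓕₂.exh y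
  have h3 := HasSer.bilin (hasExp_exp hU₁ x) (hasExp_exp hU₂ y) (expTerm_mem hU₁ ha)
    (expTerm_mem hU₂ hb) β hβ
  rwa [← funext fun m => expTerm_bilin β h₁ h₂ h hx hy m] at h3

/-- First-order variation of the exponential: perturbing `U` by an operator `u` raising the
filtration by `k ≥ 1` changes `e^U x` by `u x`, up to higher order. -/
theorem exp_add_sub {U u : V →ₗ[ℂ] V} (hU : 𝓕.Raises U) (hUu : 𝓕.Raises (U + u)) {k : ℤ}
    (hu : ∀ l, ∀ x ∈ 𝓕.F l, u x ∈ 𝓕.F (l + k)) {l : ℤ} {x : V} (hx : x ∈ 𝓕.F l) :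
    𝓕.exp (U + u) hUu x - 𝓕.exp U hU x - u x ∈ 𝓕.F (l + k + 1) := by
  -- From the second power on the difference is of higher order than `u x`.
  have hD : ∀ m : ℕ, ((U + u) ^ (m + 1)) x - (U ^ (m + 1)) x ∈ 𝓕.F (l + k + m) := by
    intro m
    induction m with
    | zero => simpa using hu _ _ hx
    | succ m ih =>
      rw [pow_succ', pow_succ' U, Module.End.mul_apply, Module.End.mul_apply]
      have h1 := hUu _ _ ih
      have h2 := hu _ _ (hU.pow hx (m + 1))
      have h3 := (𝓕.F (l + k + (m + 1 : ℕ))).add_mem (𝓕.mono (by push_cast; linarith) h1)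
        (𝓕.mono (by push_cast; linarith) h2)
      convert h3 using 1
      simp only [map_sub, LinearMap.add_apply]
      abel
  obtain ⟨n₁, h₁⟩ := hasExp_exp hUu x (l + k + 1)
  obtain ⟨n₂, h₂⟩ := hasExp_exp hU x (l + k + 1)
  have e1 := h₁ (n₁ + n₂ + 2) (by omega)
  have e2 := h₂ (n₁ + n₂ + 2) (by omega)
  have e3 := (𝓕.F (l + k + 1)).sub_mem e1 e2
  rw [Finset.sum_range_succ', Finset.sum_range_succ', Finset.sum_range_succ' (expTerm U x),
    Finset.sum_range_succ' (fun m => expTerm U x (m + 1))] at e3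
  have e4 : ∑ m ∈ Finset.range (n₁ + n₂), (expTerm (U + u) x (m + 1 + 1)
      - expTerm U x (m + 1 + 1)) ∈ 𝓕.F (l + k + 1) := by
    refine Submodule.sum_mem _ fun m _ => ?_
    rw [expTerm, expTerm, ← smul_sub]
    exact Submodule.smul_mem _ _ (𝓕.mono (by push_cast; linarith) (hD (m + 1)))
  have e5 := (𝓕.F (l + k + 1)).add_mem e3 e4
  rw [Finset.sum_sub_distrib] at e5
  convert e5 using 1
  simp [expTerm]
  abel

end Filt

/-! ### Filtered Lie superalgebras and their superderivations -/

/-- A complete filtered Lie superalgebra, with parity automorphism `P`. -/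
structure FLie (M : Type*) [AddCommGroup M] [Module ℂ M] extends Filt M where
  /-- The automorphism `x ↦ (-1)^{p(x)} x`. -/
  P : M →ₗ[ℂ] M
  P_P : ∀ x, P (P x) = x
  /-- The superbracket. -/
  br : M →ₗ[ℂ] M →ₗ[ℂ] M
  P_br : ∀ x y, P (br x y) = br (P x) (P y)
  skew : ∀ p q x y, P x = sgn p • x → P y = sgn q • y → br x y = -(sgn (p * q) • br y x)
  jacobi : ∀ p q x y z, P x = sgn p • x → P y = sgn q • y →
    br x (br y z) = br (br x y) z + sgn (p * q) • br y (br x z)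
  F_br : ∀ k l, ∀ x ∈ F k, ∀ y ∈ F l, br x y ∈ F (k + l)
  P_F : ∀ k, ∀ x ∈ F k, P x ∈ F k

namespace FLie

variable {M : Type*} [AddCommGroup M] [Module ℂ M] (𝓖 : FLie M)

/-- The endomorphisms of degree `0` of the filtered space. -/
def FEnd : Submodule ℂ (M →ₗ[ℂ] M) where
  carrier := {δ | ∀ k, ∀ x ∈ 𝓖.F k, δ x ∈ 𝓖.F k}
  zero_mem' := fun k x _ => by simp
  add_mem' := fun h h' k x hx => (𝓖.F k).add_mem (h k x hx) (h' k x hx)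
  smul_mem' := fun c _ h k x hx => (𝓖.F k).smul_mem c (h k x hx)

/-- Pairs `(δ, x)`, standing for `δ + x` in the semidirect product of the superderivations with
the Lie superalgebra. -/
abbrev Op : Type _ := 𝓖.FEnd × M

/-- The superderivations of parity `p`. -/
def der (p : ZMod 2) : Submodule ℂ (M →ₗ[ℂ] M) where
  carrier := {δ | (∀ x, 𝓖.P (δ x) = sgn p • δ (𝓖.P x)) ∧ ∀ q x y, 𝓖.P x = sgn q • x →
    δ (𝓖.br x y) = 𝓖.br (δ x) y + sgn (p * q) • 𝓖.br x (δ y)}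
  zero_mem' := by simp
  add_mem' := by
    rintro a b ⟨h1, h2⟩ ⟨h3, h4⟩
    refine ⟨fun x => by simp [h1, h3], fun q x y hx => ?_⟩
    simp only [LinearMap.add_apply, h2 q x y hx, h4 q x y hx, map_add, smul_add]
    abel
  smul_mem' := by
    rintro c a ⟨h1, h2⟩
    refine ⟨fun x => by simp [h1, smul_comm c], fun q x y hx => ?_⟩
    simp only [LinearMap.smul_apply, h2 q x y hx, map_smul, smul_add]
    rw [smul_comm c]

/-- Homogeneous elements of the semidirect product. -/
def isOp (p : ZMod 2) : Submodule ℂ 𝓖.Op where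
  carrier := {X | X.1.1 ∈ 𝓖.der p ∧ 𝓖.P X.2 = sgn p • X.2}
  zero_mem' := ⟨(𝓖.der p).zero_mem, by simp⟩
  add_mem' := fun h h' => ⟨(𝓖.der p).add_mem h.1 h'.1, by
    rw [Prod.snd_add, map_add, h.2, h'.2, smul_add]⟩
  smul_mem' := fun c _ h => ⟨(𝓖.der p).smul_mem c h.1, by
    rw [Prod.smul_snd, map_smul, h.2, smul_comm]⟩

/-- The superbracket of elements of parities `p` and `q` of the semidirect product. -/
def obr (p q : ZMod 2) : 𝓖.Op →ₗ[ℂ] 𝓖.Op →ₗ[ℂ] 𝓖.Op :=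
  LinearMap.mk₂ ℂ
    (fun X Y => (⟨X.1.1 ∘ₗ Y.1.1 - sgn (p * q) • Y.1.1 ∘ₗ X.1.1,
        𝓖.FEnd.sub_mem (fun k x hx => X.1.2 k _ (Y.1.2 k x hx))
          (𝓖.FEnd.smul_mem _ fun k x hx => Y.1.2 k _ (X.1.2 k x hx))⟩,
      X.1.1 Y.2 - sgn (p * q) • Y.1.1 X.2 + 𝓖.br X.2 Y.2))
    (fun X X' Y => by
      ext1
      · ext x
        simp [smul_add]
        abel
      · simp [smul_add]
        abel)
    (fun c X Y => by
      ext1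
      · ext x
        simp [smul_sub, smul_comm c]
      · simp [smul_add, smul_sub, smul_comm c])
    (fun X Y Y' => by
      ext1
      · ext x
        simp [smul_add]
        abel
      · simp [smul_add]
        abel)
    (fun c X Y => by
      ext1
      · ext x
        simp [smul_sub, smul_comm c]
      · simp [smul_add, smul_sub, smul_comm c])

variable {𝓖}

theorem obr_fst (p q : ZMod 2) (X Y : 𝓖.Op) :
    (𝓖.obr p q X Y).1.1 = X.1.1 ∘ₗ Y.1.1 - sgn (p * q) • Y.1.1 ∘ₗ X.1.1 := rfl

theorem obr_snd (p q : ZMod 2) (X Y : 𝓖.Op) :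
    (𝓖.obr p q X Y).2 = X.1.1 Y.2 - sgn (p * q) • Y.1.1 X.2 + 𝓖.br X.2 Y.2 := rfl

theorem op_ext {X Y : 𝓖.Op} (h1 : ∀ x, X.1.1 x = Y.1.1 x) (h2 : X.2 = Y.2) : X = Y :=
  Prod.ext (Subtype.ext (LinearMap.ext h1)) h2

theorem der_par {p q : ZMod 2} {δ : M →ₗ[ℂ] M} (hδ : δ ∈ 𝓖.der p) {x : M}
    (hx : 𝓖.P x = sgn q • x) : 𝓖.P (δ x) = sgn (p + q) • δ x := by
  rw [hδ.1, hx, map_smul, smul_smul, sgn_add]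

theorem br_par {p q : ZMod 2} {x y : M} (hx : 𝓖.P x = sgn p • x)
    (hy : 𝓖.P y = sgn q • y) : 𝓖.P (𝓖.br x y) = sgn (p + q) • 𝓖.br x y := by
  rw [𝓖.P_br, hx, hy, map_smul, map_smul, LinearMap.smul_apply, smul_smul, sgn_add, mul_comm]

theorem obr_isOp {p q : ZMod 2} {X Y : 𝓖.Op} (hX : X ∈ 𝓖.isOp p) (hY : Y ∈ 𝓖.isOp q) :
    𝓖.obr p q X Y ∈ 𝓖.isOp (p + q) := by
  refine ⟨⟨fun x => ?_, fun r x y hx => ?_⟩, ?_⟩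
  · simp only [obr_fst, LinearMap.sub_apply, LinearMap.smul_apply, LinearMap.comp_apply, map_sub,
      map_smul, hX.1.1, hY.1.1, smul_sub, smul_smul, sgn_add]
    congr 2
    ring
  · simp only [obr_fst, LinearMap.sub_apply, LinearMap.smul_apply, LinearMap.comp_apply]
    rw [hY.1.2 r x y hx, hX.1.2 r x y hx, map_add, map_add, map_smul, map_smul,
      hX.1.2 _ _ y (der_par hY.1 hx), hX.1.2 r x _ hx, hY.1.2 _ _ y (der_par hX.1 hx),
      hY.1.2 r x _ hx]
    simp only [map_sub, LinearMap.sub_apply, map_smul, LinearMap.smul_apply, smul_add, smul_sub,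
      smul_smul, mul_add, add_mul, sgn_add]
    have h := sgn_mul_self (p * q)
    rw [mul_comm q p]
    have h2 : sgn (p * q) * (sgn (p * q) * sgn (q * r)) = sgn (q * r) := by
      rw [← mul_assoc, h, one_mul]
    simp only [h2, ← mul_assoc]
    module
  · rw [obr_snd, map_add, map_sub, map_smul, der_par hX.1 hY.2, der_par hY.1 hX.2,
      br_par hX.2 hY.2, smul_add, smul_sub, smul_comm (sgn (p * q)), add_comm q p]

theorem obr_skew {p q : ZMod 2} {X Y : 𝓖.Op} (hX : X ∈ 𝓖.isOp p) (hY : Y ∈ 𝓖.isOp q) :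
    𝓖.obr p q X Y = -(sgn (p * q) • 𝓖.obr q p Y X) := by
  have h := sgn_mul_self (p * q)
  refine op_ext (fun x => ?_) ?_
  · change _ = -(sgn (p * q) • (𝓖.obr q p Y X).1.1 x)
    simp only [obr_fst, LinearMap.sub_apply, LinearMap.smul_apply, LinearMap.comp_apply, smul_sub,
      smul_smul, mul_comm q p, h]
    module
  · change _ = -(sgn (p * q) • (𝓖.obr q p Y X).2)
    rw [obr_snd, obr_snd, 𝓖.skew p q _ _ hX.2 hY.2]
    simp only [smul_add, smul_sub, smul_smul, mul_comm q p, h]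
    module

theorem obr_jacobi {p q r : ZMod 2} {X Y Z : 𝓖.Op} (hX : X ∈ 𝓖.isOp p) (hY : Y ∈ 𝓖.isOp q)
    (hZ : Z ∈ 𝓖.isOp r) : 𝓖.obr p (q + r) X (𝓖.obr q r Y Z)
      = 𝓖.obr (p + q) r (𝓖.obr p q X Y) Z
        + sgn (p * q) • 𝓖.obr q (p + r) Y (𝓖.obr p r X Z) := by
  have hs : ∀ a : ZMod 2, sgn a = 1 ∨ sgn a = -1 := fun a => by
    rcases zmod2_cases a with rfl | rfl <;> simp
  have h1 := hs (p * q)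
  have h2 := hs (p * r)
  have h3 := hs (q * r)
  have e3 := 𝓖.skew q (r + p) _ _ hY.2 (der_par hZ.1 hX.2)
  refine op_ext (fun x => ?_) ?_
  · change _ = (𝓖.obr (p + q) r (𝓖.obr p q X Y) Z).1.1 x
      + sgn (p * q) • (𝓖.obr q (p + r) Y (𝓖.obr p r X Z)).1.1 x
    simp only [obr_fst, LinearMap.sub_apply, LinearMap.smul_apply, LinearMap.comp_apply, smul_sub,
      map_sub, map_smul, mul_add, add_mul, sgn_add, mul_comm q p]
    generalize sgn (p * q) = a at *
    generalize sgn (p * r) = b at *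
    generalize sgn (q * r) = c at *
    rcases h1 with rfl | rfl <;> rcases h2 with rfl | rfl <;> rcases h3 with rfl | rfl <;> module
  · change _ = (𝓖.obr (p + q) r (𝓖.obr p q X Y) Z).2
      + sgn (p * q) • (𝓖.obr q (p + r) Y (𝓖.obr p r X Z)).2
    simp only [obr_fst, obr_snd, LinearMap.sub_apply, LinearMap.smul_apply, LinearMap.comp_apply,
      LinearMap.add_apply, map_sub, map_add, map_smul, hX.1.2 q _ _ hY.2, hY.1.2 p _ _ hX.2,
      hZ.1.2 p _ _ hX.2, 𝓖.jacobi p q _ _ Z.2 hX.2 hY.2, e3]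
    simp only [mul_add, add_mul, sgn_add, mul_comm q p, mul_comm r p]
    generalize sgn (p * q) = a at *
    generalize sgn (p * r) = b at *
    generalize sgn (q * r) = c at *
    rcases h1 with rfl | rfl <;> rcases h2 with rfl | rfl <;> rcases h3 with rfl | rfl <;> module

end FLie

namespace FLie

variable {M : Type*} [AddCommGroup M] [Module ℂ M] (𝓖 : FLie M)

/-! ### The automorphisms `e^{ad T}` -/

/-- The filtration of the semidirect product: superderivations have degree `0`. -/
def opFilt : Filt 𝓖.Op where
  F k :=
    { carrier := {X | X.2 ∈ 𝓖.F k ∧ (0 < k → X.1 = 0)}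
      zero_mem' := ⟨(𝓖.F k).zero_mem, fun _ => rfl⟩
      add_mem' := fun h h' => ⟨(𝓖.F k).add_mem h.1 h'.1, fun hk => by
        rw [Prod.fst_add, h.2 hk, h'.2 hk, add_zero]⟩
      smul_mem' := fun c _ h => ⟨(𝓖.F k).smul_mem c h.1, fun hk => by
        rw [Prod.smul_fst, h.2 hk, smul_zero]⟩ }
  anti := fun k l h X hX => ⟨𝓖.anti h hX.1, fun hk => hX.2 (lt_of_lt_of_le hk h)⟩
  exh := fun X => by
    obtain ⟨k, hk⟩ := 𝓖.exh X.2
    exact ⟨min k 0, 𝓖.anti (min_le_left _ _) hk, fun h => absurd h (by simp)⟩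
  sep := fun X hX => Prod.ext ((hX 1).2 one_pos) (𝓖.sep _ fun k => (hX k).1)
  complete := fun k X hX => by
    obtain ⟨y, hy⟩ := 𝓖.complete k (fun m => (X m).2) fun m => (hX m).1
    refine ⟨(∑ m ∈ Finset.range (1 - k).toNat, (X m).1, y), fun n => ⟨?_, fun hn => ?_⟩⟩
    · rw [Prod.snd_sub, Prod.snd_sum]
      exact hy n
    · rw [Prod.fst_sub, Prod.fst_sum, sub_eq_zero]
      refine Finset.sum_subset (Finset.range_mono (by omega)) fun m _ hm => (hX m).2 ?_
      rw [Finset.mem_range] at hm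
      omega

theorem obr_F (p q : ZMod 2) (k l : ℤ) (X : 𝓖.Op) (hX : X ∈ 𝓖.opFilt.F k) (Y : 𝓖.Op)
    (hY : Y ∈ 𝓖.opFilt.F l) : 𝓖.obr p q X Y ∈ 𝓖.opFilt.F (k + l) := by
  have h : ∀ k l : ℤ, ∀ X ∈ 𝓖.opFilt.F k, ∀ Y ∈ 𝓖.opFilt.F l, X.1.1 Y.2 ∈ 𝓖.F (k + l) := by
    intro k l X hX Y hY
    by_cases hk : 0 < k
    · rw [hX.2 hk]
      exact (𝓖.F _).zero_mem
    · exact 𝓖.anti (by linarith) (X.1.2 l _ hY.1)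
  refine ⟨?_, fun hkl => ?_⟩
  · rw [obr_snd]
    refine (𝓖.F _).add_mem ((𝓖.F _).sub_mem (h k l X hX Y hY) ((𝓖.F _).smul_mem _ ?_))
      (𝓖.F_br _ _ _ hX.1 _ hY.1)
    rw [add_comm]
    exact h l k Y hY X hX
  · ext x
    rw [obr_fst]
    by_cases hk : 0 < k
    · rw [hX.2 hk]; simp
    · rw [hY.2 (by linarith)]; simp

/-- `ad T`, for an even `T`, on the semidirect product. -/
def adOp (T : M) : 𝓖.Op →ₗ[ℂ] 𝓖.Op := 𝓖.obr 0 0 (0, T)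

variable {𝓖}

theorem adOp_fst (T : M) (X : 𝓖.Op) : (𝓖.adOp T X).1 = 0 := by
  ext x
  rw [adOp, obr_fst]; simp

theorem adOp_snd (T : M) (X : 𝓖.Op) : (𝓖.adOp T X).2 = 𝓖.br T X.2 - X.1.1 T := by
  rw [adOp, obr_snd]
  simp
  abel

/-- Even elements of positive degree. -/
def Nil (𝓖 : FLie M) (T : M) : Prop := 𝓖.P T = T ∧ T ∈ 𝓖.F 1

theorem Nil.isOp {T : M} (hT : 𝓖.Nil T) : ((0, T) : 𝓖.Op) ∈ 𝓖.isOp 0 :=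
  ⟨(𝓖.der 0).zero_mem, by simp [hT.1]⟩

theorem adOp_eq (T : M) (q : ZMod 2) (X : 𝓖.Op) : 𝓖.adOp T X = 𝓖.obr 0 q (0, T) X := by
  refine Prod.ext ?_ ?_
  · ext x; rw [adOp, obr_fst, obr_fst]; simp
  · rw [adOp, obr_snd, obr_snd]; simp

theorem adOp_raises_of_mem {T : M} {c : ℤ} (hT : T ∈ 𝓖.F c) (k : ℤ) (X : 𝓖.Op)
    (hX : X ∈ 𝓖.opFilt.F k) : 𝓖.adOp T X ∈ 𝓖.opFilt.F (k + c) := by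
  rw [add_comm]
  exact 𝓖.obr_F 0 0 c k _ ⟨hT, fun _ => rfl⟩ X hX

theorem Nil.raises {T : M} (hT : 𝓖.Nil T) : 𝓖.opFilt.Raises (𝓖.adOp T) :=
  adOp_raises_of_mem hT.2

theorem Nil.adOp_isOp {T : M} (hT : 𝓖.Nil T) {p : ZMod 2} {X : 𝓖.Op} (hX : X ∈ 𝓖.isOp p) :
    𝓖.adOp T X ∈ 𝓖.isOp p := by
  have h := obr_isOp hT.isOp hX
  rwa [zero_add, ← adOp_eq] at h

theorem Nil.adOp_obr {T : M} (hT : 𝓖.Nil T) {p q : ZMod 2} {X Y : 𝓖.Op} (hX : X ∈ 𝓖.isOp p)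
    (hY : Y ∈ 𝓖.isOp q) : 𝓖.adOp T (𝓖.obr p q X Y)
      = 𝓖.obr p q (𝓖.adOp T X) Y + 𝓖.obr p q X (𝓖.adOp T Y) := by
  have h := obr_jacobi hT.isOp hX hY
  rw [← adOp_eq, ← adOp_eq, ← adOp_eq] at h
  simpa using h

/-- The automorphism `e^{ad T}` of the semidirect product. -/
def E {T : M} (hT : 𝓖.Nil T) : 𝓖.Op →ₗ[ℂ] 𝓖.Op := 𝓖.opFilt.exp (𝓖.adOp T) hT.raises

variable {T : M} (hT : 𝓖.Nil T)

theorem E_obr {p q : ZMod 2} {X Y : 𝓖.Op} (hX : X ∈ 𝓖.isOp p) (hY : Y ∈ 𝓖.isOp q) :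
    E hT (𝓖.obr p q X Y) = 𝓖.obr p q (E hT X) (E hT Y) :=
  Filt.exp_bilin hT.raises hT.raises hT.raises (𝓖.obr p q) (𝓖.obr_F p q)
    (fun _ => hT.adOp_isOp) (fun _ => hT.adOp_isOp) (fun _ h _ h' => hT.adOp_obr h h') hX hY

theorem E_fst (X : 𝓖.Op) : (E hT X).1 = X.1 := by
  obtain ⟨n, hn⟩ := Filt.hasExp_exp hT.raises X 1
  have h := (hn (n + 1) (Nat.le_succ n)).2 one_pos
  rw [Finset.sum_range_succ', Prod.fst_sub, Prod.fst_add, Prod.fst_sum,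
    Finset.sum_eq_zero, zero_add, sub_eq_zero] at h
  · rw [E, h]
    simp [Filt.expTerm]
  · intro m _
    rw [Filt.expTerm, pow_succ', Module.End.mul_apply, Prod.smul_fst, adOp_fst, smul_zero]

theorem E_injective {X : 𝓖.Op} (h : E hT X = 0) : X = 0 := Filt.exp_injective hT.raises h

theorem E_surjective (Y : 𝓖.Op) : ∃ X, E hT X = Y := Filt.exp_surjective hT.raises Y

theorem E_surjective_snd (y : M) : ∃ x : M, E hT (0, x) = (0, y) := by
  obtain ⟨X, hX⟩ := E_surjective hT ((0, y) : 𝓖.Op)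
  refine ⟨X.2, ?_⟩
  have h := congrArg Prod.fst hX
  rw [E_fst] at h
  rw [← hX]
  congr 1
  exact Prod.ext h.symm rfl

theorem E_of_eq_zero {X : 𝓖.Op} (h : 𝓖.br T X.2 = X.1.1 T) : E hT X = X := by
  refine Filt.exp_of_eq_zero hT.raises (Prod.ext (adOp_fst _ _) ?_)
  rw [adOp_snd, h, sub_self, Prod.snd_zero]

/-- `e^{ad T} X - X` lies in every closed subspace which is stable under `ad T` and contains
`[T, X]`. -/
theorem E_sub_mem {S : Submodule ℂ M} (hS : 𝓖.IsClosed S) (hTS : ∀ x ∈ S, 𝓖.br T x ∈ S) {X : 𝓖.Op}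
    (hX : 𝓖.br T X.2 - X.1.1 T ∈ S) : (E hT X).2 - X.2 ∈ S := by
  refine hS _ fun k => ?_
  obtain ⟨n, hn⟩ := Filt.hasExp_exp hT.raises X k
  have h := (hn (n + 1) (Nat.le_succ n)).1
  rw [Finset.sum_range_succ'] at h
  refine ⟨∑ m ∈ Finset.range n, (Filt.expTerm (𝓖.adOp T) X (m + 1)).2, ?_, ?_⟩
  · refine S.sum_mem fun m hm => ?_
    clear hm
    rw [Filt.expTerm, Prod.smul_snd]
    refine S.smul_mem _ ?_
    induction m with
    | zero => rw [zero_add, pow_one, adOp_snd]; exact hX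
    | succ m ih =>
      rw [pow_succ', Module.End.mul_apply, adOp_snd, pow_succ', Module.End.mul_apply, adOp_fst]
      rw [pow_succ', Module.End.mul_apply] at ih
      simpa using hTS _ ih
  · convert h using 1
    rw [Prod.snd_sub, Prod.snd_add, Prod.snd_sum]
    simp only [Filt.expTerm, E, pow_zero, Nat.factorial_zero, Nat.cast_one, inv_one, one_smul,
      Module.End.one_apply]
    abel

theorem E_snd_mem {S : Submodule ℂ M} (hS : 𝓖.IsClosed S) (hTS : ∀ x ∈ S, 𝓖.br T x ∈ S) {X : 𝓖.Op}
    (hX : 𝓖.br T X.2 - X.1.1 T ∈ S) (hX2 : X.2 ∈ S) : (E hT X).2 ∈ S := by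
  have := S.add_mem (E_sub_mem hT hS hTS hX) hX2
  rwa [sub_add_cancel] at this

theorem isClosed_par (p : ZMod 2) :
    𝓖.IsClosed (LinearMap.ker (𝓖.P - sgn p • LinearMap.id)) :=
  Filt.isClosed_ker (𝓕₂ := 𝓖.toFilt) _ (c := 0) fun k v hv => by
    rw [add_zero]
    exact (𝓖.F k).sub_mem (𝓖.P_F k v hv) ((𝓖.F k).smul_mem _ hv)

theorem mem_par {p : ZMod 2} {x : M} :
    x ∈ LinearMap.ker (𝓖.P - sgn p • LinearMap.id) ↔ 𝓖.P x = sgn p • x := by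
  simp [LinearMap.mem_ker, sub_eq_zero]

theorem E_isOp {p : ZMod 2} {X : 𝓖.Op} (hX : X ∈ 𝓖.isOp p) : E hT X ∈ 𝓖.isOp p := by
  refine ⟨by rw [E_fst]; exact hX.1, ?_⟩
  rw [← mem_par]
  refine E_snd_mem hT (isClosed_par p) (fun x hx => ?_) ?_ (mem_par.2 hX.2)
  · have h := (hT.adOp_isOp (X := (0, x)) ⟨(𝓖.der p).zero_mem, mem_par.1 hx⟩).2
    rw [adOp_snd] at h
    rw [mem_par]
    simpa using h
  · rw [mem_par, ← adOp_snd]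
    exact (hT.adOp_isOp hX).2

/-- An invariant bilinear pairing, of degree `0` for the trivial filtration of its values, is
preserved by `e^{ad T}`. -/
theorem E_form {A : Type*} [AddCommGroup A] [Module ℂ A] (β : M →ₗ[ℂ] M →ₗ[ℂ] A)
    (hβ : ∀ k l, 0 < k + l → ∀ x ∈ 𝓖.F k, ∀ y ∈ 𝓖.F l, β x y = 0)
    (hinv : ∀ x y, β (𝓖.br T x) y + β x (𝓖.br T y) = 0) {x y x' y' : M}
    (ex : E hT (0, x) = (0, x')) (ey : E hT (0, y) = (0, y')) : β x' y' = β x y := by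
  -- On the values, `e^{ad T}` becomes the exponential of `0` for the trivial filtration.
  let 𝓐 : Filt A :=
    { F := fun k => if 0 < k then ⊥ else ⊤
      anti := fun k l h => by
        dsimp only
        by_cases h1 : 0 < k
        · rw [if_pos h1, if_pos (lt_of_lt_of_le h1 h)]
        · rw [if_neg h1]
          exact le_top
      exh := fun x => ⟨0, by simp⟩
      sep := fun x hx => by simpa using hx 1
      complete := fun k x hx => by
        refine ⟨∑ m ∈ Finset.range (1 - k).toNat, x m, fun n => ?_⟩
        split_ifs with h
        · rw [Submodule.mem_bot, sub_eq_zero]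
          refine Finset.sum_subset (Finset.range_mono (by omega)) fun m _ hm => ?_
          have h2 := hx m
          rw [Finset.mem_range] at hm
          rw [if_pos (by omega)] at h2
          exact h2
        · exact Submodule.mem_top }
  have h0 : 𝓐.Raises (0 : A →ₗ[ℂ] A) := fun k x _ => (𝓐.F _).zero_mem
  let γ : 𝓖.Op →ₗ[ℂ] 𝓖.Op →ₗ[ℂ] A :=
    β.compl₁₂ (LinearMap.snd ℂ 𝓖.FEnd M) (LinearMap.snd ℂ 𝓖.FEnd M)
  let S : Submodule ℂ 𝓖.Op := LinearMap.ker (LinearMap.fst ℂ 𝓖.FEnd M)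
  have hS : ∀ X ∈ S, 𝓖.adOp T X ∈ S := fun X _ => adOp_fst T X
  have h := Filt.exp_bilin (𝓕 := 𝓐) h0 hT.raises hT.raises γ (fun k l X hX Y hY => by
      change _ ∈ (if 0 < k + l then ⊥ else ⊤ : Submodule ℂ A)
      split_ifs with hkl
      · exact hβ k l hkl _ hX.1 _ hY.1
      · exact Submodule.mem_top) hS hS (fun X hX Y hY => by
      have hX1 : X.1 = 0 := hX
      have hY1 : Y.1 = 0 := hY
      change (0 : A) = β (𝓖.adOp T X).2 Y.2 + β X.2 (𝓖.adOp T Y).2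
      rw [adOp_snd, adOp_snd, hX1, hY1]
      simp [hinv]) (x := (0, x)) rfl (y := (0, y)) rfl
  rw [Filt.exp_of_eq_zero h0 rfl] at h
  change β x y = γ (E hT (0, x)) (E hT (0, y)) at h
  rw [ex, ey] at h
  exact h.symm

end FLie

namespace FLie

variable {M : Type*} [AddCommGroup M] [Module ℂ M] {𝓖 : FLie M}

/-! ### Normal forms by successive approximation -/

theorem adOp_add (T t : M) : 𝓖.adOp (T + t) = 𝓖.adOp T + 𝓖.adOp t := by
  refine LinearMap.ext fun X => Prod.ext ?_ ?_
  · rw [LinearMap.add_apply, Prod.fst_add, adOp_fst, adOp_fst, adOp_fst, add_zero]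
  · rw [LinearMap.add_apply, Prod.snd_add, adOp_snd, adOp_snd, adOp_snd, map_add, map_add,
      LinearMap.add_apply]
    abel

theorem E_add_sub {T t : M} (hT : 𝓖.Nil T) (hTt : 𝓖.Nil (T + t)) {k w : ℤ} (ht : t ∈ 𝓖.F k)
    {X : 𝓖.Op} (hX : X ∈ 𝓖.opFilt.F w) :
    E hTt X - E hT X - 𝓖.adOp t X ∈ 𝓖.opFilt.F (w + k + 1) := by
  have h : 𝓖.opFilt.Raises (𝓖.adOp T + 𝓖.adOp t) := by
    rw [← adOp_add]; exact hTt.raises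
  have h2 := Filt.exp_add_sub hT.raises h (fun l x hx => adOp_raises_of_mem ht l x hx) hX
  have h3 : E hTt X = 𝓖.opFilt.exp (𝓖.adOp T + 𝓖.adOp t) h X := by
    unfold E
    congr 2
    exact adOp_add T t
  rwa [h3]

/-- An operator `A = δ + Λ + (higher order)` is conjugated into `δ + Λ + 𝒱` by `e^{ad T}` with
`T ∈ 𝒯`, when the leading term `[T, Λ]` of the correction can be used to bring the error of each
order into `𝒱`. -/
theorem exists_normalForm {A : 𝓖.Op} {Λ : M} {w : ℤ} (hw : w ≤ -1) (hΛ : Λ ∈ 𝓖.F w)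
    (hA : A.2 - Λ ∈ 𝓖.F (w + 1)) {𝒯 𝒴 𝒱 : Submodule ℂ M} (h𝒱𝒴 : 𝒱 ≤ 𝒴)
    (h𝒯e : ∀ t ∈ 𝒯, 𝓖.P t = t) (h𝒯 : 𝓖.IsClosed 𝒯) (h𝒱 : 𝓖.IsClosed 𝒱)
    (h𝒴 : ∀ T ∈ 𝒯, ∀ hT : 𝓖.Nil T, (E hT A).2 - Λ ∈ 𝒴)
    (step : ∀ k, 1 ≤ k → ∀ y ∈ 𝒴, y ∈ 𝓖.F (w + k) →
      ∃ t ∈ 𝒯, t ∈ 𝓖.F k ∧ ∃ v ∈ 𝒱, y + 𝓖.br t Λ - v ∈ 𝓖.F (w + k + 1)) :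
    ∃ T ∈ 𝒯, ∃ hT : 𝓖.Nil T, (E hT A).2 - Λ ∈ 𝒱 := by
  have hAw : A ∈ 𝓖.opFilt.F w := ⟨by
    have h := (𝓖.F w).add_mem (𝓖.mono (by linarith) hA) hΛ
    rwa [sub_add_cancel] at h, fun h => by linarith⟩
  -- `Q n T`: the transform by `T` has the required form up to order `w + 1 + n`.
  let Q : ℕ → M → Prop := fun n T => T ∈ 𝒯 ∧ ∃ hT : 𝓖.Nil T, ∃ v ∈ 𝒱,
    (E hT A).2 - Λ - v ∈ 𝓖.F (w + 1 + n)
  have h0 : Q 0 0 := by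
    have hN : 𝓖.Nil 0 := ⟨map_zero _, (𝓖.F 1).zero_mem⟩
    refine ⟨𝒯.zero_mem, hN, 0, 𝒱.zero_mem, ?_⟩
    rw [E_of_eq_zero hN (by simp)]
    simpa using hA
  have hs : ∀ n T, Q n T → ∃ T', Q (n + 1) T' ∧ T' - T ∈ 𝓖.F (1 + n) := by
    rintro n T ⟨hT𝒯, hT, v, hv, hT2⟩
    obtain ⟨t, ht𝒯, htF, v', hv', hy⟩ := step (1 + n) (by linarith [Nat.cast_nonneg (α := ℤ) n])
      ((E hT A).2 - Λ - v) (𝒴.sub_mem (h𝒴 T hT𝒯 hT) (h𝒱𝒴 hv)) (by rwa [← add_assoc])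
    have hTt : 𝓖.Nil (T + t) := ⟨by rw [map_add, hT.1, h𝒯e t ht𝒯],
      (𝓖.F 1).add_mem hT.2 (𝓖.mono (by linarith [Nat.cast_nonneg (α := ℤ) n]) htF)⟩
    refine ⟨T + t, ⟨𝒯.add_mem hT𝒯 ht𝒯, hTt, v + v', 𝒱.add_mem hv hv', ?_⟩, by simpa using htF⟩
    have h1 := (E_add_sub hT hTt htF hAw).1
    rw [Prod.snd_sub, Prod.snd_sub, adOp_snd] at h1
    have h2 := 𝓖.F_br _ _ _ htF _ hA
    have h3 := A.1.2 _ _ htF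
    have e : w + 1 + ((n + 1 : ℕ) : ℤ) = w + (1 + n) + 1 := by push_cast; ring
    rw [e]
    have h4 := (𝓖.F (w + (1 + n) + 1)).add_mem ((𝓖.F _).add_mem h1 hy)
      ((𝓖.F _).sub_mem (𝓖.mono (by linarith) h2) (𝓖.mono (by linarith) h3))
    convert h4 using 1
    rw [map_sub]
    abel
  choose! next hnext hnextF using hs
  let Ts : ℕ → M := fun n => Nat.rec 0 (fun n T => next n T) n
  have hTs : ∀ n, Q n (Ts n) := fun n => by
    induction n with
    | zero => exact h0
    | succ n ih => exact hnext n _ ih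
  have hTd : ∀ n : ℕ, Ts (n + 1) - Ts n ∈ 𝓖.F (1 + n) := fun n => hnextF n _ (hTs n)
  -- The approximations `Ts n` converge, and closedness of `𝒱` passes to the limit.
  obtain ⟨T, hT⟩ := 𝓖.complete 1 _ hTd
  have hTF : ∀ n : ℕ, T - Ts n ∈ 𝓖.F (1 + n) := fun n => by
    have h := hT n
    rw [Finset.sum_range_sub] at h
    simpa [Ts] using h
  have hT𝒯 : T ∈ 𝒯 := h𝒯 T fun k => ⟨Ts k.toNat, (hTs _).1, 𝓖.mono (by
    linarith [Int.self_le_toNat k]) (hTF _)⟩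
  have hTN : 𝓖.Nil T := ⟨h𝒯e T hT𝒯, by simpa [Ts] using hTF 0⟩
  refine ⟨T, hT𝒯, hTN, h𝒱 _ fun k => ?_⟩
  obtain ⟨_, hTn, v, hv, hT2⟩ := hTs (k - w - 1).toNat
  refine ⟨v, hv, ?_⟩
  set n := (k - w - 1).toNat
  have hn : k - w - 1 ≤ n := Int.self_le_toNat _
  have hTt : 𝓖.Nil (Ts n + (T - Ts n)) := by rwa [add_sub_cancel]
  have h1 := (E_add_sub hTn hTt (hTF n) hAw).1
  rw [Prod.snd_sub, Prod.snd_sub] at h1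
  have h2 := (adOp_raises_of_mem (hTF n) w A hAw).1
  have h3 : E hTt A = E hTN A := by
    congr 2
    exact add_sub_cancel _ _
  rw [h3] at h1
  have h4 := (𝓖.F k).add_mem ((𝓖.F k).add_mem (𝓖.mono (by linarith) h1)
    (𝓖.mono (by linarith) h2)) (𝓖.mono (by linarith) hT2)
  convert h4 using 1
  abel

/-! ### Elements commuting with a semisimple leading term -/

/-- Elements which commute modulo `ker ad Λ₂` with an operator `Z = δ + H + Λ₂`, where
`H ∈ ker ad Λ₂` is of higher order than `Λ₂`, lie in `ker ad Λ₂`. -/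
theorem mem_ker_of_commute {Λ₂ : M} {w : ℤ} (hw : w ≤ -1) (hP : 𝓖.P Λ₂ = Λ₂) (hΛ : Λ₂ ∈ 𝓖.F w)
    (star : ∀ k x, x ∈ LinearMap.ker (𝓖.br Λ₂) ⊔ 𝓖.F k →
      𝓖.br Λ₂ x ∈ LinearMap.ker (𝓖.br Λ₂) ⊔ 𝓖.F (k + w + 1) →
      x ∈ LinearMap.ker (𝓖.br Λ₂) ⊔ 𝓖.F (k + 1))
    {Z : 𝓖.Op} (hZ : Z ∈ 𝓖.isOp 0) (hZΛ : Z.1.1 Λ₂ = 0)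
    (hH : 𝓖.br Λ₂ (Z.2 - Λ₂) = 0) (hHF : Z.2 - Λ₂ ∈ 𝓖.F (w + 1)) {R : M}
    (hR : 𝓖.br Λ₂ (Z.1.1 R + 𝓖.br Z.2 R) = 0) : 𝓖.br Λ₂ R = 0 := by
  set 𝒦 := LinearMap.ker (𝓖.br Λ₂) with h𝒦
  have hP0 : 𝓖.P Λ₂ = sgn 0 • Λ₂ := by rw [hP, sgn_zero, one_smul]
  have hHP : 𝓖.P (Z.2 - Λ₂) = sgn 0 • (Z.2 - Λ₂) := by
    rw [map_sub, hZ.2, hP0, smul_sub]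
  -- Write `R = κ + y` with `y` of order `k`: then `[Λ₂, y]` is, up to higher order, the bracket
  -- `Z y`, which commutes with `Λ₂`.
  have hstep : ∀ k, R ∈ 𝒦 ⊔ 𝓖.F k → R ∈ 𝒦 ⊔ 𝓖.F (k + 1) := by
    intro k hk
    refine star k R hk ?_
    obtain ⟨κ, hκ, y, hy, rfl⟩ := Submodule.mem_sup.1 hk
    rw [h𝒦, LinearMap.mem_ker] at hκ
    have e1 : 𝓖.br Λ₂ (Z.1.1 κ) = 0 := by
      have h := hZ.1.2 0 Λ₂ κ hP0
      rw [hκ, hZΛ] at h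
      simpa using h.symm
    have e2 : 𝓖.br Λ₂ (𝓖.br (Z.2 - Λ₂) κ) = 0 := by
      rw [𝓖.jacobi 0 0 _ _ κ hP0 hHP, hH, hκ]
      simp
    have e3 : 𝓖.br Z.2 κ = 𝓖.br (Z.2 - Λ₂) κ := by
      rw [map_sub, LinearMap.sub_apply, hκ, sub_zero]
    have e4 : 𝓖.br Λ₂ (Z.1.1 y + 𝓖.br Z.2 y) = 0 := by
      simp only [map_add, e1, e3, e2, zero_add] at hR
      rw [map_add]
      exact hR
    rw [map_add, hκ, zero_add]
    refine Submodule.mem_sup.2 ⟨Z.1.1 y + 𝓖.br Z.2 y, e4, -(Z.1.1 y) - 𝓖.br (Z.2 - Λ₂) y, ?_, ?_⟩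
    · refine (𝓖.F _).sub_mem ((𝓖.F _).neg_mem (𝓖.mono (by linarith) (Z.1.2 _ _ hy)))
        (𝓖.mono (by linarith) (𝓖.F_br _ _ _ hHF _ hy))
    · rw [map_sub, LinearMap.sub_apply]
      abel
  obtain ⟨k₀, hk₀⟩ := 𝓖.exh R
  have hall : ∀ n : ℕ, R ∈ 𝒦 ⊔ 𝓖.F (k₀ + n) := by
    intro n
    induction n with
    | zero => exact Submodule.mem_sup_right (by simpa using hk₀)
    | succ n ih =>
      have := hstep _ ih
      rwa [Nat.cast_succ, ← add_assoc]
  have hcl : 𝓖.IsClosed 𝒦 := Filt.isClosed_ker (𝓕₂ := 𝓖.toFilt) _ (c := w) fun k v hv => by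
    rw [add_comm]
    exact 𝓖.F_br _ _ _ hΛ _ hv
  refine hcl R fun k => ?_
  obtain ⟨κ, hκ, y, hy, hR⟩ := Submodule.mem_sup.1 (hall (k - k₀).toNat)
  refine ⟨κ, hκ, ?_⟩
  rw [← hR, add_sub_cancel_left]
  exact 𝓖.mono (by linarith [Int.self_le_toNat (k - k₀)]) hy

theorem obr_half_square {p : ZMod 2} {X L : 𝓖.Op} (hX : X ∈ 𝓖.isOp p) (hL : L ∈ 𝓖.isOp 1)
    (h : 𝓖.obr p 1 X L = 0) : 𝓖.obr p 0 X ((1 / 2 : ℂ) • 𝓖.obr 1 1 L L) = 0 := by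
  have h1 : 𝓖.obr p (1 + 1) X (𝓖.obr 1 1 L L) = 0 := by
    rw [obr_jacobi hX hL hL, h, map_zero, map_zero, LinearMap.zero_apply, smul_zero, add_zero]
  have h3 : 𝓖.obr p 0 = 𝓖.obr p (1 + 1) := by congr 1
  rw [h3, map_smul, h1, smul_zero]

theorem half_square_isOp {L : 𝓖.Op} (hL : L ∈ 𝓖.isOp 1) :
    (1 / 2 : ℂ) • 𝓖.obr 1 1 L L ∈ 𝓖.isOp 0 := by
  have h : 𝓖.isOp 0 = 𝓖.isOp (1 + 1) := by congr 1
  rw [h]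
  exact (𝓖.isOp (1 + 1)).smul_mem _ (obr_isOp hL hL)

theorem E_half_square {T : M} (hT : 𝓖.Nil T) {L : 𝓖.Op} (hL : L ∈ 𝓖.isOp 1) :
    E hT ((1 / 2 : ℂ) • 𝓖.obr 1 1 L L) = (1 / 2 : ℂ) • 𝓖.obr 1 1 (E hT L) (E hT L) := by
  rw [map_smul, E_obr hT hL hL]

/-- The case of `mem_ker_of_commute` of an operator which commutes with `Z`. -/
theorem snd_mem_ker_of_commute {Λ₂ : M} {w : ℤ} (hw : w ≤ -1) (hP : 𝓖.P Λ₂ = Λ₂)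
    (hΛ : Λ₂ ∈ 𝓖.F w)
    (star : ∀ k x, x ∈ LinearMap.ker (𝓖.br Λ₂) ⊔ 𝓖.F k →
      𝓖.br Λ₂ x ∈ LinearMap.ker (𝓖.br Λ₂) ⊔ 𝓖.F (k + w + 1) →
      x ∈ LinearMap.ker (𝓖.br Λ₂) ⊔ 𝓖.F (k + 1))
    {Z : 𝓖.Op} (hZ : Z ∈ 𝓖.isOp 0) (hZΛ : Z.1.1 Λ₂ = 0)
    (hH : 𝓖.br Λ₂ (Z.2 - Λ₂) = 0) (hHF : Z.2 - Λ₂ ∈ 𝓖.F (w + 1)) {p : ZMod 2} {X : 𝓖.Op}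
    (hX : X ∈ 𝓖.isOp p) (hXΛ : X.1.1 Λ₂ = 0) (h : 𝓖.obr p 0 X Z = 0) : 𝓖.br Λ₂ X.2 = 0 := by
  have hP0 : 𝓖.P Λ₂ = sgn 0 • Λ₂ := by rw [hP, sgn_zero, one_smul]
  refine mem_ker_of_commute hw hP hΛ star hZ hZΛ hH hHF ?_
  have h1 := obr_skew hZ hX
  rw [h] at h1
  have h2 := congrArg Prod.snd h1
  rw [obr_snd] at h2
  have h3 : Z.1.1 X.2 + 𝓖.br Z.2 X.2 = X.1.1 (Z.2 - Λ₂) := by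
    rw [map_sub, hXΛ, sub_zero, ← sub_eq_zero]
    rw [← sub_eq_zero] at h2
    simpa [sub_add_eq_add_sub] using h2
  rw [h3]
  have h4 := hX.1.2 0 Λ₂ (Z.2 - Λ₂) hP0
  rw [hH, hXΛ] at h4
  simpa using h4.symm

end FLie

/-! ### Laurent series -/

namespace Laurent

variable {M M' M'' N : Type*} [AddCommGroup M] [Module ℂ M] [AddCommGroup M'] [Module ℂ M']
  [AddCommGroup M''] [Module ℂ M''] [AddCommGroup N] [Module ℂ N]

theorem ext' {x y : Laurent M} (h : ∀ n, x.1 n = y.1 n) : x = y := Subtype.ext (funext h)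

@[simp] theorem add_coeff (x y : Laurent M) (n : ℤ) : (x + y).1 n = x.1 n + y.1 n := rfl

@[simp] theorem sub_coeff (x y : Laurent M) (n : ℤ) : (x - y).1 n = x.1 n - y.1 n := rfl

@[simp] theorem neg_coeff (x : Laurent M) (n : ℤ) : (-x).1 n = -x.1 n := rfl

@[simp] theorem smul_coeff (c : ℂ) (x : Laurent M) (n : ℤ) : (c • x).1 n = c • x.1 n := rfl

@[simp] theorem zero_coeff (n : ℤ) : (0 : Laurent M).1 n = 0 := rfl

@[simp] theorem map_coeff (g : M →ₗ[ℂ] M') (x : Laurent M) (n : ℤ) :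
    (map g x).1 n = g (x.1 n) := rfl

theorem single_coeff (k : ℤ) (a : M) (n : ℤ) : (single k a).1 n = if n = k then a else 0 := by
  change Pi.single (M := fun _ => M) k a n = _
  rw [Pi.single_apply]

@[simp] theorem single_coeff_same (k : ℤ) (a : M) : (single k a).1 k = a := by
  rw [single_coeff, if_pos rfl]

theorem sum_coeff {κ : Type*} (s : Finset κ) (x : κ → Laurent M) (n : ℤ) :
    (∑ k ∈ s, x k).1 n = ∑ k ∈ s, (x k).1 n := by
  classical
  induction s using Finset.induction_on with
  | empty => simp
  | insert a s ha ih => rw [Finset.sum_insert ha, Finset.sum_insert ha, add_coeff, ih]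

theorem conv_coeff (B : M →ₗ[ℂ] M' →ₗ[ℂ] M'') (x : Laurent M) (y : Laurent M') (n : ℤ) :
    (conv B x y).1 n = ∑ᶠ k, B (x.1 k) (y.1 (n - k)) := rfl

theorem conv_coeff_eq_zero (B : M →ₗ[ℂ] M' →ₗ[ℂ] M'') {x : Laurent M} {y : Laurent M'} {n : ℤ}
    (h : ∀ k, B (x.1 k) (y.1 (n - k)) = 0) : (conv B x y).1 n = 0 :=
  finsum_eq_zero_of_forall_eq_zero h

theorem conv_single_left (B : M →ₗ[ℂ] M' →ₗ[ℂ] M'') (k : ℤ) (a : M) (y : Laurent M') (n : ℤ) :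
    (conv B (single k a) y).1 n = B a (y.1 (n - k)) := by
  rw [conv_coeff, finsum_eq_single _ k]
  · rw [single_coeff_same]
  · intro m hm
    rw [single_coeff, if_neg hm, map_zero, LinearMap.zero_apply]

theorem conv_single_right (B : M →ₗ[ℂ] M' →ₗ[ℂ] M'') (x : Laurent M) (k : ℤ) (b : M') (n : ℤ) :
    (conv B x (single k b)).1 n = B (x.1 (n - k)) b := by
  rw [conv_coeff, finsum_eq_single _ (n - k)]
  · rw [sub_sub_cancel, single_coeff_same]
  · intro m hm
    rw [single_coeff, if_neg (by omega), map_zero]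

/-- Multiplication by `z^k`. -/
def shift (k : ℤ) : Laurent M →ₗ[ℂ] Laurent M where
  toFun x := ⟨fun n => x.1 (n - k), by
    obtain ⟨N, hN⟩ := x.2
    exact ⟨N + k, fun n hn => hN _ (by linarith)⟩⟩
  map_add' x y := rfl
  map_smul' c x := rfl

@[simp] theorem shift_coeff (k : ℤ) (x : Laurent M) (n : ℤ) : (shift k x).1 n = x.1 (n - k) := rfl

theorem conv_shift_left (B : M →ₗ[ℂ] M' →ₗ[ℂ] M'') (k : ℤ) (x : Laurent M) (y : Laurent M') :
    conv B (shift k x) y = shift k (conv B x y) := by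
  refine ext' fun n => ?_
  rw [shift_coeff, conv_coeff, conv_coeff, ← finsum_comp_equiv (Equiv.addRight k)]
  refine finsum_congr fun l => ?_
  rw [shift_coeff, Equiv.coe_addRight, add_sub_cancel_right, sub_add_eq_sub_sub_swap]

theorem conv_shift_right (B : M →ₗ[ℂ] M' →ₗ[ℂ] M'') (k : ℤ) (x : Laurent M) (y : Laurent M') :
    conv B x (shift k y) = shift k (conv B x y) := by
  refine ext' fun n => ?_
  rw [shift_coeff, conv_coeff, conv_coeff]
  refine finsum_congr fun l => ?_
  rw [shift_coeff, sub_right_comm]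

theorem conv_single_left' (B : M →ₗ[ℂ] M' →ₗ[ℂ] M'') (k : ℤ) (a : M) (y : Laurent M') :
    conv B (single k a) y = shift k (map (B a) y) :=
  ext' fun n => conv_single_left B k a y n

theorem conv_map_right (B : M →ₗ[ℂ] M' →ₗ[ℂ] M'') (g : N →ₗ[ℂ] M') (x : Laurent M)
    (y : Laurent N) : conv B x (map g y) = conv (B.compl₂ g) x y := rfl

theorem conv_map_left (B : M →ₗ[ℂ] M' →ₗ[ℂ] M'') (g : N →ₗ[ℂ] M) (x : Laurent N)
    (y : Laurent M') : conv B (map g x) y = conv (B.comp g) x y := rfl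

/-- Coefficientwise identities between sums of products. -/
theorem conv_congr (B : M →ₗ[ℂ] M' →ₗ[ℂ] M'') (x : Laurent M) (y : Laurent M') {P Q : Type*}
    [AddCommGroup P] [Module ℂ P] [AddCommGroup Q] [Module ℂ Q] (B' : P →ₗ[ℂ] Q →ₗ[ℂ] M'')
    (x' : Laurent P) (y' : Laurent Q) (h : ∀ k l, B (x.1 k) (y.1 l) = B' (x'.1 k) (y'.1 l)) :
    conv B x y = conv B' x' y' :=
  ext' fun n => finsum_congr fun k => h k (n - k)

theorem map_conv (B : M →ₗ[ℂ] M' →ₗ[ℂ] M'') (g : M'' →ₗ[ℂ] N) (x : Laurent M) (y : Laurent M') :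
    map g (conv B x y) = conv (B.compr₂ g) x y := by
  refine ext' fun n => ?_
  rw [map_coeff, conv_coeff, conv_coeff]
  exact map_finsum g (conv_finite B x y n)

theorem conv_add_map (B B' : M →ₗ[ℂ] M' →ₗ[ℂ] M'') (x : Laurent M) (y : Laurent M') :
    conv (B + B') x y = conv B x y + conv B' x y := by
  refine ext' fun n => ?_
  exact finsum_add_distrib (conv_finite B x y n) (conv_finite B' x y n)

theorem conv_smul_map (c : ℂ) (B : M →ₗ[ℂ] M' →ₗ[ℂ] M'') (x : Laurent M) (y : Laurent M') :
    conv (c • B) x y = c • conv B x y := by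
  refine ext' fun n => ?_
  rw [smul_coeff, conv_coeff, conv_coeff, smul_finsum' c (conv_finite B x y n)]
  rfl

/-- Vanishing of the coefficients of `z^n`, `n > a + b`, of a product. -/
theorem conv_bound (B : M →ₗ[ℂ] M' →ₗ[ℂ] M'') {x : Laurent M} {y : Laurent M'} {a b : ℤ}
    (hx : ∀ n, a < n → x.1 n = 0) (hy : ∀ n, b < n → y.1 n = 0) (n : ℤ) (hn : a + b < n) :
    (conv B x y).1 n = 0 := by
  refine conv_coeff_eq_zero B fun k => ?_
  by_cases hk : a < k
  · rw [hx k hk, map_zero, LinearMap.zero_apply]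
  · rw [hy _ (by linarith), map_zero]

/-- Every Laurent series is a finite sum of monomials modulo series of low order. -/
theorem exists_trunc (x : Laurent M) (m : ℤ) : ∃ s : Finset ℤ, ∀ n, m < n →
    (x - ∑ k ∈ s, single k (x.1 k)).1 n = 0 := by
  obtain ⟨N, hN⟩ := x.2
  refine ⟨Finset.Icc m N, fun n hn => ?_⟩
  rw [sub_coeff, sum_coeff]
  simp only [single_coeff]
  rw [Finset.sum_ite_eq]
  split_ifs with h
  · exact sub_self _
  · rw [sub_zero]
    refine hN n ?_
    rw [Finset.mem_Icc] at h
    omega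

/-- A linear map which does not increase the order too much is determined by its values on
monomials. -/
theorem eq_zero_of_single (T : Laurent M →ₗ[ℂ] Laurent N) (c : ℤ)
    (hT : ∀ x : Laurent M, ∀ m, (∀ n, m < n → x.1 n = 0) → ∀ n, m + c < n → (T x).1 n = 0)
    {x : Laurent M} (h : ∀ k, T (single k (x.1 k)) = 0) : T x = 0 := by
  refine ext' fun n => ?_
  obtain ⟨s, hs⟩ := exists_trunc x (n - c - 1)
  have h1 := hT _ _ hs n (by linarith)
  rw [map_sub, map_sum, Finset.sum_eq_zero fun k _ => h k, sub_zero] at h1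
  exact h1

/-- Super Jacobi identities extend to Laurent series. -/
theorem conv_jacobi (B : M →ₗ[ℂ] M →ₗ[ℂ] M) (c : ℂ) (x y z : Laurent M)
    (h : ∀ k l, ∀ w, B (x.1 k) (B (y.1 l) w) = B (B (x.1 k) (y.1 l)) w
      + c • B (y.1 l) (B (x.1 k) w)) :
    conv B x (conv B y z) = conv B (conv B x y) z + c • conv B y (conv B x z) := by
  obtain ⟨b, hb⟩ := y.2
  obtain ⟨b', hb'⟩ := z.2
  rw [← sub_eq_zero]
  let T : Laurent M →ₗ[ℂ] Laurent M := (conv B).flip (conv B y z)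
    - ((conv B).flip z ∘ₗ (conv B).flip y + c • conv B y ∘ₗ (conv B).flip z)
  have hT : ∀ x, T x = conv B x (conv B y z)
      - (conv B (conv B x y) z + c • conv B y (conv B x z)) := fun x => rfl
  rw [← hT]
  -- By continuity in `x` it is enough to consider monomials.
  refine eq_zero_of_single T (b + b') (fun x m hx n hn => ?_) fun k => ?_
  · rw [hT, sub_coeff, add_coeff, smul_coeff,
      conv_bound B hx (conv_bound B hb hb') n (by linarith),
      conv_bound B (conv_bound B hx hb) hb' n (by linarith),
      conv_bound B hb (conv_bound B hx hb') n (by linarith)]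
    simp
  · rw [hT, sub_eq_zero]
    rw [conv_single_left', conv_single_left', conv_single_left', conv_shift_left,
      conv_shift_right, ← map_smul, ← map_add, map_conv, conv_map_left, conv_map_right,
      ← conv_smul_map, ← conv_add_map]
    congr 1
    refine conv_congr _ _ _ _ _ _ fun l m => ?_
    simpa using h k l (z.1 m)

end Laurent

/-! ### Components of a direct sum decomposition -/

section GradeComp

variable {κ 𝔤 : Type*} [DecidableEq κ] [AddCommGroup 𝔤] [Module ℂ 𝔤]
  {G : κ → Submodule ℂ 𝔤} (h : DirectSum.IsInternal G)

theorem gradeComp_of_mem {k : κ} {a : 𝔤} (ha : a ∈ G k) (l : κ) :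
    gradeComp h l a = if l = k then a else 0 := by
  have h1 : (LinearEquiv.ofBijective (DirectSum.coeLinearMap G) h).symm a
      = DirectSum.lof ℂ κ (fun k => G k) k ⟨a, ha⟩ := by
    rw [LinearEquiv.symm_apply_eq]
    exact (DirectSum.coeLinearMap_lof G k ⟨a, ha⟩).symm
  simp only [gradeComp, LinearMap.comp_apply, LinearEquiv.coe_coe, h1]
  by_cases hkl : l = k
  · subst hkl
    rw [if_pos rfl]
    rw [DirectSum.component.lof_self]
    rfl
  · rw [if_neg hkl]
    rw [DirectSum.component.of, dif_neg (Ne.symm hkl), map_zero]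

theorem gradeComp_self {k : κ} {a : 𝔤} (ha : a ∈ G k) : gradeComp h k a = a := by
  rw [gradeComp_of_mem h ha, if_pos rfl]

theorem mem_of_gradeComp {k : κ} {a : 𝔤} (ha : gradeComp h k a = a) : a ∈ G k :=
  ha ▸ gradeComp_mem h k a

theorem gradeComp_gradeComp (k l : κ) (a : 𝔤) :
    gradeComp h l (gradeComp h k a) = if l = k then gradeComp h k a else 0 :=
  gradeComp_of_mem h (gradeComp_mem h k a) l

end GradeComp

open SuperPoly

theorem zmod2_eq_add_one {p q : ZMod 2} (h : p ≠ q) : p = q + 1 := by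
  revert p q
  decide

namespace DSData

variable {𝔤 ι : Type*} [AddCommGroup 𝔤] [Module ℂ 𝔤] [Fintype ι] [DecidableEq ι]
  (S : DSData 𝔤 ι)

/-! ### Parity -/

theorem gradeComp_add (a : 𝔤) : gradeComp S.internal 0 a + gradeComp S.internal 1 a = a := by
  rw [← sum_univ_zmod2 (fun p => gradeComp S.internal p a), sum_gradeComp]

theorem gParity_of_mem {p : ZMod 2} {a : 𝔤} (ha : a ∈ S.part p) : S.gParity a = sgn p • a := by
  rw [gParity, LinearMap.sub_apply, gradeComp_of_mem _ ha, gradeComp_of_mem _ ha]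
  rcases zmod2_cases p with rfl | rfl <;> simp

theorem gParity_gParity (a : 𝔤) : S.gParity (S.gParity a) = a := by
  rw [← S.gradeComp_add a, map_add, S.gParity_of_mem (gradeComp_mem S.internal 0 a),
    S.gParity_of_mem (gradeComp_mem S.internal 1 a), map_add, map_smul, map_smul,
    S.gParity_of_mem (gradeComp_mem S.internal 0 a),
    S.gParity_of_mem (gradeComp_mem S.internal 1 a), smul_smul, smul_smul, sgn_mul_self,
    sgn_mul_self, one_smul, one_smul]

/-- The automorphism `a ↦ (-1)^{π p(a)} a` of `𝔤`. -/
def gtw (π : ZMod 2) : 𝔤 →ₗ[ℂ] 𝔤 := if π = 0 then LinearMap.id else S.gParity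

theorem gtw_one : S.gtw 1 = S.gParity := if_neg (by decide)

theorem gtw_of_mem {p : ZMod 2} {a : 𝔤} (ha : a ∈ S.part p) (π : ZMod 2) :
    S.gtw π a = sgn (π * p) • a := by
  rcases zmod2_cases π with rfl | rfl
  · simp [gtw]
  · rw [gtw_one, S.gParity_of_mem ha, one_mul]

theorem qLow_mem_part (t : ι) : S.qLow t ∈ S.part (S.par t) := by
  have h : gradeComp S.internal (S.par t) (S.qLow t) = S.qLow t := by
    conv_rhs => rw [← sum_gradeComp S.internal (S.qLow t)]
    exact (Finset.sum_eq_single _ (fun p _ hp => S.qLow_part t p hp) (by simp)).symm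
  exact mem_of_gradeComp _ h

/-! ### The superalgebra `𝔤 ⊗ 𝒫(\bar 𝔤)` -/

theorem tParity_tmul (a : 𝔤) (u : S.Aff) :
    S.tParity (a ⊗ₜ u) = S.gParity a ⊗ₜ parityAut _ u := rfl

theorem tParity_pure {p q : ZMod 2} {a : 𝔤} {u : S.Aff} (ha : a ∈ S.part p) (hu : IsPar q u) :
    S.tParity (a ⊗ₜ u) = sgn (p + q) • (a ⊗ₜ u) := by
  rw [tParity_tmul, S.gParity_of_mem ha, hu, TensorProduct.smul_tmul_smul, sgn_add]

/-- Every element of `𝔤 ⊗ 𝒫(\bar 𝔤)` is a sum of products of homogeneous elements. -/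
theorem ga_induction {Q : S.GA → Prop} (h0 : Q 0) (hadd : ∀ x y, Q x → Q y → Q (x + y))
    (h : ∀ p q a u, a ∈ S.part p → IsPar q u → Q (a ⊗ₜ u)) (x : S.GA) : Q x := by
  induction x using TensorProduct.induction_on with
  | zero => exact h0
  | tmul a u =>
    rw [← S.gradeComp_add a, ← component_add_component u, TensorProduct.add_tmul,
      TensorProduct.tmul_add, TensorProduct.tmul_add]
    have := fun p q => h p q _ _ (gradeComp_mem S.internal p a) (isPar_component q u)
    exact hadd _ _ (hadd _ _ (this 0 0) (this 0 1)) (hadd _ _ (this 1 0) (this 1 1))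
  | add x y hx hy => exact hadd _ _ hx hy

theorem tParity_tParity (x : S.GA) : S.tParity (S.tParity x) = x := by
  induction x using TensorProduct.induction_on with
  | zero => simp
  | tmul a u => rw [tParity_tmul, tParity_tmul, gParity_gParity, parityAut_parityAut]
  | add x y hx hy => rw [map_add, map_add, hx, hy]

/-- Homogeneous elements of `𝔤 ⊗ 𝒫(\bar 𝔤)` are sums of products of homogeneous elements. -/
theorem ga_induction_par {p : ZMod 2} {Q : S.GA → Prop} (h0 : Q 0)
    (hadd : ∀ x y, Q x → Q y → Q (x + y)) (h : ∀ q r a u, q + r = p → a ∈ S.part q → IsPar r u →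
      Q (a ⊗ₜ u)) {x : S.GA} (hx : S.tParity x = sgn p • x) : Q x := by
  have key : ∀ x : S.GA, Q ((1 / 2 : ℂ) • (x + sgn p • S.tParity x)) := by
    intro x
    refine S.ga_induction (Q := fun x => Q ((1 / 2 : ℂ) • (x + sgn p • S.tParity x)))
      (by simpa using h0) (fun x y hx hy => ?_) (fun q r a u ha hu => ?_) x
    · convert hadd _ _ hx hy using 1
      rw [map_add]
      module
    · rw [S.tParity_pure ha hu]
      by_cases hqr : q + r = p
      · convert h q r a u hqr ha hu using 1
        rw [hqr, smul_smul, sgn_mul_self, one_smul, ← two_smul ℂ, smul_smul]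
        norm_num
      · have h1 : q + r = p + 1 := zmod2_eq_add_one hqr
        convert h0 using 1
        rw [h1, smul_smul, sgn_add, ← mul_assoc, sgn_mul_self, sgn_one, one_mul, neg_smul, one_smul,
          add_neg_cancel, smul_zero]
  have h1 := key x
  rw [hx, smul_smul, sgn_mul_self, one_smul, ← two_smul ℂ, smul_smul] at h1
  norm_num at h1
  exact h1

section TensorExt

variable {N : Type*} [AddCommGroup N] [Module ℂ N]

theorem tensorExt_tmul (B : 𝔤 →ₗ[ℂ] 𝔤 →ₗ[ℂ] N) (a b : 𝔤) (u v : S.Aff) :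
    S.tensorExt B (a ⊗ₜ u) (b ⊗ₜ v) = B a (gradeComp S.internal 0 b) ⊗ₜ (u * v)
      + B a (gradeComp S.internal 1 b) ⊗ₜ (parityAut _ u * v) := rfl

theorem tensorExt_pure (B : 𝔤 →ₗ[ℂ] 𝔤 →ₗ[ℂ] N) (a : 𝔤) {p q : ZMod 2} {b : 𝔤} {u : S.Aff}
    (hb : b ∈ S.part p) (hu : IsPar q u) (v : S.Aff) :
    S.tensorExt B (a ⊗ₜ u) (b ⊗ₜ v) = sgn (p * q) • (B a b ⊗ₜ (u * v)) := by
  rw [tensorExt_tmul, gradeComp_of_mem _ hb, gradeComp_of_mem _ hb]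
  rcases zmod2_cases p with rfl | rfl
  · simp
  · unfold IsPar at hu
    simp [hu, TensorProduct.tmul_smul]

theorem tensorExt_one_left (B : 𝔤 →ₗ[ℂ] 𝔤 →ₗ[ℂ] N) (a b : 𝔤) (v : S.Aff) :
    S.tensorExt B (a ⊗ₜ 1) (b ⊗ₜ v) = B a b ⊗ₜ v := by
  rw [tensorExt_tmul, map_one, one_mul, ← TensorProduct.add_tmul, ← map_add, gradeComp_add]

/-- `[a ⊗ 1, ·]` acts on the first factor. -/
theorem tensorExt_one_left' (B : 𝔤 →ₗ[ℂ] 𝔤 →ₗ[ℂ] N) (a : 𝔤) (y : S.GA) :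
    S.tensorExt B (a ⊗ₜ 1) y = TensorProduct.map (B a) LinearMap.id y := by
  induction y using TensorProduct.induction_on with
  | zero => simp
  | tmul b v => rw [tensorExt_one_left]; rfl
  | add x y hx hy => rw [map_add, map_add, hx, hy]

end TensorExt

/-- The Lie superbracket of `𝔤 ⊗ 𝒫(\bar 𝔤)`. -/
abbrev gBr : S.GA →ₗ[ℂ] S.GA →ₗ[ℂ] S.GA := S.tensorExt S.br

/-- The bilinear form of `𝔤 ⊗ 𝒫(\bar 𝔤)`. -/
def gForm : S.GA →ₗ[ℂ] S.GA →ₗ[ℂ] S.Aff :=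
  (S.tensorExt S.form).compr₂ (TensorProduct.lid ℂ S.Aff).toLinearMap

theorem gForm_pure (a : 𝔤) {p q : ZMod 2} {b : 𝔤} {u : S.Aff} (hb : b ∈ S.part p)
    (hu : IsPar q u) (v : S.Aff) :
    S.gForm (a ⊗ₜ u) (b ⊗ₜ v) = (sgn (p * q) * S.form a b) • (u * v) := by
  change TensorProduct.lid ℂ S.Aff (S.tensorExt S.form (a ⊗ₜ u) (b ⊗ₜ v)) = _
  rw [S.tensorExt_pure _ a hb hu, map_smul, TensorProduct.lid_tmul, smul_smul]

theorem gBr_pure (a : 𝔤) {p q : ZMod 2} {b : 𝔤} {u : S.Aff} (hb : b ∈ S.part p)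
    (hu : IsPar q u) (v : S.Aff) :
    S.gBr (a ⊗ₜ u) (b ⊗ₜ v) = sgn (p * q) • (S.br a b ⊗ₜ (u * v)) :=
  S.tensorExt_pure _ a hb hu v

theorem gBr_tParity (x y : S.GA) : S.tParity (S.gBr x y) = S.gBr (S.tParity x) (S.tParity y) := by
  refine S.ga_induction (Q := fun x => S.tParity (S.gBr x y) = S.gBr (S.tParity x) (S.tParity y))
    (by simp) (fun x y hx hy => by simp only [map_add, LinearMap.add_apply, hx, hy])
    (fun p q a u ha hu => ?_) x
  refine S.ga_induction (Q := fun y => S.tParity (S.gBr (a ⊗ₜ u) y)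
    = S.gBr (S.tParity (a ⊗ₜ u)) (S.tParity y)) (by simp)
    (fun x y hx hy => by simp only [map_add, hx, hy]) (fun r s b v hb hv => ?_) y
  rw [S.tParity_pure ha hu, S.tParity_pure hb hv, S.gBr_pure a hb hu, map_smul,
    S.tParity_pure (S.br_mem _ _ _ ha _ hb) (hu.mul hv), map_smul, map_smul, LinearMap.smul_apply,
    S.gBr_pure a hb hu]
  simp only [smul_smul, sgn_add]
  congr 1
  ring

theorem gBr_skew {p q : ZMod 2} {x y : S.GA} (hx : S.tParity x = sgn p • x)
    (hy : S.tParity y = sgn q • y) : S.gBr x y = -(sgn (p * q) • S.gBr y x) := by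
  refine S.ga_induction_par (Q := fun x => S.gBr x y = -(sgn (p * q) • S.gBr y x)) (by simp)
    (fun x y hx hy => by simp only [map_add, LinearMap.add_apply, hx, hy]; module)
    (fun p₁ p₂ a u hp ha hu => ?_) hx
  refine S.ga_induction_par (Q := fun y => S.gBr (a ⊗ₜ u) y = -(sgn (p * q) • S.gBr y (a ⊗ₜ u)))
    (by simp) (fun x y hx hy => by simp only [map_add, LinearMap.add_apply, hx, hy]; module)
    (fun q₁ q₂ b v hq hb hv => ?_) hy
  rw [S.gBr_pure a hb hu, S.gBr_pure b ha hv, S.skew _ _ a ha b hb, hu.mul_comm' hv, ← hp, ← hq,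
    TensorProduct.neg_tmul, TensorProduct.smul_tmul_smul, smul_neg, smul_smul, smul_smul]
  congr 2
  simp only [add_mul, mul_add, sgn_add]
  rw [mul_comm q₁ p₂]
  linear_combination (-(sgn (p₁ * q₁) * sgn (p₂ * q₂) * sgn (p₂ * q₁))) * sgn_mul_self (p₁ * q₂)

theorem gBr_jacobi {p q : ZMod 2} {x y : S.GA} (hx : S.tParity x = sgn p • x)
    (hy : S.tParity y = sgn q • y) (z : S.GA) :
    S.gBr x (S.gBr y z) = S.gBr (S.gBr x y) z + sgn (p * q) • S.gBr y (S.gBr x z) := by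
  refine S.ga_induction_par (Q := fun x => S.gBr x (S.gBr y z) = S.gBr (S.gBr x y) z
    + sgn (p * q) • S.gBr y (S.gBr x z)) (by simp)
    (fun x y hx hy => by simp only [map_add, LinearMap.add_apply, hx, hy]; module)
    (fun p₁ p₂ a u hp ha hu => ?_) hx
  refine S.ga_induction_par (Q := fun y => S.gBr (a ⊗ₜ u) (S.gBr y z) = S.gBr (S.gBr (a ⊗ₜ u) y) z
    + sgn (p * q) • S.gBr y (S.gBr (a ⊗ₜ u) z))
    (by simp) (fun x y hx hy => by simp only [map_add, LinearMap.add_apply, hx, hy]; module)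
    (fun q₁ q₂ b v hq hb hv => ?_) hy
  refine S.ga_induction (Q := fun z => S.gBr (a ⊗ₜ u) (S.gBr (b ⊗ₜ v) z)
    = S.gBr (S.gBr (a ⊗ₜ u) (b ⊗ₜ v)) z + sgn (p * q) • S.gBr (b ⊗ₜ v) (S.gBr (a ⊗ₜ u) z))
    (by simp) (fun x y hx hy => by simp only [map_add, hx, hy]; module)
    (fun r s c w hc hw => ?_) z
  rw [S.gBr_pure b hc hv, S.gBr_pure a hc hu, S.gBr_pure a hb hu, map_smul, map_smul, map_smul,
    LinearMap.smul_apply, S.gBr_pure a (S.br_mem _ _ _ hb _ hc) hu,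
    S.gBr_pure b (S.br_mem _ _ _ ha _ hc) hv, S.gBr_pure _ hc (hu.mul hv),
    S.jacobi _ _ a ha b hb c, TensorProduct.add_tmul, TensorProduct.smul_tmul', ← mul_assoc v u w,
    hv.mul_comm' hu, smul_mul_assoc, TensorProduct.tmul_smul, ← hp, ← hq, mul_assoc u v w]
  have hs : ∀ p : ZMod 2, sgn p = 1 ∨ sgn p = -1 := fun p => by
    rcases zmod2_cases p with rfl | rfl <;> simp
  simp only [smul_add, smul_smul, add_mul, mul_add, sgn_add, ← TensorProduct.smul_tmul',
    mul_comm q₁ p₂, mul_comm r p₂, mul_comm p₁ q₂, mul_comm q₂ p₂, mul_comm r q₂]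
  rcases hs (p₂ * q₂) with h1 | h1 <;> rcases hs (q₂ * p₁) with h2 | h2 <;>
    simp only [h1, h2] <;> module

theorem gForm_invariant (x y z : S.GA) : S.gForm (S.gBr x y) z = S.gForm x (S.gBr y z) := by
  refine S.ga_induction (Q := fun x => S.gForm (S.gBr x y) z = S.gForm x (S.gBr y z))
    (by simp) (fun x y hx hy => by simp only [map_add, LinearMap.add_apply, hx, hy])
    (fun p₁ p₂ a u ha hu => ?_) x
  refine S.ga_induction (Q := fun y => S.gForm (S.gBr (a ⊗ₜ u) y) z
    = S.gForm (a ⊗ₜ u) (S.gBr y z))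
    (by simp) (fun x y hx hy => by simp only [map_add, LinearMap.add_apply, hx, hy])
    (fun q₁ q₂ b v hb hv => ?_) y
  refine S.ga_induction (Q := fun z => S.gForm (S.gBr (a ⊗ₜ u) (b ⊗ₜ v)) z
    = S.gForm (a ⊗ₜ u) (S.gBr (b ⊗ₜ v) z))
    (by simp) (fun x y hx hy => by simp only [map_add, hx, hy])
    (fun r s c w hc hw => ?_) z
  rw [S.gBr_pure b hc hv, S.gBr_pure a hb hu, map_smul, map_smul, LinearMap.smul_apply,
    S.gForm_pure _ hc (hu.mul hv), S.gForm_pure a (S.br_mem _ _ _ hb _ hc) hu, S.form_invariant,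
    mul_assoc u]
  simp only [smul_smul, add_mul, mul_add, sgn_add]
  congr 1
  ring

/-! ### Superderivations of `𝔤 ⊗ 𝒫(\bar 𝔤)` -/

/-- The extension `a ⊗ u ↦ (-1)^{π p(a)} a ⊗ d u` of a superderivation `d` of parity `π`. -/
def gDer (π : ZMod 2) (d : S.Aff →ₗ[ℂ] S.Aff) : S.GA →ₗ[ℂ] S.GA := TensorProduct.map (S.gtw π) d

theorem gDer_pure (π : ZMod 2) (d : S.Aff →ₗ[ℂ] S.Aff) {p : ZMod 2} {a : 𝔤} (ha : a ∈ S.part p)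
    (u : S.Aff) : S.gDer π d (a ⊗ₜ u) = sgn (π * p) • (a ⊗ₜ d u) := by
  rw [gDer, TensorProduct.map_tmul, S.gtw_of_mem ha, TensorProduct.smul_tmul']

theorem gDer_tmul (π : ZMod 2) (d : S.Aff →ₗ[ℂ] S.Aff) (a : 𝔤) (u : S.Aff) :
    S.gDer π d (a ⊗ₜ u) = S.gtw π a ⊗ₜ d u := rfl

variable {S} in
theorem gDer_par {π : ZMod 2} {d : S.Aff →ₗ[ℂ] S.Aff} (hd : IsSDer π d) (x : S.GA) :
    S.tParity (S.gDer π d x) = sgn π • S.gDer π d (S.tParity x) := by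
  refine S.ga_induction (Q := fun x => S.tParity (S.gDer π d x) = sgn π • S.gDer π d (S.tParity x))
    (by simp) (fun x y hx hy => by simp only [map_add, hx, hy, smul_add])
    (fun p q a u ha hu => ?_) x
  rw [S.gDer_pure π d ha, map_smul, S.tParity_pure ha (hd.isPar hu), S.tParity_pure ha hu, map_smul,
    S.gDer_pure π d ha]
  simp only [smul_smul, sgn_add]
  congr 1
  ring

variable {S} in
theorem gDer_gBr {π : ZMod 2} {d : S.Aff →ₗ[ℂ] S.Aff} (hd : IsSDer π d) {p : ZMod 2} {x : S.GA}
    (hx : S.tParity x = sgn p • x) (y : S.GA) : S.gDer π d (S.gBr x y)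
      = S.gBr (S.gDer π d x) y + sgn (π * p) • S.gBr x (S.gDer π d y) := by
  refine S.ga_induction_par (Q := fun x => S.gDer π d (S.gBr x y)
      = S.gBr (S.gDer π d x) y + sgn (π * p) • S.gBr x (S.gDer π d y)) (by simp)
    (fun x y hx hy => by simp only [map_add, LinearMap.add_apply, hx, hy]; module)
    (fun p₁ p₂ a u hp ha hu => ?_) hx
  refine S.ga_induction (Q := fun y => S.gDer π d (S.gBr (a ⊗ₜ u) y)
      = S.gBr (S.gDer π d (a ⊗ₜ u)) y + sgn (π * p) • S.gBr (a ⊗ₜ u) (S.gDer π d y))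
    (by simp) (fun x y hx hy => by simp only [map_add, hx, hy]; module)
    (fun q₁ q₂ b v hb hv => ?_) y
  rw [S.gBr_pure a hb hu, map_smul, S.gDer_pure π d (S.br_mem _ _ _ ha _ hb), S.gDer_pure π d ha,
    S.gDer_pure π d hb, map_smul, map_smul, LinearMap.smul_apply, S.gBr_pure a hb (hd.isPar hu),
    S.gBr_pure a hb hu, hd.leib' hu, TensorProduct.tmul_add, TensorProduct.tmul_smul, ← hp]
  simp only [smul_add, smul_smul, mul_add, sgn_add, mul_comm q₁ π]
  congr 1
  · congr 1
    linear_combination (0 : ℂ) * sgn_mul_self (π * q₁)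
  · congr 1
    ring

variable {S} in
theorem gDer_gForm {π : ZMod 2} {d : S.Aff →ₗ[ℂ] S.Aff} (hd : IsSDer π d) {p : ZMod 2} {x : S.GA}
    (hx : S.tParity x = sgn p • x) (y : S.GA) : d (S.gForm x y)
      = S.gForm (S.gDer π d x) y + sgn (π * p) • S.gForm x (S.gDer π d y) := by
  refine S.ga_induction_par (Q := fun x => d (S.gForm x y)
      = S.gForm (S.gDer π d x) y + sgn (π * p) • S.gForm x (S.gDer π d y)) (by simp)
    (fun x y hx hy => by simp only [map_add, LinearMap.add_apply, hx, hy]; module)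
    (fun p₁ p₂ a u hp ha hu => ?_) hx
  refine S.ga_induction (Q := fun y => d (S.gForm (a ⊗ₜ u) y)
      = S.gForm (S.gDer π d (a ⊗ₜ u)) y + sgn (π * p) • S.gForm (a ⊗ₜ u) (S.gDer π d y))
    (by simp) (fun x y hx hy => by simp only [map_add, hx, hy]; module)
    (fun q₁ q₂ b v hb hv => ?_) y
  rw [S.gForm_pure a hb hu, map_smul, S.gDer_pure π d ha,
    S.gDer_pure π d hb, map_smul, map_smul, LinearMap.smul_apply, S.gForm_pure a hb (hd.isPar hu),
    S.gForm_pure a hb hu, hd.leib' hu, ← hp]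
  by_cases hpq : p₁ = q₁
  · subst hpq
    simp only [smul_add, smul_smul, mul_add, sgn_add, mul_comm p₁ π]
    have h1 := sgn_mul_self (π * p₁)
    congr 1
    · congr 1
      linear_combination (-(sgn (p₁ * p₂) * S.form a b)) * h1
    · congr 1
      linear_combination (-(sgn (p₁ * p₂) * S.form a b * sgn (π * p₂))) * h1
  · rw [S.form_even p₁ q₁ hpq a ha b hb]
    simp

end DSData

/-! ### Bounded gradings and the filtration of Laurent series -/

/-- A `ℤ`-grading of a vector space with finitely many components, given by its projections. -/
structure Grading (V : Type*) [AddCommGroup V] [Module ℂ V] where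
  /-- The projection onto the component of degree `k`. -/
  pr : ℤ → V →ₗ[ℂ] V
  /-- A bound for the degrees. -/
  d : ℤ
  pr_pr : ∀ k l x, pr k (pr l x) = if k = l then pr l x else 0
  sum_pr : ∀ x, ∑ k ∈ Finset.Icc (-d) d, pr k x = x
  pr_range : ∀ k x, d < |k| → pr k x = 0

namespace Grading

variable {V V₁ V₂ V₃ : Type*} [AddCommGroup V] [Module ℂ V] [AddCommGroup V₁] [Module ℂ V₁]
  [AddCommGroup V₂] [Module ℂ V₂] [AddCommGroup V₃] [Module ℂ V₃]
  (G : Grading V) (G₁ : Grading V₁) (G₂ : Grading V₂) (G₃ : Grading V₃)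

variable {G G₁ G₂ G₃}

theorem eq_zero {x : V} (h : ∀ k, G.pr k x = 0) : x = 0 := by
  rw [← G.sum_pr x]
  exact Finset.sum_eq_zero fun k _ => h k

theorem pr_of_forall_ne {x : V} {r : ℤ} (h : ∀ m, m ≠ r → G.pr m x = 0) : G.pr r x = x := by
  rw [← sub_eq_zero]
  refine eq_zero (G := G) fun k => ?_
  rw [map_sub, G.pr_pr]
  split_ifs with hk
  · rw [hk, sub_self]
  · rw [h k hk, sub_zero]

/-- A bilinear map of degree `0`. -/
def IsGr (G₁ : Grading V₁) (G₂ : Grading V₂) (G₃ : Grading V₃) (B : V₁ →ₗ[ℂ] V₂ →ₗ[ℂ] V₃) : Prop :=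
  ∀ k l m a b, m ≠ k + l → G₃.pr m (B (G₁.pr k a) (G₂.pr l b)) = 0

variable {B : V₁ →ₗ[ℂ] V₂ →ₗ[ℂ] V₃}

theorem IsGr.pr_right (hB : IsGr G₁ G₂ G₃ B) {p : ℤ} {a : V₁} (ha : G₁.pr p a = a) (q : ℤ)
    (b : V₂) :
    G₃.pr (p + q) (B a b) = B a (G₂.pr q b) := by
  rw [← ha]
  have h1 : G₃.pr (p + q) (B (G₁.pr p a) (G₂.pr q b)) = B (G₁.pr p a) (G₂.pr q b) :=
    pr_of_forall_ne fun m hm => hB p q m a b hm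
  rw [← h1]
  have h2 : B (G₁.pr p a) b - B (G₁.pr p a) (G₂.pr q b)
      = ∑ k ∈ Finset.Icc (-G₂.d) G₂.d, B (G₁.pr p a) (G₂.pr k (b - G₂.pr q b)) := by
    rw [← map_sum, G₂.sum_pr, map_sub]
  rw [← sub_eq_zero, ← map_sub, h2, map_sum]
  refine Finset.sum_eq_zero fun k _ => ?_
  by_cases hk : k = q
  · rw [map_sub, G₂.pr_pr, if_pos hk, hk, sub_self, map_zero, map_zero]
  · exact hB _ _ _ _ _ fun h => hk (by linarith)

theorem IsGr.pr_of_lt (hB : IsGr G₁ G₂ G₃ B) {α β m : ℤ} {a : V₁} {b : V₂}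
    (ha : ∀ k, k < α → G₁.pr k a = 0)
    (hb : ∀ k, k < β → G₂.pr k b = 0) (hm : m < α + β) : G₃.pr m (B a b) = 0 := by
  rw [← G₁.sum_pr a, map_sum, LinearMap.sum_apply, map_sum]
  refine Finset.sum_eq_zero fun k _ => ?_
  rw [← G₂.sum_pr b, map_sum, map_sum]
  refine Finset.sum_eq_zero fun l _ => ?_
  by_cases hk : k < α
  · rw [ha k hk, map_zero, LinearMap.zero_apply, map_zero]
  · by_cases hl : l < β
    · rw [hb l hl, map_zero, map_zero]
    · exact hB _ _ _ _ _ (by linarith)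

variable (G) in
/-- The projection of `V((z⁻¹))` onto the component of degree `k`, where `z` has degree `-e`. -/
def gc (e k : ℤ) : Laurent V →ₗ[ℂ] Laurent V where
  toFun x := ⟨fun n => G.pr (k + e * n) (x.1 n), by
    obtain ⟨N, hN⟩ := x.2
    exact ⟨N, fun n hn => by dsimp only; rw [hN n hn, map_zero]⟩⟩
  map_add' x y := Laurent.ext' fun n => map_add _ _ _
  map_smul' c x := Laurent.ext' fun n => map_smul _ _ _

@[simp] theorem gc_coeff (e k : ℤ) (x : Laurent V) (n : ℤ) :
    (G.gc e k x).1 n = G.pr (k + e * n) (x.1 n) := rfl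

theorem gc_gc (e k l : ℤ) (x : Laurent V) :
    G.gc e k (G.gc e l x) = if k = l then G.gc e l x else 0 := by
  refine Laurent.ext' fun n => ?_
  rw [gc_coeff, gc_coeff, G.pr_pr]
  by_cases h : k = l
  · rw [if_pos h, if_pos (by rw [h]), gc_coeff]
  · rw [if_neg h, if_neg fun h' => h (by linarith), Laurent.zero_coeff]

theorem gc_eq_zero {e : ℤ} {x : Laurent V} (h : ∀ k, G.gc e k x = 0) : x = 0 := by
  refine Laurent.ext' fun n => eq_zero (G := G) fun k => ?_
  have h1 := congrArg (fun y => y.1 n) (h (k - e * n))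
  simpa using h1

theorem IsGr.gc_conv (hB : IsGr G₁ G₂ G₃ B) {e p : ℤ} {x : Laurent V₁}
    (hx : G₁.gc e p x = x) (q : ℤ) (y : Laurent V₂) :
    G₃.gc e (p + q) (Laurent.conv B x y) = Laurent.conv B x (G₂.gc e q y) := by
  refine Laurent.ext' fun n => ?_
  rw [gc_coeff, Laurent.conv_coeff, Laurent.conv_coeff, map_finsum _ (Laurent.conv_finite B x y n)]
  refine finsum_congr fun k => ?_
  have h1 : G₁.pr (p + e * k) (x.1 k) = x.1 k := congrArg (fun y => y.1 k) hx
  rw [gc_coeff, ← hB.pr_right h1, show p + q + e * n = p + e * k + (q + e * (n - k)) by ring]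

/-- The elements of degree `≥ k`. -/
def filtF (G : Grading V) (e k : ℤ) : Submodule ℂ (Laurent V) where
  carrier := {x | ∀ l, l < k → G.gc e l x = 0}
  zero_mem' := fun _ _ => map_zero _
  add_mem' := fun h h' l hl => by rw [map_add, h l hl, h' l hl, add_zero]
  smul_mem' := fun c _ h l hl => by rw [map_smul, h l hl, smul_zero]

theorem mem_filtF {e k : ℤ} {x : Laurent V} :
    x ∈ G.filtF e k ↔ ∀ n l, l < k + e * n → G.pr l (x.1 n) = 0 := by
  refine ⟨fun h n l hl => ?_, fun h l hl => Laurent.ext' fun n => h n _ (by linarith)⟩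
  have h1 := congrArg (fun y => y.1 n) (h (l - e * n) (by linarith))
  simpa using h1

theorem coeff_eq_zero_of_mem {e k : ℤ} {x : Laurent V} (hx : x ∈ G.filtF e k) {n : ℤ}
    (hn : G.d < k + e * n) : x.1 n = 0 := by
  refine eq_zero (G := G) fun l => ?_
  by_cases hl : l < k + e * n
  · exact mem_filtF.1 hx n l hl
  · exact G.pr_range _ _ (lt_of_lt_of_le (by linarith) (le_abs_self l))

theorem gc_mem_filtF {e k l : ℤ} (h : l ≤ k) (x : Laurent V) : G.gc e k x ∈ G.filtF e l :=
  fun m hm => by rw [gc_gc, if_neg (by linarith)]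

theorem sub_gc_mem {e k : ℤ} {x : Laurent V} (hx : x ∈ G.filtF e k) :
    x - G.gc e k x ∈ G.filtF e (k + 1) := fun l hl => by
  rw [map_sub, gc_gc]
  split_ifs with h
  · rw [h, sub_self]
  · rw [hx l (by omega), sub_zero]

theorem IsGr.conv_mem (hB : IsGr G₁ G₂ G₃ B) {e k l : ℤ} {x : Laurent V₁}
    (hx : x ∈ G₁.filtF e k) {y : Laurent V₂}
    (hy : y ∈ G₂.filtF e l) : Laurent.conv B x y ∈ G₃.filtF e (k + l) := by
  refine mem_filtF.2 fun n m hm => ?_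
  rw [Laurent.conv_coeff, map_finsum _ (Laurent.conv_finite B x y n)]
  refine finsum_eq_zero_of_forall_eq_zero fun r => ?_
  exact hB.pr_of_lt (mem_filtF.1 hx r) (mem_filtF.1 hy (n - r)) (by linarith)

/-- The filtration of `V((z⁻¹))` by degree, where `z` has degree `-e < 0`. -/
def filt (G : Grading V) (e : ℤ) (he : 0 < e) : Filt (Laurent V) where
  F := G.filtF e
  anti := fun k l h x hx m hm => hx m (lt_of_lt_of_le hm h)
  exh := fun x => by
    obtain ⟨N, hN⟩ := x.2
    refine ⟨-G.d - e * N, mem_filtF.2 fun n l hl => ?_⟩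
    by_cases hn : N < n
    · rw [hN n hn, map_zero]
    · refine G.pr_range _ _ (lt_of_lt_of_le ?_ (neg_le_abs l))
      have : e * n ≤ e * N := mul_le_mul_of_nonneg_left (not_lt.1 hn) he.le
      linarith
  sep := fun x hx => gc_eq_zero (G := G) fun k => hx (k + 1) k (by linarith)
  complete := fun k x hx => by
    have hz : ∀ (n : ℤ) (m : ℕ), (G.d + 1 - k - e * n).toNat ≤ m → (x m).1 n = 0 := fun n m hm => by
      refine coeff_eq_zero_of_mem (hx m) ?_
      have : ((G.d + 1 - k - e * n).toNat : ℤ) ≤ m := by exact_mod_cast hm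
      linarith [Int.self_le_toNat (G.d + 1 - k - e * n)]
    have hs : ∀ (n : ℤ) (N : ℕ), (G.d + 1 - k - e * n).toNat ≤ N →
        ∑ m ∈ Finset.range (G.d + 1 - k - e * n).toNat, (x m).1 n
          = ∑ m ∈ Finset.range N, (x m).1 n := fun n N hN => by
      refine Finset.sum_subset (Finset.range_mono hN) fun m _ hm => hz n m ?_
      simpa using hm
    refine ⟨⟨fun n => ∑ m ∈ Finset.range (G.d + 1 - k - e * n).toNat, (x m).1 n,
      |G.d + 1 - k|, fun n hn => ?_⟩, fun N => mem_filtF.2 fun n l hl => ?_⟩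
    · dsimp only
      rw [Int.toNat_eq_zero.2, Finset.range_zero, Finset.sum_empty]
      have h1 := le_abs_self (G.d + 1 - k)
      have h2 := abs_nonneg (G.d + 1 - k)
      nlinarith
    · rw [Laurent.sub_coeff, Laurent.sum_coeff]
      dsimp only
      set M := max N (G.d + 1 - k - e * n).toNat
      rw [hs n M (le_max_right _ _), ← Finset.sum_sdiff (Finset.range_mono (le_max_left N _)),
        add_sub_cancel_right, map_sum]
      refine Finset.sum_eq_zero fun m hm => ?_
      rw [Finset.mem_sdiff, Finset.mem_range, Finset.mem_range, not_lt] at hm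
      have : (N : ℤ) ≤ m := by exact_mod_cast hm.2
      exact mem_filtF.1 (hx m) n l (by linarith)

theorem map_mem_filtF {g : V₁ →ₗ[ℂ] V₂} (hg : ∀ k x, G₁.pr k x = 0 → G₂.pr k (g x) = 0) {e k : ℤ}
    {x : Laurent V₁} (hx : x ∈ G₁.filtF e k) : Laurent.map g x ∈ G₂.filtF e k :=
  mem_filtF.2 fun n l hl => hg _ _ (mem_filtF.1 hx n l hl)

/-- Subspaces defined by conditions on the coefficients are closed. -/
theorem isClosed_coeff {e : ℤ} (he : 0 < e) (C : Submodule ℂ (Laurent V)) (C' : ℤ → Submodule ℂ V)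
    (h : ∀ x, x ∈ C ↔ ∀ n, x.1 n ∈ C' n) : (G.filt e he).IsClosed C := by
  intro x hx
  refine (h x).2 fun n => ?_
  obtain ⟨y, hy, hxy⟩ := hx (G.d + 1 - e * n)
  have h1 := coeff_eq_zero_of_mem hxy (n := n) (by linarith)
  rw [Laurent.sub_coeff, sub_eq_zero] at h1
  rw [h1]
  exact (h y).1 hy n

end Grading

/-- The trivial grading. -/
def Grading.triv (V : Type*) [AddCommGroup V] [Module ℂ V] : Grading V where
  pr k := if k = 0 then LinearMap.id else 0
  d := 0
  pr_pr k l x := by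
    by_cases hl : l = 0
    · by_cases hk : k = 0
      · simp [hl, hk]
      · simp [hl, hk]
    · simp [hl]
  sum_pr x := by simp
  pr_range k x hk := by rw [if_neg (by rintro rfl; simp at hk), LinearMap.zero_apply]

namespace DSData

variable {𝔤 ι : Type*} [AddCommGroup 𝔤] [Module ℂ 𝔤] [Fintype ι] [DecidableEq ι]
  (S : DSData 𝔤 ι)

/-! ### The grading of `𝔤 ⊗ 𝒫(\bar 𝔤)` -/

/-- The grading of `𝔤`. -/
def gGr : Grading 𝔤 where
  pr := gradeComp S.deg_internal
  d := S.d
  pr_pr k l x := gradeComp_gradeComp _ _ _ _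
  sum_pr x := by
    obtain ⟨y, rfl⟩ := S.deg_internal.2 x
    induction y using DirectSum.induction_on with
    | zero => simp
    | of k a =>
      have h : (DirectSum.coeAddMonoidHom S.deg) (DirectSum.of (fun k => S.deg k) k a) = a :=
        DirectSum.coeAddMonoidHom_of _ _ _
      rw [h]
      simp only [gradeComp_of_mem S.deg_internal a.2]
      rw [Finset.sum_ite_eq']
      split_ifs with hk
      · rfl
      · have h2 : ∀ b ∈ S.deg k, b = 0 := by
          rw [S.deg_range k]
          · exact fun b hb => (Submodule.mem_bot ℂ).1 hb
          rw [Finset.mem_Icc, not_and_or, not_le, not_le] at hk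
          rcases hk with hk | hk
          · exact lt_of_lt_of_le (by linarith) (neg_le_abs k)
          · exact lt_of_lt_of_le hk (le_abs_self k)
        exact (h2 _ a.2).symm
    | add x y hx hy =>
      rw [map_add]
      conv_rhs => rw [← hx, ← hy, ← Finset.sum_add_distrib]
      exact Finset.sum_congr rfl fun k _ => map_add _ _ _
  pr_range k x hk := by
    have h := gradeComp_mem S.deg_internal k x
    rwa [S.deg_range k hk, Submodule.mem_bot] at h

theorem gGr_of_mem {k : ℤ} {a : 𝔤} (ha : a ∈ S.deg k) (l : ℤ) :
    S.gGr.pr l a = if l = k then a else 0 := gradeComp_of_mem _ ha l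

theorem gGr_pr_mem (k : ℤ) (a : 𝔤) : S.gGr.pr k a ∈ S.deg k := gradeComp_mem _ _ _

theorem gGr_part {p : ZMod 2} {a : 𝔤} (ha : a ∈ S.part p) (k : ℤ) : S.gGr.pr k a ∈ S.part p := by
  have h : gradeComp S.internal p (S.gGr.pr k a) = S.gGr.pr k a := by
    have h1 : ∀ l, gradeComp S.internal p (S.gGr.pr l a) ∈ S.deg l := fun l =>
      S.deg_part l _ (S.gGr_pr_mem l a) p
    have h2 : S.gGr.pr k (gradeComp S.internal p a) = gradeComp S.internal p (S.gGr.pr k a) := by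
      conv_lhs => rw [← S.gGr.sum_pr a, map_sum, map_sum]
      rw [Finset.sum_congr rfl fun l _ => S.gGr_of_mem (h1 l) k, Finset.sum_ite_eq]
      split_ifs with hk
      · rfl
      · rw [S.gGr.pr_range k a, map_zero]
        by_contra h3
        rw [not_lt, abs_le, ← Finset.mem_Icc] at h3
        exact hk h3
    rw [← h2, gradeComp_self _ ha]
  exact mem_of_gradeComp _ h

/-- The grading of `𝔤 ⊗ 𝒫(\bar 𝔤)` by the degree of the first factor. -/
def tGr : Grading S.GA where
  pr k := TensorProduct.map (S.gGr.pr k) LinearMap.id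
  d := S.d
  pr_pr k l x := by
    induction x using TensorProduct.induction_on with
    | zero => simp
    | tmul a u =>
      rw [TensorProduct.map_tmul, TensorProduct.map_tmul, S.gGr.pr_pr]
      split_ifs
      · rfl
      · rw [TensorProduct.zero_tmul]
    | add x y hx hy =>
      rw [map_add, map_add, hx, hy]
      split_ifs <;> simp
  sum_pr x := by
    induction x using TensorProduct.induction_on with
    | zero => simp
    | tmul a u =>
      simp only [TensorProduct.map_tmul, LinearMap.id_apply]
      rw [← TensorProduct.sum_tmul]
      exact congrArg (· ⊗ₜ[ℂ] u) (S.gGr.sum_pr a)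
    | add x y hx hy =>
      conv_rhs => rw [← hx, ← hy, ← Finset.sum_add_distrib]
      exact Finset.sum_congr rfl fun k _ => map_add _ _ _
  pr_range k x hk := by
    have h : S.gGr.pr k = 0 := LinearMap.ext fun a => S.gGr.pr_range k a hk
    rw [h, TensorProduct.map_zero_left, LinearMap.zero_apply]

theorem tGr_tmul (k : ℤ) (a : 𝔤) (u : S.Aff) :
    S.tGr.pr k (a ⊗ₜ u) = S.gGr.pr k a ⊗ₜ u := rfl

theorem tGr_tParity (k : ℤ) (x : S.GA) : S.tGr.pr k (S.tParity x) = S.tParity (S.tGr.pr k x) := by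
  refine S.ga_induction (Q := fun x => S.tGr.pr k (S.tParity x) = S.tParity (S.tGr.pr k x))
    (by simp) (fun x y hx hy => by simp only [map_add, hx, hy]) (fun p q a u ha hu => ?_) x
  rw [S.tParity_pure ha hu, map_smul, tGr_tmul, S.tParity_pure (S.gGr_part ha k) hu]

theorem isGr_br : Grading.IsGr S.gGr S.gGr S.gGr S.br := fun k l m a b hm => by
  rw [S.gGr_of_mem (S.br_deg k l _ (S.gGr_pr_mem k a) _ (S.gGr_pr_mem l b)), if_neg hm]

theorem isGr_gBr : Grading.IsGr S.tGr S.tGr S.tGr S.gBr := fun k l m x y hm => by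
  refine S.ga_induction (Q := fun x => S.tGr.pr m (S.gBr (S.tGr.pr k x) (S.tGr.pr l y)) = 0)
    (by simp) (fun x y hx hy => by simp only [map_add, LinearMap.add_apply, hx, hy, add_zero])
    (fun p q a u ha hu => ?_) x
  refine S.ga_induction (Q := fun y => S.tGr.pr m (S.gBr (S.tGr.pr k (a ⊗ₜ u)) (S.tGr.pr l y)) = 0)
    (by simp) (fun x y hx hy => by simp only [map_add, hx, hy, add_zero])
    (fun r s b v hb hv => ?_) y
  rw [tGr_tmul, tGr_tmul, S.gBr_pure _ (S.gGr_part hb l) hu, map_smul, tGr_tmul,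
    S.isGr_br k l m a b hm, TensorProduct.zero_tmul, smul_zero]

theorem isGr_gForm : Grading.IsGr S.tGr S.tGr (Grading.triv S.Aff) S.gForm :=
  fun k l m x y hm => by
  by_cases h0 : m = 0
  · have hf : ∀ a b, S.form (S.gGr.pr k a) (S.gGr.pr l b) = 0 := fun a b =>
      S.form_deg k l (fun h => hm (by rw [h0, h])) _ (S.gGr_pr_mem k a) _ (S.gGr_pr_mem l b)
    refine S.ga_induction (Q := fun x => (Grading.triv S.Aff).pr m
        (S.gForm (S.tGr.pr k x) (S.tGr.pr l y)) = 0)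
      (by simp) (fun x y hx hy => by simp only [map_add, LinearMap.add_apply, hx, hy, add_zero])
      (fun p q a u ha hu => ?_) x
    refine S.ga_induction (Q := fun y => (Grading.triv S.Aff).pr m
        (S.gForm (S.tGr.pr k (a ⊗ₜ u)) (S.tGr.pr l y)) = 0)
      (by simp) (fun x y hx hy => by simp only [map_add, hx, hy, add_zero])
      (fun r s b v hb hv => ?_) y
    rw [tGr_tmul, tGr_tmul, S.gForm_pure _ (S.gGr_part hb l) hu, hf, mul_zero, zero_smul, map_zero]
  · change (if m = 0 then LinearMap.id else 0 : S.Aff →ₗ[ℂ] S.Aff) _ = 0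
    rw [if_neg h0, LinearMap.zero_apply]

/-! ### The filtered Lie superalgebra `𝔤((z⁻¹)) ⊗ 𝒫(\bar 𝔤)` -/

theorem ij_pos : 0 < S.i + S.j := add_pos S.i_pos S.j_pos

/-- `𝔤((z⁻¹)) ⊗ 𝒫(\bar 𝔤)` as a filtered Lie superalgebra. -/
def 𝓖 : FLie S.LGA where
  toFilt := S.tGr.filt (S.i + S.j) S.ij_pos
  P := S.lParity
  P_P x := Laurent.ext' fun n => S.tParity_tParity _
  br := S.lBr
  P_br x y := by
    change Laurent.map S.tParity (Laurent.conv S.gBr x y) = Laurent.conv S.gBr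
      (Laurent.map S.tParity x) (Laurent.map S.tParity y)
    rw [Laurent.map_conv]
    exact Laurent.conv_congr _ _ _ _ _ _ fun k l => S.gBr_tParity _ _
  skew p q x y hx hy := by
    have hx' : ∀ n, S.tParity (x.1 n) = sgn p • x.1 n := fun n => congrArg (fun y => y.1 n) hx
    have hy' : ∀ n, S.tParity (y.1 n) = sgn q • y.1 n := fun n => congrArg (fun y => y.1 n) hy
    refine Laurent.ext' fun n => ?_
    change (Laurent.conv S.gBr x y).1 n = -(sgn (p * q) • (Laurent.conv S.gBr y x).1 n)
    rw [Laurent.conv_coeff, Laurent.conv_coeff, smul_finsum' _ (Laurent.conv_finite S.gBr y x n),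
      ← finsum_neg_distrib, ← finsum_comp_equiv (Equiv.subLeft n)]
    refine finsum_congr fun k => ?_
    rw [Equiv.subLeft_apply, sub_sub_cancel]
    exact S.gBr_skew (hx' _) (hy' _)
  jacobi p q x y z hx hy := by
    have hx' : ∀ n, S.tParity (x.1 n) = sgn p • x.1 n := fun n => congrArg (fun y => y.1 n) hx
    have hy' : ∀ n, S.tParity (y.1 n) = sgn q • y.1 n := fun n => congrArg (fun y => y.1 n) hy
    exact Laurent.conv_jacobi S.gBr _ x y z fun k l w => S.gBr_jacobi (hx' k) (hy' l) w
  F_br k l x hx y hy := S.isGr_gBr.conv_mem hx hy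
  P_F k x hx := Grading.map_mem_filtF (fun k x h => by rw [tGr_tParity, h, map_zero]) hx

theorem 𝓖_F (k : ℤ) : S.𝓖.F k = S.tGr.filtF (S.i + S.j) k := rfl

theorem 𝓖_par_iff {p : ZMod 2} {x : S.LGA} :
    S.𝓖.P x = sgn p • x ↔ ∀ n, S.tParity (x.1 n) = sgn p • x.1 n :=
  ⟨fun h n => congrArg (fun y => y.1 n) h, fun h => Laurent.ext' h⟩

/-- The extension of a superderivation of parity `π` of `𝒫(\bar 𝔤)`. -/
def lDer (π : ZMod 2) (d : S.Aff →ₗ[ℂ] S.Aff) : S.LGA →ₗ[ℂ] S.LGA := Laurent.map (S.gDer π d)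

theorem lD_eq : S.lD = S.lDer 1 S.D := by
  rw [lD, lDer, gDer, gtw_one]

theorem gGr_gtw (π : ZMod 2) (k : ℤ) (a : 𝔤) : S.gGr.pr k (S.gtw π a) = S.gtw π (S.gGr.pr k a) := by
  rw [← S.gradeComp_add a]
  simp only [map_add]
  rw [S.gtw_of_mem (gradeComp_mem S.internal 0 a), S.gtw_of_mem (gradeComp_mem S.internal 1 a),
    S.gtw_of_mem (S.gGr_part (gradeComp_mem S.internal 0 a) k),
    S.gtw_of_mem (S.gGr_part (gradeComp_mem S.internal 1 a) k), map_smul, map_smul]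

theorem tGr_gDer (π : ZMod 2) (d : S.Aff →ₗ[ℂ] S.Aff) (k : ℤ) (x : S.GA) :
    S.tGr.pr k (S.gDer π d x) = S.gDer π d (S.tGr.pr k x) := by
  induction x using TensorProduct.induction_on with
  | zero => simp
  | tmul a u => rw [gDer_tmul, tGr_tmul, tGr_tmul, gDer_tmul, gGr_gtw]
  | add x y hx hy => rw [map_add, map_add, map_add, map_add, hx, hy]

theorem lDer_FEnd (π : ZMod 2) (d : S.Aff →ₗ[ℂ] S.Aff) : S.lDer π d ∈ S.𝓖.FEnd := fun k x hx =>
  Grading.map_mem_filtF (fun k x h => by rw [tGr_gDer, h, map_zero]) hx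

variable {S} in
theorem lDer_der {π : ZMod 2} {d : S.Aff →ₗ[ℂ] S.Aff} (hd : IsSDer π d) :
    S.lDer π d ∈ S.𝓖.der π := by
  refine ⟨fun x => Laurent.ext' fun n => gDer_par hd _, fun q x y hx => ?_⟩
  have hx' := S.𝓖_par_iff.1 hx
  change Laurent.map (S.gDer π d) (Laurent.conv S.gBr x y) = Laurent.conv S.gBr
    (Laurent.map (S.gDer π d) x) y + sgn (π * q) • Laurent.conv S.gBr x (Laurent.map (S.gDer π d) y)
  rw [Laurent.map_conv, Laurent.conv_map_left, Laurent.conv_map_right, ← Laurent.conv_smul_map,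
    ← Laurent.conv_add_map]
  exact Laurent.conv_congr _ _ _ _ _ _ fun k l => gDer_gBr hd (hx' k) _

/-! ### The invariant form -/

/-- The bilinear form of `𝔤((z⁻¹)) ⊗ 𝒫(\bar 𝔤)` as a bilinear map. -/
def lFormL : S.LGA →ₗ[ℂ] S.LGA →ₗ[ℂ] S.Aff :=
  (Laurent.conv S.gForm).compr₂ (LinearMap.proj 0 ∘ₗ (Laurent S.Aff).subtype)

theorem lFormL_apply (x y : S.LGA) : S.lFormL x y = (Laurent.conv S.gForm x y).1 0 := rfl

theorem lForm_eq (x y : S.LGA) : S.lForm x y = S.lFormL x y := by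
  rw [lFormL_apply, gForm, ← Laurent.map_conv]
  rfl

theorem lFormL_invariant (x y z : S.LGA) :
    S.lFormL (S.lBr x y) z = S.lFormL x (S.lBr y z) := by
  rw [lFormL_apply, lFormL_apply]
  refine congrArg (fun y : Laurent S.Aff => y.1 0) ?_
  obtain ⟨b, hb⟩ := y.2
  obtain ⟨c, hc⟩ := z.2
  let T : S.LGA →ₗ[ℂ] Laurent S.Aff := (Laurent.conv S.gForm).flip z ∘ₗ (Laurent.conv S.gBr).flip y
    - (Laurent.conv S.gForm).flip (Laurent.conv S.gBr y z)
  have hT : ∀ x, T x = Laurent.conv S.gForm (Laurent.conv S.gBr x y) z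
    - Laurent.conv S.gForm x (Laurent.conv S.gBr y z) := fun x => rfl
  change Laurent.conv S.gForm (Laurent.conv S.gBr x y) z
    = Laurent.conv S.gForm x (Laurent.conv S.gBr y z)
  rw [← sub_eq_zero, ← hT]
  refine Laurent.eq_zero_of_single T (b + c) (fun x m hx n hn => ?_) fun k => ?_
  · rw [hT, Laurent.sub_coeff, Laurent.conv_bound _ (Laurent.conv_bound _ hx hb) hc n (by linarith),
      Laurent.conv_bound _ hx (Laurent.conv_bound _ hb hc) n (by linarith), sub_zero]
  · rw [hT, sub_eq_zero, Laurent.conv_single_left', Laurent.conv_single_left',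
      Laurent.conv_shift_left, Laurent.map_conv, Laurent.conv_map_left]
    congr 1
    exact Laurent.conv_congr _ _ _ _ _ _ fun l m => S.gForm_invariant _ _ _

theorem lFormL_of_deg {k l : ℤ} (hkl : 0 < k + l) {x y : S.LGA} (hx : x ∈ S.𝓖.F k)
    (hy : y ∈ S.𝓖.F l) : S.lFormL x y = 0 := by
  rw [lFormL_apply]
  have h := Grading.mem_filtF.1 (S.isGr_gForm.conv_mem hx hy) 0 0 (by linarith)
  have h2 : ∀ a : S.Aff, (Grading.triv S.Aff).pr 0 a = a := fun a => rfl
  rwa [h2] at h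

variable {S} in
theorem lDer_lFormL {π : ZMod 2} {d : S.Aff →ₗ[ℂ] S.Aff} (hd : IsSDer π d) {p : ZMod 2} {x : S.LGA}
    (hx : S.𝓖.P x = sgn p • x) (y : S.LGA) : d (S.lFormL x y)
      = S.lFormL (S.lDer π d x) y + sgn (π * p) • S.lFormL x (S.lDer π d y) := by
  have hx' := S.𝓖_par_iff.1 hx
  have h : Laurent.map d (Laurent.conv S.gForm x y) = Laurent.conv S.gForm
      (Laurent.map (S.gDer π d) x) y
      + sgn (π * p) • Laurent.conv S.gForm x (Laurent.map (S.gDer π d) y) := by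
    rw [Laurent.map_conv, Laurent.conv_map_left, Laurent.conv_map_right, ← Laurent.conv_smul_map,
      ← Laurent.conv_add_map]
    exact Laurent.conv_congr _ _ _ _ _ _ fun k l => gDer_gForm hd (hx' k) _
  exact congrArg (fun y => y.1 0) h

end DSData

-- Shortcut instances, as instance search is slow to unfold `Op`.
instance {M : Type*} [AddCommGroup M] [Module ℂ M] (𝓖 : FLie M) : AddCommGroup 𝓖.Op :=
  Prod.instAddCommGroup

instance {M : Type*} [AddCommGroup M] [Module ℂ M] (𝓖 : FLie M) : Module ℂ 𝓖.Op :=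
  Prod.instModule

theorem FLie.snd_sub {M : Type*} [AddCommGroup M] [Module ℂ M] {𝓖 : FLie M} (X Y : 𝓖.Op) :
    (X - Y).2 = X.2 - Y.2 := rfl

theorem FLie.snd_sum {M : Type*} [AddCommGroup M] [Module ℂ M] {𝓖 : FLie M} {κ : Type*}
    (s : Finset κ) (X : κ → 𝓖.Op) : (∑ k ∈ s, X k).2 = ∑ k ∈ s, (X k).2 := Prod.snd_sum

theorem FLie.adOp_pow_succ {M : Type*} [AddCommGroup M] [Module ℂ M] (𝓖 : FLie M) (T : M)
    (X : 𝓖.Op) (m : ℕ) : (𝓖.adOp T ^ (m + 1)) X = 𝓖.adOp T ((𝓖.adOp T ^ m) X) := by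
  rw [pow_succ', Module.End.mul_apply]

namespace DSData

variable {𝔤 ι : Type*} [AddCommGroup 𝔤] [Module ℂ 𝔤] [Fintype ι] [DecidableEq ι]
  (S : DSData 𝔤 ι)

/-! ### Operators `c D + e D² + x` -/

theorem isSDer_D : IsSDer 1 S.D := SuperDS.isSDer_D

theorem lD_FEnd : S.lD ∈ S.𝓖.FEnd := by
  rw [lD_eq]; exact S.lDer_FEnd _ _

theorem lD_der : S.lD ∈ S.𝓖.der 1 := by
  rw [lD_eq]; exact lDer_der S.isSDer_D

/-- The operator `c D + e D² + x` as an element of the semidirect product of the superderivations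
with `𝔤((z⁻¹)) ⊗ 𝒫(\bar 𝔤)`. -/
def toOp (A : S.Lax) : S.𝓖.Op :=
  (⟨A.1 • S.lD + A.2.1 • (S.lD ∘ₗ S.lD), S.𝓖.FEnd.add_mem (S.𝓖.FEnd.smul_mem _ S.lD_FEnd)
    (S.𝓖.FEnd.smul_mem _ fun k x hx => S.lD_FEnd k _ (S.lD_FEnd k x hx))⟩, A.2.2)

theorem toOp_laxBr {T : S.LGA} (hT : S.𝓖.P T = T) (A : S.Lax) :
    S.toOp (S.laxBr (0, 0, T) A) = S.𝓖.adOp T (S.toOp A) := by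
  have hT' : S.lParity T = T := hT
  refine FLie.op_ext (fun x => ?_) ?_
  · rw [FLie.adOp_fst]
    simp [toOp, laxBr]
  · rw [FLie.adOp_snd]
    change S.lBr T A.2.2 + (0 : ℂ) • S.lD A.2.2 - A.1 • S.lD (S.lParity T)
      + (0 : ℂ) • S.lD (S.lD A.2.2) - A.2.1 • S.lD (S.lD T) = S.lBr T A.2.2
        - (A.1 • S.lD T + A.2.1 • S.lD (S.lD T))
    rw [hT']
    module

theorem toOp_iterate {T : S.LGA} (hT : S.𝓖.P T = T) (A : S.Lax) (m : ℕ) :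
    S.toOp ((S.laxBr (0, 0, T))^[m] A) = (S.𝓖.adOp T ^ m) (S.toOp A) := by
  induction m with
  | zero => rfl
  | succ m ih => rw [Function.iterate_succ_apply', toOp_laxBr S hT, ih, FLie.adOp_pow_succ]

/-- The coefficientwise finite exponential series of the statement is the convergent exponential
`e^{ad T}` of the filtered Lie superalgebra. -/
theorem isExpAd_iff {T : S.LGA} (hT : S.𝓖.Nil T) (A B : S.Lax) :
    S.IsExpAd T A B ↔ B.1 = A.1 ∧ B.2.1 = A.2.1 ∧ (FLie.E hT (S.toOp A)).2 = B.2.2 := by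
  have hit : ∀ m, ((S.laxBr (0, 0, T))^[m] A).2.2 = ((S.𝓖.adOp T ^ m) (S.toOp A)).2 := fun m =>
    congrArg Prod.snd (S.toOp_iterate hT.1 A m)
  obtain ⟨k₀, hk₀⟩ := S.𝓖.opFilt.exh (S.toOp A)
  have hz : ∀ n : ℤ, ∃ M : ℕ, ∀ m, M ≤ m → ((S.laxBr (0, 0, T))^[m] A).2.2.1 n = 0 := fun n => by
    refine ⟨(S.d + 1 - k₀ - (S.i + S.j) * n).toNat, fun m hm => ?_⟩
    have h1 := (hT.raises.pow hk₀ m).1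
    rw [hit]
    refine Grading.coeff_eq_zero_of_mem h1 (n := n) ?_
    have : ((S.d + 1 - k₀ - (S.i + S.j) * n).toNat : ℤ) ≤ m := by exact_mod_cast hm
    have h2 := Int.self_le_toNat (S.d + 1 - k₀ - (S.i + S.j) * n)
    change S.d < _
    linarith
  have hE : ∀ n : ℤ, (FLie.E hT (S.toOp A)).2.1 n
      = ∑ᶠ m : ℕ, ((m.factorial : ℂ)⁻¹) • ((S.laxBr (0, 0, T))^[m] A).2.2.1 n := fun n => by
    obtain ⟨M, hM⟩ := hz n
    obtain ⟨M', hM'⟩ := Filt.hasExp_exp hT.raises (S.toOp A) (S.d + 1 - (S.i + S.j) * n)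
    have h1 := (hM' (max M M') (le_max_right _ _)).1
    have h2 := Grading.coeff_eq_zero_of_mem h1 (n := n) (by change S.d < _; linarith)
    rw [FLie.snd_sub, Laurent.sub_coeff, sub_eq_zero] at h2
    rw [FLie.E, h2, FLie.snd_sum, Laurent.sum_coeff, finsum_eq_sum_of_support_subset
      (s := Finset.range (max M M'))]
    · refine Finset.sum_congr rfl fun m _ => ?_
      rw [hit]
      rfl
    · intro m hm
      rw [Function.mem_support] at hm
      by_contra h
      refine hm ?_
      rw [hM m, smul_zero]
      have h3 : ¬ m < max M M' := by simpa using h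
      exact le_trans (le_max_left _ _) (not_lt.1 h3)
  constructor
  · rintro ⟨h1, h2, h3⟩
    exact ⟨h1, h2, Laurent.ext' fun n => (hE n).trans (h3 n).2.symm⟩
  · rintro ⟨h1, h2, h3⟩
    refine ⟨h1, h2, fun n => ⟨?_, by rw [← h3]; exact hE n⟩⟩
    obtain ⟨M, hM⟩ := hz n
    refine (Finset.range M).finite_toSet.subset fun m hm => ?_
    rw [Function.mem_support] at hm
    by_contra h
    have h4 : ¬ m < M := by simpa using h
    exact hm (hM m (not_lt.1 h4))

theorem toOp_isOp {x : S.LGA} (hx : S.𝓖.P x = -x) : S.toOp (1, 0, x) ∈ S.𝓖.isOp 1 := by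
  refine ⟨?_, by rw [sgn_one, neg_smul, one_smul]; exact hx⟩
  have h : (S.toOp (1, 0, x)).1.1 = S.lD := by
    change (1 : ℂ) • S.lD + (0 : ℂ) • (S.lD ∘ₗ S.lD) = _
    rw [one_smul, zero_smul, add_zero]
  rw [h]
  exact S.lD_der

theorem toOp_fst (x : S.LGA) : (S.toOp (1, 0, x)).1.1 = S.lD := by
  change (1 : ℂ) • S.lD + (0 : ℂ) • (S.lD ∘ₗ S.lD) = _
  rw [one_smul, zero_smul, add_zero]

theorem toOp_half_square {x : S.LGA} (hx : S.𝓖.P x = -x) :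
    S.toOp ((1 / 2 : ℂ) • S.laxBr (1, 0, x) (1, 0, x))
      = (1 / 2 : ℂ) • S.𝓖.obr 1 1 (S.toOp (1, 0, x)) (S.toOp (1, 0, x)) := by
  have hx' : S.lParity x = -x := hx
  refine FLie.op_ext (fun y => ?_) ?_
  · change ((1 / 2 : ℂ) * 0) • S.lD y + ((1 / 2 : ℂ) * (2 * 1 * 1)) • S.lD (S.lD y)
      = (1 / 2 : ℂ) • (S.𝓖.obr 1 1 (S.toOp (1, 0, x)) (S.toOp (1, 0, x))).1.1 y
    rw [FLie.obr_fst, toOp_fst]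
    simp only [LinearMap.sub_apply, LinearMap.smul_apply, LinearMap.comp_apply, mul_one, sgn_one]
    module
  · change (1 / 2 : ℂ) • (S.lBr x x + (1 : ℂ) • S.lD x - (1 : ℂ) • S.lD (S.lParity x)
      + (0 : ℂ) • S.lD (S.lD x) - (0 : ℂ) • S.lD (S.lD x))
      = (1 / 2 : ℂ) • (S.𝓖.obr 1 1 (S.toOp (1, 0, x)) (S.toOp (1, 0, x))).2
    rw [FLie.obr_snd, toOp_fst, hx', mul_one, sgn_one]
    change _ = (1 / 2 : ℂ) • (S.lD x - (-1 : ℂ) • S.lD x + S.lBr x x)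
    rw [map_neg]
    module

/-! ### Coordinates -/

/-- The coordinates `x_t` of `x = ∑ b_t ⊗ x_t` with respect to a basis of `𝔤`. -/
def coord (b : Module.Basis ι ℂ 𝔤) (t : ι) : S.GA →ₗ[ℂ] S.Aff :=
  (TensorProduct.lid ℂ S.Aff).toLinearMap ∘ₗ TensorProduct.map (b.coord t) LinearMap.id

theorem coord_tmul (b : Module.Basis ι ℂ 𝔤) (t : ι) (a : 𝔤) (u : S.Aff) :
    S.coord b t (a ⊗ₜ u) = b.coord t a • u := by
  simp [coord]

theorem sum_coord (b : Module.Basis ι ℂ 𝔤) (x : S.GA) : ∑ t, b t ⊗ₜ S.coord b t x = x := by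
  induction x using TensorProduct.induction_on with
  | zero => simp
  | tmul a u =>
    simp only [coord_tmul]
    conv_rhs => rw [← b.sum_repr a, TensorProduct.sum_tmul]
    exact Finset.sum_congr rfl fun t _ => by rw [TensorProduct.smul_tmul, b.coord_apply]
  | add x y hx hy =>
    conv_rhs => rw [← hx, ← hy, ← Finset.sum_add_distrib]
    exact Finset.sum_congr rfl fun t _ => by rw [map_add, TensorProduct.tmul_add]

theorem coord_basis (b : Module.Basis ι ℂ 𝔤) (t r : ι) (u : S.Aff) :
    S.coord b t (b r ⊗ₜ u) = if r = t then u else 0 := by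
  rw [coord_tmul, b.coord_apply, b.repr_self, Finsupp.single_apply]
  split_ifs <;> simp

/-- Contraction of the second factor with a linear functional. -/
def con (ℓ : S.Aff →ₗ[ℂ] ℂ) : S.GA →ₗ[ℂ] 𝔤 :=
  (TensorProduct.rid ℂ 𝔤).toLinearMap ∘ₗ TensorProduct.map LinearMap.id ℓ

theorem con_tmul (ℓ : S.Aff →ₗ[ℂ] ℂ) (a : 𝔤) (u : S.Aff) : S.con ℓ (a ⊗ₜ u) = ℓ u • a := by
  simp [con]

theorem coord_con (b : Module.Basis ι ℂ 𝔤) (t : ι) (ℓ : S.Aff →ₗ[ℂ] ℂ) (x : S.GA) :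
    b.coord t (S.con ℓ x) = ℓ (S.coord b t x) := by
  induction x using TensorProduct.induction_on with
  | zero => simp
  | tmul a u => rw [con_tmul, coord_tmul, map_smul, map_smul, smul_eq_mul, smul_eq_mul, mul_comm]
  | add x y hx hy => simp only [map_add, hx, hy]

theorem eq_zero_of_con {x : S.GA} (h : ∀ ℓ, S.con ℓ x = 0) : x = 0 := by
  rw [← S.sum_coord S.qUp x]
  refine Finset.sum_eq_zero fun t _ => ?_
  rw [(Module.forall_dual_apply_eq_zero_iff ℂ (S.coord S.qUp t x)).1 fun ℓ => ?_,
    TensorProduct.tmul_zero]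
  rw [← coord_con, h, map_zero]

theorem con_gBr (ℓ : S.Aff →ₗ[ℂ] ℂ) (a : 𝔤) (y : S.GA) :
    S.con ℓ (S.gBr (a ⊗ₜ 1) y) = S.br a (S.con ℓ y) := by
  rw [tensorExt_one_left']
  induction y using TensorProduct.induction_on with
  | zero => simp
  | tmul b u => rw [TensorProduct.map_tmul, con_tmul, con_tmul, map_smul, LinearMap.id_apply]
  | add x y hx hy => simp only [map_add, hx, hy]

theorem con_lBr (ℓ : S.Aff →ₗ[ℂ] ℂ) (x : Laurent 𝔤) (y : S.LGA) :
    Laurent.map (S.con ℓ) (S.lBr (S.tensorOne x) y)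
      = Laurent.conv S.br x (Laurent.map (S.con ℓ) y) := by
  rw [lBr, tensorOne, Laurent.map_conv, Laurent.conv_map_left, Laurent.conv_map_right]
  exact Laurent.conv_congr _ _ _ _ _ _ fun k l => S.con_gBr ℓ _ _

theorem lga_eq_zero_of_con {x : S.LGA} (h : ∀ ℓ, Laurent.map (S.con ℓ) x = 0) : x = 0 :=
  Laurent.ext' fun n => S.eq_zero_of_con fun ℓ => congrArg (fun y => y.1 n) (h ℓ)

theorem con_gc (ℓ : S.Aff →ₗ[ℂ] ℂ) (e k : ℤ) (x : S.LGA) :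
    Laurent.map (S.con ℓ) (S.tGr.gc e k x) = S.gGr.gc e k (Laurent.map (S.con ℓ) x) := by
  have h : ∀ (k : ℤ) (x : S.GA), S.con ℓ (S.tGr.pr k x) = S.gGr.pr k (S.con ℓ x) := fun k x => by
    induction x using TensorProduct.induction_on with
    | zero => simp
    | tmul a u => rw [tGr_tmul, con_tmul, con_tmul, map_smul]
    | add x y hx hy => simp only [map_add, hx, hy]
  exact Laurent.ext' fun n => h _ _

/-! ### The element `Λ² ⊗ 1` -/

theorem tensorOne_conv (x y : Laurent 𝔤) :
    S.tensorOne (Laurent.conv S.br x y) = S.lBr (S.tensorOne x) (S.tensorOne y) := by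
  rw [lBr, tensorOne, Laurent.map_conv, Laurent.conv_map_left, Laurent.conv_map_right]
  refine Laurent.conv_congr _ _ _ _ _ _ fun k l => ?_
  exact (S.tensorExt_one_left S.br _ _ _).symm

theorem lDer_tensorOne {π : ZMod 2} {d : S.Aff →ₗ[ℂ] S.Aff} (hd : IsSDer π d) (x : Laurent 𝔤) :
    S.lDer π d (S.tensorOne x) = 0 := Laurent.ext' fun n => by
  change S.gDer π d (x.1 n ⊗ₜ 1) = 0
  rw [gDer_tmul, hd.one, TensorProduct.tmul_zero]

theorem lD_tensorOne (x : Laurent 𝔤) : S.lD (S.tensorOne x) = 0 := by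
  rw [lD_eq]; exact S.lDer_tensorOne S.isSDer_D x

theorem tensorOne_par {p : ZMod 2} {x : Laurent 𝔤} (hx : S.HasParity p x) :
    S.𝓖.P (S.tensorOne x) = sgn p • S.tensorOne x := by
  refine S.𝓖_par_iff.2 fun n => ?_
  have h := S.tParity_pure (hx n) (isPar_one (ε := fun x : ι × ℕ => S.barPar x.1 + (x.2 : ZMod 2)))
  rwa [add_zero] at h

theorem tensorOne_gc (e k : ℤ) (x : Laurent 𝔤) :
    S.tGr.gc e k (S.tensorOne x) = S.tensorOne (S.gGr.gc e k x) := rfl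

theorem Λ_par : S.HasParity 1 S.Λ := fun n => by
  have h : S.Λ.1 n = (if n = 0 then S.f else 0) + if n = 1 then S.s else 0 := by
    rw [Λ, Laurent.add_coeff, Laurent.single_coeff, Laurent.single_coeff]
  rw [h]
  refine (S.part 1).add_mem ?_ ?_
  · split_ifs
    exacts [S.f_odd, zero_mem _]
  · split_ifs
    exacts [S.s_odd, zero_mem _]

theorem Λ_deg : S.gGr.gc (S.i + S.j) (-S.i) S.Λ = S.Λ := Laurent.ext' fun n => by
  rw [Grading.gc_coeff, Λ, Laurent.add_coeff, Laurent.single_coeff, Laurent.single_coeff, map_add]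
  congr 1
  · split_ifs with h
    · rw [h, S.gGr_of_mem S.f_deg, if_pos (by ring)]
    · rw [map_zero]
  · split_ifs with h
    · rw [h, S.gGr_of_mem S.s_deg, if_pos (by ring)]
    · rw [map_zero]

theorem Λsq_deg : S.gGr.gc (S.i + S.j) (-(2 * S.i)) S.Λsq = S.Λsq := by
  have h := S.isGr_br.gc_conv S.Λ_deg (-S.i) S.Λ
  rw [S.Λ_deg] at h
  rw [Λsq, map_smul, show -(2 * S.i) = -S.i + -S.i by ring, h]

/-- `Λ² ⊗ 1`. -/
def Λ₂ : S.LGA := S.tensorOne S.Λsq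

theorem Λ₂_eq : S.Λ₂ = (1 / 2 : ℂ) • S.lBr (S.tensorOne S.Λ) (S.tensorOne S.Λ) := by
  rw [Λ₂, Λsq, map_smul, tensorOne_conv]

theorem Λ₂_par : S.𝓖.P S.Λ₂ = S.Λ₂ := by
  have h := FLie.br_par (S.tensorOne_par S.Λ_par) (S.tensorOne_par S.Λ_par)
  rw [show (1 : ZMod 2) + 1 = 0 by decide, sgn_zero, one_smul] at h
  rw [Λ₂_eq, map_smul]
  exact congrArg _ h

theorem Λ₂_deg : S.tGr.gc (S.i + S.j) (-(2 * S.i)) S.Λ₂ = S.Λ₂ := by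
  rw [Λ₂, tensorOne_gc, Λsq_deg]

theorem mem_F_of_gc {k : ℤ} {x : S.LGA} (h : S.tGr.gc (S.i + S.j) k x = x) : x ∈ S.𝓖.F k := by
  rw [← h]; exact Grading.gc_mem_filtF le_rfl x

theorem Λ₂_mem : S.Λ₂ ∈ S.𝓖.F (-(2 * S.i)) := S.mem_F_of_gc S.Λ₂_deg

theorem tensorOne_Λ_mem : S.tensorOne S.Λ ∈ S.𝓖.F (-S.i) :=
  S.mem_F_of_gc (by rw [tensorOne_gc, Λ_deg])

theorem gc_lBr_Λ₂ (k : ℤ) (x : S.LGA) : S.tGr.gc (S.i + S.j) (-(2 * S.i) + k) (S.lBr S.Λ₂ x)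
    = S.lBr S.Λ₂ (S.tGr.gc (S.i + S.j) k x) := S.isGr_gBr.gc_conv S.Λ₂_deg k x

theorem isCompl_Λ : IsCompl S.kerΛ S.imΛ := S.semisimple

theorem lBr_Λ₂_eq_zero {x : S.LGA} (h : S.lBr S.Λ₂ (S.lBr S.Λ₂ x) = 0) : S.lBr S.Λ₂ x = 0 := by
  refine S.lga_eq_zero_of_con fun ℓ => ?_
  have h1 := congrArg (Laurent.map (S.con ℓ)) h
  rw [Λ₂, con_lBr, con_lBr, map_zero] at h1
  rw [Λ₂, con_lBr]
  exact Submodule.disjoint_def.1 S.isCompl_Λ.disjoint _ h1 ⟨_, rfl⟩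

/-- Modulo higher order, an element of order `k` whose bracket with `Λ²` lies in `ker ad Λ²` lies in
`ker ad Λ²`. -/
theorem star (k : ℤ) (x : S.LGA) (hx : x ∈ LinearMap.ker (S.𝓖.br S.Λ₂) ⊔ S.𝓖.F k)
    (h : S.𝓖.br S.Λ₂ x ∈ LinearMap.ker (S.𝓖.br S.Λ₂) ⊔ S.𝓖.F (k + -(2 * S.i) + 1)) :
    x ∈ LinearMap.ker (S.𝓖.br S.Λ₂) ⊔ S.𝓖.F (k + 1) := by
  obtain ⟨κ, hκ, y, hy, rfl⟩ := Submodule.mem_sup.1 hx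
  obtain ⟨κ', hκ', y', hy', hxy⟩ := Submodule.mem_sup.1 h
  rw [map_add, LinearMap.mem_ker.1 hκ, zero_add] at hxy
  have h1 : S.lBr S.Λ₂ κ' = 0 := hκ'
  have h2 : S.tGr.gc (S.i + S.j) (-(2 * S.i) + k) y' = 0 := hy' _ (by linarith)
  have h3 : S.tGr.gc (S.i + S.j) (-(2 * S.i) + k) κ' = S.lBr S.Λ₂ (S.tGr.gc (S.i + S.j) k y) := by
    rw [← gc_lBr_Λ₂]
    change _ = S.tGr.gc (S.i + S.j) (-(2 * S.i) + k) (S.𝓖.br S.Λ₂ y)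
    rw [← hxy, map_add, h2, add_zero]
  have h4 : S.lBr S.Λ₂ (S.tGr.gc (S.i + S.j) k y) = 0 := by
    refine S.lBr_Λ₂_eq_zero ?_
    rw [← h3, ← gc_lBr_Λ₂, h1, map_zero]
  refine Submodule.mem_sup.2 ⟨κ + S.tGr.gc (S.i + S.j) k y, Submodule.add_mem _ hκ h4,
    y - S.tGr.gc (S.i + S.j) k y, Grading.sub_gc_mem hy, by abel⟩

end DSData

/-! ### Parity projections -/

namespace FLie

variable {M : Type*} [AddCommGroup M] [Module ℂ M] (𝓖 : FLie M)

/-- The projection onto the elements of parity `p`. -/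
def parProj (p : ZMod 2) : M →ₗ[ℂ] M := (1 / 2 : ℂ) • (LinearMap.id + sgn p • 𝓖.P)

theorem parProj_apply (p : ZMod 2) (x : M) :
    𝓖.parProj p x = (1 / 2 : ℂ) • (x + sgn p • 𝓖.P x) := rfl

theorem P_parProj (p : ZMod 2) (x : M) : 𝓖.P (𝓖.parProj p x) = sgn p • 𝓖.parProj p x := by
  have h := sgn_mul_self p
  rw [parProj_apply, map_smul, map_add, map_smul, 𝓖.P_P, smul_comm (sgn p), smul_add (sgn p),
    smul_smul (sgn p), h, one_smul, add_comm]

theorem parProj_of_par {p : ZMod 2} {x : M} (hx : 𝓖.P x = sgn p • x) : 𝓖.parProj p x = x := by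
  rw [parProj_apply, hx, smul_smul, sgn_mul_self]
  module

theorem br_parProj {p q : ZMod 2} {Λ : M} (hΛ : 𝓖.P Λ = sgn q • Λ) (x : M) :
    𝓖.br Λ (𝓖.parProj p x) = 𝓖.parProj (p + q) (𝓖.br Λ x) := by
  rw [parProj_apply, parProj_apply, 𝓖.P_br, hΛ, map_smul, map_add, map_smul, map_smul,
    LinearMap.smul_apply, smul_smul, sgn_add, mul_assoc, sgn_mul_self, mul_one]

theorem br_even_comm {q : ZMod 2} {Λ t : M} (hΛ : 𝓖.P Λ = sgn q • Λ) (ht : 𝓖.P t = t) :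
    𝓖.br t Λ = -𝓖.br Λ t := by
  rw [𝓖.skew 0 q t Λ (by rw [ht, sgn_zero, one_smul]) hΛ, zero_mul, sgn_zero, one_smul]

end FLie

/-! ### Differential subalgebras -/

section DiffAlg

variable {ι : Type*} {ε : ι → ZMod 2} {G : Set (DiffPoly ε)}

theorem diffAlg_par (hG : ∀ g ∈ G, ∃ p, IsPar p g) {a : DiffPoly ε} (ha : a ∈ diffAlg G) :
    parityAut _ a ∈ diffAlg G := by
  suffices h : diffAlg G ≤ (diffAlg G).comap (parityAut _) from h ha
  refine Algebra.adjoin_le ?_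
  rintro _ ⟨g, hg, n, rfl⟩
  obtain ⟨p, hp⟩ := hG g hg
  have h : ∃ q, IsPar q ((D ε ^ n) g) := by
    induction n with
    | zero => exact ⟨p, hp⟩
    | succ n ih =>
      obtain ⟨q, hq⟩ := ih
      exact ⟨1 + q, by rw [pow_succ', Module.End.mul_apply]; exact isPar_D hq⟩
  obtain ⟨q, hq⟩ := h
  change parityAut _ ((D ε ^ n) g) ∈ diffAlg G
  rw [show parityAut _ ((D ε ^ n) g) = sgn q • (D ε ^ n) g from hq]
  exact Subalgebra.smul_mem _ (D_pow_mem_diffAlg hg n) _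

/-- A superderivation which maps the generators of a differential subalgebra into it preserves
it. -/
theorem diffAlg_der (hG : ∀ g ∈ G, ∃ p, IsPar p g) {π : ZMod 2} {d : DiffPoly ε →ₗ[ℂ] DiffPoly ε}
    (hd : IsSDer π d) (h : ∀ g ∈ G, ∀ n, d ((D ε ^ n) g) ∈ diffAlg G) {a : DiffPoly ε}
    (ha : a ∈ diffAlg G) : d a ∈ diffAlg G := by
  induction ha using Algebra.adjoin_induction with
  | mem x hx =>
    obtain ⟨g, hg, n, rfl⟩ := hx
    exact h g hg n
  | algebraMap c => rw [hd.algebraMap]; exact (diffAlg G).zero_mem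
  | add x y _ _ hx hy => rw [map_add]; exact (diffAlg G).add_mem hx hy
  | mul x y hxm hym hx hy =>
    rw [hd.leib]
    refine (diffAlg G).add_mem ((diffAlg G).mul_mem hx hym) ((diffAlg G).mul_mem ?_ hy)
    have h1 : tw (ε := fun x : ι × ℕ => ε x.1 + (x.2 : ZMod 2)) π x = x
        ∨ tw (ε := fun x : ι × ℕ => ε x.1 + (x.2 : ZMod 2)) π x = parityAut _ x := by
      rcases zmod2_cases π with rfl | rfl
      · left; simp [tw]
      · right; simp [tw]
    rcases h1 with h1 | h1
    · rw [h1]; exact hxm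
    · rw [h1]; exact diffAlg_par hG hxm

theorem diffAlg_D (hG : ∀ g ∈ G, ∃ p, IsPar p g) {a : DiffPoly ε} (ha : a ∈ diffAlg G) :
    D ε a ∈ diffAlg G := by
  refine diffAlg_der hG isSDer_D (fun g hg n => ?_) ha
  rw [← Module.End.mul_apply, ← pow_succ']
  exact D_pow_mem_diffAlg hg (n + 1)

end DiffAlg

namespace DSData

variable {𝔤 ι : Type*} [AddCommGroup 𝔤] [Module ℂ 𝔤] [Fintype ι] [DecidableEq ι]
  (S : DSData 𝔤 ι)

/-! ### Subspaces `U ⊗ R` -/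

theorem tmul_mem_tens {U : Submodule ℂ 𝔤} {R : Submodule ℂ S.Aff} {a : 𝔤} {u : S.Aff} (ha : a ∈ U)
    (hu : u ∈ R) : a ⊗ₜ u ∈ S.tens U R := Submodule.apply_mem_map₂ _ ha hu

theorem tens_le {U : Submodule ℂ 𝔤} {R : Submodule ℂ S.Aff} {Q : Submodule ℂ S.GA}
    (h : ∀ a ∈ U, ∀ u ∈ R, a ⊗ₜ u ∈ Q) : S.tens U R ≤ Q := Submodule.map₂_le.2 h

theorem map_mem_tens {U U' : Submodule ℂ 𝔤} {R R' : Submodule ℂ S.Aff} {g : 𝔤 →ₗ[ℂ] 𝔤}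
    {h : S.Aff →ₗ[ℂ] S.Aff} (hg : ∀ a ∈ U, g a ∈ U') (hh : ∀ u ∈ R, h u ∈ R') {x : S.GA}
    (hx : x ∈ S.tens U R) : TensorProduct.map g h x ∈ S.tens U' R' :=
  S.tens_le (Q := (S.tens U' R').comap (TensorProduct.map g h))
    (fun a ha u hu => S.tmul_mem_tens (hg a ha) (hh u hu)) hx

theorem tens_pr {U : Submodule ℂ 𝔤} {R : Submodule ℂ S.Aff} (hU : ∀ a ∈ U, ∀ k, S.gGr.pr k a ∈ U)
    (k : ℤ) {x : S.GA} (hx : x ∈ S.tens U R) : S.tGr.pr k x ∈ S.tens U R :=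
  S.map_mem_tens (fun a ha => hU a ha k) (fun _ hu => hu) hx

theorem tens_par {U : Submodule ℂ 𝔤} {R : Submodule ℂ S.Aff}
    (hU : ∀ a ∈ U, ∀ p, gradeComp S.internal p a ∈ U) (hR : ∀ u ∈ R, parityAut _ u ∈ R)
    {x : S.GA} (hx : x ∈ S.tens U R) : S.tParity x ∈ S.tens U R :=
  S.map_mem_tens (fun a ha => U.sub_mem (hU a ha 0) (hU a ha 1)) (fun u hu => hR u hu) hx

theorem gtw_mem {U : Submodule ℂ 𝔤} (hU : ∀ a ∈ U, ∀ p, gradeComp S.internal p a ∈ U)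
    (π : ZMod 2) {a : 𝔤} (ha : a ∈ U) : S.gtw π a ∈ U := by
  rcases zmod2_cases π with rfl | rfl
  · simpa [gtw] using ha
  · rw [gtw_one]
    exact U.sub_mem (hU a ha 0) (hU a ha 1)

theorem tens_gDer {U : Submodule ℂ 𝔤} {R R' : Submodule ℂ S.Aff}
    (hU : ∀ a ∈ U, ∀ p, gradeComp S.internal p a ∈ U) (π : ZMod 2) {d : S.Aff →ₗ[ℂ] S.Aff}
    (hR : ∀ u ∈ R, d u ∈ R') {x : S.GA} (hx : x ∈ S.tens U R) : S.gDer π d x ∈ S.tens U R' :=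
  S.map_mem_tens (fun _ ha => S.gtw_mem hU π ha) hR hx

theorem gBr_mem_tens {U U' U'' : Submodule ℂ 𝔤} {R : Subalgebra ℂ S.Aff}
    (hU' : ∀ a ∈ U', ∀ p, gradeComp S.internal p a ∈ U') (hR : ∀ u ∈ R, parityAut _ u ∈ R)
    (h : ∀ a ∈ U, ∀ b ∈ U', S.br a b ∈ U'') {x y : S.GA}
    (hx : x ∈ S.tens U (Subalgebra.toSubmodule R)) (hy : y ∈ S.tens U' (Subalgebra.toSubmodule R)) :
    S.gBr x y ∈ S.tens U'' (Subalgebra.toSubmodule R) := by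
  refine S.tens_le (Q := (S.tens U'' (Subalgebra.toSubmodule R)).comap (S.gBr.flip y))
    (fun a ha u hu => ?_) hx
  refine S.tens_le (Q := (S.tens U'' (Subalgebra.toSubmodule R)).comap (S.gBr (a ⊗ₜ u)))
    (fun b hb v hv => ?_) hy
  rw [Submodule.mem_comap, gBr, tensorExt_tmul]
  exact Submodule.add_mem _ (S.tmul_mem_tens (h a ha _ (hU' b hb 0)) (R.mul_mem hu hv))
    (S.tmul_mem_tens (h a ha _ (hU' b hb 1)) (R.mul_mem (hR u hu) hv))

theorem coord_mem {R : Submodule ℂ S.Aff} (b : Module.Basis ι ℂ 𝔤) (t : ι) {U : Submodule ℂ 𝔤}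
    {x : S.GA} (hx : x ∈ S.tens U R) : S.coord b t x ∈ R :=
  S.tens_le (Q := R.comap (S.coord b t)) (fun a _ u hu => by
    rw [Submodule.mem_comap, coord_tmul]
    exact R.smul_mem _ hu) hx

theorem coord_eq_zero {R : Submodule ℂ S.Aff} (b : Module.Basis ι ℂ 𝔤) {A : Set ι} {t : ι}
    (ht : t ∉ A) {x : S.GA} (hx : x ∈ S.tens (Submodule.span ℂ (b '' A)) R) :
    S.coord b t x = 0 := by
  refine S.tens_le (Q := LinearMap.ker (S.coord b t)) (fun a ha u hu => ?_) hx
  rw [LinearMap.mem_ker, coord_tmul]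
  have h : b.coord t a = 0 := by
    have h1 : Submodule.span ℂ (b '' A) ≤ LinearMap.ker (b.coord t) := by
      rw [Submodule.span_le]
      rintro _ ⟨r, hr, rfl⟩
      have hrt : r ≠ t := fun e => ht (e ▸ hr)
      simp [b.repr_self, hrt]
    exact h1 ha
  rw [h, zero_smul]

/-! ### The subspaces `𝔟` and `V` -/

/-- `𝔟 = 𝔪^⊥`. -/
def 𝔟 : Submodule ℂ 𝔤 := Submodule.span ℂ (S.qUp '' S.I)

/-- The complement `V` of `[f, 𝔫]` in `𝔟`. -/
def V : Submodule ℂ 𝔤 := Submodule.span ℂ (S.qUp '' ((S.I \ S.J : Finset ι) : Set ι))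

theorem mem_𝔟 {x : 𝔤} : x ∈ S.𝔟 ↔ ∀ y ∈ S.𝔪, S.form x y = 0 := S.span_I x

theorem V_le_𝔟 : S.V ≤ S.𝔟 :=
  Submodule.span_mono (Set.image_mono (by exact_mod_cast Finset.sdiff_subset))

/-- Spans of homogeneous elements are homogeneous. -/
theorem span_qUp_part (A : Set ι) {a : 𝔤} (ha : a ∈ Submodule.span ℂ (S.qUp '' A)) (p : ZMod 2) :
    gradeComp S.internal p a ∈ Submodule.span ℂ (S.qUp '' A) := by
  suffices h : Submodule.span ℂ (S.qUp '' A)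
      ≤ (Submodule.span ℂ (S.qUp '' A)).comap (gradeComp S.internal p) from h ha
  rw [Submodule.span_le]
  rintro _ ⟨t, ht, rfl⟩
  rw [SetLike.mem_coe, Submodule.mem_comap, gradeComp_of_mem _ (S.qUp_part t)]
  split_ifs
  exacts [Submodule.subset_span ⟨t, ht, rfl⟩, zero_mem _]

theorem span_qUp_deg (A : Set ι) {a : 𝔤} (ha : a ∈ Submodule.span ℂ (S.qUp '' A)) (k : ℤ) :
    S.gGr.pr k a ∈ Submodule.span ℂ (S.qUp '' A) := by
  suffices h : Submodule.span ℂ (S.qUp '' A)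
      ≤ (Submodule.span ℂ (S.qUp '' A)).comap (S.gGr.pr k) from h ha
  rw [Submodule.span_le]
  rintro _ ⟨t, ht, rfl⟩
  obtain ⟨l, hl⟩ := S.qUp_deg t
  rw [SetLike.mem_coe, Submodule.mem_comap, S.gGr_of_mem hl]
  split_ifs
  exacts [Submodule.subset_span ⟨t, ht, rfl⟩, zero_mem _]

theorem form_pr (k : ℤ) (a b : 𝔤) : S.form (S.gGr.pr k a) b = S.form a (S.gGr.pr (-k) b) := by
  have h1 : S.form (S.gGr.pr k a) b = S.form (S.gGr.pr k a) (S.gGr.pr (-k) b) := by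
    rw [← sub_eq_zero, ← map_sub, ← S.gGr.sum_pr (b - S.gGr.pr (-k) b), map_sum]
    refine Finset.sum_eq_zero fun l _ => ?_
    by_cases hl : l = -k
    · rw [map_sub, S.gGr.pr_pr, if_pos hl, hl, sub_self, map_zero]
    · exact S.form_deg k l (fun h => hl (by linarith)) _ (S.gGr_pr_mem k a) _ (S.gGr_pr_mem l _)
  rw [h1, ← sub_eq_zero, ← LinearMap.sub_apply, ← map_sub,
    ← S.gGr.sum_pr (S.gGr.pr k a - a), map_sum, LinearMap.sum_apply]
  refine Finset.sum_eq_zero fun l _ => ?_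
  by_cases hl : l = k
  · rw [map_sub, S.gGr.pr_pr, if_pos hl, hl, sub_self, map_zero, LinearMap.zero_apply]
  · exact S.form_deg l (-k) (fun h => hl (by linarith)) _ (S.gGr_pr_mem l _) _ (S.gGr_pr_mem _ b)

theorem pr_of_mem_𝔟 {b : 𝔤} (hb : b ∈ S.𝔟) {l : ℤ} (hl : l < -S.i + 1) : S.gGr.pr l b = 0 :=
  S.form_nondegenerate _ fun y => by
    rw [form_pr]
    exact S.mem_𝔟.1 hb _ (S.deg_ge_le (-l) (by linarith) (S.gGr_pr_mem _ _))

theorem pr_of_mem_𝔫 {n : 𝔤} (hn : n ∈ S.𝔫) {l : ℤ} (hl : l < 1) : S.gGr.pr l n = 0 := by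
  have h : (⨆ k ∈ Set.Ioi (0 : ℤ), S.deg k) ≤ LinearMap.ker (S.gGr.pr l) := by
    refine iSup₂_le fun k hk a ha => ?_
    rw [LinearMap.mem_ker, S.gGr_of_mem ha, if_neg]
    rintro rfl
    exact absurd (Set.mem_Ioi.1 hk) (by linarith)
  exact h (S.𝔫_pos hn)

theorem 𝔫_le_𝔟 : S.𝔫 ≤ S.𝔟 := fun n hn => S.mem_𝔟.2 fun m hm => by
  rw [← S.gGr.sum_pr n, map_sum, LinearMap.sum_apply]
  refine Finset.sum_eq_zero fun k _ => ?_
  by_cases hk : k < 1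
  · rw [S.pr_of_mem_𝔫 hn hk, map_zero, LinearMap.zero_apply]
  · rw [form_pr, S.pr_of_mem_𝔫 (S.𝔪_le hm) (by linarith), map_zero]

theorem br_𝔫_𝔟 {n b : 𝔤} (hn : n ∈ S.𝔫) (hb : b ∈ S.𝔟) : S.br n b ∈ S.𝔟 := by
  -- It suffices to treat homogeneous `n` and `b`.
  rw [← S.gradeComp_add n, ← S.gradeComp_add b]
  have key : ∀ p q, S.br (gradeComp S.internal p n) (gradeComp S.internal q b) ∈ S.𝔟 := by
    intro p q
    rw [S.skew p q _ (gradeComp_mem _ _ _) _ (gradeComp_mem _ _ _)]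
    refine S.𝔟.neg_mem (S.𝔟.smul_mem _ (S.mem_𝔟.2 fun m hm => ?_))
    rw [S.form_invariant]
    exact S.mem_𝔟.1 (S.span_qUp_part _ hb q) _ (S.𝔪_br _ (S.𝔫_part n hn p) m hm)
  simp only [map_add, LinearMap.add_apply]
  exact S.𝔟.add_mem (S.𝔟.add_mem (key 0 0) (key 1 0)) (S.𝔟.add_mem (key 0 1) (key 1 1))

theorem br_f_mem {n : 𝔤} (hn : n ∈ S.𝔫) : S.br S.f n ∈ S.𝔟 := S.mem_𝔟.2 (S.br_f_perp n hn)

theorem br_𝔫_f {n : 𝔤} (hn : n ∈ S.𝔫) : S.br n S.f ∈ S.𝔟 := by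
  rw [← S.gradeComp_add n, map_add, LinearMap.add_apply]
  have key : ∀ p, S.br (gradeComp S.internal p n) S.f ∈ S.𝔟 := fun p => by
    rw [S.skew p 1 _ (gradeComp_mem _ _ _) _ S.f_odd]
    exact S.𝔟.neg_mem (S.𝔟.smul_mem _ (S.br_f_mem (S.𝔫_part n hn p)))
  exact S.𝔟.add_mem (key 0) (key 1)

theorem mem_𝔟_decomp {b : 𝔤} (hb : b ∈ S.𝔟) : ∃ v ∈ S.V, ∃ n ∈ S.𝔫, b = v + S.br S.f n := by
  have h : S.𝔟 = S.V ⊔ Submodule.span ℂ (S.qUp '' S.J) := by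
    rw [V, ← Submodule.span_union, ← Set.image_union, 𝔟]
    congr 2
    have h2 := Finset.sdiff_union_of_subset S.J_le
    exact_mod_cast h2.symm
  rw [h, S.span_J] at hb
  obtain ⟨v, hv, y, hy, rfl⟩ := Submodule.mem_sup.1 hb
  obtain ⟨n, hn, rfl⟩ := hy
  exact ⟨v, hv, n, hn, rfl⟩

theorem V_inf {v n : 𝔤} (hv : v ∈ S.V) (hn : n ∈ S.𝔫) (h : v = S.br S.f n) : n = 0 := by
  refine S.br_f_inj n hn ?_
  rw [← h]
  have h1 : v ∈ Submodule.span ℂ (S.qUp '' S.J) := by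
    rw [S.span_J, h]
    exact ⟨n, hn, rfl⟩
  rw [← S.qUp.sum_repr v]
  refine Finset.sum_eq_zero fun t _ => ?_
  have h2 : ∀ A : Set ι, t ∉ A → v ∈ Submodule.span ℂ (S.qUp '' A) → S.qUp.repr v t = 0 :=
    fun A hA hvA => by
    have h3 : Submodule.span ℂ (S.qUp '' A) ≤ LinearMap.ker (S.qUp.coord t) := by
      rw [Submodule.span_le]
      rintro _ ⟨r, hr, rfl⟩
      have hrt : r ≠ t := fun e => hA (e ▸ hr)
      simp [hrt]
    exact h3 hvA
  by_cases ht : t ∈ S.J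
  · rw [h2 _ (by simp [ht]) hv, zero_smul]
  · rw [h2 _ (by simpa using ht) h1, zero_smul]

end DSData

namespace DSData

variable {𝔤 ι : Type*} [AddCommGroup 𝔤] [Module ℂ 𝔤] [Fintype ι] [DecidableEq ι]
  (S : DSData 𝔤 ι)

/-! ### Existence of the canonical form and of its dressing -/

theorem sgn_one_smul (x : S.LGA) : sgn 1 • x = -x := by
  rw [sgn_one]; module

theorem P_gc (e k : ℤ) (x : S.LGA) : S.𝓖.P (S.tGr.gc e k x) = S.tGr.gc e k (S.𝓖.P x) :=
  Laurent.ext' fun _ => (S.tGr_tParity _ _).symm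

theorem parProj_gc (p : ZMod 2) (e k : ℤ) (x : S.LGA) :
    S.𝓖.parProj p (S.tGr.gc e k x) = S.tGr.gc e k (S.𝓖.parProj p x) := by
  rw [FLie.parProj_apply, FLie.parProj_apply, P_gc, map_smul, map_add, map_smul]

/-- The successive approximation step for a homogeneous leading term `Λ`, from a decomposition of
the leading component of the error. -/
theorem normalForm_step {q : ZMod 2} {w k : ℤ} {Λ y v t : S.LGA} (hP : S.𝓖.P Λ = sgn q • Λ)
    (hΛ : S.tGr.gc (S.i + S.j) w Λ = Λ) (hyP : S.𝓖.P y = sgn q • y) (hy : y ∈ S.𝓖.F (w + k))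
    (h : S.tGr.gc (S.i + S.j) (w + k) y = S.tGr.gc (S.i + S.j) (w + k) (v + S.𝓖.br Λ t)) :
    S.𝓖.parProj 0 (S.tGr.gc (S.i + S.j) k t) ∈ S.𝓖.F k ∧
    y + S.𝓖.br (S.𝓖.parProj 0 (S.tGr.gc (S.i + S.j) k t)) Λ
      - S.𝓖.parProj q (S.tGr.gc (S.i + S.j) (w + k) v) ∈ S.𝓖.F (w + k + 1) := by
  refine ⟨?_, ?_⟩
  · rw [parProj_gc]
    exact Grading.gc_mem_filtF le_rfl _
  · have h1 := S.𝓖.P_parProj 0 (S.tGr.gc (S.i + S.j) k t)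
    rw [sgn_zero, one_smul] at h1
    have h2 : S.tGr.gc (S.i + S.j) (w + k) (S.𝓖.br Λ t)
        = S.𝓖.br Λ (S.tGr.gc (S.i + S.j) k t) := S.isGr_gBr.gc_conv hΛ k t
    have h3 : S.𝓖.parProj q (S.tGr.gc (S.i + S.j) (w + k) v)
        + S.𝓖.br Λ (S.𝓖.parProj 0 (S.tGr.gc (S.i + S.j) k t))
        = S.tGr.gc (S.i + S.j) (w + k) y := by
      rw [FLie.br_parProj _ hP, zero_add, ← h2, ← map_add, ← map_add, ← h, parProj_gc,
        FLie.parProj_of_par _ hyP]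
    rw [FLie.br_even_comm _ hP h1]
    have h5 : y - S.tGr.gc (S.i + S.j) (w + k) y ∈ S.𝓖.F (w + k + 1) := Grading.sub_gc_mem hy
    rw [← h3] at h5
    convert h5 using 1
    abel

/-- The Laurent series whose coefficients lie in given subspaces. -/
def coeffSub (C : ℤ → Submodule ℂ S.GA) : Submodule ℂ S.LGA where
  carrier := {x | ∀ n, x.1 n ∈ C n}
  zero_mem' := fun n => (C n).zero_mem
  add_mem' := fun h h' n => (C n).add_mem (h n) (h' n)
  smul_mem' := fun c _ h n => (C n).smul_mem c (h n)

theorem isClosed_coeffSub (C : ℤ → Submodule ℂ S.GA) : S.𝓖.IsClosed (S.coeffSub C) :=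
  Grading.isClosed_coeff S.ij_pos _ C fun _ => Iff.rfl

theorem coeffSub_gc {C : ℤ → Submodule ℂ S.GA} (hC : ∀ n k, ∀ x ∈ C n, S.tGr.pr k x ∈ C n) (e k : ℤ)
    {x : S.LGA} (hx : x ∈ S.coeffSub C) : S.tGr.gc e k x ∈ S.coeffSub C :=
  fun n => hC n _ _ (hx n)

theorem coeffSub_parProj {C : ℤ → Submodule ℂ S.GA} (hC : ∀ n, ∀ x ∈ C n, S.tParity x ∈ C n)
    (p : ZMod 2) {x : S.LGA} (hx : x ∈ S.coeffSub C) : S.𝓖.parProj p x ∈ S.coeffSub C :=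
  fun n => (C n).smul_mem _ ((C n).add_mem (hx n) ((C n).smul_mem _ (hC n _ (hx n))))

/-- The elements of parity `p`. -/
def parSub (p : ZMod 2) : Submodule ℂ S.LGA := LinearMap.ker (S.𝓖.P - sgn p • LinearMap.id)

theorem mem_parSub {p : ZMod 2} {x : S.LGA} : x ∈ S.parSub p ↔ S.𝓖.P x = sgn p • x :=
  FLie.mem_par

/-- The series concentrated in degree `0` in `z`, with coefficient in a given subspace. -/
def constSub (U : Submodule ℂ S.GA) : Submodule ℂ S.LGA :=
  S.coeffSub fun n => if n = 0 then U else ⊥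

variable {S} in
theorem mem_constSub {U : Submodule ℂ S.GA} {x : S.LGA} :
    x ∈ S.constSub U ↔ ∃ a ∈ U, x = Laurent.single 0 a := by
  constructor
  · intro h
    refine ⟨x.1 0, by simpa using h 0, Laurent.ext' fun n => ?_⟩
    rw [Laurent.single_coeff]
    split_ifs with hn
    · rw [hn]
    · have := h n
      simpa only [if_neg hn, Submodule.mem_bot] using this
  · rintro ⟨a, ha, rfl⟩ n
    dsimp only
    rw [Laurent.single_coeff]
    split_ifs
    · exact ha
    · exact zero_mem _

theorem constSub_le {U U' : Submodule ℂ S.GA} (h : U ≤ U') : S.constSub U ≤ S.constSub U' := by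
  intro x hx
  obtain ⟨a, ha, rfl⟩ := mem_constSub.1 hx
  exact mem_constSub.2 ⟨a, h ha, rfl⟩

theorem single_gc (e k : ℤ) (a : S.GA) :
    S.tGr.gc e k (Laurent.single 0 a) = Laurent.single 0 (S.tGr.pr k a) := by
  refine Laurent.ext' fun n => ?_
  rw [Grading.gc_coeff, Laurent.single_coeff, Laurent.single_coeff]
  split_ifs with h
  · rw [h, mul_zero, add_zero]
  · exact map_zero _

theorem lBr_single (a b : S.GA) :
    S.lBr (Laurent.single 0 a) (Laurent.single 0 b) = Laurent.single 0 (S.gBr a b) := by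
  rw [lBr, Laurent.conv_single_left']
  refine Laurent.ext' fun n => ?_
  rw [Laurent.shift_coeff, Laurent.map_coeff, Laurent.single_coeff, Laurent.single_coeff, sub_zero]
  split_ifs
  · rfl
  · exact map_zero _

theorem lDer_single (π : ZMod 2) (d : S.Aff →ₗ[ℂ] S.Aff) (a : S.GA) :
    S.lDer π d (Laurent.single 0 a) = Laurent.single 0 (S.gDer π d a) := by
  refine Laurent.ext' fun n => ?_
  rw [lDer, Laurent.map_coeff, Laurent.single_coeff, Laurent.single_coeff]
  split_ifs
  · rfl
  · exact map_zero _

theorem P_single (a : S.GA) :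
    S.𝓖.P (Laurent.single 0 a) = Laurent.single 0 (S.tParity a) := by
  refine Laurent.ext' fun n => ?_
  change S.tParity ((Laurent.single 0 a).1 n) = _
  rw [Laurent.single_coeff, Laurent.single_coeff]
  split_ifs
  · rfl
  · exact map_zero _

theorem tensorOne_single (a : 𝔤) :
    S.tensorOne (Laurent.single 0 a) = Laurent.single 0 (a ⊗ₜ 1) := by
  refine Laurent.ext' fun n => ?_
  change ((Laurent.single 0 a).1 n) ⊗ₜ[ℂ] (1 : S.Aff) = _
  rw [Laurent.single_coeff, Laurent.single_coeff]
  split_ifs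
  · rfl
  · exact TensorProduct.zero_tmul _ _

theorem P_eq : S.P = diffAlg {x | ∃ t ∈ S.I, x = jet S.barPar t 0} := by
  rw [P, diffAlg]
  congr 1
  ext x
  constructor
  · rintro ⟨t, ht, n, rfl⟩
    exact ⟨_, ⟨t, ht, rfl⟩, n, (D_pow_jet t n).symm⟩
  · rintro ⟨_, ⟨t, ht, rfl⟩, n, rfl⟩
    exact ⟨t, ht, n, D_pow_jet t n⟩

theorem P_gen : ∀ g ∈ {x : S.Aff | ∃ t ∈ S.I, x = jet S.barPar t 0}, ∃ p, IsPar p g := by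
  rintro _ ⟨t, _, rfl⟩
  exact ⟨_, isPar_jet t 0⟩

theorem jet_mem_P {t : ι} (ht : t ∈ S.I) (n : ℕ) : jet S.barPar t n ∈ S.P :=
  Algebra.subset_adjoin ⟨t, ht, n, rfl⟩

theorem P_par {a : S.Aff} (ha : a ∈ S.P) : parityAut _ a ∈ S.P := by
  rw [P_eq] at ha ⊢
  exact diffAlg_par S.P_gen ha

theorem P_D {a : S.Aff} (ha : a ∈ S.P) : S.D a ∈ S.P := by
  rw [P_eq] at ha ⊢
  exact diffAlg_D S.P_gen ha

theorem Qu_mem : S.Qu ∈ S.tens S.𝔟 (Subalgebra.toSubmodule S.P) :=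
  Submodule.sum_mem _ fun t ht => S.tmul_mem_tens (Submodule.subset_span ⟨t, ht, rfl⟩)
    (S.jet_mem_P ht 0)

theorem Qu_par : S.tParity S.Qu = -S.Qu := by
  rw [Qu, map_sum, ← Finset.sum_neg_distrib]
  refine Finset.sum_congr rfl fun t _ => ?_
  rw [S.tParity_pure (S.qUp_part t) (isPar_jet t 0), barPar, Nat.cast_zero, add_zero, ← add_assoc,
    par_add_self, zero_add, sgn_one, neg_smul, one_smul]

/-- `f ⊗ 1`. -/
def f₁ : S.LGA := S.tensorOne (Laurent.single 0 S.f)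

theorem f₁_par : S.𝓖.P S.f₁ = sgn 1 • S.f₁ := S.tensorOne_par fun n => by
  rw [Laurent.single_coeff]
  split_ifs
  exacts [S.f_odd, zero_mem _]

theorem f₁_deg : S.tGr.gc (S.i + S.j) (-S.i) S.f₁ = S.f₁ := by
  rw [f₁, tensorOne_single, single_gc, tGr_tmul, S.gGr_of_mem S.f_deg, if_pos rfl]

theorem single_mem_F {U : Submodule ℂ 𝔤} {R : Submodule ℂ S.Aff} {k : ℤ}
    (hU : ∀ a ∈ U, ∀ l, l < k → S.gGr.pr l a = 0) {x : S.GA} (hx : x ∈ S.tens U R) :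
    (Laurent.single 0 x : S.LGA) ∈ S.𝓖.F k := fun l hl => by
  rw [single_gc]
  have h : S.tGr.pr l x = 0 :=
    S.tens_le (Q := LinearMap.ker (S.tGr.pr l)) (fun a ha u _ => by
      rw [LinearMap.mem_ker, tGr_tmul, hU a ha l hl, TensorProduct.zero_tmul]) hx
  rw [h, map_zero]

theorem laxOp_par (Q : S.GA) (hQ : S.tParity Q = -Q) :
    S.𝓖.P (Laurent.single 0 Q + S.f₁) = -(Laurent.single 0 Q + S.f₁) := by
  rw [map_add, f₁_par, P_single, hQ, sgn_one_smul, map_neg, neg_add]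

/-- Existence of the canonical form: `𝔟 = V ⊕ [f, 𝔫]`, where `V` is the span of the `q^t`,
`t ∈ I \ J`, and gauge transformations by `𝔫` remove the part in `[f, 𝔫]` degree by degree. -/
theorem exists_canonical : ∃ N ∈ S.tens S.𝔫 (Subalgebra.toSubmodule S.P), ∃ v ∈
    S.tens S.V (Subalgebra.toSubmodule S.P), S.tParity N = N ∧ S.tParity v = -v ∧
    S.IsExpAd (Laurent.single 0 N) (S.laxOp S.Qu) (S.laxOp v) := by
  set R := Subalgebra.toSubmodule S.P with hR
  have hRp : ∀ u ∈ R, parityAut _ u ∈ R := fun u hu => S.P_par hu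
  set Λ := S.f₁ with hΛdef
  set A := S.toOp (S.laxOp S.Qu) with hA
  have hA2 : A.2 = Laurent.single 0 S.Qu + Λ := rfl
  have hAΛ : A.2 - Λ ∈ S.𝓖.F (-S.i + 1) := by
    rw [hA2, add_sub_cancel_right]
    exact S.single_mem_F (fun a ha l hl => S.pr_of_mem_𝔟 ha hl) S.Qu_mem
  have hAop : A ∈ S.𝓖.isOp 1 := S.toOp_isOp (S.laxOp_par _ S.Qu_par)
  -- The spaces of constants in `U ⊗ 𝒫` are stable under the projections onto parity and degree.
  have cpar : ∀ U : Submodule ℂ 𝔤, (∀ a ∈ U, ∀ p, gradeComp S.internal p a ∈ U) → ∀ p, ∀ x ∈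
      S.constSub (S.tens U R), S.𝓖.parProj p x ∈ S.constSub (S.tens U R) := by
    intro U hU p x hx
    refine S.coeffSub_parProj (fun n x hx => ?_) p hx
    split_ifs at hx ⊢
    · exact S.tens_par hU hRp hx
    · rw [(Submodule.mem_bot ℂ).1 hx, map_zero]
      exact zero_mem _
  have cgc : ∀ U : Submodule ℂ 𝔤, (∀ a ∈ U, ∀ k, S.gGr.pr k a ∈ U) → ∀ k, ∀ x ∈
      S.constSub (S.tens U R), S.tGr.gc (S.i + S.j) k x ∈ S.constSub (S.tens U R) := by
    intro U hU k x hx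
    refine S.coeffSub_gc (fun n k x hx => ?_) _ k hx
    split_ifs at hx ⊢
    · exact S.tens_pr hU k hx
    · rw [(Submodule.mem_bot ℂ).1 hx, map_zero]
      exact zero_mem _
  have hcl : ∀ (U : Submodule ℂ S.GA) (p : ZMod 2), S.𝓖.IsClosed (S.constSub U ⊓ S.parSub p) :=
    fun U p => Filt.IsClosed.inf (S.isClosed_coeffSub _) (FLie.isClosed_par p)
  have hw : -S.i ≤ -1 := by linarith [S.i_pos]
  have main : ∃ T ∈ S.constSub (S.tens S.𝔫 R) ⊓ S.parSub 0, ∃ hT : S.𝓖.Nil T,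
      (FLie.E hT A).2 - Λ ∈ S.constSub (S.tens S.V R) ⊓ S.parSub 1 := by
    refine FLie.exists_normalForm (𝓖 := S.𝓖) (A := A) (Λ := Λ) hw
      (S.mem_F_of_gc S.f₁_deg) hAΛ (𝒯 := S.constSub (S.tens S.𝔫 R) ⊓ S.parSub 0)
      (𝒴 := S.constSub (S.tens S.𝔟 R) ⊓ S.parSub 1) (𝒱 := S.constSub (S.tens S.V R) ⊓ S.parSub 1)
      (inf_le_inf_right _ (S.constSub_le (S.tens_le fun a ha u hu =>
        S.tmul_mem_tens (S.V_le_𝔟 ha) hu)))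
      (fun t ht => by simpa using S.mem_parSub.1 ht.2) (hcl _ _) (hcl _ _) ?_ ?_
    · intro T hT𝒯 hT
      obtain ⟨N, hN, rfl⟩ := mem_constSub.1 hT𝒯.1
      refine ⟨?_, S.mem_parSub.2 ?_⟩
      · have h1 := FLie.E_sub_mem hT (S := S.constSub (S.tens S.𝔟 R)) (S.isClosed_coeffSub _)
          (fun x hx => ?_) (X := A) ?_
        · have h2 := Submodule.add_mem _ h1 (mem_constSub.2 ⟨S.Qu, S.Qu_mem, rfl⟩)
          have e : (FLie.E hT A).2 - Λ = (FLie.E hT A).2 - A.2 + Laurent.single 0 S.Qu := by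
            rw [hA2]
            abel
          rw [e]
          exact h2
        · obtain ⟨b, hb, rfl⟩ := mem_constSub.1 hx
          refine mem_constSub.2 ⟨_, ?_, S.lBr_single N b⟩
          exact S.gBr_mem_tens (fun a ha p => S.span_qUp_part _ ha p) hRp
            (fun n hn b hb => S.br_𝔫_𝔟 hn hb) hN hb
        · have h3 : A.1.1 = S.lD := S.toOp_fst _
          rw [hA2, h3, map_add, hΛdef, f₁, tensorOne_single, lD_eq, lDer_single]
          refine Submodule.sub_mem _ (Submodule.add_mem _ ?_ ?_) ?_
          · exact mem_constSub.2 ⟨_, S.gBr_mem_tens (fun a ha p => S.span_qUp_part _ ha p) hRp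
              (fun n hn b hb => S.br_𝔫_𝔟 hn hb) hN S.Qu_mem, S.lBr_single _ _⟩
          · refine mem_constSub.2 ⟨_, S.gBr_mem_tens (U' := Submodule.span ℂ {S.f})
              (fun a ha p => ?_) hRp (fun n hn b hb => ?_) hN
              (S.tmul_mem_tens (Submodule.mem_span_singleton_self _) S.P.one_mem),
              S.lBr_single _ _⟩
            · obtain ⟨c, rfl⟩ := Submodule.mem_span_singleton.1 ha
              rw [map_smul, gradeComp_of_mem _ S.f_odd]
              split_ifs
              · exact ha
              · rw [smul_zero]; exact zero_mem _
            · obtain ⟨c, rfl⟩ := Submodule.mem_span_singleton.1 hb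
              rw [map_smul]
              exact Submodule.smul_mem _ _ (S.br_𝔫_f hn)
          · refine mem_constSub.2 ⟨_, ?_, rfl⟩
            refine S.tens_le (fun a ha u hu => S.tmul_mem_tens (S.𝔫_le_𝔟 ha) hu)
              (S.tens_gDer (R' := R) S.𝔫_part 1 (fun u hu => S.P_D hu) hN)
      · rw [map_sub, (FLie.E_isOp hT hAop).2, S.f₁_par, smul_sub]
    · rintro k hk y ⟨hy, hyP⟩ hyF
      obtain ⟨y', hy', rfl⟩ := mem_constSub.1 hy
      -- The decomposition `𝔟 = V ⊕ [f, 𝔫]` gives the correction in each degree.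
      have hdec : S.tens S.𝔟 R ≤ S.tens S.V R ⊔ (S.tens S.𝔫 R).map (S.gBr (S.f ⊗ₜ 1)) := by
        refine S.tens_le fun b hb u hu => ?_
        obtain ⟨v, hv, n, hn, rfl⟩ := S.mem_𝔟_decomp hb
        rw [TensorProduct.add_tmul]
        refine Submodule.add_mem_sup (S.tmul_mem_tens hv hu) ⟨n ⊗ₜ u, S.tmul_mem_tens hn hu, ?_⟩
        rw [gBr, tensorExt_one_left]
      obtain ⟨v, hv, _, ⟨n, hn, rfl⟩, hvn⟩ := Submodule.mem_sup.1 (hdec hy')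
      have h := S.normalForm_step (v := Laurent.single 0 v) (t := Laurent.single 0 n) (k := k)
        S.f₁_par S.f₁_deg (S.mem_parSub.1 hyP) hyF (by
          rw [← hvn, map_add]
          congr 2
          rw [f₁, tensorOne_single]
          exact (S.lBr_single _ _).symm)
      refine ⟨_, ⟨?_, ?_⟩, h.1, _, ⟨?_, ?_⟩, h.2⟩
      · exact cpar _ S.𝔫_part _ _ (cgc _ (fun a ha k => S.𝔫_deg a ha k) _ _
          (mem_constSub.2 ⟨n, hn, rfl⟩))
      · exact S.mem_parSub.2 (S.𝓖.P_parProj _ _)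
      · exact cpar _ (fun a ha p => S.span_qUp_part _ ha p) _ _
          (cgc _ (fun a ha k => S.span_qUp_deg _ ha k) _ _ (mem_constSub.2 ⟨v, hv, rfl⟩))
      · exact S.mem_parSub.2 (S.𝓖.P_parProj _ _)
  obtain ⟨T, hT𝒯, hT, hT𝒱⟩ := main
  obtain ⟨N, hN, rfl⟩ := mem_constSub.1 hT𝒯.1
  obtain ⟨v, hv, hTv⟩ := mem_constSub.1 hT𝒱.1
  have hinj : ∀ a b : S.GA, (Laurent.single 0 a : S.LGA) = Laurent.single 0 b → a = b :=
    fun a b h => by simpa using congrArg (fun y => y.1 0) h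
  refine ⟨N, hN, v, hv, hinj _ _ ?_, hinj _ _ ?_, (S.isExpAd_iff hT _ _).2 ⟨rfl, rfl, ?_⟩⟩
  · rw [← P_single]
    exact hT.1
  · have h := S.mem_parSub.1 hT𝒱.2
    rw [hTv, P_single, sgn_one_smul] at h
    rw [h, map_neg]
  · rw [sub_eq_iff_eq_add] at hTv
    exact hTv

end DSData

namespace DSData

variable {𝔤 ι : Type*} [AddCommGroup 𝔤] [Module ℂ 𝔤] [Fintype ι] [DecidableEq ι]
  (S : DSData 𝔤 ι)

/-! ### The kernel and the image of `ad Λ²` -/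

theorem gParity_br (a b : 𝔤) : S.gParity (S.br a b) = S.br (S.gParity a) (S.gParity b) := by
  have key : ∀ p q, ∀ a ∈ S.part p, ∀ b ∈ S.part q,
      S.gParity (S.br a b) = S.br (S.gParity a) (S.gParity b) := by
    intro p q a ha b hb
    rw [S.gParity_of_mem (S.br_mem _ _ a ha b hb), S.gParity_of_mem ha, S.gParity_of_mem hb,
      map_smul, map_smul, LinearMap.smul_apply, smul_smul, sgn_add, mul_comm]
  have h := fun p q => key p q _ (gradeComp_mem S.internal p a) _ (gradeComp_mem S.internal q b)
  rw [← S.gradeComp_add a, ← S.gradeComp_add b]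
  simp only [map_add, LinearMap.add_apply, h]

theorem gParity_conv (x y : Laurent 𝔤) : Laurent.map S.gParity (Laurent.conv S.br x y)
    = Laurent.conv S.br (Laurent.map S.gParity x) (Laurent.map S.gParity y) := by
  rw [Laurent.map_conv, Laurent.conv_map_left, Laurent.conv_map_right]
  exact Laurent.conv_congr _ _ _ _ _ _ fun k l => S.gParity_br _ _

theorem gParity_Λsq : Laurent.map S.gParity S.Λsq = S.Λsq := by
  have h : Laurent.map S.gParity S.Λ = -S.Λ := Laurent.ext' fun n => by
    rw [Laurent.map_coeff, S.gParity_of_mem (S.Λ_par n), sgn_one, neg_smul, one_smul,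
      Laurent.neg_coeff]
  rw [Λsq, map_smul, gParity_conv, h, map_neg, map_neg, LinearMap.neg_apply, neg_neg]

theorem imΛ_gParity {x : Laurent 𝔤} (hx : x ∈ S.imΛ) : Laurent.map S.gParity x ∈ S.imΛ := by
  obtain ⟨y, rfl⟩ := hx
  rw [gParity_conv, gParity_Λsq]
  exact ⟨_, rfl⟩

theorem gc_conv_Λsq (k : ℤ) (x : Laurent 𝔤) :
    S.gGr.gc (S.i + S.j) k (Laurent.conv S.br S.Λsq x)
      = Laurent.conv S.br S.Λsq (S.gGr.gc (S.i + S.j) (k + 2 * S.i) x) := by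
  have h := S.isGr_br.gc_conv S.Λsq_deg (k + 2 * S.i) x
  rwa [show -(2 * S.i) + (k + 2 * S.i) = k by ring] at h

theorem imΛ_gc {x : Laurent 𝔤} (hx : x ∈ S.imΛ) (k : ℤ) :
    S.gGr.gc (S.i + S.j) k x ∈ S.imΛ := by
  obtain ⟨y, rfl⟩ := hx
  rw [gc_conv_Λsq]
  exact ⟨_, rfl⟩

theorem kerΛ_gc {x : Laurent 𝔤} (hx : x ∈ S.kerΛ) (k : ℤ) :
    S.gGr.gc (S.i + S.j) k x ∈ S.kerΛ := by
  have h : Laurent.conv S.br S.Λsq x = 0 := hx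
  change Laurent.conv S.br S.Λsq _ = 0
  rw [show k = k - 2 * S.i + 2 * S.i by ring, ← gc_conv_Λsq, h, map_zero]

theorem exists_ker_add_im (x : Laurent 𝔤) : ∃ κ ∈ S.kerΛ, ∃ y ∈ S.imΛ, κ + y = x :=
  Submodule.mem_sup.1 (S.isCompl_Λ.sup_eq_top ▸ Submodule.mem_top)

/-- The image of `ad Λ²` is closed, because it has a homogeneous complement. -/
theorem imΛ_closed {x : Laurent 𝔤} (hx : ∀ k, ∃ y ∈ S.imΛ, x - y ∈ S.gGr.filtF (S.i + S.j) k) :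
    x ∈ S.imΛ := by
  obtain ⟨κ, hκ, y, hy, rfl⟩ := S.exists_ker_add_im x
  suffices h : κ = 0 by rwa [h, zero_add]
  refine Grading.gc_eq_zero (G := S.gGr) (e := S.i + S.j) fun k => ?_
  obtain ⟨y', hy', h⟩ := hx (k + 1)
  have h1 := h k (by linarith)
  rw [add_sub_assoc, map_add] at h1
  refine Submodule.disjoint_def.1 S.isCompl_Λ.disjoint _ (S.kerΛ_gc hκ k) ?_
  rw [eq_neg_of_add_eq_zero_left h1]
  exact S.imΛ.neg_mem (S.imΛ_gc (S.imΛ.sub_mem hy hy') k)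

/-- The completed tensor product of `im ad Λ²` with `𝒫(\bar 𝔤)`. -/
def imSub : Submodule ℂ S.LGA := ⨅ ℓ, S.imΛ.comap (Laurent.map (S.con ℓ))

theorem mem_imSub {x : S.LGA} : x ∈ S.imSub ↔ ∀ ℓ, Laurent.map (S.con ℓ) x ∈ S.imΛ := by
  simp [imSub]

theorem isClosed_imSub : S.𝓖.IsClosed S.imSub := fun x hx => S.mem_imSub.2 fun ℓ => by
  refine S.imΛ_closed fun k => ?_
  obtain ⟨y, hy, hxy⟩ := hx k
  refine ⟨_, S.mem_imSub.1 hy ℓ, ?_⟩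
  intro l hl
  have h : S.tGr.gc (S.i + S.j) l (x - y) = 0 := hxy l hl
  rw [← map_sub, ← con_gc, h, map_zero]

theorem con_tParity (ℓ : S.Aff →ₗ[ℂ] ℂ) (x : S.GA) : S.con ℓ (S.tParity x)
    = S.gParity (S.con (ℓ ∘ₗ (parityAut _).toLinearMap) x) := by
  induction x using TensorProduct.induction_on with
  | zero => simp
  | tmul a u => rw [tParity_tmul, con_tmul, con_tmul, map_smul]; rfl
  | add x y hx hy => simp only [map_add, hx, hy]

theorem imSub_parProj (p : ZMod 2) {x : S.LGA} (hx : x ∈ S.imSub) :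
    S.𝓖.parProj p x ∈ S.imSub := by
  refine S.imSub.smul_mem _ (S.imSub.add_mem hx (S.imSub.smul_mem _ (S.mem_imSub.2 fun ℓ => ?_)))
  have h : Laurent.map (S.con ℓ) (S.𝓖.P x)
      = Laurent.map S.gParity (Laurent.map (S.con (ℓ ∘ₗ (parityAut _).toLinearMap)) x) :=
    Laurent.ext' fun n => S.con_tParity ℓ _
  rw [h]
  exact S.imΛ_gParity (S.mem_imSub.1 hx _)

theorem imSub_gc {x : S.LGA} (hx : x ∈ S.imSub) (k : ℤ) :
    S.tGr.gc (S.i + S.j) k x ∈ S.imSub := S.mem_imSub.2 fun ℓ => by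
  rw [con_gc]
  exact S.imΛ_gc (S.mem_imSub.1 hx ℓ) k

/-- `ker ad (Λ² ⊗ 1)`. -/
def kerSub : Submodule ℂ S.LGA := LinearMap.ker (S.𝓖.br S.Λ₂)

theorem mem_kerSub {x : S.LGA} : x ∈ S.kerSub ↔ S.lBr S.Λ₂ x = 0 := LinearMap.mem_ker

theorem mem_kerSub_iff {x : S.LGA} :
    x ∈ S.kerSub ↔ ∀ ℓ, Laurent.map (S.con ℓ) x ∈ S.kerΛ := by
  have h : ∀ ℓ, Laurent.map (S.con ℓ) x ∈ S.kerΛ ↔ Laurent.map (S.con ℓ) (S.lBr S.Λ₂ x) = 0 :=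
    fun ℓ => by rw [Λ₂, con_lBr]; rfl
  simp only [h, mem_kerSub]
  exact ⟨fun h ℓ => by rw [h, map_zero], S.lga_eq_zero_of_con⟩

theorem isClosed_kerSub : S.𝓖.IsClosed S.kerSub :=
  Filt.isClosed_ker (𝓕₂ := S.𝓖.toFilt) _ (c := -(2 * S.i)) fun k v hv => by
    rw [add_comm]
    exact S.𝓖.F_br _ _ _ S.Λ₂_mem _ hv

theorem kerSub_gc {x : S.LGA} (hx : x ∈ S.kerSub) (k : ℤ) :
    S.tGr.gc (S.i + S.j) k x ∈ S.kerSub := by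
  rw [mem_kerSub] at hx ⊢
  rw [← gc_lBr_Λ₂, hx, map_zero]

theorem kerSub_parProj (p : ZMod 2) {x : S.LGA} (hx : x ∈ S.kerSub) :
    S.𝓖.parProj p x ∈ S.kerSub := by
  have h : S.𝓖.br S.Λ₂ x = 0 := hx
  change S.𝓖.br S.Λ₂ _ = 0
  rw [FLie.br_parProj (q := 0) _ (by rw [Λ₂_par, sgn_zero, one_smul]), h, map_zero]

/-- `x ↦ x ⊗ u`. -/
def tensorU (u : S.Aff) : Laurent 𝔤 →ₗ[ℂ] S.LGA :=
  Laurent.map ((TensorProduct.mk ℂ 𝔤 S.Aff).flip u)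

theorem con_tensorU (ℓ : S.Aff →ₗ[ℂ] ℂ) (u : S.Aff) (x : Laurent 𝔤) :
    Laurent.map (S.con ℓ) (S.tensorU u x) = ℓ u • x := Laurent.ext' fun _ => S.con_tmul ℓ _ u

theorem lBr_tensorU (u : S.Aff) (x y : Laurent 𝔤) :
    S.lBr (S.tensorOne x) (S.tensorU u y) = S.tensorU u (Laurent.conv S.br x y) := by
  rw [lBr, tensorOne, tensorU, Laurent.map_conv, Laurent.conv_map_left, Laurent.conv_map_right]
  refine Laurent.conv_congr _ _ _ _ _ _ fun k l => ?_
  exact S.tensorExt_one_left S.br _ _ _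

/-- The series with coefficients in `𝔤 ⊗ R`. -/
def coefR (R : Submodule ℂ S.Aff) : Submodule ℂ S.LGA := S.coeffSub fun _ => S.tens ⊤ R

theorem tensorU_mem {R : Submodule ℂ S.Aff} {u : S.Aff} (hu : u ∈ R) (x : Laurent 𝔤) :
    S.tensorU u x ∈ S.coefR R := fun _ => S.tmul_mem_tens Submodule.mem_top hu

theorem single_mem_dec {R : Submodule ℂ S.Aff} (n : ℤ) {x : S.GA} (hx : x ∈ S.tens ⊤ R) :
    (Laurent.single n x : S.LGA) ∈ (S.coefR R ⊓ S.kerSub)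
      ⊔ (S.coefR R ⊓ S.imSub).map (S.𝓖.br S.Λ₂) := by
  refine S.tens_le (Q := ((S.coefR R ⊓ S.kerSub)
    ⊔ (S.coefR R ⊓ S.imSub).map (S.𝓖.br S.Λ₂)).comap (Laurent.single n)) (fun a _ u hu => ?_) hx
  obtain ⟨κ, hκ, y, ⟨t, rfl⟩, hy⟩ := S.exists_ker_add_im (Laurent.single n a)
  obtain ⟨κ', hκ', t', ht', rfl⟩ := S.exists_ker_add_im t
  have h1 : Laurent.conv S.br S.Λsq κ' = 0 := hκ'
  rw [map_add, h1, zero_add] at hy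
  have h2 : (Laurent.single n (a ⊗ₜ u) : S.LGA) = S.tensorU u (Laurent.single n a) := by
    refine Laurent.ext' fun m => ?_
    change _ = ((Laurent.single n a).1 m) ⊗ₜ[ℂ] u
    rw [Laurent.single_coeff, Laurent.single_coeff]
    split_ifs
    · rfl
    · exact (TensorProduct.zero_tmul _ _).symm
  rw [Submodule.mem_comap, h2, ← hy, map_add, ← lBr_tensorU]
  refine Submodule.add_mem_sup ⟨S.tensorU_mem hu _, S.mem_kerSub_iff.2 fun ℓ => ?_⟩
    ⟨_, ⟨S.tensorU_mem hu t', S.mem_imSub.2 fun ℓ => ?_⟩, rfl⟩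
  · rw [con_tensorU]
    exact S.kerΛ.smul_mem _ hκ
  · rw [con_tensorU]
    exact S.imΛ.smul_mem _ ht'

theorem exists_dec {R : Submodule ℂ S.Aff} {y : S.LGA} (hy : y ∈ S.coefR R) (k : ℤ) :
    ∃ v ∈ S.coefR R ⊓ S.kerSub, ∃ t ∈ S.coefR R ⊓ S.imSub, S.tGr.gc (S.i + S.j) k y
      = S.tGr.gc (S.i + S.j) k (v + S.𝓖.br S.Λ₂ t) := by
  obtain ⟨s, hs⟩ := Laurent.exists_trunc y (-(S.d + 1 + |k|))
  obtain ⟨v, hv, _, ⟨t, ht, rfl⟩, h⟩ := Submodule.mem_sup.1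
    (Submodule.sum_mem _ fun n (_hn : n ∈ s) => S.single_mem_dec n (hy n))
  refine ⟨v, hv, t, ht, ?_⟩
  rw [h, ← sub_eq_zero, ← map_sub]
  refine Laurent.ext' fun n => ?_
  rw [Grading.gc_coeff, Laurent.zero_coeff]
  by_cases hn : -(S.d + 1 + |k|) < n
  · rw [hs n hn, map_zero]
  · refine S.tGr.pr_range _ _ (lt_of_lt_of_le ?_ (neg_le_abs _))
    change S.d < -(k + (S.i + S.j) * n)
    have h1 := le_abs_self k
    have h2 := abs_nonneg k
    have h3 := S.d_pos
    have h4 : (S.i + S.j) * n ≤ 1 * n :=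
      mul_le_mul_of_nonpos_right (by linarith [S.i_pos, S.j_pos]) (by linarith)
    linarith

theorem coefR_gc {R : Submodule ℂ S.Aff} {x : S.LGA} (hx : x ∈ S.coefR R) (k : ℤ) :
    S.tGr.gc (S.i + S.j) k x ∈ S.coefR R :=
  S.coeffSub_gc (fun _ k _ hx => S.tens_pr (fun _ _ _ => Submodule.mem_top) k hx) _ k hx

theorem coefR_parProj {R : Submodule ℂ S.Aff} (hR : ∀ u ∈ R, parityAut _ u ∈ R) (p : ZMod 2)
    {x : S.LGA} (hx : x ∈ S.coefR R) : S.𝓖.parProj p x ∈ S.coefR R :=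
  S.coeffSub_parProj (fun _ _ hx => S.tens_par (fun _ _ _ => Submodule.mem_top) hR hx) p hx

theorem coefR_lBr {R : Subalgebra ℂ S.Aff} (hR : ∀ u ∈ R, parityAut _ u ∈ R) {x y : S.LGA}
    (hx : x ∈ S.coefR (Subalgebra.toSubmodule R)) (hy : y ∈ S.coefR (Subalgebra.toSubmodule R)) :
    S.lBr x y ∈ S.coefR (Subalgebra.toSubmodule R) := fun n => by
  rw [lBr, Laurent.conv_coeff]
  refine finsum_induction _ (zero_mem _) (fun _ _ h h' => Submodule.add_mem _ h h') fun k => ?_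
  exact S.gBr_mem_tens (fun _ _ _ => Submodule.mem_top) hR (fun _ _ _ _ => Submodule.mem_top)
    (hx k) (hy (n - k))

theorem coefR_lDer {R R' : Submodule ℂ S.Aff} (π : ZMod 2) {d : S.Aff →ₗ[ℂ] S.Aff}
    (hd : ∀ u ∈ R, d u ∈ R') {x : S.LGA} (hx : x ∈ S.coefR R) : S.lDer π d x ∈ S.coefR R' :=
  fun n => S.tens_gDer (fun _ _ _ => Submodule.mem_top) π hd (hx n)

theorem mem_lTens_im {R : Submodule ℂ S.Aff} {x : S.LGA} :
    x ∈ S.lTens S.imΛ R ↔ x ∈ S.coefR R ⊓ S.imSub :=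
  and_congr Iff.rfl S.mem_imSub.symm

theorem mem_lTens_ker {R : Submodule ℂ S.Aff} {x : S.LGA} :
    x ∈ S.lTens S.kerΛ R ↔ x ∈ S.coefR R ⊓ S.kerSub :=
  and_congr Iff.rfl S.mem_kerSub_iff.symm

/-- Elements of positive degree, where `z` has degree `-i-j`, are the elements of filtration degree
at least `1`. -/
theorem mem_lPos {x : S.LGA} : x ∈ S.lPos ↔ x ∈ S.𝓖.F 1 := by
  rw [𝓖_F, Grading.mem_filtF]
  refine forall_congr' fun n => ?_
  constructor
  · intro h l hl
    refine (iSup₂_le (a := LinearMap.ker (S.tGr.pr l)) fun k hk => ?_) h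
    refine S.tens_le fun a ha u _ => ?_
    rw [LinearMap.mem_ker, tGr_tmul, S.gGr_of_mem ha, if_neg, TensorProduct.zero_tmul]
    rintro rfl
    have : 0 < l - (S.i + S.j) * n := hk
    linarith
  · intro h
    rw [← S.tGr.sum_pr (x.1 n)]
    refine Submodule.sum_mem _ fun k _ => ?_
    by_cases hk : k < 1 + (S.i + S.j) * n
    · rw [h k hk]
      exact zero_mem _
    · have h1 : S.tGr.pr k (x.1 n) ∈ S.tens (S.deg k) ⊤ := by
        have h2 : x.1 n ∈ S.tens ⊤ ⊤ := by
          rw [← S.sum_coord S.qUp (x.1 n)]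
          exact Submodule.sum_mem _ fun t _ => S.tmul_mem_tens Submodule.mem_top Submodule.mem_top
        exact S.map_mem_tens (fun a _ => S.gGr_pr_mem k a) (fun _ h => h) h2
      refine Submodule.mem_iSup_of_mem k (Submodule.mem_iSup_of_mem ?_ h1)
      change 0 < k - (S.i + S.j) * n
      linarith

/-! #### The dressing of `ℒ^c` -/

section Dress

variable {w : ι → S.Aff}
  (hw : ∀ t ∈ S.I \ S.J, parityAut _ (w t) = sgn (S.barPar t) • w t)

theorem Pw_eq : S.Pw w = diffAlg {x | ∃ t ∈ S.I \ S.J, x = w t} := by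
  rw [Pw, diffAlg]
  congr 1
  ext x
  constructor
  · rintro ⟨t, ht, n, rfl⟩
    exact ⟨_, ⟨t, ht, rfl⟩, n, rfl⟩
  · rintro ⟨_, ⟨t, ht, rfl⟩, n, rfl⟩
    exact ⟨t, ht, n, rfl⟩

theorem w_mem_Pw {t : ι} (ht : t ∈ S.I \ S.J) : w t ∈ S.Pw w :=
  Algebra.subset_adjoin ⟨t, ht, 0, rfl⟩

variable {S} in
theorem Pw_par (hw : ∀ t ∈ S.I \ S.J, parityAut _ (w t) = sgn (S.barPar t) • w t) {a : S.Aff}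
    (ha : a ∈ S.Pw w) : parityAut _ a ∈ S.Pw w := by
  rw [Pw_eq] at ha ⊢
  refine diffAlg_par ?_ ha
  rintro _ ⟨t, ht, rfl⟩
  exact ⟨_, hw t ht⟩

variable {S} in
theorem Pw_D (hw : ∀ t ∈ S.I \ S.J, parityAut _ (w t) = sgn (S.barPar t) • w t) {a : S.Aff}
    (ha : a ∈ S.Pw w) : S.D a ∈ S.Pw w := by
  rw [Pw_eq] at ha ⊢
  refine diffAlg_D ?_ ha
  rintro _ ⟨t, ht, rfl⟩
  exact ⟨_, hw t ht⟩

theorem Qw_mem : S.Qw w ∈ S.tens S.V (Subalgebra.toSubmodule (S.Pw w)) :=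
  Submodule.sum_mem _ fun t ht => S.tmul_mem_tens
    (Submodule.subset_span ⟨t, by exact_mod_cast ht, rfl⟩) (S.w_mem_Pw ht)

variable {S} in
theorem Qw_par (hw : ∀ t ∈ S.I \ S.J, parityAut _ (w t) = sgn (S.barPar t) • w t) :
    S.tParity (S.Qw w) = -S.Qw w := by
  rw [Qw, map_sum, ← Finset.sum_neg_distrib]
  refine Finset.sum_congr rfl fun t ht => ?_
  rw [S.tParity_pure (S.qUp_part t) (hw t ht), barPar, ← add_assoc,
    par_add_self, zero_add, sgn_one, neg_smul, one_smul]

theorem laxOpS_par (Q : S.GA) (hQ : S.tParity Q = -Q) :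
    S.𝓖.P (Laurent.single 0 Q + S.tensorOne S.Λ) = -(Laurent.single 0 Q + S.tensorOne S.Λ) := by
  rw [map_add, S.tensorOne_par S.Λ_par, P_single, hQ, sgn_one_smul, map_neg, neg_add]

variable {S} in
/-- The square of `D + Q + Λ` is `D² + Λ²` up to higher order. -/
theorem half_square_snd {Q : S.LGA} (hQ : S.𝓖.P Q = -Q) (hQF : Q ∈ S.𝓖.F (-S.i + 1)) :
    (S.toOp ((1 / 2 : ℂ) • S.laxBr (1, 0, Q + S.tensorOne S.Λ) (1, 0, Q + S.tensorOne S.Λ))).2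
      - S.Λ₂ ∈ S.𝓖.F (-(2 * S.i) + 1) := by
  have hP : S.lParity (Q + S.tensorOne S.Λ) = -(Q + S.tensorOne S.Λ) := by
    have h : S.𝓖.P (S.tensorOne S.Λ) = -S.tensorOne S.Λ := by
      rw [S.tensorOne_par S.Λ_par, sgn_one_smul]
    change S.𝓖.P (Q + S.tensorOne S.Λ) = _
    rw [map_add, hQ, h, neg_add]
  have e : (S.toOp ((1 / 2 : ℂ) • S.laxBr (1, 0, Q + S.tensorOne S.Λ)
      (1, 0, Q + S.tensorOne S.Λ))).2 - S.Λ₂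
      = S.lD Q + (1 / 2 : ℂ) • (S.𝓖.br Q Q + S.𝓖.br Q (S.tensorOne S.Λ)
        + S.𝓖.br (S.tensorOne S.Λ) Q) := by
    change (1 / 2 : ℂ) • (S.lBr (Q + S.tensorOne S.Λ) (Q + S.tensorOne S.Λ)
      + (1 : ℂ) • S.lD (Q + S.tensorOne S.Λ) - (1 : ℂ) • S.lD (S.lParity (Q + S.tensorOne S.Λ))
      + (0 : ℂ) • S.lD (S.lD (Q + S.tensorOne S.Λ))
      - (0 : ℂ) • S.lD (S.lD (Q + S.tensorOne S.Λ))) - S.Λ₂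
      = S.lD Q + (1 / 2 : ℂ) • (S.lBr Q Q + S.lBr Q (S.tensorOne S.Λ) + S.lBr (S.tensorOne S.Λ) Q)
    rw [hP, Λ₂_eq, map_neg, map_add S.lD, lD_tensorOne]
    simp only [map_add, LinearMap.add_apply]
    module
  rw [e]
  have hi := S.i_pos
  refine Submodule.add_mem _ (S.𝓖.mono (by linarith) (S.lD_FEnd _ _ hQF))
    (Submodule.smul_mem _ _ (Submodule.add_mem _ (Submodule.add_mem _ ?_ ?_) ?_))
  · exact S.𝓖.mono (by linarith) (S.𝓖.F_br _ _ _ hQF _ hQF)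
  · exact S.𝓖.mono (by linarith) (S.𝓖.F_br _ _ _ hQF _ S.tensorOne_Λ_mem)
  · exact S.𝓖.mono (by linarith) (S.𝓖.F_br _ _ _ S.tensorOne_Λ_mem _ hQF)

theorem Qw_F : (Laurent.single 0 (S.Qw w) : S.LGA) ∈ S.𝓖.F (-S.i + 1) :=
  S.single_mem_F (fun _ ha _ hl => S.pr_of_mem_𝔟 (S.V_le_𝔟 ha) hl) S.Qw_mem

variable {S} in
/-- Existence of the dressing: the decomposition `𝔤((z⁻¹)) = 𝒦 ⊕ im ad Λ²` gives the corrections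
degree by degree. -/
theorem exists_dress (hw : ∀ t ∈ S.I \ S.J, parityAut _ (w t) = sgn (S.barPar t) • w t) :
    ∃ T ∈ S.coefR (Subalgebra.toSubmodule (S.Pw w)) ⊓ S.imSub, ∃ hT : S.𝓖.Nil T,
      (FLie.E hT (S.toOp ((1 / 2 : ℂ) • S.laxBr (S.laxOpS (S.Qw w)) (S.laxOpS (S.Qw w))))).2 - S.Λ₂
        ∈ S.coefR (Subalgebra.toSubmodule (S.Pw w)) ⊓ S.kerSub := by
  set R := Subalgebra.toSubmodule (S.Pw w) with hR
  have hRp : ∀ u ∈ R, parityAut _ u ∈ R := fun u hu => Pw_par hw hu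
  have hQP : S.𝓖.P (Laurent.single 0 (S.Qw w)) = -Laurent.single 0 (S.Qw w) := by
    rw [P_single, Qw_par hw, map_neg]
  set x : S.LGA := Laurent.single 0 (S.Qw w) + S.tensorOne S.Λ with hx
  have hxP : S.𝓖.P x = -x := S.laxOpS_par _ (Qw_par hw)
  set A := S.toOp ((1 / 2 : ℂ) • S.laxBr (S.laxOpS (S.Qw w)) (S.laxOpS (S.Qw w))) with hA
  have hAeq : A = (1 / 2 : ℂ) • S.𝓖.obr 1 1 (S.toOp (1, 0, x)) (S.toOp (1, 0, x)) :=
    S.toOp_half_square hxP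
  have hAop : A ∈ S.𝓖.isOp 0 := by
    rw [hAeq]
    exact FLie.half_square_isOp (S.toOp_isOp hxP)
  have hAΛ : A.2 - S.Λ₂ ∈ S.𝓖.F (-(2 * S.i) + 1) := half_square_snd hQP S.Qw_F
  have hΛ0 : S.𝓖.P S.Λ₂ = sgn 0 • S.Λ₂ := by rw [Λ₂_par, sgn_zero, one_smul]
  have hxR : x ∈ S.coefR R := by
    refine Submodule.add_mem _ (fun n => ?_) (fun n => S.tmul_mem_tens Submodule.mem_top
      (S.Pw w).one_mem)
    rw [Laurent.single_coeff]
    split_ifs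
    · exact S.tens_le (fun a _ u hu => S.tmul_mem_tens Submodule.mem_top hu) S.Qw_mem
    · exact zero_mem _
  have hDR : ∀ y ∈ S.coefR R, S.lD y ∈ S.coefR R := fun y hy => by
    rw [lD_eq]
    exact S.coefR_lDer 1 (fun u hu => Pw_D hw hu) hy
  have hAR : A.2 ∈ S.coefR R := by
    rw [hAeq]
    change (1 / 2 : ℂ) • (S.𝓖.obr 1 1 (S.toOp (1, 0, x)) (S.toOp (1, 0, x))).2 ∈ S.coefR R
    rw [FLie.obr_snd, toOp_fst]
    exact Submodule.smul_mem _ _ (Submodule.add_mem _ (Submodule.sub_mem _ (hDR x hxR)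
      (Submodule.smul_mem _ _ (hDR x hxR))) (S.coefR_lBr hRp hxR hxR))
  have hcl : S.𝓖.IsClosed (S.coefR R) := S.isClosed_coeffSub _
  have hw1 : -(2 * S.i) ≤ -1 := by linarith [S.i_pos]
  have main : ∃ T ∈ S.coefR R ⊓ S.imSub ⊓ S.parSub 0, ∃ hT : S.𝓖.Nil T,
      (FLie.E hT A).2 - S.Λ₂ ∈ S.coefR R ⊓ S.kerSub ⊓ S.parSub 0 := by
    refine FLie.exists_normalForm (𝓖 := S.𝓖) (A := A) (Λ := S.Λ₂) hw1 S.Λ₂_mem hAΛ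
      (𝒴 := S.coefR R ⊓ S.parSub 0) (inf_le_inf_right _ inf_le_left)
      (fun t ht => by simpa using S.mem_parSub.1 ht.2)
      (Filt.IsClosed.inf (Filt.IsClosed.inf hcl S.isClosed_imSub) (FLie.isClosed_par 0))
      (Filt.IsClosed.inf (Filt.IsClosed.inf hcl S.isClosed_kerSub) (FLie.isClosed_par 0)) ?_ ?_
    · intro T hT𝒯 hT
      refine ⟨?_, S.mem_parSub.2 ?_⟩
      · refine Submodule.sub_mem _ (FLie.E_snd_mem hT hcl
          (fun y hy => S.coefR_lBr hRp hT𝒯.1.1 hy) ?_ hAR) fun n => S.tmul_mem_tens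
            Submodule.mem_top (S.Pw w).one_mem
        refine Submodule.sub_mem _ (S.coefR_lBr hRp hT𝒯.1.1 hAR) ?_
        rw [hAeq]
        change (1 / 2 : ℂ) • (S.𝓖.obr 1 1 (S.toOp (1, 0, x)) (S.toOp (1, 0, x))).1.1 T ∈ S.coefR R
        rw [FLie.obr_fst, toOp_fst]
        exact Submodule.smul_mem _ _ (Submodule.sub_mem _ (hDR _ (hDR _ hT𝒯.1.1))
          (Submodule.smul_mem _ _ (hDR _ (hDR _ hT𝒯.1.1))))
      · rw [map_sub, (FLie.E_isOp hT hAop).2, hΛ0, smul_sub]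
    · rintro k hk y ⟨hy, hyP⟩ hyF
      obtain ⟨v, hv, t, ht, h0⟩ := S.exists_dec hy (-(2 * S.i) + k)
      have h := S.normalForm_step hΛ0 S.Λ₂_deg (S.mem_parSub.1 hyP) hyF h0
      refine ⟨_, ⟨⟨?_, ?_⟩, ?_⟩, h.1, _, ⟨⟨?_, ?_⟩, ?_⟩, h.2⟩
      · exact S.coefR_parProj hRp _ (S.coefR_gc ht.1 _)
      · exact S.imSub_parProj _ (S.imSub_gc ht.2 _)
      · exact S.mem_parSub.2 (S.𝓖.P_parProj _ _)
      · exact S.coefR_parProj hRp _ (S.coefR_gc hv.1 _)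
      · exact S.kerSub_parProj _ (S.kerSub_gc hv.2 _)
      · exact S.mem_parSub.2 (S.𝓖.P_parProj _ _)
  obtain ⟨T, hT𝒯, hT, hT𝒱⟩ := main
  exact ⟨T, hT𝒯.1, hT, hT𝒱.1⟩

end Dress

/-- The canonical form and its dressing exist. -/
theorem nonempty_dressing : Nonempty S.Dressing := by
  obtain ⟨N, hN, v, hv, hNP, hvP, hgauge⟩ := S.exists_canonical
  let w : ι → S.Aff := fun t => S.coord S.qUp t v
  have hvw : v = S.Qw w := by
    rw [Qw]
    conv_lhs => rw [← S.sum_coord S.qUp v]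
    refine (Finset.sum_subset (Finset.subset_univ _) fun t _ ht => ?_).symm
    rw [S.coord_eq_zero S.qUp (A := ((S.I \ S.J : Finset ι) : Set ι)) (by exact_mod_cast ht) hv,
      TensorProduct.tmul_zero]
  have hw : ∀ t ∈ S.I \ S.J, parityAut _ (w t) = sgn (S.barPar t) • w t := by
    intro t _
    have h : ∀ x : S.GA, S.coord S.qUp t (S.tParity x)
        = sgn (S.par t) • parityAut _ (S.coord S.qUp t x) := fun x => by
      rw [← S.sum_coord S.qUp x]
      simp only [map_sum, tParity_tmul, S.gParity_of_mem (S.qUp_part _), ← TensorProduct.smul_tmul',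
        map_smul, coord_basis]
      rw [Finset.smul_sum]
      refine Finset.sum_congr rfl fun r _ => ?_
      split_ifs with hr
      · rw [hr]
      · simp
    have h1 := h v
    rw [hvP, map_neg] at h1
    have h2 := congrArg (sgn (S.par t) • ·) h1
    rw [smul_smul, sgn_mul_self, one_smul, smul_neg] at h2
    change parityAut _ (S.coord S.qUp t v) = sgn (S.par t + 1) • S.coord S.qUp t v
    rw [← h2, sgn_add, sgn_one, mul_neg_one, neg_smul]
  obtain ⟨T, hT𝒯, hT, hT𝒱⟩ := exists_dress hw
  refine ⟨⟨N, hN, hNP, w, fun t _ => S.coord_mem _ t hv, hw, by rwa [← hvw], T,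
    S.mem_lTens_im.2 hT𝒯, hT.1, S.mem_lPos.2 hT.2,
    (FLie.E hT (S.toOp ((1 / 2 : ℂ) • S.laxBr (S.laxOpS (S.Qw w)) (S.laxOpS (S.Qw w))))).2 - S.Λ₂,
    S.mem_lTens_ker.2 hT𝒱, (S.isExpAd_iff hT _ _).2 ⟨?_, ?_, ?_⟩,
    (FLie.E hT (S.toOp (S.laxOpS (S.Qw w)))).2 - S.tensorOne S.Λ,
    (S.isExpAd_iff hT _ _).2 ⟨rfl, rfl, ?_⟩⟩⟩
  · simp [laxBr, laxOpS]
  · simp [laxBr, laxOpS]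
  · rw [← Λ₂, sub_add_cancel]
  · rw [sub_add_cancel]

end DSData

/-! ### Brackets with a fixed left argument -/

section RevVal

variable {ι : Type*} {ε : ι → ZMod 2}

/-- The values `{a_χ u_j}` of the `χ`-bracket with brackets `c` on the variables, obtained from
`{u_j _χ a}` by skew-symmetry, for `a` of parity `p`. -/
def revVal (c : ι → ι → ℕ → DiffPoly ε) (p : ZMod 2) (a : DiffPoly ε) (j : ι) (k : ℕ) :
    DiffPoly ε :=
  sgn (p * ε j) • ∑ᶠ m : ℕ, (-1 : ℂ) ^ m •
    ((chiD ε ^ m) (Pi.single 0 (leibnizExt ε (ε j) (c j) m a))) k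

theorem revVal_zero_right (c : ι → ι → ℕ → DiffPoly ε) (p : ZMod 2) : revVal c p 0 = 0 := by
  funext j k
  rw [revVal, finsum_eq_zero_of_forall_eq_zero, smul_zero]
  · rfl
  · intro m
    rw [map_zero, Pi.single_zero, map_zero, Pi.zero_apply, smul_zero]

theorem chiBracket_eq_sum (c : ι → ι → ℕ → DiffPoly ε) (a b : DiffPoly ε) (n : ℕ) :
    chiBracket ε c a b n = ∑ p : ZMod 2, leibnizExt ε p (revVal c p (component _ p a)) n b := rfl

theorem chiBracket_of_isPar (c : ι → ι → ℕ → DiffPoly ε) {p : ZMod 2} {a : DiffPoly ε}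
    (ha : IsPar p a) (b : DiffPoly ε) (n : ℕ) :
    chiBracket ε c a b n = leibnizExt ε p (revVal c p a) n b := by
  rw [chiBracket_eq_sum, Finset.sum_eq_single p]
  · rw [ha.component_eq]
  · intro q _ hq
    rw [component_of_isPar ha, if_neg hq, revVal_zero_right, leibnizExt_zero, LinearMap.zero_apply]
  · exact fun h => absurd (Finset.mem_univ _) h

theorem chiBracket_eq_add (c : ι → ι → ℕ → DiffPoly ε) (a b : DiffPoly ε) (n : ℕ) :
    chiBracket ε c a b n
      = chiBracket ε c (component _ 0 a) b n + chiBracket ε c (component _ 1 a) b n := by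
  rw [chiBracket_of_isPar c (isPar_component 0 a), chiBracket_of_isPar c (isPar_component 1 a),
    chiBracket_eq_sum, sum_univ_zmod2]

theorem isPar_single {e : ZMod 2} {x : DiffPoly ε} (hx : IsPar e x) (i : ℕ) :
    IsPar (e + i) ((Pi.single 0 x : ℕ → DiffPoly ε) i) := by
  cases i with
  | zero => simpa using hx
  | succ i => simpa using isPar_zero _

theorem valPar_revVal (c : ι → ι → ℕ → DiffPoly ε) {p : ZMod 2} {a : DiffPoly ε}
    (ha : IsPar p a) : ValPar (p + 1) (revVal c p a) := by
  intro j k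
  refine IsPar.smul _ (finsum_induction _ (isPar_zero _) (fun _ _ h h' => h.add h') fun m =>
    IsPar.smul _ ?_)
  convert isPar_chiD_pow (isPar_single ((isSDer_leibnizExt (ε j) (c j) m).isPar ha)) m k using 1
  rw [show ε j + (m : ZMod 2) + 1 + p + m + k = p + 1 + ε j + k + (m + m) by ring, par_add_self,
    add_zero]

theorem revVal_coeff_zero (c : ι → ι → ℕ → DiffPoly ε) (p : ZMod 2) (a : DiffPoly ε) (j : ι) :
    revVal c p a j 0 = sgn (p * ε j) •
      ∑ᶠ m : ℕ, (-1 : ℂ) ^ m • (D ε ^ m) (leibnizExt ε (ε j) (c j) m a) := by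
  rw [revVal]
  congr 1
  exact finsum_congr fun m => by rw [chiD_pow_zero, Pi.single_eq_same]

end RevVal

namespace DSData

variable {𝔤 ι : Type*} [AddCommGroup 𝔤] [Module ℂ 𝔤] [Fintype ι] [DecidableEq ι]
  (S : DSData 𝔤 ι)

/-! ### The quotient by the ideal -/

/-- `x = ∑ (x|q_t) q^t`. -/
theorem qUp_repr (x : 𝔤) (t : ι) : S.qUp.repr x t = S.form x (S.qLow t) := by
  conv_rhs => rw [← S.qUp.sum_repr x]
  simp only [map_sum, map_smul, LinearMap.sum_apply, LinearMap.smul_apply, S.dual, smul_eq_mul,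
    mul_ite, mul_one, mul_zero, Finset.sum_ite_eq', Finset.mem_univ, if_true]

/-- `x = ∑ (q^t|x) q_t`. -/
theorem qLow_repr (x : 𝔤) (t : ι) : S.qLow.repr x t = S.form (S.qUp t) x := by
  conv_rhs => rw [← S.qLow.sum_repr x]
  simp only [map_sum, map_smul, S.dual, smul_eq_mul, mul_ite, mul_one, mul_zero, Finset.sum_ite_eq,
    Finset.mem_univ, if_true]

theorem form_mem_𝔟_qLow {x : 𝔤} (hx : x ∈ S.𝔟) {t : ι} (ht : t ∉ S.I) :
    S.form x (S.qLow t) = 0 := by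
  have h : S.𝔟 ≤ LinearMap.ker (S.form.flip (S.qLow t)) := by
    refine Submodule.span_le.2 ?_
    rintro _ ⟨r, hr, rfl⟩
    have hrt : r ≠ t := fun e => ht (e ▸ hr)
    simp [S.dual, hrt]
  exact h hx

theorem qLow_mem_𝔪 {t : ι} (ht : t ∉ S.I) : S.qLow t ∈ S.𝔪 := by
  by_contra h
  -- A functional vanishing on `𝔪` is `(x|·)` for some `x` in `𝔟`.
  obtain ⟨φ, hφ, hφ𝔪⟩ := Submodule.exists_dual_map_eq_bot_of_notMem h inferInstance
  let x : 𝔤 := ∑ r, φ (S.qLow r) • S.qUp r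
  have hx : ∀ y, S.form x y = φ y := by
    intro y
    conv_lhs => rw [← S.qLow.sum_repr y]
    conv_rhs => rw [← S.qLow.sum_repr y]
    simp only [map_sum, map_smul, x, LinearMap.sum_apply, LinearMap.smul_apply, S.dual]
    simp
  have hx𝔟 : x ∈ S.𝔟 := S.mem_𝔟.2 fun m hm => by
    rw [hx]
    have : φ m ∈ S.𝔪.map φ := ⟨m, hm, rfl⟩
    rwa [hφ𝔪, Submodule.mem_bot] at this
  exact hφ (by rw [← hx, S.form_mem_𝔟_qLow hx𝔟 ht])

theorem bar_qLow (t : ι) : S.bar (S.qLow t) = jet S.barPar t 0 := by simp [bar]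

theorem bar_eq (x : 𝔤) : S.bar x = ∑ t, S.form (S.qUp t) x • jet S.barPar t 0 := by
  conv_lhs => rw [← S.qLow.sum_repr x]
  simp only [map_sum, map_smul, bar_qLow, qLow_repr]

theorem isPar_bar {p : ZMod 2} {x : 𝔤} (hx : x ∈ S.part p) : IsPar (p + 1) (S.bar x) := by
  rw [bar_eq]
  refine IsPar.sum _ fun t _ => ?_
  by_cases h : S.par t = p
  · rw [← h]
    refine IsPar.smul _ ?_
    simpa [barPar] using isPar_jet (ε := S.barPar) t 0
  · rw [S.form_even _ _ h _ (S.qUp_part t) _ hx, zero_smul]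
    exact isPar_zero _

theorem component_bar (p : ZMod 2) (x : 𝔤) :
    component _ p (S.bar x) = S.bar (gradeComp S.internal (p + 1) x) := by
  conv_lhs => rw [← S.gradeComp_add x, map_add, map_add]
  rw [component_of_isPar (S.isPar_bar (gradeComp_mem S.internal 0 x)),
    component_of_isPar (S.isPar_bar (gradeComp_mem S.internal 1 x))]
  rcases zmod2_cases p with rfl | rfl <;> simp [show (1 + 1 : ZMod 2) = 0 by decide]

theorem reduce_jet (t : ι) (n : ℕ) : S.reduce (jet S.barPar t n) = S.reduceVal (t, n) :=
  lift_gen _ _ _ _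

theorem isPar_reduceVal (x : ι × ℕ) : IsPar (S.barPar x.1 + x.2) (S.reduceVal x) := by
  unfold reduceVal
  split_ifs with h h0
  · exact isPar_jet _ _
  · by_cases h1 : S.par x.1 = 1
    · rw [h0, barPar, h1]
      exact isPar_algebraMap _
    · rw [S.form_f_qLow _ h1, map_zero]
      exact isPar_zero _
  · exact isPar_zero _

theorem reduce_parityAut (a : S.Aff) : S.reduce (parityAut _ a) = parityAut _ (S.reduce a) := by
  induction a using SuperPoly.induction with
  | halg c => simp
  | hgen x =>
    rw [parityAut_gen, map_smul]
    exact (by rw [S.reduce_jet]; exact (S.isPar_reduceVal x).symm :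
      sgn _ • S.reduce (jet S.barPar x.1 x.2) = parityAut _ (S.reduce (jet S.barPar x.1 x.2)))
  | hmul a b ha hb => simp only [map_mul, ha, hb]
  | hadd a b ha hb => simp only [map_add, ha, hb]

theorem reduce_tw (p : ZMod 2) (a : S.Aff) : S.reduce (tw p a) = tw p (S.reduce a) := by
  rcases zmod2_cases p with rfl | rfl
  · simp [tw]
  · simpa [tw] using S.reduce_parityAut a

theorem D_jet' (t : ι) (n : ℕ) : S.D (jet S.barPar t n) = jet S.barPar t (n + 1) := D_jet t n

theorem reduce_D (a : S.Aff) : S.reduce (S.D a) = S.D (S.reduce a) := by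
  induction a using SuperPoly.induction with
  | halg c => rw [AlgHom.commutes, S.isSDer_D.algebraMap, map_zero]
  | hgen x =>
    change S.reduce (S.D (jet S.barPar x.1 x.2)) = S.D (S.reduce (jet S.barPar x.1 x.2))
    rw [D_jet', reduce_jet, reduce_jet, reduceVal, reduceVal]
    by_cases h : x.1 ∈ S.I
    · rw [if_pos h, if_pos h, D_jet']
    · rw [if_neg h, if_neg h, if_neg (Nat.succ_ne_zero _)]
      split_ifs
      · rw [S.isSDer_D.algebraMap]
      · rw [map_zero]
  | hmul a b ha hb =>
    rw [S.isSDer_D.leib, map_add, map_mul, map_mul, ha, hb, map_mul, S.isSDer_D.leib, reduce_tw]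
  | hadd a b ha hb => simp only [map_add, ha, hb]

theorem reduce_of_mem_P {a : S.Aff} (ha : a ∈ S.P) : S.reduce a = a := by
  induction ha using Algebra.adjoin_induction with
  | mem x hx =>
    obtain ⟨t, ht, n, rfl⟩ := hx
    rw [reduce_jet, reduceVal, if_pos ht]
  | algebraMap c => rw [AlgHom.commutes]
  | add a b _ _ ha hb => rw [map_add, ha, hb]
  | mul a b _ _ ha hb => rw [map_mul, ha, hb]

theorem reduce_mem_P (a : S.Aff) : S.reduce a ∈ S.P := by
  induction a using SuperPoly.induction with
  | halg c => rw [AlgHom.commutes]; exact S.P.algebraMap_mem c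
  | hgen x =>
    change S.reduce (jet S.barPar x.1 x.2) ∈ S.P
    rw [reduce_jet, reduceVal]
    split_ifs with h
    · exact S.jet_mem_P h _
    · exact S.P.algebraMap_mem _
    · exact S.P.zero_mem
  | hmul a b ha hb => rw [map_mul]; exact S.P.mul_mem ha hb
  | hadd a b ha hb => rw [map_add]; exact S.P.add_mem ha hb

/-- For `t ∈ I` the generator `u_t` is not affected by the reduction `\bar m ↦ (f|m)`: the vectors
`q^t`, `t ∈ I`, lie in `𝔟` and hence do not have the degree of `f`. -/
theorem form_f_qLow_of_mem {t : ι} (ht : t ∈ S.I) : S.form S.f (S.qLow t) = 0 := by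
  obtain ⟨k, hk⟩ := S.qUp_deg t
  have h1 : -S.i ≠ k := by
    intro e
    have h := S.pr_of_mem_𝔟 (Submodule.subset_span ⟨t, ht, rfl⟩) (show k < -S.i + 1 by omega)
    rw [S.gGr_of_mem hk, if_pos rfl] at h
    exact S.qUp.ne_zero t h
  rw [← S.qUp_repr]
  have h2 : ∀ x, S.qUp.repr (S.gGr.pr (-S.i) x) t = 0 := by
    intro x
    conv_lhs => rw [← S.qUp.sum_repr x]
    simp only [map_sum, map_smul, Finsupp.coe_finsetSum, Finset.sum_apply, Finsupp.smul_apply]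
    refine Finset.sum_eq_zero fun r _ => ?_
    obtain ⟨l, hl⟩ := S.qUp_deg r
    rw [S.gGr_of_mem hl]
    split_ifs with h
    · have hrt : r ≠ t := by
        rintro rfl
        have h3 := S.gGr_of_mem hl k
        rw [S.gGr_of_mem hk, if_pos rfl] at h3
        split_ifs at h3 with h4
        · exact h1 (by rw [h4, h])
        · exact S.qUp.ne_zero _ h3
      simp [hrt]
    · simp
  have h3 := h2 S.f
  rwa [S.gGr_of_mem S.f_deg, if_pos rfl] at h3

theorem reduce_bar (x : 𝔤) : S.reduce (S.bar x)
    = ∑ t ∈ S.I, S.form (S.qUp t) x • jet S.barPar t 0 + algebraMap ℂ _ (S.form S.f x) := by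
  have h : ∀ t, S.reduce (jet S.barPar t 0) = (if t ∈ S.I then jet S.barPar t 0 else 0)
      + algebraMap ℂ _ (S.form S.f (S.qLow t)) := by
    intro t
    rw [reduce_jet, reduceVal]
    split_ifs with ht
    · rw [S.form_f_qLow_of_mem ht, map_zero, add_zero]
    · rw [zero_add]
    · exact absurd rfl ‹¬ _›
  have h2 : S.form S.f x = ∑ t, S.form (S.qUp t) x * S.form S.f (S.qLow t) := by
    conv_lhs => rw [← S.qLow.sum_repr x]
    simp only [map_sum, map_smul, qLow_repr, smul_eq_mul]
  rw [bar_eq, h2, map_sum, map_sum, ← Finset.univ_inter S.I, ← Finset.sum_ite_mem,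
    ← Finset.sum_add_distrib]
  refine Finset.sum_congr rfl fun t _ => ?_
  rw [map_smul, h, smul_add, smul_ite, smul_zero, map_mul, Algebra.smul_def (S.form (S.qUp t) x)
    (algebraMap ℂ _ _)]

theorem reduce_of_mem_ideal {a : S.Aff} (ha : a ∈ S.ideal) : S.reduce a = 0 := by
  have h : S.ideal ≤ LinearMap.ker S.reduce.toLinearMap := by
    refine sInf_le ⟨?_, fun a x hx => ?_, fun x hx => ?_⟩
    · rintro _ ⟨m, hm, rfl⟩
      have h1 : ∀ t ∈ S.I, S.form (S.qUp t) m = 0 := fun t ht =>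
        S.mem_𝔟.1 (Submodule.subset_span ⟨t, ht, rfl⟩) m hm
      change S.reduce _ = 0
      rw [map_sub, reduce_bar, AlgHom.commutes, Finset.sum_eq_zero fun t ht => by
        rw [h1 t ht, zero_smul], zero_add, sub_self]
    · have h1 : S.reduce x = 0 := hx
      change S.reduce _ = 0 ∧ S.reduce _ = 0
      rw [map_mul, map_mul, h1]
      simp
    · have h1 : S.reduce x = 0 := hx
      change S.reduce (S.D x) = 0
      rw [reduce_D, h1, map_zero]
  exact h ha

/-- `reduce` is the quotient map: every element is congruent to its reduction. -/
theorem sub_reduce_mem_ideal (a : S.Aff) : a - S.reduce a ∈ S.ideal := by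
  rw [ideal, diffIdeal, Submodule.mem_sInf]
  rintro I ⟨h1, h2, h3⟩
  induction a using SuperPoly.induction with
  | halg c => rw [AlgHom.commutes, sub_self]; exact I.zero_mem
  | hgen x =>
    obtain ⟨t, n⟩ := x
    change jet S.barPar t n - S.reduce (jet S.barPar t n) ∈ I
    induction n with
    | zero =>
      rw [reduce_jet, reduceVal]
      split_ifs with h
      · rw [sub_self]; exact I.zero_mem
      · exact h1 ⟨_, S.qLow_mem_𝔪 h, by rw [bar_qLow]⟩
      · exact absurd rfl ‹¬ _›
    | succ n ih =>
      rw [← D_jet', reduce_D, ← map_sub]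
      exact h3 _ ih
  | hmul a b ha hb =>
    rw [map_mul, show a * b - S.reduce a * S.reduce b
      = (a - S.reduce a) * b + S.reduce a * (b - S.reduce b) by noncomm_ring]
    exact I.add_mem (h2 _ _ ha).2 (h2 _ _ hb).1
  | hadd a b ha hb =>
    rw [map_add, add_sub_add_comm]
    exact I.add_mem ha hb

/-- The ideal is the kernel of the projection onto `𝒫`. -/
theorem mem_ideal_iff {a : S.Aff} : a ∈ S.ideal ↔ S.reduce a = 0 :=
  ⟨S.reduce_of_mem_ideal, fun h => by simpa [h] using S.sub_reduce_mem_ideal a⟩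

theorem reduce_chiD (y : ℕ → S.Aff) (n : ℕ) :
    S.reduce (chiD S.barPar y n) = chiD S.barPar (fun m => S.reduce (y m)) n := by
  cases n with
  | zero => exact S.reduce_D _
  | succ n =>
    rw [chiD_succ, chiD_succ, map_add, map_smul, map_smul]
    congr 2
    exact S.reduce_D _

/-- The values on the variables `\bar q_t`, `t ∈ I`, reduced modulo the ideal. -/
def redVal (v : ι → ℕ → S.Aff) (t : ι) (n : ℕ) : S.Aff :=
  if t ∈ S.I then S.reduce (v t n) else 0

theorem IsPar_reduce {p : ZMod 2} {a : S.Aff} (ha : IsPar p a) : IsPar p (S.reduce a) := by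
  rw [IsPar, ← reduce_parityAut, ha, map_smul]

theorem valPar_redVal {π : ZMod 2} {v : ι → ℕ → S.Aff} (hv : ValPar π v) :
    ValPar π (S.redVal v) := by
  intro j i
  rw [redVal]
  split_ifs
  exacts [S.IsPar_reduce (hv j i), isPar_zero _]

/-- On `𝒫`, a bracket modulo the ideal is again given by the Leibniz rule. -/
theorem reduce_leibnizExt {p : ZMod 2} {v : ι → ℕ → S.Aff} (hv : ValPar (p + 1) v) {a : S.Aff}
    (ha : a ∈ S.P) (n : ℕ) :
    S.reduce (leibnizExt S.barPar p v n a) = leibnizExt S.barPar p (S.redVal v) n a := by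
  have h1 := isChiDer_leibnizExt hv
  have h2 := isChiDer_leibnizExt (S.valPar_redVal hv)
  induction ha using Algebra.adjoin_induction generalizing n with
  | mem x hx =>
    obtain ⟨t, ht, m, rfl⟩ := hx
    induction m generalizing n with
    | zero =>
      rw [leibnizExt_jet_zero hv, leibnizExt_jet_zero (S.valPar_redVal hv), redVal, if_pos ht]
    | succ m ih =>
      rw [← D_jet, h1.map_D, h2.map_D, map_smul, reduce_chiD, funext fun k => ih k]
  | algebraMap c =>
    rw [(h1.der n).algebraMap, (h2.der n).algebraMap, map_zero]
  | add a b _ _ ha hb => rw [map_add, map_add, map_add, ha, hb]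
  | mul a b ha' hb' ha hb =>
    rw [(h1.der n).leib, (h2.der n).leib, map_add, map_mul, map_mul, ha, hb, reduce_tw,
      S.reduce_of_mem_P ha', S.reduce_of_mem_P hb']

end DSData

namespace FLie

variable {M : Type*} [AddCommGroup M] [Module ℂ M] {𝓖 : FLie M} {T : M} (hT : 𝓖.Nil T)

/-! ### Subspaces and maps compatible with `e^{ad T}` -/

theorem E_zero_fst (x : M) : E hT (0, x) = (0, (E hT (0, x)).2) := Prod.ext (E_fst hT _) rfl

/-- A closed subspace contains everything that `e^{ad T}` maps into it. -/
theorem mem_of_E_mem {S : Submodule ℂ M} (hS : 𝓖.IsClosed S)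
    (hTS : ∀ x ∈ S, (E hT (0, x)).2 ∈ S) {x : M} (hx : (E hT (0, x)).2 ∈ S) : x ∈ S := by
  have key : ∀ (k : ℤ) (n : ℕ), x ∈ 𝓖.F k → ∃ y ∈ S, x - y ∈ 𝓖.F (k + n) := by
    intro k n hk
    induction n with
    | zero => exact ⟨0, S.zero_mem, by simpa using hk⟩
    | succ n ih =>
      obtain ⟨y, hy, hxy⟩ := ih
      have h1 := E_sub_mem hT (Filt.isClosed_F (𝓕 := 𝓖.toFilt) (k + n + 1)) (X := (0, x - y))
        (fun v hv => 𝓖.mono (by linarith) (𝓖.F_br 1 _ _ hT.2 _ hv)) (by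
          simpa [add_comm] using 𝓖.F_br 1 _ _ hT.2 _ hxy)
      have h2 : ((0, x - y) : 𝓖.Op) = (0, x) - (0, y) := by simp
      refine ⟨y + ((E hT (0, x)).2 - (E hT (0, y)).2),
        S.add_mem hy (S.sub_mem hx (hTS y hy)), ?_⟩
      have h3 : (E hT (0, x - y)).2 = (E hT (0, x)).2 - (E hT (0, y)).2 := by
        rw [h2, map_sub]; rfl
      have h4 := (𝓖.F _).neg_mem h1
      rw [h3] at h4
      have e : k + ((n + 1 : ℕ) : ℤ) = k + n + 1 := by push_cast; ring
      rw [e]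
      convert h4 using 1
      dsimp only
      abel
  obtain ⟨k, hk⟩ := 𝓖.exh x
  refine hS x fun l => ?_
  obtain ⟨y, hy, h⟩ := key k (l - k).toNat hk
  exact ⟨y, hy, 𝓖.mono (by linarith [Int.self_le_toNat (l - k)]) h⟩

/-- A map of bounded degree which commutes with `ad T` commutes with `e^{ad T}`. -/
theorem E_map (ψ : M →ₗ[ℂ] M) {c : ℤ} (hψ : ∀ k, ∀ v ∈ 𝓖.F k, ψ v ∈ 𝓖.F (k + c))
    (hψT : ∀ v, 𝓖.br T (ψ v) = ψ (𝓖.br T v)) (y : M) :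
    (E hT (0, ψ y)).2 = ψ (E hT (0, y)).2 := by
  let g : 𝓖.Op →ₗ[ℂ] 𝓖.Op := LinearMap.inr ℂ _ _ ∘ₗ ψ ∘ₗ LinearMap.snd ℂ _ _
  have hg : ∀ k, ∀ v ∈ 𝓖.opFilt.F k, g v ∈ 𝓖.opFilt.F (k + c) :=
    fun k v hv => ⟨hψ k _ hv.1, fun _ => rfl⟩
  have hpow : ∀ m : ℕ, (𝓖.adOp T ^ m) (g (0, y)) = g ((𝓖.adOp T ^ m) (0, y)) ∧
      ((𝓖.adOp T ^ m) (0, y)).1 = 0 := by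
    intro m
    induction m with
    | zero => exact ⟨rfl, rfl⟩
    | succ m ih =>
      rw [adOp_pow_succ, adOp_pow_succ, ih.1]
      refine ⟨Prod.ext (adOp_fst _ _) ?_, adOp_fst _ _⟩
      rw [adOp_snd]
      change 𝓖.br T (ψ _) - (0 : M →ₗ[ℂ] M) T = ψ (𝓖.adOp T _).2
      rw [adOp_snd, ih.2, hψT]
      simp
  have h1 := (Filt.hasExp_exp (𝓕 := 𝓖.opFilt) hT.raises (0, y)).map (𝓕₂ := 𝓖.opFilt) g hg
  have h2 := Filt.hasExp_exp (𝓕 := 𝓖.opFilt) hT.raises (g (0, y))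
  have h3 : (fun m => g (Filt.expTerm (𝓖.adOp T) (0, y) m))
      = Filt.expTerm (𝓖.adOp T) (g (0, y)) := by
    funext m
    rw [Filt.expTerm, Filt.expTerm, map_smul, (hpow m).1]
  rw [h3] at h1
  exact congrArg Prod.snd (Filt.HasSer.unique h2 h1)

end FLie

namespace DSData

variable {𝔤 ι : Type*} [AddCommGroup 𝔤] [Module ℂ 𝔤] [Fintype ι] [DecidableEq ι]
  (S : DSData 𝔤 ι)

/-! ### Superderivations of the coefficients as operators -/

theorem gtw_gtw (π ρ : ZMod 2) (a : 𝔤) : S.gtw π (S.gtw ρ a) = S.gtw (π + ρ) a := by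
  rcases zmod2_cases π with rfl | rfl <;> rcases zmod2_cases ρ with rfl | rfl <;>
    simp [gtw, par_add_self, gParity_gParity]

theorem gDer_gDer (π ρ : ZMod 2) (d e : S.Aff →ₗ[ℂ] S.Aff) (x : S.GA) :
    S.gDer π d (S.gDer ρ e x) = S.gDer (π + ρ) (d ∘ₗ e) x := by
  induction x using TensorProduct.induction_on with
  | zero => simp
  | tmul a u => rw [gDer_tmul, gDer_tmul, gDer_tmul, gtw_gtw]; rfl
  | add x y hx hy => simp only [map_add, hx, hy]

theorem gDer_add (π : ZMod 2) (d e : S.Aff →ₗ[ℂ] S.Aff) :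
    S.gDer π (d + e) = S.gDer π d + S.gDer π e := TensorProduct.map_add_right _ _ _

theorem gDer_smul (π : ZMod 2) (c : ℂ) (d : S.Aff →ₗ[ℂ] S.Aff) :
    S.gDer π (c • d) = c • S.gDer π d := TensorProduct.map_smul_right _ _ _

theorem lDer_coeff (π : ZMod 2) (d : S.Aff →ₗ[ℂ] S.Aff) (x : S.LGA) (n : ℤ) :
    (S.lDer π d x).1 n = S.gDer π d (x.1 n) := rfl

variable {S}

section Family

variable {π : ZMod 2} {d : S.Aff →ₗ[ℂ] S.Aff} {F : ℕ → S.Aff →ₗ[ℂ] S.Aff}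

theorem evol_comp_D (hd : IsEvol π d) : d ∘ₗ S.D = sgn π • S.D ∘ₗ d := LinearMap.ext hd.map_D

theorem chiDer_comp_D (hF : IsChiDer π F) (n : ℕ) : F (n + 1) ∘ₗ S.D
    = sgn (π + (n + 1 : ℕ)) • S.D ∘ₗ F (n + 1) + sgn (π + n) • F n :=
  LinearMap.ext fun b => hF.map_D_succ n b

theorem evol_gDer_D (hd : IsEvol π d) (x : S.GA) :
    S.gDer π d (S.gDer 1 S.D x) = sgn π • S.gDer 1 S.D (S.gDer π d x) := by
  rw [gDer_gDer, gDer_gDer, evol_comp_D hd, gDer_smul, add_comm, LinearMap.smul_apply]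

theorem chiDer_gDer_D (hF : IsChiDer π F) (n : ℕ) (x : S.GA) :
    S.gDer (π + (n + 1 : ℕ)) (F (n + 1)) (S.gDer 1 S.D x)
      = sgn (π + (n + 1 : ℕ)) • S.gDer 1 S.D (S.gDer (π + (n + 1 : ℕ)) (F (n + 1)) x)
        + sgn (π + n) • S.gDer (π + n) (F n) x := by
  rw [gDer_gDer, gDer_gDer, chiDer_comp_D hF, gDer_add, gDer_smul, gDer_smul, add_comm (1 : ZMod 2)]
  have h : π + ((n + 1 : ℕ) : ZMod 2) + 1 = π + n := by
    push_cast
    rw [show π + ((n : ZMod 2) + 1) + 1 = π + n + (1 + 1) by ring, par_add_self, add_zero]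
  rw [h]
  simp only [LinearMap.add_apply, LinearMap.smul_apply]

theorem evol_lDer_lD (hd : IsEvol π d) (x : S.LGA) :
    S.lDer π d (S.lD x) = sgn π • S.lD (S.lDer π d x) := by
  rw [lD_eq]
  exact Laurent.ext' fun n => evol_gDer_D hd _

theorem chiDer_lDer_lD (hF : IsChiDer π F) (n : ℕ) (x : S.LGA) :
    S.lDer (π + (n + 1 : ℕ)) (F (n + 1)) (S.lD x)
      = sgn (π + (n + 1 : ℕ)) • S.lD (S.lDer (π + (n + 1 : ℕ)) (F (n + 1)) x)
        + sgn (π + n) • S.lDer (π + n) (F n) x := by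
  rw [lD_eq]
  exact Laurent.ext' fun n => chiDer_gDer_D hF _ _

variable (S) in
/-- The operator `d + y`, where `d` acts on the coefficients. -/
def opOf (π : ZMod 2) (d : S.Aff →ₗ[ℂ] S.Aff) (y : S.LGA) : S.𝓖.Op :=
  (⟨S.lDer π d, S.lDer_FEnd π d⟩, y)

theorem opOf_isOp (hd : IsSDer π d) {y : S.LGA} (hy : S.𝓖.P y = sgn π • y) :
    S.opOf π d y ∈ S.𝓖.isOp π := ⟨S.lDer_der hd, hy⟩

theorem zero_isOp {y : S.LGA} (hy : S.𝓖.P y = sgn π • y) : ((0, y) : S.𝓖.Op) ∈ S.𝓖.isOp π :=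
  ⟨(S.𝓖.der π).zero_mem, hy⟩

theorem obr_evol_lax (hd : IsEvol π d) (y x : S.LGA) :
    S.𝓖.obr π 1 (S.opOf π d y) (S.toOp (1, 0, x))
      = (0, S.lDer π d x - sgn π • S.lD y + S.lBr y x) := by
  refine FLie.op_ext (fun v => ?_) ?_
  · rw [FLie.obr_fst, toOp_fst]
    change S.lDer π d (S.lD v) - sgn (π * 1) • S.lD (S.lDer π d v) = 0
    rw [evol_lDer_lD hd, mul_one, sub_self]
  · rw [FLie.obr_snd, toOp_fst, mul_one]
    rfl

theorem obr_chiDer_lax (hF : IsChiDer π F) (n : ℕ) (y x : S.LGA) :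
    S.𝓖.obr (π + (n + 1 : ℕ)) 1 (S.opOf (π + (n + 1 : ℕ)) (F (n + 1)) y) (S.toOp (1, 0, x))
      = sgn (π + n) • S.opOf (π + n) (F n) 0
        + (0, S.lDer (π + (n + 1 : ℕ)) (F (n + 1)) x - sgn (π + (n + 1 : ℕ)) • S.lD y
          + S.lBr y x) := by
  refine FLie.op_ext (fun v => ?_) ?_
  · rw [FLie.obr_fst, toOp_fst]
    change S.lDer (π + (n + 1 : ℕ)) (F (n + 1)) (S.lD v) - sgn ((π + (n + 1 : ℕ)) * 1) •
      S.lD (S.lDer (π + (n + 1 : ℕ)) (F (n + 1)) v) = sgn (π + n) • S.lDer (π + n) (F n) v + 0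
    rw [chiDer_lDer_lD hF, mul_one, add_sub_cancel_left, add_zero]
  · rw [FLie.obr_snd, toOp_fst, mul_one]
    change _ = sgn (π + n) • (0 : S.LGA) + _
    rw [smul_zero, zero_add]
    rfl

theorem obr_zero_lax {q : ZMod 2} (y x : S.LGA) : S.𝓖.obr q 1 (0, y) (S.toOp (1, 0, x))
    = (0, -(sgn q • S.lD y) + S.lBr y x) := by
  refine FLie.op_ext (fun v => ?_) ?_
  · rw [FLie.obr_fst]
    change (0 : S.LGA →ₗ[ℂ] S.LGA) _
      - sgn (q * 1) • (S.toOp (1, 0, x)).1.1 ((0 : S.LGA →ₗ[ℂ] S.LGA) v) = 0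
    simp
  · rw [FLie.obr_snd, toOp_fst, mul_one]
    change (0 : S.LGA →ₗ[ℂ] S.LGA) _ - _ + _ = _
    rw [LinearMap.zero_apply, zero_sub]
    rfl

/-- If the operators `F n a` vanish for large `n`, then `∑ F n` raises the filtration. -/
theorem eventually_lDer_mem (hF : ∀ a, ∃ N, ∀ n, N ≤ n → F n a = 0) (x : S.LGA) (k : ℤ)
    (π : ℕ → ZMod 2) : ∃ N, ∀ n, N ≤ n → S.lDer (π n) (F n) x ∈ S.𝓖.F k := by
  have hG : ∀ y : S.GA, ∃ N, ∀ n, N ≤ n → S.gDer (π n) (F n) y = 0 := by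
    intro y
    induction y using TensorProduct.induction_on with
    | zero => exact ⟨0, fun n _ => map_zero _⟩
    | tmul a u =>
      obtain ⟨N, hN⟩ := hF u
      exact ⟨N, fun n hn => by rw [gDer_tmul, hN n hn, TensorProduct.tmul_zero]⟩
    | add y y' h h' =>
      obtain ⟨N, hN⟩ := h
      obtain ⟨N', hN'⟩ := h'
      exact ⟨max N N', fun n hn => by
        rw [map_add, hN n (le_trans (le_max_left _ _) hn), hN' n (le_trans (le_max_right _ _) hn),
          add_zero]⟩
  choose N hN using hG
  obtain ⟨b, hb⟩ := x.2
  -- Only the coefficients of `z^m` with `-(d + |k|) ≤ m ≤ b` matter.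
  refine ⟨(Finset.Icc (-(S.d + |k|)) b).sup fun m => N (x.1 m), fun n hn => ?_⟩
  rw [𝓖_F, Grading.mem_filtF]
  intro m l hl
  rw [lDer_coeff]
  by_cases h1 : b < m
  · rw [hb m h1, map_zero, map_zero]
  by_cases h2 : m < -(S.d + |k|)
  · refine S.tGr.pr_range _ _ ?_
    have hd : S.tGr.d = S.d := rfl
    have h3 := S.ij_pos
    have h4 := le_abs_self k
    have h5 : (S.i + S.j) * m ≤ m := by
      have := S.d_pos
      have := abs_nonneg k
      nlinarith
    rw [hd]
    exact lt_of_lt_of_le (by linarith) (neg_le_abs l)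
  · rw [hN (x.1 m) n (le_trans (Finset.le_sup (f := fun m => N (x.1 m)) (Finset.mem_Icc.2
      ⟨not_lt.1 h2, not_lt.1 h1⟩)) hn), map_zero]

end Family

end DSData

/-! ### Uniqueness of the canonical form -/

theorem FLie.E_snd_injective {M : Type*} [AddCommGroup M] [Module ℂ M] {𝓖 : FLie M} {T : M}
    (hT : 𝓖.Nil T) {x : M} (h : (FLie.E hT (0, x)).2 = 0) : x = 0 :=
  congrArg Prod.snd (FLie.E_injective hT (X := (0, x)) (Prod.ext (FLie.E_fst hT _) h))

namespace DSData

variable {𝔤 ι : Type*} [AddCommGroup 𝔤] [Module ℂ 𝔤] [Fintype ι] [DecidableEq ι]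
  (S : DSData 𝔤 ι)

theorem con_mem {U : Submodule ℂ 𝔤} {R : Submodule ℂ S.Aff} (ℓ : S.Aff →ₗ[ℂ] ℂ) {x : S.GA}
    (hx : x ∈ S.tens U R) : S.con ℓ x ∈ U :=
  S.tens_le (Q := U.comap (S.con ℓ)) (fun a ha u _ => by
    rw [Submodule.mem_comap, con_tmul]
    exact U.smul_mem _ ha) hx

theorem tens_mono {U U' : Submodule ℂ 𝔤} {R R' : Submodule ℂ S.Aff} (hU : U ≤ U') (hR : R ≤ R') :
    S.tens U R ≤ S.tens U' R' := S.tens_le fun _ ha _ hu => S.tmul_mem_tens (hU ha) (hR hu)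

theorem coefR_mono {R R' : Submodule ℂ S.Aff} (h : R ≤ R') : S.coefR R ≤ S.coefR R' :=
  fun _ hx n => S.tens_mono le_rfl h (hx n)

theorem isClosed_coefR (R : Submodule ℂ S.Aff) : S.𝓖.IsClosed (S.coefR R) :=
  S.isClosed_coeffSub _

theorem tensorOne_mem_coefR (R : Subalgebra ℂ S.Aff) (x : Laurent 𝔤) :
    S.tensorOne x ∈ S.coefR (Subalgebra.toSubmodule R) :=
  fun _ => S.tmul_mem_tens Submodule.mem_top R.one_mem

theorem f_odd₁ : S.tParity (S.f ⊗ₜ (1 : S.Aff)) = sgn 1 • (S.f ⊗ₜ (1 : S.Aff)) := by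
  simpa using S.tParity_pure (q := 0) S.f_odd isPar_one

/-- The canonical form is unique: `ad f` maps `𝔫` to a complement of `V`. -/
theorem canonical_unique {q : ZMod 2} {d : S.Aff →ₗ[ℂ] S.Aff} {v y : S.GA}
    (hv : v ∈ S.tens S.V ⊤) (hy : y ∈ S.tens S.𝔫 ⊤) (hyP : S.tParity y = sgn q • y)
    (h : S.gDer q d v - sgn q • S.gDer 1 S.D y + S.gBr y (v + S.f ⊗ₜ 1) = 0) : y = 0 := by
  have hv𝔟 : ∀ l, l < -S.i + 1 → S.tGr.pr l v = 0 := fun l hl =>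
    S.tens_le (Q := LinearMap.ker (S.tGr.pr l)) (fun a ha u _ => by
      rw [LinearMap.mem_ker, tGr_tmul, S.pr_of_mem_𝔟 (S.V_le_𝔟 ha) hl, TensorProduct.zero_tmul]) hv
  have hf : S.tGr.pr (-S.i) (S.f ⊗ₜ (1 : S.Aff)) = S.f ⊗ₜ 1 := by
    rw [tGr_tmul, S.gGr_of_mem S.f_deg, if_pos rfl]
  have key : ∀ k : ℕ, ∀ l : ℤ, l < k + 1 → S.tGr.pr l y = 0 := by
    intro k
    induction k with
    | zero =>
      intro l hl
      exact S.tens_le (Q := LinearMap.ker (S.tGr.pr l)) (fun a ha u _ => by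
        rw [LinearMap.mem_ker, tGr_tmul, S.pr_of_mem_𝔫 ha (by simpa using hl),
          TensorProduct.zero_tmul]) hy
    | succ k ih =>
      intro l hl
      push_cast at hl
      rcases lt_or_eq_of_le (show l ≤ k + 1 by omega) with h1 | h1
      · exact ih l h1
      -- In degree `l - i` only `[y, f]` contributes besides `V`.
      have h2 := congrArg (S.tGr.pr (-S.i + l)) h
      rw [map_add, map_sub, map_smul, tGr_gDer, tGr_gDer, ih (-S.i + l) (by
        linarith [S.i_pos]), map_zero, smul_zero, sub_zero, map_add, map_add,
        S.isGr_gBr.pr_of_lt (α := k + 1) (β := -S.i + 1) (fun m hm => ih m hm) hv𝔟 (by linarith),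
        zero_add, S.gBr_skew hyP S.f_odd₁, map_neg, map_smul, S.isGr_gBr.pr_right hf, map_zero,
        add_neg_eq_zero] at h2
      refine S.eq_zero_of_con fun ℓ => ?_
      have h3 : S.br S.f (S.con ℓ (S.tGr.pr l y)) ∈ S.V := by
        rw [← con_gBr]
        refine S.con_mem (R := ⊤) ℓ ?_
        have h4 : S.gDer q d (S.tGr.pr (-S.i + l) v) ∈ S.tens S.V ⊤ :=
          S.tens_gDer (R := ⊤) (fun a ha p => S.span_qUp_part _ ha p) q
            (fun _ _ => Submodule.mem_top) (S.tens_pr (fun a ha k => S.span_qUp_deg _ ha k) _ hv)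
        rw [h2] at h4
        have h5 := (S.tens S.V ⊤).smul_mem (sgn (q * 1)) h4
        rwa [smul_smul, sgn_mul_self, one_smul] at h5
      exact S.V_inf h3 (S.con_mem (R := ⊤) ℓ (S.tens_pr (fun a ha k => S.𝔫_deg a ha k) _ hy)) rfl
  refine Grading.eq_zero (G := S.tGr) fun l => key l.toNat l ?_
  linarith [Int.self_le_toNat l]

/-! ### Gauge transformations -/

section Gauge

variable {π : ZMod 2} {F : ℕ → S.Aff →ₗ[ℂ] S.Aff} {n : 𝔤}

/-- A family of superderivations that acts on the universal Lax operator as an infinitesimal gauge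
transformation by `n`. -/
structure IsGauge (π : ZMod 2) (F : ℕ → S.Aff →ₗ[ℂ] S.Aff) (n : 𝔤) : Prop where
  mem : n ∈ S.𝔫
  par : n ∈ S.part π
  chiDer : IsChiDer π F
  act_zero : S.gDer π (F 0) S.Qu = -S.gBr (n ⊗ₜ 1) (S.Qu + S.f ⊗ₜ 1)
  act_one : S.gDer (π + 1) (F 1) S.Qu = sgn π • (n ⊗ₜ 1)
  act : ∀ k, 2 ≤ k → ∀ q, S.gDer q (F k) S.Qu = 0

/-- The part of degree `0` of the operator `X_k` attached to a gauge transformation. -/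
def gaugeElt (n : 𝔤) (k : ℕ) : S.GA := if k = 0 then n ⊗ₜ 1 else 0

variable {S} in
theorem gaugeElt_par (hn : n ∈ S.part π) (k : ℕ) :
    S.tParity (S.gaugeElt n k) = sgn (π + k) • S.gaugeElt n k := by
  unfold gaugeElt
  split_ifs with h
  · rw [h]
    simpa using S.tParity_pure hn (isPar_one (ε := fun x : ι × ℕ => S.barPar x.1 + (x.2 : ZMod 2)))
  · simp

end Gauge

/-! ### Conjugation by the dressing -/

namespace Dressing

variable {S} (R : S.Dressing)

theorem nilN : S.𝓖.Nil (Laurent.single 0 R.N) :=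
  ⟨by rw [P_single, R.N_even], S.single_mem_F (fun a ha l hl => S.pr_of_mem_𝔫 ha hl) R.N_mem⟩

theorem nilT : S.𝓖.Nil R.T := ⟨R.T_even, S.mem_lPos.1 R.T_pos⟩

/-- `e^{ad T} e^{ad N}`. -/
def conj : S.𝓖.Op →ₗ[ℂ] S.𝓖.Op := FLie.E R.nilT ∘ₗ FLie.E R.nilN

theorem conj_apply (X : S.𝓖.Op) : R.conj X = FLie.E R.nilT (FLie.E R.nilN X) := rfl

theorem conj_obr {p q : ZMod 2} {X Y : S.𝓖.Op} (hX : X ∈ S.𝓖.isOp p) (hY : Y ∈ S.𝓖.isOp q) :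
    R.conj (S.𝓖.obr p q X Y) = S.𝓖.obr p q (R.conj X) (R.conj Y) := by
  simp only [conj_apply]
  have h := FLie.E_obr R.nilN hX hY
  have h' := FLie.E_obr R.nilT (FLie.E_isOp R.nilN hX) (FLie.E_isOp R.nilN hY)
  rw [← h']
  exact congrArg (FLie.E R.nilT) h

theorem conj_fst (X : S.𝓖.Op) : (R.conj X).1 = X.1 := by
  rw [conj_apply, FLie.E_fst, FLie.E_fst]

theorem conj_injective {x : S.LGA} (h : (R.conj (0, x)).2 = 0) : x = 0 := by
  rw [conj_apply, FLie.E_zero_fst R.nilN] at h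
  exact FLie.E_snd_injective _ (FLie.E_snd_injective _ h)

theorem conj_isOp {p : ZMod 2} {X : S.𝓖.Op} (hX : X ∈ S.𝓖.isOp p) : R.conj X ∈ S.𝓖.isOp p := by
  rw [conj_apply]
  exact FLie.E_isOp _ (FLie.E_isOp _ hX)

theorem Pw_le_P : S.Pw R.w ≤ S.P := by
  refine Algebra.adjoin_le ?_
  rintro _ ⟨t, ht, n, rfl⟩
  induction n with
  | zero => exact R.w_mem t ht
  | succ n ih =>
    rw [pow_succ', Module.End.mul_apply]
    exact S.P_D ih

theorem N_coefR : Laurent.single 0 R.N ∈ S.coefR (Subalgebra.toSubmodule S.P) := fun n => by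
  rw [Laurent.single_coeff]
  split_ifs
  exacts [S.tens_mono le_top le_rfl R.N_mem, zero_mem _]

theorem T_coefR_Pw : R.T ∈ S.coefR (Subalgebra.toSubmodule (S.Pw R.w)) :=
  (S.mem_lTens_im.1 R.T_mem).1

theorem T_coefR : R.T ∈ S.coefR (Subalgebra.toSubmodule S.P) :=
  S.coefR_mono (fun _ h => R.Pw_le_P h) R.T_coefR_Pw

theorem E_N_lax : FLie.E R.nilN (S.toOp (S.laxOp S.Qu)) = S.toOp (S.laxOp (S.Qw R.w)) :=
  Prod.ext (FLie.E_fst _ _) ((S.isExpAd_iff R.nilN _ _).1 R.gauge).2.2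

theorem laxOpS_eq (Q : S.GA) : S.toOp (S.laxOpS Q)
    = S.toOp (S.laxOp Q) + (0, S.tensorOne (Laurent.single 1 S.s)) := by
  refine Prod.ext (by rw [Prod.fst_add, add_zero]; rfl) ?_
  change Laurent.single 0 Q + S.tensorOne (Laurent.single 0 S.f + Laurent.single 1 S.s)
    = Laurent.single 0 Q + S.tensorOne (Laurent.single 0 S.f) + S.tensorOne (Laurent.single 1 S.s)
  rw [map_add, add_assoc]

theorem br_𝔫_s {n : 𝔤} (hn : n ∈ S.𝔫) : S.br n S.s = 0 := by
  rw [← S.gradeComp_add n, map_add, LinearMap.add_apply]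
  have key : ∀ p, S.br (gradeComp S.internal p n) S.s = 0 := fun p => by
    rw [S.skew p 1 _ (gradeComp_mem _ _ _) _ S.s_odd, S.br_s _ (S.𝔫_part n hn p), smul_zero,
      neg_zero]
  rw [key, key, add_zero]

theorem tensorOne_single' (k : ℤ) (a : 𝔤) :
    S.tensorOne (Laurent.single k a) = Laurent.single k (a ⊗ₜ 1) := by
  refine Laurent.ext' fun n => ?_
  change ((Laurent.single k a).1 n) ⊗ₜ[ℂ] (1 : S.Aff) = _
  rw [Laurent.single_coeff, Laurent.single_coeff]
  split_ifs
  · rfl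
  · exact TensorProduct.zero_tmul _ _

theorem gBr_𝔫_s {n : S.GA} {A : Submodule ℂ S.Aff} (hn : n ∈ S.tens S.𝔫 A) :
    S.gBr n (S.s ⊗ₜ 1) = 0 :=
  S.tens_le (Q := LinearMap.ker (S.gBr.flip (S.s ⊗ₜ 1))) (fun a ha u _ => by
    rw [LinearMap.mem_ker, LinearMap.flip_apply, gBr, tensorExt_tmul,
      gradeComp_of_mem _ S.s_odd, gradeComp_of_mem _ S.s_odd]
    simp [br_𝔫_s ha]) hn

theorem conj_lax : R.conj (S.toOp (S.laxOpS S.Qu)) = S.toOp (1, 0, R.K + S.tensorOne S.Λ) := by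
  have h1 : FLie.E R.nilN (0, S.tensorOne (Laurent.single 1 S.s))
      = (0, S.tensorOne (Laurent.single 1 S.s)) := by
    refine FLie.E_of_eq_zero _ ?_
    change S.lBr _ _ = (0 : S.LGA →ₗ[ℂ] S.LGA) _
    rw [tensorOne_single', lBr, Laurent.conv_single_left', LinearMap.zero_apply]
    refine Laurent.ext' fun n => ?_
    rw [Laurent.shift_coeff, Laurent.map_coeff, Laurent.single_coeff]
    split_ifs
    · exact gBr_𝔫_s R.N_mem
    · exact map_zero _
  rw [conj_apply, laxOpS_eq, map_add, E_N_lax, h1, ← laxOpS_eq]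
  exact Prod.ext (FLie.E_fst _ _) ((S.isExpAd_iff R.nilT _ _).1 R.dress).2.2

theorem K_coefR : R.K ∈ S.coefR (Subalgebra.toSubmodule (S.Pw R.w)) := by
  have h := ((S.isExpAd_iff R.nilT _ _).1 R.dress).2.2
  have hp : ∀ u ∈ S.Pw R.w, parityAut _ u ∈ S.Pw R.w := fun u hu => Pw_par R.w_parity hu
  have hx : (S.toOp (S.laxOpS (S.Qw R.w))).2 ∈ S.coefR (Subalgebra.toSubmodule (S.Pw R.w)) := by
    refine Submodule.add_mem _ (fun n => ?_) (S.tensorOne_mem_coefR _ _)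
    rw [Laurent.single_coeff]
    split_ifs
    · exact S.tens_mono le_top le_rfl S.Qw_mem
    · exact zero_mem _
  have h2 := FLie.E_snd_mem R.nilT (S.isClosed_coefR (Subalgebra.toSubmodule (S.Pw R.w)))
    (X := S.toOp (S.laxOpS (S.Qw R.w)))
    (fun y hy => S.coefR_lBr hp R.T_coefR_Pw hy)
    (Submodule.sub_mem _ (S.coefR_lBr hp R.T_coefR_Pw hx) (by
      change (S.toOp (1, 0, _)).1.1 _ ∈ _
      rw [toOp_fst, lD_eq]
      exact S.coefR_lDer 1 (fun u hu => Pw_D R.w_parity hu) R.T_coefR_Pw)) hx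
  rw [h] at h2
  have h3 := Submodule.sub_mem _ h2 (S.tensorOne_mem_coefR (S.Pw R.w) S.Λ)
  rwa [add_sub_cancel_right] at h3

theorem laxOpS_isOp : S.toOp (S.laxOpS S.Qu) ∈ S.𝓖.isOp 1 :=
  S.toOp_isOp (S.laxOpS_par _ S.Qu_par)

theorem K_par : S.𝓖.P R.K = -R.K := by
  have h := (R.conj_isOp laxOpS_isOp).2
  rw [conj_lax] at h
  change S.𝓖.P (R.K + S.tensorOne S.Λ) = sgn 1 • (R.K + S.tensorOne S.Λ) at h
  rw [map_add, S.tensorOne_par S.Λ_par, smul_add, add_left_inj, sgn_one_smul] at h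
  exact h

end Dressing

end DSData

namespace DSData

variable {𝔤 ι : Type*} [AddCommGroup 𝔤] [Module ℂ 𝔤] [Fintype ι] [DecidableEq ι]
  {S : DSData 𝔤 ι}

/-! ### Gauge invariance of the dressing -/

theorem gDer_tmul_one {q : ZMod 2} {d : S.Aff →ₗ[ℂ] S.Aff} (hd : IsSDer q d) (π : ZMod 2) (a : 𝔤) :
    S.gDer π d (a ⊗ₜ 1) = 0 := by
  rw [gDer_tmul, hd.one, TensorProduct.tmul_zero]

theorem single_injective {a b : S.GA} (h : (Laurent.single 0 a : S.LGA) = Laurent.single 0 b) :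
    a = b := by
  simpa using congrArg (fun y => y.1 0) h

theorem toOp_laxOp (Q : S.GA) :
    S.toOp (S.laxOp Q) = S.toOp (1, 0, Laurent.single 0 (Q + S.f ⊗ₜ 1)) := by
  rw [laxOp, tensorOne_single, map_add]

theorem lD_single (a : S.GA) : S.lD (Laurent.single 0 a) = Laurent.single 0 (S.gDer 1 S.D a) := by
  rw [lD_eq, lDer_single]

variable (S) in
/-- The operators `X_0 = 𝔡_0 + n` and `X_k = 𝔡_k`, `k > 0`, where the superderivations `𝔡_k` act on
the coefficients. -/
def gaugeOp (π : ZMod 2) (F : ℕ → S.Aff →ₗ[ℂ] S.Aff) (n : 𝔤) (k : ℕ) : S.𝓖.Op :=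
  S.opOf (π + k) (F k) (Laurent.single 0 (S.gaugeElt n k))

theorem gaugeOp_zero (π : ZMod 2) (F : ℕ → S.Aff →ₗ[ℂ] S.Aff) (n : 𝔤) :
    S.gaugeOp π F n 0 = S.opOf π (F 0) (Laurent.single 0 (n ⊗ₜ 1)) := by
  simp [gaugeOp, gaugeElt]

theorem gaugeOp_succ (π : ZMod 2) (F : ℕ → S.Aff →ₗ[ℂ] S.Aff) (n : 𝔤) (k : ℕ) :
    S.gaugeOp π F n (k + 1) = S.opOf (π + (k + 1 : ℕ)) (F (k + 1)) 0 := by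
  simp [gaugeOp, gaugeElt]

variable {π : ZMod 2} {F : ℕ → S.Aff →ₗ[ℂ] S.Aff} {n : 𝔤}

namespace IsGauge

theorem gaugeOp_isOp (h : S.IsGauge π F n) (k : ℕ) : S.gaugeOp π F n k ∈ S.𝓖.isOp (π + k) :=
  opOf_isOp (h.chiDer.der k) (by rw [P_single, gaugeElt_par h.par, map_smul])

theorem obr_gaugeOp_zero (h : S.IsGauge π F n) :
    S.𝓖.obr π 1 (S.gaugeOp π F n 0) (S.toOp (S.laxOp S.Qu)) = 0 := by
  have h1 := obr_evol_lax h.chiDer.isEvol (Laurent.single 0 (n ⊗ₜ 1))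
    (Laurent.single 0 (S.Qu + S.f ⊗ₜ 1))
  have h2 : S.lDer π (F 0) (Laurent.single 0 (S.Qu + S.f ⊗ₜ 1))
      - sgn π • S.lD (Laurent.single 0 (n ⊗ₜ 1))
      + S.lBr (Laurent.single 0 (n ⊗ₜ 1)) (Laurent.single 0 (S.Qu + S.f ⊗ₜ 1)) = 0 := by
    rw [lDer_single, lD_single, lBr_single, map_add, gDer_tmul_one h.chiDer.isEvol.der,
      gDer_tmul_one S.isSDer_D, map_zero, smul_zero, sub_zero, add_zero, h.act_zero, map_neg,
      neg_add_cancel]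
  exact (congrArg₂ (fun X Y => S.𝓖.obr π 1 X Y) (gaugeOp_zero π F n) (toOp_laxOp _)).trans
    (h1.trans (congrArg (Prod.mk 0) h2))

theorem obr_gaugeOp_succ (h : S.IsGauge π F n) (k : ℕ) :
    S.𝓖.obr (π + (k + 1 : ℕ)) 1 (S.gaugeOp π F n (k + 1)) (S.toOp (S.laxOp S.Qu))
      = sgn (π + k) • S.gaugeOp π F n k := by
  have h1 := obr_chiDer_lax h.chiDer k 0 (Laurent.single 0 (S.Qu + S.f ⊗ₜ 1))
  have h2 : S.gDer (π + (k + 1 : ℕ)) (F (k + 1)) S.Qu = sgn (π + k) • S.gaugeElt n k := by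
    rw [gaugeElt]
    split_ifs with hk
    · subst hk
      simpa using h.act_one
    · rw [h.act _ (by omega), smul_zero]
  have h3 : S.lDer (π + (k + 1 : ℕ)) (F (k + 1)) (Laurent.single 0 (S.Qu + S.f ⊗ₜ 1))
      - sgn (π + (k + 1 : ℕ)) • S.lD 0 + S.lBr 0 (Laurent.single 0 (S.Qu + S.f ⊗ₜ 1))
      = sgn (π + k) • Laurent.single 0 (S.gaugeElt n k) := by
    rw [lDer_single, map_add, gDer_tmul_one (h.chiDer.der _), map_zero, smul_zero, map_zero,
      LinearMap.zero_apply, add_zero, sub_zero, add_zero, h2, map_smul]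
  refine (congrArg₂ (fun X Y => S.𝓖.obr _ 1 X Y) (gaugeOp_succ π F n k) (toOp_laxOp _)).trans
    (h1.trans (Prod.ext ?_ ?_))
  · rw [Prod.fst_add, add_zero]
    rfl
  · rw [Prod.snd_add]
    change sgn (π + k) • (0 : S.LGA) + _ = sgn (π + k) • Laurent.single 0 (S.gaugeElt n k)
    rw [smul_zero, zero_add]
    exact h3

end IsGauge

namespace Dressing

variable (R : S.Dressing)

theorem E_N_mem {q : ZMod 2} {d : S.Aff →ₗ[ℂ] S.Aff} {a : S.GA} (ha : a ∈ S.tens S.𝔫 ⊤) :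
    ∃ y ∈ S.tens S.𝔫 ⊤, FLie.E R.nilN (S.opOf q d (Laurent.single 0 a))
      = S.opOf q d (Laurent.single 0 y) := by
  have hN : R.N ∈ S.tens S.𝔫 (Subalgebra.toSubmodule (⊤ : Subalgebra ℂ S.Aff)) :=
    by
    rw [Algebra.top_toSubmodule]
    exact S.tens_mono le_rfl le_top R.N_mem
  have htop : (Subalgebra.toSubmodule (⊤ : Subalgebra ℂ S.Aff)) = ⊤ := Algebra.top_toSubmodule
  have hbr : ∀ b ∈ S.tens S.𝔫 ⊤, S.gBr R.N b ∈ S.tens S.𝔫 ⊤ := by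
    intro b hb
    rw [← htop] at hb ⊢
    exact S.gBr_mem_tens S.𝔫_part (fun _ _ => Algebra.mem_top) S.𝔫_br hN hb
  have h := FLie.E_snd_mem R.nilN (S := S.constSub (S.tens S.𝔫 ⊤)) (S.isClosed_coeffSub _)
    (X := S.opOf q d (Laurent.single 0 a)) (fun x hx => by
      obtain ⟨b, hb, rfl⟩ := mem_constSub.1 hx
      exact mem_constSub.2 ⟨_, hbr b hb, S.lBr_single _ _⟩) (by
      refine Submodule.sub_mem _ (mem_constSub.2 ⟨_, hbr a ha, S.lBr_single _ _⟩) ?_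
      refine mem_constSub.2 ⟨_, ?_, S.lDer_single q d R.N⟩
      exact S.tens_gDer S.𝔫_part q (fun _ _ => Submodule.mem_top) hN) (mem_constSub.2 ⟨a, ha, rfl⟩)
  obtain ⟨y, hy, hy'⟩ := mem_constSub.1 h
  exact ⟨y, hy, Prod.ext (FLie.E_fst _ _) hy'⟩

theorem gaugeElt_mem (hn : n ∈ S.𝔫) (k : ℕ) : S.gaugeElt n k ∈ S.tens S.𝔫 ⊤ := by
  rw [gaugeElt]
  split_ifs
  exacts [S.tmul_mem_tens hn Submodule.mem_top, zero_mem _]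

theorem Qw_mem' (w : ι → S.Aff) : S.Qw w ∈ S.tens S.V ⊤ :=
  S.tens_mono le_rfl le_top (S.Qw_mem (w := w))

/-- The transformation to canonical form absorbs gauge transformations, by uniqueness of the
canonical form. -/
theorem E_N_gaugeOp (h : S.IsGauge π F n) (k : ℕ) :
    FLie.E R.nilN (S.gaugeOp π F n k) = S.opOf (π + k) (F k) 0 ∧
      S.gDer (π + k) (F k) (S.Qw R.w) = 0 := by
  -- The transform of `X_k` is `𝔡_k + y` with `y ∈ 𝔫 ⊗ 𝒫`; `y = 0` by uniqueness, once it is known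
  -- to commute with the canonical Lax operator.
  have key : ∀ k : ℕ, (∀ y, FLie.E R.nilN (S.gaugeOp π F n k)
      = S.opOf (π + k) (F k) (Laurent.single 0 y) → S.gDer (π + k) (F k) (S.Qw R.w)
        - sgn (π + k) • S.gDer 1 S.D y + S.gBr y (S.Qw R.w + S.f ⊗ₜ 1) = 0) →
      FLie.E R.nilN (S.gaugeOp π F n k) = S.opOf (π + k) (F k) 0 ∧
        S.gDer (π + k) (F k) (S.Qw R.w) = 0 := by
    intro k hk
    obtain ⟨y, hy, hE⟩ := R.E_N_mem (q := π + k) (d := F k) (gaugeElt_mem h.mem k)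
    have h1 := hk y hE
    have hyP : S.tParity y = sgn (π + k) • y := by
      have h2 := (FLie.E_isOp R.nilN (h.gaugeOp_isOp k)).2
      rw [gaugeOp, hE] at h2
      change S.𝓖.P (Laurent.single 0 y) = sgn (π + k) • Laurent.single 0 y at h2
      rw [P_single, ← map_smul] at h2
      exact single_injective h2
    have hy0 := S.canonical_unique (Qw_mem' _) hy hyP h1
    rw [hy0, map_zero] at hE
    rw [hy0, map_zero, smul_zero, map_zero, LinearMap.zero_apply, sub_zero, add_zero] at h1
    exact ⟨hE, h1⟩
  have hL : S.toOp (S.laxOp S.Qu) ∈ S.𝓖.isOp 1 := S.toOp_isOp (S.laxOp_par _ S.Qu_par)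
  induction k with
  | zero =>
    refine key 0 fun y hy => ?_
    rw [Nat.cast_zero, add_zero] at hy ⊢
    have h0 := h.gaugeOp_isOp 0
    rw [Nat.cast_zero, add_zero] at h0
    have h1 := (FLie.E_obr R.nilN h0 hL).symm.trans
      ((congrArg (FLie.E R.nilN) h.obr_gaugeOp_zero).trans (map_zero _))
    have e := congrArg₂ (fun X Y => S.𝓖.obr π 1 X Y) hy (R.E_N_lax.trans (toOp_laxOp _))
    have h2 : S.lDer π (F 0) (Laurent.single 0 (S.Qw R.w + S.f ⊗ₜ 1))
      - sgn π • S.lD (Laurent.single 0 y)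
      + S.lBr (Laurent.single 0 y) (Laurent.single 0 (S.Qw R.w + S.f ⊗ₜ 1)) = 0 :=
      congrArg Prod.snd ((obr_evol_lax h.chiDer.isEvol _ _).symm.trans (e.symm.trans h1))
    rw [lDer_single, lD_single, lBr_single, ← map_smul, ← map_sub, ← map_add,
      ← map_zero (Laurent.single 0)] at h2
    have h3 := single_injective h2
    rwa [map_add, gDer_tmul_one h.chiDer.isEvol.der, add_zero] at h3
  | succ k ih =>
    refine key (k + 1) fun y hy => ?_
    have h1 := (FLie.E_obr R.nilN (h.gaugeOp_isOp (k + 1)) hL).symm.trans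
      ((congrArg (FLie.E R.nilN) (h.obr_gaugeOp_succ k)).trans
        ((map_smul _ _ _).trans (congrArg (sgn (π + k) • ·) ih.1)))
    have e := congrArg₂ (fun X Y => S.𝓖.obr (π + (k + 1 : ℕ)) 1 X Y) hy
      (R.E_N_lax.trans (toOp_laxOp _))
    have h2 := congrArg Prod.snd
      ((obr_chiDer_lax h.chiDer k _ _).symm.trans (e.symm.trans h1))
    rw [Prod.snd_add] at h2
    have h2' : S.lDer (π + (k + 1 : ℕ)) (F (k + 1)) (Laurent.single 0 (S.Qw R.w + S.f ⊗ₜ 1))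
      - sgn (π + (k + 1 : ℕ)) • S.lD (Laurent.single 0 y)
      + S.lBr (Laurent.single 0 y) (Laurent.single 0 (S.Qw R.w + S.f ⊗ₜ 1)) = 0 :=
      add_eq_left.1 h2
    rw [lDer_single, lD_single, lBr_single, ← map_smul, ← map_sub, ← map_add,
      ← map_zero (Laurent.single 0)] at h2'
    have h3 := single_injective h2'
    rwa [map_add, gDer_tmul_one (h.chiDer.der _), add_zero] at h3

theorem gauge_w (h : S.IsGauge π F n) (k : ℕ) {t : ι} (ht : t ∈ S.I \ S.J) : F k (R.w t) = 0 := by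
  have h1 := congrArg (S.coord S.qUp t) (R.E_N_gaugeOp h k).2
  rw [Qw, map_sum, map_sum, map_zero] at h1
  have h2 : ∀ r, S.coord S.qUp t (S.gDer (π + k) (F k) (S.qUp r ⊗ₜ R.w r))
      = if r = t then sgn ((π + k) * S.par r) • F k (R.w r) else 0 := fun r => by
    rw [S.gDer_pure _ _ (S.qUp_part r), map_smul, coord_basis]
    split_ifs <;> simp
  simp only [h2, Finset.sum_ite_eq', if_pos ht] at h1
  have h3 := congrArg (sgn ((π + k) * S.par t) • ·) h1
  simpa only [smul_smul, sgn_mul_self, one_smul, smul_zero] using h3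

theorem gauge_Pw (h : S.IsGauge π F n) (k : ℕ) {a : S.Aff} (ha : a ∈ S.Pw R.w) : F k a = 0 := by
  rw [Pw_eq] at ha
  refine h.chiDer.eqOn (IsChiDer.zero π) ?_ ha k
  rintro _ ⟨t, ht, rfl⟩ k
  exact R.gauge_w h k ht

theorem lDer_eq_zero {q : ZMod 2} {d : S.Aff →ₗ[ℂ] S.Aff} {A : Submodule ℂ S.Aff}
    (hd : ∀ a ∈ A, d a = 0) {x : S.LGA} (hx : x ∈ S.coefR A) : S.lDer q d x = 0 :=
  Laurent.ext' fun m => S.tens_le (Q := LinearMap.ker (S.gDer q d)) (fun a _ u hu => by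
    rw [LinearMap.mem_ker, gDer_tmul, hd u hu, TensorProduct.tmul_zero]) (hx m)

theorem conj_gaugeOp (h : S.IsGauge π F n) (k : ℕ) :
    R.conj (S.gaugeOp π F n k) = S.opOf (π + k) (F k) 0 := by
  rw [conj_apply, (R.E_N_gaugeOp h k).1]
  refine FLie.E_of_eq_zero R.nilT ?_
  change S.𝓖.br R.T 0 = S.lDer _ (F k) R.T
  rw [lDer_eq_zero (fun a ha => R.gauge_Pw h k ha) R.T_coefR_Pw, map_zero]

/-! ### The resolvents -/

theorem exists_res (C : Laurent 𝔤) : ∃ x : S.LGA, R.conj (0, x) = (0, S.tensorOne C) := by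
  obtain ⟨y, hy⟩ := FLie.E_surjective_snd R.nilT (S.tensorOne C)
  obtain ⟨x, hx⟩ := FLie.E_surjective_snd R.nilN y
  exact ⟨x, by rw [conj_apply, hx, hy]⟩

/-- The resolvent `e^{-ad N} e^{-ad T} (C ⊗ 1)`. -/
def res (C : Laurent 𝔤) : S.LGA := (R.exists_res C).choose

theorem conj_res (C : Laurent 𝔤) : R.conj (0, R.res C) = (0, S.tensorOne C) :=
  (R.exists_res C).choose_spec

theorem conj_map (ψ : S.LGA →ₗ[ℂ] S.LGA) {c : ℤ} (hψ : ∀ k, ∀ v ∈ S.𝓖.F k, ψ v ∈ S.𝓖.F (k + c))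
    (hψT : ∀ T v, S.lBr T (ψ v) = ψ (S.lBr T v)) (y : S.LGA) :
    (R.conj (0, ψ y)).2 = ψ (R.conj (0, y)).2 := by
  rw [conj_apply, conj_apply, FLie.E_zero_fst R.nilN, FLie.E_zero_fst R.nilN y,
    FLie.E_map R.nilN ψ hψ (hψT _), FLie.E_map R.nilT ψ hψ (hψT _)]

theorem res_eq {C : Laurent 𝔤} {x : S.LGA} (h : (R.conj (0, x)).2 = S.tensorOne C) :
    R.res C = x := by
  rw [← sub_eq_zero]
  refine R.conj_injective ?_
  have h1 : ((0, R.res C - x) : S.𝓖.Op) = (0, R.res C) - (0, x) := by simp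
  rw [h1, map_sub, conj_res]
  change S.tensorOne C - (R.conj (0, x)).2 = 0
  rw [h, sub_self]

theorem tensorOne_zMul (C : Laurent 𝔤) :
    S.tensorOne (Laurent.zMul C) = Laurent.shift 1 (S.tensorOne C) := rfl

theorem res_zMul (C : Laurent 𝔤) : R.res (Laurent.zMul C) = Laurent.shift 1 (R.res C) := by
  refine R.res_eq ?_
  rw [R.conj_map (Laurent.shift 1) (c := -(S.i + S.j)) (fun k v hv => ?_) (fun T v => ?_),
    conj_res, tensorOne_zMul]
  · rw [𝓖_F, Grading.mem_filtF] at hv ⊢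
    intro m l hl
    rw [Laurent.shift_coeff]
    exact hv _ _ (by linarith)
  · exact Laurent.conv_shift_right _ _ _ _

theorem mem_of_conj_mem {A : Submodule ℂ S.LGA} (hA : S.𝓖.IsClosed A)
    (hN : ∀ x ∈ A, (FLie.E R.nilN (0, x)).2 ∈ A) (hT : ∀ x ∈ A, (FLie.E R.nilT (0, x)).2 ∈ A)
    {x : S.LGA} (hx : (R.conj (0, x)).2 ∈ A) : x ∈ A := by
  rw [conj_apply, FLie.E_zero_fst R.nilN] at hx
  exact FLie.mem_of_E_mem R.nilN hA hN (FLie.mem_of_E_mem R.nilT hA hT hx)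

theorem res_par {p : ZMod 2} {C : Laurent 𝔤} (hC : S.HasParity p C) :
    S.𝓖.P (R.res C) = sgn p • R.res C := by
  refine S.mem_parSub.1 (R.mem_of_conj_mem (FLie.isClosed_par p) ?_ ?_ ?_)
  · exact fun x hx => S.mem_parSub.2 (FLie.E_isOp R.nilN (zero_isOp (S.mem_parSub.1 hx))).2
  · exact fun x hx => S.mem_parSub.2 (FLie.E_isOp R.nilT (zero_isOp (S.mem_parSub.1 hx))).2
  · rw [conj_res]
    exact S.mem_parSub.2 (S.tensorOne_par hC)

theorem res_coefR (C : Laurent 𝔤) : R.res C ∈ S.coefR (Subalgebra.toSubmodule S.P) := by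
  have key : ∀ {T : S.LGA} (hT : S.𝓖.Nil T), T ∈ S.coefR (Subalgebra.toSubmodule S.P) →
      ∀ x ∈ S.coefR (Subalgebra.toSubmodule S.P),
        (FLie.E hT (0, x)).2 ∈ S.coefR (Subalgebra.toSubmodule S.P) := by
    intro T hT hTP x hx
    refine FLie.E_snd_mem hT (S.isClosed_coefR _)
      (fun y hy => S.coefR_lBr (fun _ h => S.P_par h) hTP hy) ?_ hx
    change S.lBr T x - (0 : S.LGA →ₗ[ℂ] S.LGA) T ∈ _
    rw [LinearMap.zero_apply, sub_zero]
    exact S.coefR_lBr (fun _ h => S.P_par h) hTP hx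
  refine R.mem_of_conj_mem (S.isClosed_coefR _) (key R.nilN R.N_coefR) (key R.nilT R.T_coefR) ?_
  rw [conj_res]
  exact S.tensorOne_mem_coefR _ _

/-- The invariance of the form under conjugation. -/
theorem lFormL_conj (x y : S.LGA) :
    S.lFormL (R.conj (0, x)).2 (R.conj (0, y)).2 = S.lFormL x y := by
  have key : ∀ {T : S.LGA} (hT : S.𝓖.Nil T) (x y : S.LGA),
      S.lFormL (FLie.E hT (0, x)).2 (FLie.E hT (0, y)).2 = S.lFormL x y := by
    intro T hT x y
    refine FLie.E_form hT S.lFormL (fun k l hkl x hx y hy => S.lFormL_of_deg hkl hx hy)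
      (fun x y => ?_) (FLie.E_zero_fst hT x) (FLie.E_zero_fst hT y)
    -- `ad T` is skew for the form, as `T` is even; skew symmetry needs homogeneous `x`.
    have h : ∀ p, S.lFormL (S.lBr T (S.𝓖.parProj p x)) y
        + S.lFormL (S.𝓖.parProj p x) (S.lBr T y) = 0 := by
      intro p
      have h1 : S.lBr T (S.𝓖.parProj p x) = -S.lBr (S.𝓖.parProj p x) T := by
        have h2 := S.𝓖.skew 0 p T (S.𝓖.parProj p x) (by simpa using hT.1) (S.𝓖.P_parProj p x)
        rw [zero_mul, sgn_zero, one_smul] at h2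
        exact h2
      rw [h1, map_neg, LinearMap.neg_apply, lFormL_invariant, neg_add_cancel]
    have h2 : x = S.𝓖.parProj 0 x + S.𝓖.parProj 1 x := by
      rw [FLie.parProj_apply, FLie.parProj_apply, sgn_zero, sgn_one]
      module
    rw [h2]
    have h3 := congrArg₂ (· + ·) (h 0) (h 1)
    simp only [add_zero] at h3
    rw [← h3]
    change S.lFormL (S.lBr T _) y + S.lFormL _ (S.lBr T y) = _
    simp only [map_add, LinearMap.add_apply]
    abel
  rw [conj_apply, conj_apply, FLie.E_zero_fst R.nilN, FLie.E_zero_fst R.nilN y, key, key]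

/-- The resolvent is gauge invariant. -/
theorem gauge_res (h : S.IsGauge π F n) (k : ℕ) {p : ZMod 2} {C : Laurent 𝔤}
    (hC : S.HasParity p C) : S.lDer (π + k) (F k) (R.res C)
      + S.lBr (Laurent.single 0 (S.gaugeElt n k)) (R.res C) = 0 := by
  refine R.conj_injective ?_
  have h1 := (R.conj_obr (h.gaugeOp_isOp k) (zero_isOp (R.res_par hC))).trans
    (congrArg₂ (fun X Y => S.𝓖.obr (π + k) p X Y) (R.conj_gaugeOp h k) (R.conj_res C))
  have h2 := congrArg Prod.snd h1
  rw [FLie.obr_snd] at h2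
  have h3 : S.𝓖.obr (π + k) p (S.gaugeOp π F n k) (0, R.res C)
      = (0, S.lDer (π + k) (F k) (R.res C)
        + S.lBr (Laurent.single 0 (S.gaugeElt n k)) (R.res C)) := by
    refine FLie.op_ext (fun v => ?_) ?_
    · rw [FLie.obr_fst]
      change S.lDer _ _ ((0 : S.LGA →ₗ[ℂ] S.LGA) v) - sgn ((π + k) * p) •
        (0 : S.LGA →ₗ[ℂ] S.LGA) _ = 0
      simp
    · rw [FLie.obr_snd]
      change _ - sgn ((π + k) * p) • (0 : S.LGA →ₗ[ℂ] S.LGA) _ + _ = _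
      rw [LinearMap.zero_apply, smul_zero, sub_zero]
      rfl
  rw [h3] at h2
  rw [h2]
  have h4 : S.lDer (π + k) (F k) (S.tensorOne C)
      - sgn ((π + k) * p) • (0 : S.LGA →ₗ[ℂ] S.LGA) 0 + S.lBr 0 (S.tensorOne C) = 0 := by
    rw [S.lDer_tensorOne (h.chiDer.der k), map_zero S.lBr, LinearMap.zero_apply,
      LinearMap.zero_apply, smul_zero, sub_zero, add_zero]
  exact h4

end Dressing

end DSData

namespace DSData

variable {𝔤 ι : Type*} [AddCommGroup 𝔤] [Module ℂ 𝔤] [Fintype ι] [DecidableEq ι]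
  (S : DSData 𝔤 ι)

/-! ### Reduced brackets with the linear variables -/

/-- The values `{\bar a_χ \bar q_t}_1`, `p(a) = π`. -/
def affVal (π : ZMod 2) (a : 𝔤) (t : ι) (m : ℕ) : S.Aff :=
  match m with
  | 0 => sgn π • S.bar (S.br a (S.qLow t))
  | 1 => sgn π • algebraMap ℂ S.Aff (S.form a (S.qLow t))
  | _ => 0

theorem c₁_eq (t : ι) : S.c₁ t = S.affVal (S.par t) (S.qLow t) := by
  funext r m
  match m with
  | 0 => rfl
  | 1 => rfl
  | m + 2 => rfl

variable {S} in
theorem valPar_affVal {π : ZMod 2} {a : 𝔤} (ha : a ∈ S.part π) : ValPar π (S.affVal π a) := by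
  intro t m
  match m with
  | 0 =>
    refine IsPar.smul _ ?_
    convert S.isPar_bar (S.br_mem _ _ a ha _ (S.qLow_mem_part t)) using 1
    rw [barPar]
    push_cast
    ring
  | 1 =>
    by_cases h : π = S.par t
    · subst h
      refine IsPar.smul _ ?_
      convert isPar_algebraMap (ε := fun x : ι × ℕ => S.barPar x.1 + (x.2 : ZMod 2)) _ using 1
      rw [barPar]
      push_cast
      rw [show S.par t + (S.par t + 1) + 1 = (S.par t + S.par t) + (1 + 1) by ring, par_add_self,
        par_add_self, add_zero]
    · rw [affVal, S.form_even _ _ h a ha _ (S.qLow_mem_part t), map_zero, smul_zero]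
      exact isPar_zero _
  | m + 2 => exact isPar_zero _

theorem affVal_eq_zero (π : ZMod 2) (a : 𝔤) (t : ι) (m : ℕ) (hm : 2 ≤ m) :
    S.affVal π a t m = 0 := by
  obtain ⟨k, rfl⟩ : ∃ k, m = k + 2 := ⟨m - 2, by omega⟩
  rfl

theorem par_add_one_add_one (π : ZMod 2) : π + 1 + 1 = π := by
  rw [add_assoc, par_add_self, add_zero]

variable {S} in
theorem valPar_c₁ (t : ι) : ValPar (S.barPar t + 1) (S.c₁ t) := by
  rw [c₁_eq, barPar, par_add_one_add_one]
  exact valPar_affVal (S.qLow_mem_part t)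

/-- `{u_t _χ \bar a}_1` for a variable `u_t`. -/
theorem leibnizExt_bar {p : ZMod 2} {v : ι → ℕ → S.Aff} (hv : ValPar (p + 1) v) (m : ℕ) (a : 𝔤) :
    leibnizExt S.barPar p v m (S.bar a) = ∑ t, S.form (S.qUp t) a • v t m := by
  rw [bar_eq, map_sum]
  exact Finset.sum_congr rfl fun t _ => by rw [map_smul, leibnizExt_jet_zero hv]

theorem revVal_bar {π : ZMod 2} {a : 𝔤} (ha : a ∈ S.part π) :
    revVal S.c₁ (π + 1) (S.bar a) = S.affVal π a := by
  funext j k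
  -- `{u_j _χ \bar a}_1` has degree at most one in `χ`.
  have h0 : leibnizExt S.barPar (S.barPar j) (S.c₁ j) 0 (S.bar a)
      = sgn (S.par j) • S.bar (S.br (S.qLow j) a) := by
    rw [S.leibnizExt_bar (valPar_c₁ j)]
    conv_rhs => rw [← S.qLow.sum_repr a]
    simp only [map_sum, map_smul, qLow_repr, c₁, Finset.smul_sum]
    exact Finset.sum_congr rfl fun t _ => smul_comm _ _ _
  have h1 : leibnizExt S.barPar (S.barPar j) (S.c₁ j) 1 (S.bar a)
      = sgn (S.par j) • algebraMap ℂ _ (S.form (S.qLow j) a) := by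
    rw [S.leibnizExt_bar (valPar_c₁ j)]
    conv_rhs => rw [← S.qLow.sum_repr a]
    simp only [map_sum, map_smul, qLow_repr, c₁, Finset.smul_sum]
    refine Finset.sum_congr rfl fun t _ => ?_
    rw [smul_eq_mul, map_mul, ← Algebra.smul_def]
    exact smul_comm _ _ _
  have h2 : ∀ m, 2 ≤ m → leibnizExt S.barPar (S.barPar j) (S.c₁ j) m (S.bar a) = 0 := by
    intro m hm
    rw [S.leibnizExt_bar (valPar_c₁ j)]
    exact Finset.sum_eq_zero fun t _ => by rw [c₁_eq, S.affVal_eq_zero _ _ _ _ hm, smul_zero]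
  have hs : sgn ((π + 1) * S.barPar j) * sgn (S.par j) = -(sgn π * sgn (π * S.par j)) := by
    rw [barPar]
    rcases zmod2_cases π with rfl | rfl <;> rcases zmod2_cases (S.par j) with h | h <;> rw [h] <;>
      simp [show (1 + 1 : ZMod 2) = 0 by decide]
  have hbr : S.br (S.qLow j) a = -(sgn (π * S.par j) • S.br a (S.qLow j)) := by
    rw [S.skew _ _ _ (S.qLow_mem_part j) a ha, mul_comm]
  have hform : S.form (S.qLow j) a = sgn (π * S.par j) * S.form a (S.qLow j) := by
    rw [S.form_symm _ _ _ (S.qLow_mem_part j) a ha, mul_comm (S.par j)]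
  rw [revVal, finsum_eq_sum_of_support_subset (s := {0, 1}), Finset.sum_pair zero_ne_one, h0, h1,
    pow_zero, pow_zero, pow_one, pow_one, one_smul, Module.End.one_apply]
  · match k with
    | 0 =>
      rw [chiD_zero, Pi.single_eq_same, Pi.single_eq_same, map_smul]
      rw [show SuperDS.D S.barPar (algebraMap ℂ _ (S.form (S.qLow j) a)) = 0 from
        S.isSDer_D.algebraMap _, smul_zero, smul_zero, add_zero, smul_smul, hs, hbr, map_neg,
        map_smul, smul_neg, smul_smul, neg_mul, neg_smul, neg_neg, mul_assoc, sgn_mul_self, mul_one]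
      rfl
    | 1 =>
      rw [chiD_succ, Pi.single_eq_of_ne one_ne_zero, Pi.single_eq_of_ne (by omega : 0 + 1 ≠ 0),
        Pi.single_eq_same, map_zero, smul_zero, zero_add, zero_add, pow_zero, one_smul, smul_smul,
        smul_smul, hform, map_mul, ← Algebra.smul_def, smul_smul]
      change _ = sgn π • algebraMap ℂ S.Aff (S.form a (S.qLow j))
      congr 1
      have h := sgn_mul_self (π * S.par j)
      linear_combination (-1 * sgn (π * S.par j)) * hs + sgn π * h
    | k + 2 =>
      rw [chiD_succ, Pi.single_eq_of_ne (by omega), Pi.single_eq_of_ne (by omega),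
        Pi.single_eq_of_ne (by omega), map_zero, smul_zero, smul_zero, add_zero, smul_zero,
        add_zero, smul_zero]
      rfl
  · intro m hm
    rw [Function.mem_support] at hm
    by_contra h
    refine hm ?_
    have hm2 : 2 ≤ m := by
      simp only [Finset.coe_insert, Finset.coe_singleton, Set.mem_insert_iff,
        Set.mem_singleton_iff] at h
      omega
    rw [h2 m hm2, Pi.single_zero, map_zero, Pi.zero_apply, smul_zero]

/-- The superderivations `𝔡_m` with `{\bar a_χ φ}_1 = ∑ χ^m 𝔡_m φ` modulo the ideal for `φ` in `𝒫`,
where `a` has parity `π`. -/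
def fam (π : ZMod 2) (a : 𝔤) (m : ℕ) : S.Aff →ₗ[ℂ] S.Aff :=
  leibnizExt S.barPar (π + 1) (S.redVal (S.affVal π a)) m

variable {S}

theorem valPar_redVal_affVal {π : ZMod 2} {a : 𝔤} (ha : a ∈ S.part π) :
    ValPar (π + 1 + 1) (S.redVal (S.affVal π a)) := by
  rw [par_add_one_add_one]
  exact S.valPar_redVal (valPar_affVal ha)

theorem isChiDer_fam {π : ZMod 2} {a : 𝔤} (ha : a ∈ S.part π) : IsChiDer π (S.fam π a) := by
  have h := isChiDer_leibnizExt (valPar_redVal_affVal ha)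
  rwa [par_add_one_add_one] at h

theorem fam_jet {π : ZMod 2} {a : 𝔤} (ha : a ∈ S.part π) (m : ℕ) {t : ι} (ht : t ∈ S.I) :
    S.fam π a m (jet S.barPar t 0) = S.reduce (S.affVal π a t m) := by
  rw [fam, leibnizExt_jet_zero (valPar_redVal_affVal ha), redVal, if_pos ht]

theorem fam_eventually {π : ZMod 2} {a : 𝔤} (ha : a ∈ S.part π) (φ : S.Aff) :
    ∃ N, ∀ m, N ≤ m → S.fam π a m φ = 0 :=
  leibnizExt_eventually (valPar_redVal_affVal ha) (N := 2) (fun t m hm => by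
    rw [redVal, S.affVal_eq_zero _ _ _ _ hm, map_zero, ite_self]) φ

theorem reduce_affVal {π : ZMod 2} {a : 𝔤} (ha : a ∈ S.part π) {φ : S.Aff} (hφ : φ ∈ S.P) (m : ℕ) :
    S.reduce (leibnizExt S.barPar (π + 1) (S.affVal π a) m φ) = S.fam π a m φ :=
  S.reduce_leibnizExt (by rw [par_add_one_add_one]; exact valPar_affVal ha) hφ m

theorem reduce_affBr₁_bar {π : ZMod 2} {a : 𝔤} (ha : a ∈ S.part π) {φ : S.Aff} (hφ : φ ∈ S.P)
    (m : ℕ) : S.reduce (S.affBr₁ (S.bar a) φ m) = S.fam π a m φ := by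
  rw [affBr₁, chiBracket_of_isPar _ (S.isPar_bar ha), revVal_bar S ha, reduce_affVal ha hφ]

/-- The W-algebra is the space of gauge invariants in `𝒫`. -/
theorem mem_W_iff {φ : S.Aff} : φ ∈ S.W ↔ φ ∈ S.P ∧
    ∀ π, ∀ n ∈ S.𝔫, n ∈ S.part π → ∀ k, S.fam π n k φ = 0 := by
  constructor
  · rintro ⟨hφ, h⟩
    refine ⟨hφ, fun π n hn hπ k => ?_⟩
    rw [← reduce_affBr₁_bar hπ hφ]
    exact S.reduce_of_mem_ideal (h n hn k)
  · rintro ⟨hφ, h⟩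
    refine ⟨hφ, fun n hn k => ?_⟩
    rw [mem_ideal_iff, affBr₁, chiBracket_eq_add, map_add, component_bar, component_bar]
    have h1 : ∀ p, S.reduce (chiBracket S.barPar S.c₁ (S.bar (gradeComp S.internal p n)) φ k)
        = 0 := fun p => (reduce_affBr₁_bar (gradeComp_mem _ _ _) hφ k).trans
          (h p _ (S.𝔫_part n hn p) (gradeComp_mem _ _ _) k)
    rw [h1, h1, add_zero]

/-! ### The action on the universal Lax operator -/

theorem gForm_one_tmul (b a : 𝔤) (u : S.Aff) :
    S.gForm (b ⊗ₜ 1) (a ⊗ₜ u) = S.form b a • u := by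
  rw [gForm, LinearMap.compr₂_apply, tensorExt_one_left]
  exact TensorProduct.lid_tmul _ _

/-- The coordinates with respect to the basis `q^t`. -/
theorem coord_eq_gForm (t : ι) (y : S.GA) :
    S.coord S.qUp t y = sgn (S.par t) • S.gForm (S.qLow t ⊗ₜ 1) y := by
  conv_lhs => rw [← S.sum_coord S.qUp y]
  conv_rhs => rw [← S.sum_coord S.qUp y]
  simp only [map_sum, coord_basis, Finset.smul_sum, gForm_one_tmul]
  refine Finset.sum_congr rfl fun r _ => ?_
  rw [S.form_symm _ _ _ (S.qLow_mem_part t) _ (S.qUp_part r), S.dual]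
  split_ifs with h
  · rw [h, par_mul_self, mul_one, smul_smul, sgn_mul_self, one_smul]
  · rw [mul_zero, zero_smul, smul_zero]

theorem sum_reduce_bar :
    ∑ t, S.qUp t ⊗ₜ S.reduce (jet S.barPar t 0) = S.Qu + S.f ⊗ₜ[ℂ] (1 : S.Aff) := by
  have h : ∀ t, S.reduce (jet S.barPar t 0) = (if t ∈ S.I then jet S.barPar t 0 else 0)
      + S.form S.f (S.qLow t) • (1 : S.Aff) := by
    intro t
    rw [reduce_jet, reduceVal]
    split_ifs with ht
    · rw [S.form_f_qLow_of_mem ht, zero_smul, add_zero]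
    · rw [zero_add, Algebra.algebraMap_eq_smul_one]
    · exact absurd rfl ‹¬ _›
  simp only [h, TensorProduct.tmul_add, Finset.sum_add_distrib, ← TensorProduct.smul_tmul]
  rw [← TensorProduct.sum_tmul]
  congr 1
  · rw [Qu]
    refine ((Finset.sum_subset (Finset.subset_univ _) fun t _ ht => ?_).trans
      (Finset.sum_congr rfl fun t _ => rfl)).symm.trans (Finset.sum_congr rfl fun t ht => ?_)
    · rw [if_neg ht, TensorProduct.tmul_zero]
    · rw [if_pos ht]
  · congr 1
    conv_rhs => rw [← S.qUp.sum_repr S.f]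
    simp only [qUp_repr]

theorem gForm_bar {β : ZMod 2} {b : 𝔤} (hb : b ∈ S.part β) :
    S.gForm (b ⊗ₜ 1) (S.Qu + S.f ⊗ₜ 1) = sgn β • S.reduce (S.bar b) := by
  rw [← sum_reduce_bar, map_sum, bar_eq, map_sum, Finset.smul_sum]
  refine Finset.sum_congr rfl fun t _ => ?_
  rw [gForm_one_tmul, map_smul, S.form_symm _ _ b hb _ (S.qUp_part t), smul_smul]
  by_cases h : S.par t = β
  · rw [h, par_mul_self]
  · rw [S.form_even _ _ h _ (S.qUp_part t) b hb, mul_zero, mul_zero]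

variable (S) in
/-- The projection onto `𝔟 ⊗ 𝒫(\bar 𝔤)` along the span of the `q^t`, `t ∉ I`. -/
def pB : S.GA →ₗ[ℂ] S.GA := ∑ t ∈ S.I, TensorProduct.mk ℂ 𝔤 S.Aff (S.qUp t) ∘ₗ S.coord S.qUp t

theorem pB_apply (y : S.GA) : S.pB y = ∑ t ∈ S.I, S.qUp t ⊗ₜ S.coord S.qUp t y := by
  rw [pB, LinearMap.sum_apply]
  rfl

theorem pB_of_mem {A : Submodule ℂ S.Aff} {y : S.GA} (hy : y ∈ S.tens S.𝔟 A) : S.pB y = y := by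
  rw [pB_apply]
  conv_rhs => rw [← S.sum_coord S.qUp y]
  refine Finset.sum_subset (Finset.subset_univ _) fun t _ ht => ?_
  rw [S.coord_eq_zero S.qUp (A := (S.I : Set ι)) (by exact_mod_cast ht) hy,
    TensorProduct.tmul_zero]

theorem gDer_Qu (π : ZMod 2) (d : S.Aff →ₗ[ℂ] S.Aff) : S.gDer π d S.Qu
    = ∑ t ∈ S.I, sgn (π * S.par t) • (S.qUp t ⊗ₜ d (jet S.barPar t 0)) := by
  rw [Qu, map_sum]
  exact Finset.sum_congr rfl fun t _ => S.gDer_pure _ _ (S.qUp_part t) _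

theorem fam_zero_Qu {π : ZMod 2} {a : 𝔤} (ha : a ∈ S.part π) :
    S.gDer π (S.fam π a 0) S.Qu = -S.pB (S.gBr (a ⊗ₜ 1) (S.Qu + S.f ⊗ₜ 1)) := by
  rw [gDer_Qu, pB_apply, ← Finset.sum_neg_distrib]
  refine Finset.sum_congr rfl fun t ht => ?_
  have h1 : S.gBr (S.qLow t ⊗ₜ[ℂ] (1 : S.Aff)) (a ⊗ₜ 1) = S.br (S.qLow t) a ⊗ₜ 1 :=
    S.tensorExt_one_left S.br _ _ _
  rw [fam_jet ha 0 ht, coord_eq_gForm, ← gForm_invariant, h1,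
    gForm_bar (S.br_mem _ _ _ (S.qLow_mem_part t) a ha),
    S.skew _ _ _ (S.qLow_mem_part t) a ha]
  change sgn (π * S.par t) • S.qUp t ⊗ₜ[ℂ] S.reduce (sgn π • S.bar (S.br a (S.qLow t))) = _
  rw [map_neg, map_smul, map_neg, map_smul, map_smul, smul_neg, smul_neg, TensorProduct.tmul_neg,
    neg_neg, TensorProduct.tmul_smul, TensorProduct.tmul_smul, TensorProduct.tmul_smul,
    TensorProduct.tmul_smul, smul_smul, smul_smul, smul_smul, sgn_add, mul_comm (S.par t) π]
  congr 1
  have h2 := sgn_mul_self (S.par t)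
  linear_combination (-(sgn π * sgn (π * S.par t))) * h2

theorem fam_one_Qu {π : ZMod 2} {a : 𝔤} (ha : a ∈ S.part π) :
    S.gDer (π + 1) (S.fam π a 1) S.Qu = sgn π • S.pB (a ⊗ₜ 1) := by
  rw [gDer_Qu, pB_apply, Finset.smul_sum]
  refine Finset.sum_congr rfl fun t ht => ?_
  rw [fam_jet ha 1 ht, coord_tmul]
  change _ • _ ⊗ₜ[ℂ] S.reduce (sgn π • algebraMap ℂ S.Aff (S.form a (S.qLow t))) = _
  rw [Module.Basis.coord_apply, qUp_repr, map_smul, AlgHom.commutes, Algebra.algebraMap_eq_smul_one,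
    TensorProduct.tmul_smul]
  by_cases h : π = S.par t
  · have h2 : (π + 1) * S.par t = 0 := by
      rw [← h, add_mul, par_mul_self, one_mul, par_add_self]
    rw [h2, sgn_zero, one_smul]
  · rw [S.form_even _ _ h a ha _ (S.qLow_mem_part t)]
    simp

theorem fam_Qu {π : ZMod 2} {a : 𝔤} (ha : a ∈ S.part π) (k : ℕ) (hk : 2 ≤ k) (q : ZMod 2) :
    S.gDer q (S.fam π a k) S.Qu = 0 := by
  rw [gDer_Qu]
  refine Finset.sum_eq_zero fun t ht => ?_
  rw [fam_jet ha k ht, S.affVal_eq_zero _ _ _ _ hk, map_zero, TensorProduct.tmul_zero, smul_zero]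

theorem isGauge_fam {π : ZMod 2} {n : 𝔤} (hn : n ∈ S.𝔫) (hπ : n ∈ S.part π) :
    S.IsGauge π (S.fam π n) n where
  mem := hn
  par := hπ
  chiDer := isChiDer_fam hπ
  act_zero := by
    rw [fam_zero_Qu hπ, pB_of_mem (A := Subalgebra.toSubmodule S.P)]
    rw [map_add]
    refine Submodule.add_mem _ ?_ ?_
    · exact S.gBr_mem_tens (fun a ha p => S.span_qUp_part _ ha p) (fun _ h => S.P_par h)
        (fun n hn b hb => S.br_𝔫_𝔟 hn hb) (S.tmul_mem_tens hn S.P.one_mem) S.Qu_mem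
    · rw [gBr, tensorExt_one_left]
      exact S.tmul_mem_tens (S.br_𝔫_f hn) S.P.one_mem
  act_one := by
    rw [fam_one_Qu hπ, pB_of_mem (A := ⊤) (S.tmul_mem_tens (S.𝔫_le_𝔟 hn) Submodule.mem_top)]
  act := fam_Qu hπ

namespace Dressing

variable (R : S.Dressing)

theorem w_mem_W {t : ι} (ht : t ∈ S.I \ S.J) : R.w t ∈ S.W :=
  mem_W_iff.2 ⟨R.w_mem t ht, fun _ _ hn hπ k => R.gauge_w (isGauge_fam hn hπ) k ht⟩

theorem Pw_le_W {a : S.Aff} (ha : a ∈ S.Pw R.w) : a ∈ S.W :=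
  mem_W_iff.2 ⟨R.Pw_le_P ha, fun _ _ hn hπ k => R.gauge_Pw (isGauge_fam hn hπ) k ha⟩

theorem h_mem_W (C : Laurent 𝔤) : R.h C ∈ S.W := by
  refine R.Pw_le_W ?_
  rw [h, lForm_eq, lFormL_apply, Laurent.conv_coeff]
  refine finsum_induction (· ∈ S.Pw R.w) (zero_mem _) (fun _ _ h h' => Subalgebra.add_mem _ h h')
    fun k => ?_
  refine S.tens_le (Q := (Subalgebra.toSubmodule (S.Pw R.w)).comap
    (S.gForm.flip ((S.tensorOne C).1 (0 - k)))) (fun a _ u hu => ?_) (R.K_coefR k)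
  change TensorProduct.lid ℂ S.Aff (S.tensorExt S.form (a ⊗ₜ u) (C.1 (0 - k) ⊗ₜ 1)) ∈ S.Pw R.w
  rw [tensorExt_tmul, map_add, TensorProduct.lid_tmul, TensorProduct.lid_tmul, mul_one, mul_one]
  exact Subalgebra.add_mem _ (Subalgebra.smul_mem _ hu _)
    (Subalgebra.smul_mem _ (S.Pw_par R.w_parity hu) _)

end Dressing

end DSData

namespace FLie

variable {M : Type*} [AddCommGroup M] [Module ℂ M] {𝓖 : FLie M}

/-- An odd element commutes with its square. -/
theorem obr_self_half_square {L : 𝓖.Op} (hL : L ∈ 𝓖.isOp 1) :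
    𝓖.obr 1 0 L ((1 / 2 : ℂ) • 𝓖.obr 1 1 L L) = 0 := by
  have h1 := obr_jacobi hL hL hL
  have h2 := obr_skew (obr_isOp hL hL) hL
  rw [par_add_self, zero_mul, sgn_zero, one_smul] at h2
  rw [par_add_self, mul_one, sgn_one, h2] at h1
  rw [map_smul]
  generalize 𝓖.obr 1 0 L (𝓖.obr 1 1 L L) = x at h1 ⊢
  have h3 : (3 : ℂ) • x = 0 := by
    rw [← sub_eq_zero.2 h1]
    module
  rw [(smul_eq_zero.1 h3).resolve_left (by norm_num), smul_zero]

end FLie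

namespace DSData

variable {𝔤 ι : Type*} [AddCommGroup 𝔤] [Module ℂ 𝔤] [Fintype ι] [DecidableEq ι]
  {S : DSData 𝔤 ι}

/-! ### The commutant of the dressed Lax operator -/

theorem lBr_center {C : Laurent 𝔤} (hC : C ∈ S.Z) {x : S.LGA} (hx : x ∈ S.kerSub) :
    S.lBr (S.tensorOne C) x = 0 :=
  S.lga_eq_zero_of_con fun ℓ => by rw [con_lBr, hC.2 _ (S.mem_kerSub_iff.1 hx ℓ)]

theorem lBr_center' {p q : ZMod 2} {C : Laurent 𝔤} (hC : C ∈ S.Z) (hp : S.HasParity p C)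
    {x : S.LGA} (hx : x ∈ S.kerSub) (hq : S.𝓖.P x = sgn q • x) :
    S.lBr x (S.tensorOne C) = 0 := by
  have h : S.lBr x (S.tensorOne C) = -(sgn (q * p) • S.lBr (S.tensorOne C) x) :=
    S.𝓖.skew q p x _ hq (S.tensorOne_par hp)
  rw [h, lBr_center hC hx, smul_zero, neg_zero]

namespace Dressing

variable (R : S.Dressing)

/-- The matrix part of the dressed Lax operator. -/
def KΛ : S.LGA := R.K + S.tensorOne S.Λ

theorem KΛ_par : S.𝓖.P R.KΛ = sgn 1 • R.KΛ := by
  rw [KΛ, map_add, K_par, S.tensorOne_par S.Λ_par, sgn_one_smul, sgn_one_smul, neg_add]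

theorem dressed_isOp : S.toOp (1, 0, R.KΛ) ∈ S.𝓖.isOp 1 :=
  S.toOp_isOp (by rw [KΛ_par, sgn_one_smul])

/-- The square of the dressed Lax operator. -/
def sq : S.𝓖.Op := (1 / 2 : ℂ) • S.𝓖.obr 1 1 (S.toOp (1, 0, R.KΛ)) (S.toOp (1, 0, R.KΛ))

theorem sq_isOp : R.sq ∈ S.𝓖.isOp 0 := FLie.half_square_isOp R.dressed_isOp

theorem half_square_dressed : FLie.E R.nilT
      (S.toOp ((1 / 2 : ℂ) • S.laxBr (S.laxOpS (S.Qw R.w)) (S.laxOpS (S.Qw R.w))))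
    = R.sq := by
  have hpar := S.laxOpS_par _ (Qw_par R.w_parity)
  have h1 : FLie.E R.nilT (S.toOp (S.laxOpS (S.Qw R.w))) = S.toOp (1, 0, R.KΛ) :=
    Prod.ext (FLie.E_fst _ _) ((S.isExpAd_iff R.nilT _ _).1 R.dress).2.2
  have h2 := S.toOp_half_square hpar
  have h3 := FLie.E_half_square R.nilT (S.toOp_isOp hpar)
  exact (congrArg (FLie.E R.nilT) h2).trans (h3.trans
    (congrArg₂ (fun X Y => (1 / 2 : ℂ) • S.𝓖.obr 1 1 X Y) h1 h1))

theorem sq_snd : R.sq.2 = R.H + S.Λ₂ :=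
  (congrArg Prod.snd R.half_square_dressed).symm.trans
    ((S.isExpAd_iff R.nilT _ _).1 R.dress_sq).2.2

theorem sq_Λ₂ : R.sq.1.1 S.Λ₂ = 0 := by
  have h : R.sq.1.1 S.Λ₂ = (1 / 2 : ℂ) •
      (S.𝓖.obr 1 1 (S.toOp (1, 0, R.KΛ)) (S.toOp (1, 0, R.KΛ))).1.1 S.Λ₂ := rfl
  rw [h, FLie.obr_fst, toOp_fst, LinearMap.sub_apply, LinearMap.smul_apply, LinearMap.comp_apply,
    Λ₂, lD_tensorOne, map_zero, smul_zero, sub_zero, smul_zero]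

theorem H_mem_F : R.H ∈ S.𝓖.F (-(2 * S.i) + 1) := by
  have h0 := half_square_snd (Q := Laurent.single 0 (S.Qw R.w))
    (by rw [P_single, Qw_par R.w_parity, map_neg]) S.Qw_F
  have e := ((S.isExpAd_iff R.nilT _ _).1 R.dress_sq).2.2
  change (S.toOp ((1 / 2 : ℂ) • S.laxBr (S.laxOpS (S.Qw R.w)) (S.laxOpS (S.Qw R.w)))).2 - S.Λ₂
    ∈ S.𝓖.F (-(2 * S.i) + 1) at h0
  generalize S.toOp ((1 / 2 : ℂ) • S.laxBr (S.laxOpS (S.Qw R.w)) (S.laxOpS (S.Qw R.w))) = Y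
    at h0 e
  have hY2 : Y.2 ∈ S.𝓖.F (-(2 * S.i)) := by
    have := Submodule.add_mem _ (S.𝓖.mono (by linarith) h0) S.Λ₂_mem
    rwa [sub_add_cancel] at this
  have h1 := FLie.E_sub_mem R.nilT (Filt.isClosed_F (𝓕 := S.𝓖.toFilt) (-(2 * S.i) + 1)) (X := Y)
    (fun x hx => S.𝓖.mono (by linarith) (S.𝓖.F_br 1 _ _ R.nilT.2 _ hx))
    (Submodule.sub_mem _ (S.𝓖.mono (by linarith) (S.𝓖.F_br 1 _ _ R.nilT.2 _ hY2))
      (S.𝓖.mono (by linarith [S.i_pos]) (Y.1.2 1 _ R.nilT.2)))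
  have h2 := Submodule.add_mem _ h1 h0
  rw [sub_add_sub_cancel, e] at h2
  exact (add_sub_cancel_right R.H S.Λ₂) ▸ h2

/-- Everything that commutes with the square of the dressed Lax operator lies in `𝒦`. -/
theorem mem_kerSub_of_commute_square {p : ZMod 2} {X : S.𝓖.Op} (hX : X ∈ S.𝓖.isOp p)
    (hXΛ : X.1.1 S.Λ₂ = 0) (h : S.𝓖.obr p 0 X R.sq = 0) : X.2 ∈ S.kerSub := by
  have h4 : R.sq.2 - S.Λ₂ = R.H := by rw [sq_snd, add_sub_cancel_right]
  have h5 : S.𝓖.br S.Λ₂ (R.sq.2 - S.Λ₂) = 0 := by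
    rw [h4]
    exact S.mem_kerSub.1 (S.mem_lTens_ker.1 R.H_mem).2
  have h6 : R.sq.2 - S.Λ₂ ∈ S.𝓖.F (-(2 * S.i) + 1) := by
    rw [h4]
    exact R.H_mem_F
  exact S.mem_kerSub.2 (FLie.snd_mem_ker_of_commute (w := -(2 * S.i)) (by linarith [S.i_pos])
    S.Λ₂_par S.Λ₂_mem S.star R.sq_isOp R.sq_Λ₂ h5 h6 hX hXΛ h)

theorem mem_kerSub_of_commute {p : ZMod 2} {X : S.𝓖.Op} (hX : X ∈ S.𝓖.isOp p)
    (hXΛ : X.1.1 S.Λ₂ = 0) (h : S.𝓖.obr p 1 X (S.toOp (1, 0, R.KΛ)) = 0) : X.2 ∈ S.kerSub :=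
  R.mem_kerSub_of_commute_square hX hXΛ (FLie.obr_half_square hX R.dressed_isOp h)

theorem KΛ_mem : R.KΛ ∈ S.kerSub := by
  have h : (S.toOp (1, 0, R.KΛ)).1.1 S.Λ₂ = 0 := by
    rw [toOp_fst]
    exact S.lD_tensorOne _
  exact R.mem_kerSub_of_commute_square R.dressed_isOp h
    (FLie.obr_self_half_square R.dressed_isOp)

theorem lBr_KΛ {p : ZMod 2} {C : Laurent 𝔤} (hC : C ∈ S.Z) (hp : S.HasParity p C) :
    S.lBr R.KΛ (S.tensorOne C) = 0 := lBr_center' hC hp R.KΛ_mem R.KΛ_par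

variable (S) in
/-- The matrix part `𝒬_u + Λ` of the universal Lax operator. -/
def lax : S.LGA := Laurent.single 0 S.Qu + S.tensorOne S.Λ

theorem conj_toOp_lax : R.conj (S.toOp (1, 0, lax S)) = S.toOp (1, 0, R.KΛ) := R.conj_lax

theorem lax_isOp : S.toOp (1, 0, lax S) ∈ S.𝓖.isOp 1 := laxOpS_isOp

/-- The resolvents commute with the universal Lax operator. -/
theorem lax_res {p : ZMod 2} {C : Laurent 𝔤} (hC : C ∈ S.Z) (hp : S.HasParity p C) :
    -(sgn p • S.lD (R.res C)) + S.lBr (R.res C) (lax S) = 0 := by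
  refine R.conj_injective ?_
  have h1 := (R.conj_obr (zero_isOp (R.res_par hp)) lax_isOp).trans
    (congrArg₂ (fun X Y => S.𝓖.obr p 1 X Y) (R.conj_res C) R.conj_toOp_lax)
  have h2 := (congrArg R.conj (obr_zero_lax (q := p) (R.res C) (lax S))).symm.trans
    (h1.trans (obr_zero_lax (q := p) (S.tensorOne C) R.KΛ))
  rw [h2]
  change -(sgn p • S.lD (S.tensorOne C)) + S.lBr (S.tensorOne C) R.KΛ = 0
  rw [lD_tensorOne, lBr_center hC R.KΛ_mem, smul_zero, neg_zero, zero_add]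

theorem lax_eq : lax S = Laurent.single 0 (S.Qu + S.f ⊗ₜ 1) + Laurent.single 1 (S.s ⊗ₜ 1) := by
  rw [lax, Λ, map_add, tensorOne_single, tensorOne_single', map_add, add_assoc]

theorem lBr_lax_coeff (x : S.LGA) (n : ℤ) : (S.lBr x (lax S)).1 n
    = S.gBr (x.1 n) (S.Qu + S.f ⊗ₜ 1) + S.gBr (x.1 (n - 1)) (S.s ⊗ₜ 1) := by
  rw [lax_eq, map_add]
  change (S.lBr x (Laurent.single 0 _)).1 n + (S.lBr x (Laurent.single 1 _)).1 n = _
  rw [lBr, Laurent.conv_single_right, Laurent.conv_single_right, sub_zero]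

theorem lax_res_coeff {p : ZMod 2} {C : Laurent 𝔤} (hC : C ∈ S.Z) (hp : S.HasParity p C) (n : ℤ) :
    S.gBr ((R.res C).1 n) (S.Qu + S.f ⊗ₜ 1) - sgn p • S.gDer 1 S.D ((R.res C).1 n)
      = -S.gBr ((R.res C).1 (n - 1)) (S.s ⊗ₜ 1) := by
  have h := congrArg (fun y => y.1 n) (R.lax_res hC hp)
  have h' : -(sgn p • S.gDer 1 S.D ((R.res C).1 n)) + (S.lBr (R.res C) (lax S)).1 n = 0 := by
    rw [lD_eq] at h
    exact h
  rw [lBr_lax_coeff] at h'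
  rw [eq_neg_iff_add_eq_zero, ← h']
  abel

/-! ### The variational derivatives of the Hamiltonian densities -/

theorem h_eq (C : Laurent 𝔤) : R.h C = S.lFormL R.K (S.tensorOne C) := S.lForm_eq _ _

theorem lFormL_lDer_KΛ {π : ZMod 2} {d : S.Aff →ₗ[ℂ] S.Aff} (hd : IsSDer π d) (C : Laurent 𝔤) :
    S.lFormL (S.lDer π d R.KΛ) (S.tensorOne C) = d (R.h C) := by
  rw [h_eq, lDer_lFormL hd (p := 1) (by rw [K_par, sgn_one_smul]), S.lDer_tensorOne hd, map_zero,
    smul_zero, add_zero, KΛ, map_add, S.lDer_tensorOne hd, add_zero]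

theorem lFormL_lD_tensorOne {p : ZMod 2} {x : S.LGA} (hx : S.𝓖.P x = sgn p • x) (C : Laurent 𝔤) :
    S.lFormL (S.lD x) (S.tensorOne C) = S.D (S.lFormL x (S.tensorOne C)) := by
  rw [lDer_lFormL S.isSDer_D hx, ← lD_eq, lD_tensorOne, map_zero, smul_zero, add_zero]

theorem lFormL_lBr_KΛ {p : ZMod 2} {C : Laurent 𝔤} (hC : C ∈ S.Z) (hp : S.HasParity p C)
    (x : S.LGA) : S.lFormL (S.lBr x R.KΛ) (S.tensorOne C) = 0 := by
  rw [lFormL_invariant, R.lBr_KΛ hC hp, map_zero]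

theorem lFormL_conj_res (x : S.LGA) (C : Laurent 𝔤) :
    S.lFormL (R.conj (0, x)).2 (S.tensorOne C) = S.lFormL x (R.res C) := by
  have h := R.lFormL_conj x (R.res C)
  rwa [conj_res] at h

variable {π : ZMod 2} {F : ℕ → S.Aff →ₗ[ℂ] S.Aff}

theorem lDer_lax {d : S.Aff →ₗ[ℂ] S.Aff} (hd : IsSDer π d) :
    S.lDer π d (lax S) = Laurent.single 0 (S.gDer π d S.Qu) := by
  rw [lax, map_add, S.lDer_tensorOne hd, add_zero, lDer_single]

theorem conj_opOf {d : S.Aff →ₗ[ℂ] S.Aff} (x : S.LGA) :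
    R.conj (S.opOf π d x) = S.opOf π d (R.conj (S.opOf π d x)).2 :=
  Prod.ext (R.conj_fst _) rfl

set_option maxHeartbeats 1000000 in
/-- The variation of `h_C` along an evolutionary derivation, up to a total derivative, is the
pairing of the variation of the Lax operator with the resolvent: pair the dressed variation with
`C ⊗ 1`. -/
theorem evol_h {d : S.Aff →ₗ[ℂ] S.Aff} (hd : IsEvol π d) {p : ZMod 2} {C : Laurent 𝔤}
    (hC : C ∈ S.Z) (hp : S.HasParity p C) :
    d (R.h C) = sgn π • S.D (S.lFormL (R.conj (S.opOf π d 0)).2 (S.tensorOne C))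
      + S.lFormL (Laurent.single 0 (S.gDer π d S.Qu)) (R.res C) := by
  have hop := opOf_isOp hd.der (y := (0 : S.LGA)) (by simp)
  have h1 := (R.conj_obr hop lax_isOp).trans
    (congrArg₂ (fun X Y => S.𝓖.obr π 1 X Y) (R.conj_opOf (π := π) (d := d) 0) R.conj_toOp_lax)
  have e : S.lDer π d (lax S) - sgn π • S.lD 0 + S.lBr 0 (lax S)
      = Laurent.single 0 (S.gDer π d S.Qu) := by
    rw [lDer_lax hd.der, map_zero, smul_zero, sub_zero, map_zero, LinearMap.zero_apply, add_zero]
  have hΘ := (R.conj_isOp hop).2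
  generalize (R.conj (S.opOf π d 0)).2 = Θ at h1 hΘ ⊢
  have h2 : (R.conj (0, Laurent.single 0 (S.gDer π d S.Qu))).2
      = S.lDer π d R.KΛ - sgn π • S.lD Θ + S.lBr Θ R.KΛ :=
    (congrArg (fun y => (R.conj (0, y)).2) e).symm.trans (congrArg Prod.snd
      ((congrArg R.conj (obr_evol_lax hd 0 (lax S))).symm.trans
        (h1.trans (obr_evol_lax hd Θ R.KΛ))))
  rw [← R.lFormL_conj_res, h2, map_add, map_sub, map_smul, LinearMap.add_apply,
    LinearMap.sub_apply, LinearMap.smul_apply, R.lFormL_lDer_KΛ hd.der, lFormL_lD_tensorOne hΘ,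
    R.lFormL_lBr_KΛ hC hp, add_zero, add_sub_cancel]

set_option maxHeartbeats 1000000 in
/-- The analogue of `evol_h` for a family of superderivations. -/
theorem chiDer_h (hF : IsChiDer π F) (n : ℕ) {p : ZMod 2} {C : Laurent 𝔤}
    (hC : C ∈ S.Z) (hp : S.HasParity p C) :
    F (n + 1) (R.h C) = sgn (π + (n + 1 : ℕ)) •
        S.D (S.lFormL (R.conj (S.opOf (π + (n + 1 : ℕ)) (F (n + 1)) 0)).2 (S.tensorOne C))
      + sgn (π + n) • S.lFormL (R.conj (S.opOf (π + n) (F n) 0)).2 (S.tensorOne C)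
      + S.lFormL (Laurent.single 0 (S.gDer (π + (n + 1 : ℕ)) (F (n + 1)) S.Qu)) (R.res C) := by
  have hd := hF.der (n + 1)
  have hop := opOf_isOp hd (y := (0 : S.LGA)) (by simp)
  have h1 := (R.conj_obr hop lax_isOp).trans
    (congrArg₂ (fun X Y => S.𝓖.obr (π + (n + 1 : ℕ)) 1 X Y)
      (R.conj_opOf (π := π + (n + 1 : ℕ)) (d := F (n + 1)) 0) R.conj_toOp_lax)
  have e : S.lDer (π + (n + 1 : ℕ)) (F (n + 1)) (lax S) - sgn (π + (n + 1 : ℕ)) • S.lD 0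
      + S.lBr 0 (lax S) = Laurent.single 0 (S.gDer (π + (n + 1 : ℕ)) (F (n + 1)) S.Qu) := by
    rw [lDer_lax hd, map_zero, smul_zero, sub_zero, map_zero, LinearMap.zero_apply, add_zero]
  have hΘ := (R.conj_isOp hop).2
  generalize (R.conj (S.opOf (π + (n + 1 : ℕ)) (F (n + 1)) 0)).2 = Θ at h1 hΘ ⊢
  have h2 : sgn (π + n) • (R.conj (S.opOf (π + n) (F n) 0)).2
      + (R.conj (0, Laurent.single 0 (S.gDer (π + (n + 1 : ℕ)) (F (n + 1)) S.Qu))).2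
      = S.lDer (π + (n + 1 : ℕ)) (F (n + 1)) R.KΛ - sgn (π + (n + 1 : ℕ)) • S.lD Θ
        + S.lBr Θ R.KΛ := by
    have h3 := (congrArg R.conj (obr_chiDer_lax hF n 0 (lax S))).symm.trans
        (h1.trans (obr_chiDer_lax hF n Θ R.KΛ))
    rw [e, map_add, map_smul] at h3
    have h4 := congrArg Prod.snd h3
    refine h4.trans ?_
    change sgn (π + n) • (0 : S.LGA) + _ = _
    rw [smul_zero, zero_add]
  have h3 := congrArg (fun x => S.lFormL x (S.tensorOne C)) h2
  simp only [map_add, map_sub, map_smul, LinearMap.add_apply, LinearMap.sub_apply,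
    LinearMap.smul_apply, lFormL_conj_res] at h3
  rw [R.lFormL_lDer_KΛ hd, lFormL_lD_tensorOne hΘ, R.lFormL_lBr_KΛ hC hp, add_zero,
    eq_sub_iff_add_eq] at h3
  rw [← h3]
  abel

/-- The components `Θ_m` of the conjugated superderivations tend to zero. -/
theorem conj_opOf_eventually (hF : ∀ a, ∃ N, ∀ n, N ≤ n → F n a = 0) (k : ℤ) :
    ∃ N : ℕ, ∀ n : ℕ, N ≤ n → (R.conj (S.opOf (π + n) (F n) 0)).2 ∈ S.𝓖.F k := by
  obtain ⟨N₁, h₁⟩ := eventually_lDer_mem hF (Laurent.single 0 R.N) k (fun n => π + n)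
  obtain ⟨N₂, h₂⟩ := eventually_lDer_mem hF R.T k (fun n => π + n)
  have key : ∀ {T : S.LGA} (hT : S.𝓖.Nil T) (X : S.𝓖.Op), X.2 ∈ S.𝓖.F k → X.1.1 T ∈ S.𝓖.F k →
      (FLie.E hT X).2 ∈ S.𝓖.F k := by
    intro T hT X hX h
    have hbr : ∀ x ∈ S.𝓖.F k, S.𝓖.br T x ∈ S.𝓖.F k :=
      fun x hx => S.𝓖.mono (by linarith) (S.𝓖.F_br 1 _ _ hT.2 _ hx)
    exact FLie.E_snd_mem hT (Filt.isClosed_F (𝓕 := S.𝓖.toFilt) k) hbr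
      (Submodule.sub_mem _ (hbr _ hX) h) hX
  refine ⟨max N₁ N₂, fun n hn => ?_⟩
  rw [conj_apply]
  refine key R.nilT _ (key R.nilN _ (zero_mem _) (h₁ n (le_trans (le_max_left _ _) hn))) ?_
  rw [FLie.E_fst]
  exact h₂ n (le_trans (le_max_right _ _) hn)

end Dressing

end DSData

/-- The telescoping behind the formula for variational derivatives. -/
theorem finsum_telescope {A : Type*} [AddCommGroup A] [Module ℂ A] (D : A →ₗ[ℂ] A) {a b g : ℕ → A}
    {s : ℕ → ℂ} (h0 : a 0 = s 0 • D (g 0) + b 0)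
    (h : ∀ m, a (m + 1) = s (m + 1) • D (g (m + 1)) + s m • g m + b (m + 1))
    (ha : ∃ N, ∀ m, N ≤ m → a m = 0) (hg : ∃ N, ∀ m, N ≤ m → g m = 0)
    (hb : ∀ m, 2 ≤ m → b m = 0) :
    ∑ᶠ m : ℕ, (-1 : ℂ) ^ m • (D ^ m) (a m) = b 0 - D (b 1) := by
  obtain ⟨N, hN⟩ := ha
  obtain ⟨N', hN'⟩ := hg
  have key : ∀ M, ∑ m ∈ Finset.range (M + 1), (-1 : ℂ) ^ m • (D ^ m) (a m)
      = ∑ m ∈ Finset.range (M + 1), (-1 : ℂ) ^ m • (D ^ m) (b m)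
        + (-1 : ℂ) ^ M • s M • (D ^ (M + 1)) (g M) := by
    intro M
    induction M with
    | zero => simp [h0, add_comm]
    | succ M ih =>
      rw [Finset.sum_range_succ, ih, Finset.sum_range_succ _ (M + 1), h, map_add, map_add,
        map_smul, map_smul, ← Module.End.mul_apply, ← pow_succ]
      module
  rw [finsum_eq_sum_of_support_subset (s := Finset.range (max N N' + 1 + 1)), key,
    hN' (max N N' + 1) (by omega), map_zero, smul_zero, smul_zero, add_zero,
    Finset.sum_range_succ', Finset.sum_range_succ', Finset.sum_eq_zero]
  · simp [sub_eq_neg_add]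
  · intro m _
    rw [hb _ (by omega), map_zero, smul_zero]
  · intro m hm
    rw [Function.mem_support] at hm
    rw [Finset.coe_range, Set.mem_Iio]
    by_contra hlt
    exact hm (by rw [hN m (by omega), map_zero, smul_zero])

namespace DSData

variable {𝔤 ι : Type*} [AddCommGroup 𝔤] [Module ℂ 𝔤] [Fintype ι] [DecidableEq ι]
  {S : DSData 𝔤 ι}

/-- The skew-adjoint of a family of superderivations, applied to a Hamiltonian density, is given by
the resolvent. -/
theorem Dressing.finsum_chiDer_h (R : S.Dressing) {π : ZMod 2} {F : ℕ → S.Aff →ₗ[ℂ] S.Aff}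
    (hF : IsChiDer π F) (hev : ∀ a, ∃ N, ∀ n, N ≤ n → F n a = 0)
    (h2 : ∀ m, 2 ≤ m → ∀ q, S.gDer q (F m) S.Qu = 0) {p : ZMod 2} {C : Laurent 𝔤}
    (hC : C ∈ S.Z) (hp : S.HasParity p C) :
    ∑ᶠ m : ℕ, (-1 : ℂ) ^ m • (S.D ^ m) (F m (R.h C))
      = S.lFormL (Laurent.single 0 (S.gDer π (F 0) S.Qu)) (R.res C)
        - S.D (S.lFormL (Laurent.single 0 (S.gDer (π + 1) (F 1) S.Qu)) (R.res C)) := by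
  have h := finsum_telescope S.D (a := fun m => F m (R.h C))
    (b := fun m => S.lFormL (Laurent.single 0 (S.gDer (π + m) (F m) S.Qu)) (R.res C))
    (g := fun m => S.lFormL (R.conj (S.opOf (π + m) (F m) 0)).2 (S.tensorOne C))
    (s := fun m => sgn (π + m)) (by simpa using R.evol_h hF.isEvol hC hp)
    (fun m => R.chiDer_h hF m hC hp) (hev _) ?_ (fun m hm => by
      rw [h2 m hm, map_zero, map_zero, LinearMap.zero_apply])
  · simpa using h
  · obtain ⟨c, hc⟩ := S.𝓖.exh (S.tensorOne C)
    obtain ⟨N, hN⟩ := R.conj_opOf_eventually (π := π) hev (1 - c)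
    exact ⟨N, fun m hm => S.lFormL_of_deg (by linarith) (hN m hm) hc⟩

end DSData

namespace DSData

variable {𝔤 ι : Type*} [AddCommGroup 𝔤] [Module ℂ 𝔤] [Fintype ι] [DecidableEq ι]
  {S : DSData 𝔤 ι}

/-! ### The Hamiltonian flows on the universal Lax operator -/

theorem parityAut_gForm (x y : S.GA) :
    parityAut _ (S.gForm x y) = S.gForm (S.tParity x) (S.tParity y) := by
  induction x using S.ga_induction with
  | h0 => simp
  | hadd x x' hx hx' => simp only [map_add, LinearMap.add_apply, hx, hx']
  | h p q a u ha hu =>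
    induction y using S.ga_induction with
    | h0 => simp
    | hadd y y' hy hy' => simp only [map_add, hy, hy']
    | h p' q' b v hb hv =>
      rw [S.tParity_pure ha hu, S.tParity_pure hb hv, map_smul, map_smul, LinearMap.smul_apply,
        S.gForm_pure a hb hu, map_smul, hu.mul hv, smul_smul, smul_smul, smul_smul]
      by_cases h : p = p'
      · subst h
        congr 1
        have e := sgn_mul_self p
        simp only [sgn_add]
        linear_combination (-(sgn (p * q) * S.form a b * sgn q * sgn q')) * e
      · rw [S.form_even _ _ h a ha b hb]
        simp

theorem isPar_lFormL {p q : ZMod 2} {x y : S.LGA} (hx : S.𝓖.P x = sgn p • x)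
    (hy : S.𝓖.P y = sgn q • y) : IsPar (p + q) (S.lFormL x y) := by
  rw [IsPar, lFormL_apply, Laurent.conv_coeff]
  have hf := Laurent.conv_finite S.gForm x y 0
  rw [← AlgHom.toLinearMap_apply, ← LinearMap.toAddMonoidHom_coe, AddMonoidHom.map_finsum _ hf,
    smul_finsum' _ hf]
  refine finsum_congr fun k => ?_
  change parityAut _ _ = _
  rw [parityAut_gForm, S.𝓖_par_iff.1 hx, S.𝓖_par_iff.1 hy, map_smul, map_smul,
    LinearMap.smul_apply, smul_smul, sgn_add, mul_comm]

theorem Dressing.h_par (R : S.Dressing) {p : ZMod 2} {C : Laurent 𝔤} (hp : S.HasParity p C) :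
    IsPar (p + 1) (R.h C) := by
  rw [R.h_eq, add_comm]
  exact isPar_lFormL (by rw [R.K_par, sgn_one_smul]) (S.tensorOne_par hp)

section Ham

variable (c : ι → ι → ℕ → S.Aff)

variable (S) in
/-- The superderivations `φ ↦ {u_t _χ φ}` of `𝒫`, for the reduced bracket with values `c`. -/
def redFam (t : ι) (m : ℕ) : S.Aff →ₗ[ℂ] S.Aff :=
  leibnizExt S.barPar (S.barPar t) (S.redVal (c t)) m

variable (S) in
/-- The Hamiltonian derivation `{a_χ · }|_{χ = 0}` of `𝒫`, where `a` has parity `p + 1`, for the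
reduced bracket with values `c`. -/
def ham (p : ZMod 2) (a : S.Aff) : S.Aff →ₗ[ℂ] S.Aff :=
  leibnizExt S.barPar (p + 1) (S.redVal (revVal c (p + 1) a)) 0

variable {c}

theorem valPar_redVal_revVal {p : ZMod 2} {a : S.Aff} (ha : IsPar (p + 1) a) :
    ValPar (p + 1 + 1) (S.redVal (revVal c (p + 1) a)) := S.valPar_redVal (valPar_revVal c ha)

theorem isEvol_ham {p : ZMod 2} {a : S.Aff} (ha : IsPar (p + 1) a) : IsEvol p (S.ham c p a) := by
  have h := (isChiDer_leibnizExt (valPar_redVal_revVal (c := c) ha)).isEvol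
  rwa [par_add_one_add_one] at h

theorem reduce_chiBracket {p : ZMod 2} {a φ : S.Aff} (ha : IsPar (p + 1) a) (hφ : φ ∈ S.P) :
    S.reduce (chiBracket S.barPar c a φ 0) = S.ham c p a φ := by
  rw [chiBracket_of_isPar _ ha, S.reduce_leibnizExt (valPar_revVal c ha) hφ]
  rfl

variable (hc : ∀ t, ValPar (S.barPar t + 1) (c t)) (hc2 : ∀ t r m, 2 ≤ m → c t r m = 0)

theorem isChiDer_redFam (hc : ∀ t, ValPar (S.barPar t + 1) (c t)) (t : ι) :
    IsChiDer (S.par t) (S.redFam c t) := by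
  have h := isChiDer_leibnizExt (S.valPar_redVal (hc t))
  rwa [barPar, par_add_one_add_one] at h

theorem redFam_jet (hc : ∀ t, ValPar (S.barPar t + 1) (c t)) (t : ι) {r : ι} (hr : r ∈ S.I)
    (m : ℕ) : S.redFam c t m (jet S.barPar r 0) = S.reduce (c t r m) := by
  rw [redFam, leibnizExt_jet_zero (S.valPar_redVal (hc t)), redVal, if_pos hr]

theorem redFam_eventually (hc : ∀ t, ValPar (S.barPar t + 1) (c t))
    (hc2 : ∀ t r m, 2 ≤ m → c t r m = 0) (t : ι) (φ : S.Aff) :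
    ∃ N, ∀ m, N ≤ m → S.redFam c t m φ = 0 :=
  leibnizExt_eventually (S.valPar_redVal (hc t)) (N := 2) (fun r m hm => by
    rw [redVal, hc2 t r m hm, map_zero, ite_self]) φ

theorem redFam_Qu (hc : ∀ t, ValPar (S.barPar t + 1) (c t))
    (hc2 : ∀ t r m, 2 ≤ m → c t r m = 0) (t : ι) (m : ℕ) (hm : 2 ≤ m) (q : ZMod 2) :
    S.gDer q (S.redFam c t m) S.Qu = 0 := by
  rw [gDer_Qu]
  refine Finset.sum_eq_zero fun r hr => ?_
  rw [redFam_jet hc t hr, hc2 t r m hm, map_zero, TensorProduct.tmul_zero, smul_zero]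

theorem reduce_D_pow (m : ℕ) (a : S.Aff) : S.reduce ((S.D ^ m) a) = (S.D ^ m) (S.reduce a) := by
  induction m with
  | zero => rfl
  | succ m ih => rw [pow_succ', Module.End.mul_apply, Module.End.mul_apply, reduce_D, ih]

theorem ham_jet (hc : ∀ t, ValPar (S.barPar t + 1) (c t))
    (hc2 : ∀ t r m, 2 ≤ m → c t r m = 0) {p : ZMod 2} {a : S.Aff} (ha : IsPar (p + 1) a)
    (haP : a ∈ S.P) {t : ι} (ht : t ∈ S.I) : S.ham c p a (jet S.barPar t 0)
      = sgn ((p + 1) * S.barPar t) • ∑ᶠ m : ℕ, (-1 : ℂ) ^ m • (S.D ^ m) (S.redFam c t m a) := by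
  rw [ham, leibnizExt_jet_zero (valPar_redVal_revVal ha), redVal, if_pos ht, revVal_coeff_zero,
    map_smul]
  congr 1
  have hf : (Function.support fun m : ℕ => (-1 : ℂ) ^ m • (SuperDS.D S.barPar ^ m)
      (leibnizExt S.barPar (S.barPar t) (c t) m a)).Finite := by
    obtain ⟨N, hN⟩ := leibnizExt_eventually (hc t) (N := 2) (fun r m hm => hc2 t r m hm) a
    refine (Finset.range N).finite_toSet.subset fun m hm => ?_
    rw [Finset.coe_range, Set.mem_Iio]
    by_contra h
    exact hm (by dsimp only; rw [hN m (not_lt.1 h), map_zero, smul_zero])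
  have h := AddMonoidHom.map_finsum (S.reduce.toLinearMap.toAddMonoidHom) hf
  refine h.trans (finsum_congr fun m => ?_)
  change S.reduce ((-1 : ℂ) ^ m • (S.D ^ m) (leibnizExt S.barPar (S.barPar t) (c t) m a)) = _
  rw [map_smul, reduce_D_pow, S.reduce_leibnizExt (hc t) haP]
  rfl

end Ham

variable (S) in
/-- The projection onto the span of the `q_t ⊗ 1`, `t ∈ I`, along the span of the `q_t ⊗ 1`,
`t ∉ I`; it is adjoint to the projection onto `𝔟 ⊗ 𝒫(\bar 𝔤)`. -/
def pLow : S.GA →ₗ[ℂ] S.GA :=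
  ∑ t ∈ S.I, TensorProduct.mk ℂ 𝔤 S.Aff (S.qLow t) ∘ₗ S.coord S.qLow t

theorem pLow_apply (y : S.GA) : S.pLow y = ∑ t ∈ S.I, S.qLow t ⊗ₜ S.coord S.qLow t y := by
  rw [pLow, LinearMap.sum_apply]
  rfl

theorem gForm_dual {t r : ι} (h : t ≠ r) (u v : S.Aff) :
    S.gForm (S.qUp t ⊗ₜ u) (S.qLow r ⊗ₜ v) = 0 := by
  change TensorProduct.lid ℂ S.Aff
    (S.tensorExt S.form (S.qUp t ⊗ₜ u) (S.qLow r ⊗ₜ v)) = 0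
  rw [tensorExt_tmul, gradeComp_of_mem _ (S.qLow_mem_part r),
    gradeComp_of_mem _ (S.qLow_mem_part r)]
  have h0 : S.form (S.qUp t) (S.qLow r) = 0 := by rw [S.dual, if_neg h]
  split_ifs <;> simp [h0]

theorem gForm_pB (y x : S.GA) : S.gForm (S.pB y) x = S.gForm y (S.pLow x) := by
  rw [pB_apply, pLow_apply]
  conv_lhs => rw [← S.sum_coord S.qLow x]
  conv_rhs => rw [← S.sum_coord S.qUp y]
  simp only [map_sum, LinearMap.sum_apply]
  have h1 : ∀ t ∈ S.I, ∑ r, S.gForm (S.qUp t ⊗ₜ S.coord S.qUp t y) (S.qLow r ⊗ₜ S.coord S.qLow r x)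
      = S.gForm (S.qUp t ⊗ₜ S.coord S.qUp t y) (S.qLow t ⊗ₜ S.coord S.qLow t x) := fun t _ =>
    Finset.sum_eq_single t (fun r _ hr => gForm_dual hr.symm _ _)
      fun h => absurd (Finset.mem_univ _) h
  have h2 : ∀ r ∈ S.I, ∑ t, S.gForm (S.qUp t ⊗ₜ S.coord S.qUp t y) (S.qLow r ⊗ₜ S.coord S.qLow r x)
      = S.gForm (S.qUp r ⊗ₜ S.coord S.qUp r y) (S.qLow r ⊗ₜ S.coord S.qLow r x) := fun r _ =>
    Finset.sum_eq_single r (fun t _ ht => gForm_dual ht _ _) fun h => absurd (Finset.mem_univ _) h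
  rw [Finset.sum_comm, Finset.sum_congr rfl h1, Finset.sum_congr rfl h2]

theorem coord_qLow_par {p : ZMod 2} {x : S.GA} (hx : S.tParity x = sgn p • x) (t : ι) :
    IsPar (p + S.par t) (S.coord S.qLow t x) := by
  refine S.ga_induction_par (p := p) (Q := fun x => IsPar (p + S.par t) (S.coord S.qLow t x)) ?_ ?_
    ?_ hx
  · rw [map_zero]
    exact isPar_zero _
  · intro x y hx hy
    rw [map_add]
    exact hx.add hy
  · intro q r a u hqr ha hu
    rw [coord_tmul, Module.Basis.coord_apply, qLow_repr]
    by_cases h : S.par t = q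
    · refine IsPar.smul _ ?_
      rw [← hqr, h, add_assoc, add_comm r, ← add_assoc, par_add_self, zero_add]
      exact hu
    · rw [S.form_even _ _ h _ (S.qUp_part t) _ ha, zero_smul]
      exact isPar_zero _

theorem pLow_par {p : ZMod 2} {x : S.GA} (hx : S.tParity x = sgn p • x) :
    S.tParity (S.pLow x) = sgn p • S.pLow x := by
  rw [pLow_apply, map_sum, Finset.smul_sum]
  refine Finset.sum_congr rfl fun t _ => ?_
  rw [S.tParity_pure (S.qLow_mem_part t) (coord_qLow_par hx t), add_left_comm, par_add_self,
    add_zero]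

theorem pLow_sub (x : S.GA) :
    S.pLow x - x = -∑ t ∈ Finset.univ \ S.I, S.qLow t ⊗ₜ S.coord S.qLow t x := by
  have e := (Finset.sum_sdiff (Finset.subset_univ S.I)
    (f := fun t => S.qLow t ⊗ₜ[ℂ] S.coord S.qLow t x)).trans (S.sum_coord S.qLow x)
  rw [pLow_apply, eq_neg_iff_add_eq_zero, sub_add_eq_add_sub, sub_eq_zero, add_comm]
  exact e

theorem pLow_sub_mem {x : S.GA} (hx : x ∈ S.tens ⊤ (Subalgebra.toSubmodule S.P)) :
    S.pLow x - x ∈ S.tens S.𝔪 (Subalgebra.toSubmodule S.P) := by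
  rw [pLow_sub]
  refine Submodule.neg_mem _ (Submodule.sum_mem _ fun t ht => ?_)
  exact S.tmul_mem_tens (qLow_mem_𝔪 S (Finset.mem_sdiff.1 ht).2) (S.coord_mem _ _ hx)

namespace Dressing

variable (R : S.Dressing)

theorem lFormL_single (x : S.GA) (y : S.LGA) :
    S.lFormL (Laurent.single 0 x) y = S.gForm x (y.1 0) := by
  rw [lFormL_apply, Laurent.conv_single_left, sub_zero]

theorem res_par_coeff {p : ZMod 2} {C : Laurent 𝔤} (hp : S.HasParity p C) (n : ℤ) :
    S.tParity ((R.res C).1 n) = sgn p • (R.res C).1 n := S.𝓖_par_iff.1 (R.res_par hp) n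

/-- The Hamiltonian derivation of `h_C` acts on the universal Lax operator through the resolvent. -/
theorem ham_h_Qu {c : ι → ι → ℕ → S.Aff} (hc : ∀ t, ValPar (S.barPar t + 1) (c t))
    (hc2 : ∀ t r m, 2 ≤ m → c t r m = 0) {A : S.GA} (hA : S.tParity A = sgn 1 • A) (μ : ℂ)
    (h0 : ∀ t ∈ S.I, S.gDer (S.par t) (S.redFam c t 0) S.Qu
      = -S.pB (S.gBr (S.qLow t ⊗ₜ 1) A))
    (h1 : ∀ t ∈ S.I, S.gDer (S.par t + 1) (S.redFam c t 1) S.Qu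
      = (μ * sgn (S.par t)) • S.pB (S.qLow t ⊗ₜ 1))
    {p : ZMod 2} {C : Laurent 𝔤} (hC : C ∈ S.Z) (hp : S.HasParity p C) :
    S.gDer p (S.ham c p (R.h C)) S.Qu
      = -S.pB (S.gBr (S.pLow ((R.res C).1 0)) A
          - (μ * sgn p) • S.gDer 1 S.D (S.pLow ((R.res C).1 0))) := by
  have hE := pLow_par (R.res_par_coeff hp 0)
  set E := S.pLow ((R.res C).1 0)
  rw [gDer_Qu, pB_apply, ← Finset.sum_neg_distrib]
  refine Finset.sum_congr rfl fun t ht => ?_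
  rw [ham_jet hc hc2 (R.h_par hp) (R.h_mem_W C).1 ht,
    R.finsum_chiDer_h (isChiDer_redFam hc t) (redFam_eventually hc hc2 t) (redFam_Qu hc hc2 t)
      hC hp,
    h0 t ht, h1 t ht, lFormL_single, lFormL_single, map_neg, map_smul, LinearMap.neg_apply,
    LinearMap.smul_apply, gForm_pB, gForm_pB, map_smul, gForm_invariant]
  have hq : S.tParity (S.qLow t ⊗ₜ[ℂ] (1 : S.Aff)) = sgn (S.par t) • (S.qLow t ⊗ₜ 1) := by
    simpa using S.tParity_pure (S.qLow_mem_part t)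
      (isPar_one (ε := fun x : ι × ℕ => S.barPar x.1 + (x.2 : ZMod 2)))
  rw [gDer_gForm S.isSDer_D hq, gDer_tmul_one S.isSDer_D, map_zero, LinearMap.zero_apply, zero_add,
    one_mul, coord_eq_gForm, S.gBr_skew hA hE, one_mul, ← TensorProduct.tmul_smul,
    ← TensorProduct.tmul_neg]
  congr 1
  simp only [map_neg, map_sub, map_smul]
  generalize S.gForm (S.qLow t ⊗ₜ[ℂ] (1 : S.Aff)) (S.gBr E A) = x
  generalize S.gForm (S.qLow t ⊗ₜ[ℂ] (1 : S.Aff)) (S.gDer 1 S.D E) = y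
  rw [barPar]
  rcases zmod2_cases p with rfl | rfl <;> rcases zmod2_cases (S.par t) with h | h <;> rw [h] <;>
    simp [show (1 + 1 : ZMod 2) = 0 by decide] <;> module

theorem gBr_odd_mem {U : Submodule ℂ 𝔤} {b : 𝔤} (hb : b ∈ S.part 1)
    (h : ∀ a ∈ U, S.br a b ∈ S.𝔟) {A : Submodule ℂ S.Aff} {x : S.GA} (hx : x ∈ S.tens U A) :
    S.gBr x (b ⊗ₜ 1) ∈ S.tens S.𝔟 ⊤ := by
  refine S.tens_le (Q := (S.tens S.𝔟 ⊤).comap ((S.gBr.flip) (b ⊗ₜ[ℂ] (1 : S.Aff))))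
    (fun a ha u _ => ?_) hx
  rw [Submodule.mem_comap, LinearMap.flip_apply, gBr, tensorExt_tmul, gradeComp_of_mem _ hb,
    gradeComp_of_mem _ hb, if_neg (by decide), if_pos rfl, map_zero, TensorProduct.zero_tmul,
    zero_add]
  exact S.tmul_mem_tens (h a ha) Submodule.mem_top

theorem gBr_s_mem_𝔟 {A : Submodule ℂ S.Aff} {x : S.GA} (hx : x ∈ S.tens ⊤ A) :
    S.gBr x (S.s ⊗ₜ 1) ∈ S.tens S.𝔟 ⊤ :=
  gBr_odd_mem S.s_odd (fun a _ => S.mem_𝔟.2 fun m hm => by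
    rw [S.form_invariant, S.br_s _ (S.𝔪_le hm), map_zero]) hx

/-- The gauge part of the Hamiltonian derivation of `h_C`. -/
def gaugePart (C : Laurent 𝔤) : S.GA := S.pLow ((R.res C).1 0) - (R.res C).1 0

theorem gaugePart_mem (C : Laurent 𝔤) :
    R.gaugePart C ∈ S.tens S.𝔪 (Subalgebra.toSubmodule S.P) := pLow_sub_mem (R.res_coefR C 0)

theorem Qf_par : S.tParity (S.Qu + S.f ⊗ₜ 1) = sgn 1 • (S.Qu + S.f ⊗ₜ 1) := by
  rw [map_add, S.Qu_par, S.f_odd₁, smul_add]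
  simp

/-- The first Hamiltonian flow of `h_C` on the universal Lax operator: up to an infinitesimal gauge
transformation by an element of `𝔪 ⊗ 𝒫`, it is `[E_{-1}, s]` with the resolvent `E` of `C`. -/
theorem ham₁_Qu {p : ZMod 2} {C : Laurent 𝔤} (hC : C ∈ S.Z) (hp : S.HasParity p C) :
    S.gDer p (S.ham S.c₁ p (R.h C)) S.Qu = S.gBr ((R.res C).1 (-1)) (S.s ⊗ₜ 1)
      - (S.gBr (R.gaugePart C) (S.Qu + S.f ⊗ₜ 1) - sgn p • S.gDer 1 S.D (R.gaugePart C)) := by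
  have hfam : ∀ t, S.redFam S.c₁ t = S.fam (S.par t) (S.qLow t) := fun t => by
    funext m
    rw [redFam, c₁_eq]
    rfl
  rw [R.ham_h_Qu valPar_c₁ (fun t r m hm => by rw [c₁_eq, S.affVal_eq_zero _ _ _ _ hm]) Qf_par 1
    (fun t _ => by rw [hfam]; exact fam_zero_Qu (S.qLow_mem_part t))
    (fun t _ => by rw [hfam, fam_one_Qu (S.qLow_mem_part t), one_mul]) hC hp]
  have e := R.lax_res_coeff hC hp 0
  rw [zero_sub] at e
  have h1 : S.pLow ((R.res C).1 0) = R.gaugePart C + (R.res C).1 0 := by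
    rw [gaugePart, sub_add_cancel]
  have h2 : S.gBr (S.pLow ((R.res C).1 0)) (S.Qu + S.f ⊗ₜ 1)
      - (1 * sgn p) • S.gDer 1 S.D (S.pLow ((R.res C).1 0))
      = (S.gBr (R.gaugePart C) (S.Qu + S.f ⊗ₜ 1) - sgn p • S.gDer 1 S.D (R.gaugePart C))
        - S.gBr ((R.res C).1 (-1)) (S.s ⊗ₜ 1) := by
    rw [h1, one_mul, map_add S.gBr, LinearMap.add_apply, map_add (S.gDer 1 S.D), smul_add,
      sub_eq_add_neg _ (S.gBr ((R.res C).1 (-1)) (S.s ⊗ₜ 1)), ← e]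
    abel
  rw [h2, pB_of_mem (A := ⊤), neg_sub]
  refine Submodule.sub_mem _ (Submodule.sub_mem _ ?_ ?_) (gBr_s_mem_𝔟 (R.res_coefR C (-1)))
  · have hm := S.tens_mono S.𝔪_le le_rfl (R.gaugePart_mem C)
    rw [map_add]
    refine Submodule.add_mem _ ?_ ?_
    · exact S.tens_mono le_rfl le_top (S.gBr_mem_tens (fun a ha p => S.span_qUp_part _ ha p)
        (fun _ h => S.P_par h) (fun n hn b hb => S.br_𝔫_𝔟 hn hb) hm S.Qu_mem)
    · exact gBr_odd_mem S.f_odd (fun a ha => S.br_𝔫_f ha) hm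
  · refine Submodule.smul_mem _ _ ?_
    refine S.tens_gDer (R := ⊤) (fun a ha p => S.span_qUp_part _ ha p) 1
      (fun _ _ => Submodule.mem_top) ?_
    exact S.tens_mono (S.𝔪_le.trans S.𝔫_le_𝔟) le_top (R.gaugePart_mem C)

theorem valPar_c₂ (t : ι) : ValPar (S.barPar t + 1) (S.c₂ t) := by
  intro r m
  match m with
  | 0 =>
    change IsPar _
      (sgn (S.par t + 1) • algebraMap ℂ S.Aff (S.form S.s (S.br (S.qLow t) (S.qLow r))))
    by_cases h : 1 = S.par t + S.par r
    · refine IsPar.smul _ ?_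
      convert isPar_algebraMap (ε := fun x : ι × ℕ => S.barPar x.1 + (x.2 : ZMod 2)) _ using 1
      rw [barPar, barPar, par_add_one_add_one, ← add_assoc, ← h, Nat.cast_zero, add_zero,
        par_add_self]
    · rw [S.form_even _ _ h _ S.s_odd _ (S.br_mem _ _ _ (S.qLow_mem_part t) _ (S.qLow_mem_part r)),
        map_zero, smul_zero]
      exact isPar_zero _
  | m + 1 => exact isPar_zero _

/-- The second Hamiltonian flow of `h_C` on the universal Lax operator. -/
theorem ham₂_Qu {p : ZMod 2} {C : Laurent 𝔤} (hC : C ∈ S.Z) (hp : S.HasParity p C) :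
    S.gDer p (S.ham S.c₂ p (R.h C)) S.Qu = S.gBr ((R.res C).1 0) (S.s ⊗ₜ 1) := by
  have hs : S.tParity (-(S.s ⊗ₜ[ℂ] (1 : S.Aff))) = sgn 1 • -(S.s ⊗ₜ[ℂ] (1 : S.Aff)) := by
    have := S.tParity_pure (q := 0) S.s_odd isPar_one
    rw [add_zero] at this
    rw [map_neg, smul_neg, this]
  have hc : ∀ t r m, 1 ≤ m → S.c₂ t r m = 0 := fun t r m hm => by
    obtain ⟨k, rfl⟩ : ∃ k, m = k + 1 := ⟨m - 1, by omega⟩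
    rfl
  rw [R.ham_h_Qu valPar_c₂ (fun t r m hm => hc t r m (by omega)) hs 0 ?_ ?_ hC hp]
  · rw [zero_mul, zero_smul, sub_zero, map_neg, map_neg, neg_neg]
    have h1 : S.pLow ((R.res C).1 0) = R.gaugePart C + (R.res C).1 0 := by
      rw [gaugePart, sub_add_cancel]
    rw [h1, map_add, LinearMap.add_apply, gBr_𝔫_s (S.tens_mono S.𝔪_le le_rfl (R.gaugePart_mem C)),
      zero_add]
    exact pB_of_mem (gBr_s_mem_𝔟 (R.res_coefR C 0))
  · intro t ht
    have e : S.gBr (S.qLow t ⊗ₜ[ℂ] (1 : S.Aff)) (-(S.s ⊗ₜ 1)) = -(S.br (S.qLow t) S.s ⊗ₜ 1) := by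
      rw [map_neg]
      exact congrArg Neg.neg (S.tensorExt_one_left S.br _ _ _)
    rw [e, map_neg, neg_neg, gDer_Qu, pB_apply]
    refine Finset.sum_congr rfl fun r hr => ?_
    rw [redFam_jet valPar_c₂ t hr, coord_tmul, Module.Basis.coord_apply, qUp_repr]
    change _ • _ ⊗ₜ[ℂ] S.reduce (sgn (S.par t + 1) •
      algebraMap ℂ S.Aff (S.form S.s (S.br (S.qLow t) (S.qLow r)))) = _
    rw [map_smul, AlgHom.commutes, Algebra.algebraMap_eq_smul_one, smul_smul,
      TensorProduct.tmul_smul, TensorProduct.tmul_smul, smul_smul, ← S.form_invariant,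
      S.skew 1 (S.par t) _ S.s_odd _ (S.qLow_mem_part t), one_mul, map_neg, map_smul,
      LinearMap.neg_apply, LinearMap.smul_apply, smul_eq_mul]
    by_cases h : S.par t + 1 = S.par r
    · congr 1
      rw [← h, mul_add, par_mul_self, mul_one, par_add_self, sgn_zero, sgn_add, sgn_one]
      have := sgn_mul_self (S.par t)
      linear_combination S.form (S.br (S.qLow t) S.s) (S.qLow r) * this
    · rw [S.form_even _ _ h _ (S.br_mem _ _ _ (S.qLow_mem_part t) _ S.s_odd) _
        (S.qLow_mem_part r)]
      simp
  · intro t ht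
    rw [zero_mul, zero_smul, gDer_Qu]
    refine Finset.sum_eq_zero fun r hr => ?_
    rw [redFam_jet valPar_c₂ t hr, hc t r 1 le_rfl, map_zero, TensorProduct.tmul_zero, smul_zero]

end Dressing

end DSData

/-! ### Evolutionary derivations combined from a family of superderivations -/

section Smear

variable {ι : Type*} {ε : ι → ZMod 2}

theorem isPar_D_pow {ρ : ZMod 2} {r : DiffPoly ε} (hr : IsPar ρ r) (k : ℕ) :
    IsPar (ρ + k) ((D ε ^ k) r) := by
  induction k with
  | zero => simpa using hr
  | succ k ih =>
    rw [pow_succ', Module.End.mul_apply, Nat.cast_succ, ← add_assoc, add_comm]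
    exact isPar_D ih

/-- The signs of `smear`. -/
def smearSgn (ρ : ZMod 2) : ℕ → ℂ
  | 0 => 1
  | k + 1 => sgn (ρ + k) * smearSgn ρ k

theorem smear_finite {F : ℕ → DiffPoly ε →ₗ[ℂ] DiffPoly ε} (hF : ∀ a, ∃ N, ∀ n, N ≤ n → F n a = 0)
    (c : ℕ → ℂ) (r : ℕ → DiffPoly ε) (a : DiffPoly ε) :
    (Function.support fun k => c k • (r k * F k a)).Finite := by
  obtain ⟨N, hN⟩ := hF a
  refine (Finset.range N).finite_toSet.subset fun m hm => ?_
  rw [Finset.coe_range, Set.mem_Iio]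
  by_contra h
  exact hm (by simp only [hN m (not_lt.1 h), mul_zero, smul_zero])

variable {π ρ : ZMod 2} {F : ℕ → DiffPoly ε →ₗ[ℂ] DiffPoly ε}

/-- The derivation `∑_k ± (D^k r) F_k`, where `r` has parity `ρ`: it is obtained from
`∑_k χ^k F_k` by substituting `±D` acting on `r` for `χ`. -/
def smear (ρ : ZMod 2) (r : DiffPoly ε) (hF : ∀ a, ∃ N, ∀ n, N ≤ n → F n a = 0) :
    DiffPoly ε →ₗ[ℂ] DiffPoly ε where
  toFun a := ∑ᶠ k, smearSgn ρ k • ((D ε ^ k) r * F k a)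
  map_add' a b := by
    rw [← finsum_add_distrib (smear_finite hF _ _ a) (smear_finite hF _ _ b)]
    exact finsum_congr fun k => by rw [map_add, mul_add, smul_add]
  map_smul' c a := by
    rw [RingHom.id_apply, smul_finsum' _ (smear_finite hF _ _ a)]
    exact finsum_congr fun k => by rw [map_smul, mul_smul_comm, smul_comm]

variable {r : DiffPoly ε} (hF : ∀ a, ∃ N, ∀ n, N ≤ n → F n a = 0)

theorem smear_apply (a : DiffPoly ε) :
    smear ρ r hF a = ∑ᶠ k, smearSgn ρ k • ((D ε ^ k) r * F k a) := rfl

theorem smear_eq_sum {a : DiffPoly ε} {N : ℕ} (hN : ∀ n, N ≤ n → F n a = 0) :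
    smear ρ r hF a = ∑ k ∈ Finset.range N, smearSgn ρ k • ((D ε ^ k) r * F k a) := by
  refine finsum_eq_sum_of_support_subset _ fun m hm => ?_
  rw [Finset.coe_range, Set.mem_Iio]
  by_contra h
  exact hm (by simp only [hN m (not_lt.1 h), mul_zero, smul_zero])

theorem smear_eq_zero {a : DiffPoly ε} (h : ∀ k, F k a = 0) : smear ρ r hF a = 0 :=
  smear_eq_sum hF (N := 0) fun n _ => h n

/-- The combination `∑ ± (D^k r) F_k` is evolutionary: its commutator with `D` telescopes. -/
theorem isEvol_smear (h : IsChiDer π F) (hr : IsPar ρ r) : IsEvol (π + ρ) (smear ρ r hF) := by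
  refine ⟨⟨fun a => ?_, fun a b => ?_⟩, fun b => ?_⟩
  · rw [smear_apply, smear_apply, ← AlgHom.toLinearMap_apply, ← LinearMap.toAddMonoidHom_coe,
      AddMonoidHom.map_finsum _ (smear_finite hF _ _ a), smul_finsum' _ (smear_finite hF _ _ _)]
    refine finsum_congr fun k => ?_
    change parityAut _ (smearSgn ρ k • ((D ε ^ k) r * F k a)) = _
    rw [map_smul, map_mul, isPar_D_pow hr, (h.der k).par, smul_mul_smul_comm, ← sgn_add, smul_comm]
    congr 2
    rw [show ρ + (k : ZMod 2) + (π + k) = π + ρ + (k + k) by ring, par_add_self, add_zero]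
  · have e : ∀ x : DiffPoly ε, smear ρ r hF a * x
        = ∑ᶠ k, smearSgn ρ k • ((D ε ^ k) r * (F k a * x)) := fun x => by
      rw [smear_apply, finsum_mul' _ _ (smear_finite hF _ _ a)]
      exact finsum_congr fun k => by rw [smul_mul_assoc, mul_assoc]
    obtain ⟨N, hN⟩ := hF a
    obtain ⟨N', hN'⟩ := hF b
    have hab : ∀ n, max N N' ≤ n → F n (a * b) = 0 := fun n hn => by
      rw [(h.der n).leib, hN n (le_trans (le_max_left _ _) hn),
        hN' n (le_trans (le_max_right _ _) hn), zero_mul, mul_zero, add_zero]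
    rw [smear_eq_sum hF hab, smear_eq_sum hF (N := max N N') fun n hn => hN n (le_trans
      (le_max_left _ _) hn), smear_eq_sum hF (N := max N N') fun n hn => hN' n (le_trans
      (le_max_right _ _) hn), Finset.sum_mul, Finset.mul_sum, ← Finset.sum_add_distrib]
    refine Finset.sum_congr rfl fun k _ => ?_
    rw [(h.der k).leib, mul_add, smul_add, smul_mul_assoc, mul_assoc, mul_smul_comm]
    congr 2
    rw [← mul_assoc, (isPar_D_pow hr k).mul_eq_tw, tw_tw, mul_assoc]
    rw [show ρ + (k : ZMod 2) + (π + k) = π + ρ + (k + k) by ring, par_add_self, add_zero]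
  · obtain ⟨N, hN⟩ := hF b
    obtain ⟨N', hN'⟩ := hF (D ε b)
    have key : ∀ K, ∑ k ∈ Finset.range (K + 1), smearSgn ρ k • ((D ε ^ k) r * F k (D ε b))
        = sgn (π + ρ) • D ε (∑ k ∈ Finset.range K, smearSgn ρ k • ((D ε ^ k) r * F k b))
          + (smearSgn ρ K * sgn (π + K)) • ((D ε ^ K) r * D ε (F K b)) := by
      intro K
      induction K with
      | zero => simp [smearSgn, h.isEvol.map_D]
      | succ K ih =>
        have hD : D ε ((D ε ^ K) r) = (D ε ^ (K + 1)) r := by rw [pow_succ', Module.End.mul_apply]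
        rw [Finset.sum_range_succ, ih, Finset.sum_range_succ _ K, map_add, map_smul,
          isSDer_D.leib' (isPar_D_pow hr K), h.map_D_succ, mul_add, mul_smul_comm, mul_smul_comm,
          smearSgn, hD, one_mul, sgn_add π ρ, sgn_add ρ,
          sgn_add π, smul_add, smul_add, smul_add, smul_add, smul_smul, smul_smul, smul_smul,
          smul_smul, smul_smul]
        have e1 := sgn_mul_self ρ
        have e2 : sgn π * sgn ρ * smearSgn ρ K * (sgn ρ * sgn (K : ZMod 2))
            = smearSgn ρ K * (sgn π * sgn (K : ZMod 2)) := by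
          linear_combination (smearSgn ρ K * (sgn π * sgn (K : ZMod 2))) * e1
        rw [e2]
        have e3 : sgn ρ * sgn (K : ZMod 2) * smearSgn ρ K * (sgn π * sgn (K : ZMod 2))
            = sgn π * sgn ρ * smearSgn ρ K := by
          linear_combination (sgn π * sgn ρ * smearSgn ρ K) * sgn_mul_self (K : ZMod 2)
        rw [e3]
        abel
    rw [smear_eq_sum hF (N := max N N' + 1) fun n hn => hN' n (by omega), key,
      smear_eq_sum hF (N := max N N') fun n hn => hN n (le_trans (le_max_left _ _) hn),
      hN _ (le_max_left _ _), map_zero, mul_zero, smul_zero, add_zero]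

end Smear

theorem IsEvol.add {ι : Type*} {ε : ι → ZMod 2} {π : ZMod 2} {d e : DiffPoly ε →ₗ[ℂ] DiffPoly ε}
    (hd : IsEvol π d) (he : IsEvol π e) : IsEvol π (d + e) :=
  ⟨hd.der.add he.der, fun b => by
    rw [LinearMap.add_apply, LinearMap.add_apply, hd.map_D, he.map_D, map_add, smul_add]⟩

theorem IsEvol.smul {ι : Type*} {ε : ι → ZMod 2} {π : ZMod 2} {d : DiffPoly ε →ₗ[ℂ] DiffPoly ε}
    (c : ℂ) (hd : IsEvol π d) : IsEvol π (c • d) :=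
  ⟨hd.der.smul c, fun b => by
    rw [LinearMap.smul_apply, LinearMap.smul_apply, hd.map_D, map_smul, smul_comm]⟩

theorem IsEvol.sum {ι κ : Type*} {ε : ι → ZMod 2} {π : ZMod 2} {s : Finset κ}
    {d : κ → DiffPoly ε →ₗ[ℂ] DiffPoly ε} (hd : ∀ k ∈ s, IsEvol π (d k)) :
    IsEvol π (∑ k ∈ s, d k) := by
  classical
  induction s using Finset.induction_on with
  | empty => exact (IsChiDer.zero π).isEvol
  | insert k s hk ih =>
    rw [Finset.sum_insert hk]
    exact (hd k (Finset.mem_insert_self _ _)).add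
      (ih fun l hl => hd l (Finset.mem_insert_of_mem hl))

/-- The supercommutators of a family of superderivations with an evolutionary one. -/
theorem IsChiDer.supercomm {ι : Type*} {ε : ι → ZMod 2} {π p : ZMod 2}
    {F : ℕ → DiffPoly ε →ₗ[ℂ] DiffPoly ε} {X : DiffPoly ε →ₗ[ℂ] DiffPoly ε} (hF : IsChiDer π F)
    (hX : IsEvol p X) :
    IsChiDer (π + p) fun k => F k ∘ₗ X - sgn ((π + k) * p) • X ∘ₗ F k := by
  refine ⟨fun k => ?_, fun k b => ?_⟩
  · have h := (hF.der k).supercomm hX.der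
    rwa [add_right_comm] at h
  · cases k with
    | zero =>
      rw [chiD_zero]
      simp only [LinearMap.sub_apply, LinearMap.smul_apply, LinearMap.comp_apply, Nat.cast_zero,
        add_zero, hX.map_D, hF.isEvol.map_D, map_smul, map_sub, smul_sub, smul_smul, sgn_add]
      congr 2 <;> ring
    | succ k =>
      rw [chiD_succ]
      simp only [LinearMap.sub_apply, LinearMap.smul_apply, LinearMap.comp_apply, hX.map_D,
        hF.map_D_succ, map_smul, map_sub, map_add, smul_sub, smul_add, smul_smul, sgn_add, add_mul,
        ← sgn_natCast]
      have hp := sgn_mul_self p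
      have h1 : sgn (((k + 1 : ℕ) : ZMod 2) * p) = sgn ((k : ZMod 2) * p) * sgn p := by
        rw [← sgn_add, Nat.cast_succ, add_mul, one_mul]
      rw [h1]
      match_scalars
      · ring
      · ring
      · ring
      · ring

namespace DSData

variable {𝔤 ι : Type*} [AddCommGroup 𝔤] [Module ℂ 𝔤] [Fintype ι] [DecidableEq ι]
  {S : DSData 𝔤 ι}

/-- Superderivations of `𝒫(\bar 𝔤)` are determined on `u_t`, `t ∈ I`, by their action on `𝒬_u`. -/
theorem jet_eq_of_gDer_Qu {q : ZMod 2} {d e : S.Aff →ₗ[ℂ] S.Aff}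
    (h : S.gDer q d S.Qu = S.gDer q e S.Qu) {t : ι} (ht : t ∈ S.I) :
    d (jet S.barPar t 0) = e (jet S.barPar t 0) := by
  have key : ∀ d : S.Aff →ₗ[ℂ] S.Aff, S.coord S.qUp t (S.gDer q d S.Qu)
      = sgn (q * S.par t) • d (jet S.barPar t 0) := fun d => by
    rw [gDer_Qu, map_sum]
    simp only [map_smul, coord_basis]
    rw [Finset.sum_eq_single t (fun r _ hr => by rw [if_neg hr, smul_zero])
      (fun h => absurd ht h), if_pos rfl]
  have h1 := congrArg (S.coord S.qUp t) h
  rw [key, key] at h1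
  exact (smul_right_injective _ (sgn_ne_zero _)) h1

theorem evol_eq_on_P {q : ZMod 2} {d e : S.Aff →ₗ[ℂ] S.Aff} (hd : IsEvol q d) (he : IsEvol q e)
    (h : S.gDer q d S.Qu = S.gDer q e S.Qu) {a : S.Aff} (ha : a ∈ S.P) : d a = e a := by
  rw [P_eq] at ha
  refine hd.eqOn he ?_ ha
  rintro _ ⟨t, ht, rfl⟩
  exact jet_eq_of_gDer_Qu h ht

theorem gDer_supercomm (p q : ZMod 2) (c : ℂ) (d e : S.Aff →ₗ[ℂ] S.Aff) (y : S.GA) :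
    S.gDer (p + q) (d ∘ₗ e - c • e ∘ₗ d) y
      = S.gDer p d (S.gDer q e y) - c • S.gDer q e (S.gDer p d y) := by
  rw [gDer_gDer, gDer_gDer, sub_eq_add_neg, ← neg_one_smul ℂ (c • e ∘ₗ d), gDer_add, gDer_smul,
    gDer_smul, add_comm q p, LinearMap.add_apply, LinearMap.smul_apply, LinearMap.smul_apply,
    neg_one_smul, ← sub_eq_add_neg]

/-! ### Field-dependent gauge transformations -/

theorem gDer_mulLeft_gBr {π ρ : ZMod 2} {n : 𝔤} (hn : n ∈ S.part π) {r : S.Aff} (hr : IsPar ρ r)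
    (y : S.GA) : S.gDer ρ (LinearMap.mulLeft ℂ r) (S.gBr (n ⊗ₜ 1) y)
      = sgn (ρ * π) • S.gBr (n ⊗ₜ r) y := by
  induction y using S.ga_induction with
  | h0 => simp
  | hadd x y hx hy => simp only [map_add, hx, hy, smul_add]
  | h q q' b v hb hv =>
    rw [S.gBr_pure n hb isPar_one, S.gBr_pure n hb hr, map_smul,
      S.gDer_pure _ _ (S.br_mem _ _ _ hn _ hb), one_mul, mul_zero, sgn_zero, one_smul, smul_smul,
      mul_add, sgn_add, mul_comm q]
    rfl

theorem smear_fam_Qu {π ρ : ZMod 2} {n : 𝔤} (h : S.IsGauge π (S.fam π n) n) {r : S.Aff}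
    (hr : IsPar ρ r) : S.gDer (π + ρ) (smear ρ r (fam_eventually h.par)) S.Qu
      = -(sgn (ρ * π) • (S.gBr (n ⊗ₜ r) (S.Qu + S.f ⊗ₜ 1)
          - sgn (π + ρ) • S.gDer 1 S.D (n ⊗ₜ r))) := by
  -- Only the first two terms of the sum contribute to the action on the variables.
  have h1 : S.gDer (π + ρ) (smear ρ r (fam_eventually h.par)) S.Qu
      = S.gDer (π + ρ) (LinearMap.mulLeft ℂ r ∘ₗ S.fam π n 0
        + sgn ρ • LinearMap.mulLeft ℂ (S.D r) ∘ₗ S.fam π n 1) S.Qu := by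
    rw [gDer_Qu, gDer_Qu]
    refine Finset.sum_congr rfl fun t ht => ?_
    congr 2
    rw [smear_eq_sum _ (N := 2) fun m hm => by
      rw [fam_jet h.par m ht, S.affVal_eq_zero _ _ _ _ hm, map_zero], Finset.sum_range_succ,
      Finset.sum_range_one]
    simp [smearSgn, D]
  have h2 : π + ρ = ρ + 1 + (π + 1) := by
    rw [show ρ + 1 + (π + 1) = π + ρ + (1 + 1) by ring, par_add_self, add_zero]
  rw [h1, gDer_add, gDer_smul, LinearMap.add_apply, LinearMap.smul_apply, add_comm π ρ,
    ← gDer_gDer, h.act_zero, map_neg, gDer_mulLeft_gBr h.par hr, add_comm ρ π, h2, ← gDer_gDer,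
    ← h2, h.act_one, map_smul, S.gDer_pure _ _ h.par, S.gDer_pure _ _ h.par, smul_smul, smul_smul,
    smul_sub, smul_smul, smul_smul, neg_sub, neg_add_eq_sub, LinearMap.mulLeft_apply, mul_one]
  congr 2
  rw [add_mul, one_mul, sgn_add, sgn_add]
  ring

namespace Dressing

variable (R : S.Dressing)

variable (S) in
/-- The evolutionary derivation that acts on `𝒬_u` as the gauge transformation by
`∑_{t ∉ I} q_t ⊗ e_t`. -/
def gaugeDer (p : ZMod 2) (e : ι → S.Aff) : S.Aff →ₗ[ℂ] S.Aff :=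
  ∑ t ∈ Finset.univ \ S.I, sgn ((p + S.par t) * S.par t) •
    smear (p + S.par t) (e t) (fam_eventually (S.qLow_mem_part t))

theorem isGauge_qLow {t : ι} (ht : t ∈ Finset.univ \ S.I) :
    S.IsGauge (S.par t) (S.fam (S.par t) (S.qLow t)) (S.qLow t) :=
  isGauge_fam (S.𝔪_le (S.qLow_mem_𝔪 (Finset.mem_sdiff.1 ht).2)) (S.qLow_mem_part t)

variable {p : ZMod 2} {e : ι → S.Aff}

theorem par_add_cancel (p q : ZMod 2) : q + (p + q) = p := by
  rw [add_left_comm, par_add_self, add_zero]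

theorem isEvol_gaugeDer (he : ∀ t, IsPar (p + S.par t) (e t)) : IsEvol p (gaugeDer S p e) :=
  IsEvol.sum fun t _ => IsEvol.smul _ (by
    have h := isEvol_smear (fam_eventually (S.qLow_mem_part t)) (isChiDer_fam (S.qLow_mem_part t))
      (he t)
    rwa [par_add_cancel] at h)

theorem gaugeDer_W {φ : S.Aff} (hφ : φ ∈ S.W) : gaugeDer S p e φ = 0 := by
  rw [gaugeDer, LinearMap.sum_apply]
  refine Finset.sum_eq_zero fun t ht => ?_
  rw [LinearMap.smul_apply, smear_eq_zero _ (fun k => (mem_W_iff.1 hφ).2 _ _ (isGauge_qLow ht).mem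
    (S.qLow_mem_part t) k), smul_zero]

theorem gaugeDer_Qu (he : ∀ t, IsPar (p + S.par t) (e t)) : S.gDer p (gaugeDer S p e) S.Qu
    = -(S.gBr (∑ t ∈ Finset.univ \ S.I, S.qLow t ⊗ₜ e t) (S.Qu + S.f ⊗ₜ 1)
      - sgn p • S.gDer 1 S.D (∑ t ∈ Finset.univ \ S.I, S.qLow t ⊗ₜ e t)) := by
  have h : ∀ t ∈ Finset.univ \ S.I, S.gDer p (sgn ((p + S.par t) * S.par t) •
      smear (p + S.par t) (e t) (fam_eventually (S.qLow_mem_part t))) S.Qu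
      = -(S.gBr (S.qLow t ⊗ₜ e t) (S.Qu + S.f ⊗ₜ 1)
        - sgn p • S.gDer 1 S.D (S.qLow t ⊗ₜ e t)) := by
    intro t ht
    have h1 := smear_fam_Qu (isGauge_qLow ht) (he t)
    rw [par_add_cancel] at h1
    rw [gDer_smul, LinearMap.smul_apply, h1, smul_neg, smul_smul, sgn_mul_self, one_smul]
  have h2 : S.gDer p (gaugeDer S p e) S.Qu
      = ∑ t ∈ Finset.univ \ S.I, S.gDer p (sgn ((p + S.par t) * S.par t) •
        smear (p + S.par t) (e t) (fam_eventually (S.qLow_mem_part t))) S.Qu := by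
    simp only [gDer_Qu, gaugeDer, LinearMap.sum_apply, TensorProduct.tmul_sum, Finset.smul_sum]
    rw [Finset.sum_comm]
  rw [h2, Finset.sum_congr rfl h, Finset.sum_neg_distrib, Finset.sum_sub_distrib, ← Finset.smul_sum,
    map_sum, map_sum, LinearMap.sum_apply]

/-! ### The flows as isospectral deformations -/

theorem gaugePart_eq (C : Laurent 𝔤) : R.gaugePart C
    = -∑ t ∈ Finset.univ \ S.I, S.qLow t ⊗ₜ S.coord S.qLow t ((R.res C).1 0) := by
  rw [gaugePart, pLow_sub]

/-- The evolutionary derivation `X_C` with `X_C 𝒬_u = [E_{-1}, s]`, where `E` is the resolvent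
of `C`. -/
def flowDer (p : ZMod 2) (C : Laurent 𝔤) : S.Aff →ₗ[ℂ] S.Aff :=
  S.ham S.c₁ p (R.h C) + gaugeDer S p fun t => S.coord S.qLow t ((R.res C).1 0)

variable {C : Laurent 𝔤}

theorem isEvol_flowDer (hp : S.HasParity p C) : IsEvol p (R.flowDer p C) :=
  (isEvol_ham (R.h_par hp)).add
    (isEvol_gaugeDer fun t => coord_qLow_par (R.res_par_coeff hp 0) t)

theorem flowDer_Qu (hC : C ∈ S.Z) (hp : S.HasParity p C) :
    S.gDer p (R.flowDer p C) S.Qu = S.gBr ((R.res C).1 (-1)) (S.s ⊗ₜ 1) := by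
  have h := gaugeDer_Qu (S := S) fun t => coord_qLow_par (R.res_par_coeff hp 0) t
  rw [flowDer, gDer_add, LinearMap.add_apply, R.ham₁_Qu hC hp, h, R.gaugePart_eq]
  simp only [map_neg, LinearMap.neg_apply, smul_neg]
  abel

/-- On the W-algebra the first flow of `C` is `X_C`, as gauge transformations act trivially
there. -/
theorem flow₁_eq (hp : S.HasParity p C) {φ : S.Aff} (hφ : φ ∈ S.W) :
    R.flow₁ C φ = R.flowDer p C φ := by
  rw [flow₁, wBr₁, affBr₁, reduce_chiBracket (R.h_par hp) hφ.1, flowDer, LinearMap.add_apply,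
    gaugeDer_W hφ, add_zero]

theorem hasParity_zMul (hp : S.HasParity p C) : S.HasParity p (Laurent.zMul C) :=
  fun n => hp (n - 1)

theorem zMul_mem_Z (hC : C ∈ S.Z) : Laurent.zMul C ∈ S.Z := by
  refine ⟨?_, fun x hx => ?_⟩
  · have h : Laurent.conv S.br S.Λsq C = 0 := hC.1
    change Laurent.conv S.br S.Λsq (Laurent.shift 1 C) = 0
    rw [Laurent.conv_shift_right, h, map_zero]
  · change Laurent.conv S.br (Laurent.shift 1 C) x = 0
    rw [Laurent.conv_shift_left, hC.2 x hx, map_zero]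

/-- The second flow of `z C` is `X_C`, as the resolvent of `z C` is `z E`. -/
theorem flow₂_zMul_eq (hC : C ∈ S.Z) (hp : S.HasParity p C) {φ : S.Aff} (hφ : φ ∈ S.P) :
    R.flow₂ (Laurent.zMul C) φ = R.flowDer p C φ := by
  have hp' := hasParity_zMul hp
  rw [flow₂, wBr₂, affBr₂, reduce_chiBracket (R.h_par hp') hφ]
  refine evol_eq_on_P (isEvol_ham (R.h_par hp')) (R.isEvol_flowDer hp) ?_ hφ
  rw [R.ham₂_Qu (zMul_mem_Z hC) hp', R.flowDer_Qu hC hp, res_zMul]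
  rfl

/-- The derivations `X_C` preserve the W-algebra, because the resolvent is gauge invariant. -/
theorem flowDer_mem_W (hC : C ∈ S.Z) (hp : S.HasParity p C) {φ : S.Aff} (hφ : φ ∈ S.W) :
    R.flowDer p C φ ∈ S.W := by
  refine mem_W_iff.2 ⟨?_, fun π n hn hπ k => ?_⟩
  · rw [← R.flow₁_eq hp hφ]
    exact S.reduce_mem_P _
  have hg := isGauge_fam hn hπ
  have hX := R.isEvol_flowDer hp
  -- It suffices that `X_C` supercommutes with the gauge family on `𝒬_u`. There the gauge variation
  -- of `X_C 𝒬_u = [E_{-1}, s]` is `-[[n, E_{-1}], s]`, and `[n, s] = 0`.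
  have hcomm := hg.chiDer.supercomm hX
  have hQ : ∀ k : ℕ, S.gDer (π + k) (S.fam π n k) (S.gDer p (R.flowDer p C) S.Qu)
      = sgn ((π + k) * p) • S.gDer p (R.flowDer p C) (S.gDer (π + k) (S.fam π n k) S.Qu) := by
    intro k
    have hres : S.gDer (π + k) (S.fam π n k) ((R.res C).1 (-1))
        = -S.gBr (S.gaugeElt n k) ((R.res C).1 (-1)) := by
      have h1 := congrArg (fun y => y.1 (-1)) (R.gauge_res hg k hp)
      have h2 : S.gDer (π + k) (S.fam π n k) ((R.res C).1 (-1))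
          + (S.lBr (Laurent.single 0 (S.gaugeElt n k)) (R.res C)).1 (-1) = 0 := h1
      rw [lBr, Laurent.conv_single_left, sub_zero] at h2
      exact eq_neg_of_add_eq_zero_left h2
    rw [R.flowDer_Qu hC hp, gDer_gBr (hg.chiDer.der k) (R.res_par_coeff hp (-1)),
      gDer_tmul_one (hg.chiDer.der k), map_zero, smul_zero, add_zero, hres, map_neg,
      LinearMap.neg_apply]
    match k with
    | 0 =>
      have hnP := gaugeElt_par (S := S) hπ 0
      rw [Nat.cast_zero, add_zero] at hnP ⊢
      have h1 := S.gBr_jacobi hnP (R.res_par_coeff hp (-1)) (S.s ⊗ₜ 1)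
      rw [gBr_𝔫_s (gaugeElt_mem hn 0), map_zero, smul_zero, add_zero] at h1
      rw [← h1, hg.act_zero, map_neg, smul_neg]
      have h2 : S.gaugeElt n 0 = n ⊗ₜ 1 := if_pos rfl
      rw [h2] at hnP ⊢
      rw [gDer_gBr hX.der hnP, gDer_tmul_one hX.der, map_zero, LinearMap.zero_apply, zero_add,
        map_add, gDer_tmul_one hX.der, add_zero, R.flowDer_Qu hC hp, smul_smul, mul_comm p,
        sgn_mul_self, one_smul]
    | 1 =>
      have h2 : S.gaugeElt n 1 = 0 := if_neg one_ne_zero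
      rw [h2, Nat.cast_one, hg.act_one, map_smul, gDer_tmul_one hX.der]
      simp
    | k + 2 =>
      have h2 : S.gaugeElt n (k + 2) = 0 := if_neg (by omega)
      rw [h2, hg.act _ (by omega)]
      simp
  have hzero : ∀ a ∈ S.P, (S.fam π n k ∘ₗ R.flowDer p C
      - sgn ((π + k) * p) • R.flowDer p C ∘ₗ S.fam π n k) a = 0 := by
    intro a ha
    rw [P_eq] at ha
    refine hcomm.eqOn (IsChiDer.zero _) ?_ ha k
    rintro _ ⟨t, ht, rfl⟩ k
    refine jet_eq_of_gDer_Qu (q := π + k + p) ?_ ht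
    rw [gDer_supercomm, hQ k, sub_self, gDer_Qu]
    exact (Finset.sum_eq_zero fun t _ => by
      rw [LinearMap.zero_apply, TensorProduct.tmul_zero, smul_zero]).symm
  have h1 := hzero φ hφ.1
  rw [LinearMap.sub_apply, LinearMap.smul_apply, LinearMap.comp_apply, LinearMap.comp_apply,
    (mem_W_iff.1 hφ).2 π n hn hπ k, map_zero, smul_zero, sub_zero] at h1
  exact h1

end Dressing

end DSData

/-! ### Compatibility, integrals of motion and the bi-Hamiltonian property -/

/-- A family of superderivations that annihilates `D g`, and of which only finitely many members act
nontrivially on `g`, annihilates `g`: apply the relation with `D` from the top index down. -/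
theorem IsChiDer.eq_zero_of_D {ι : Type*} {ε : ι → ZMod 2} {π : ZMod 2}
    {F : ℕ → DiffPoly ε →ₗ[ℂ] DiffPoly ε} (hF : IsChiDer π F) {g : DiffPoly ε}
    (hev : ∃ N, ∀ n, N ≤ n → F n g = 0) (h : ∀ n, F n (D ε g) = 0) (n : ℕ) : F n g = 0 := by
  obtain ⟨N, hN⟩ := hev
  have key : ∀ m k, N ≤ k + m → F k g = 0 := by
    intro m
    induction m with
    | zero => exact fun k hk => hN k hk
    | succ m ih =>
      intro k hk
      have h1 := h (k + 1)
      rw [hF.map_D_succ, ih (k + 1) (by omega), map_zero, smul_zero, zero_add] at h1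
      exact (smul_eq_zero.1 h1).resolve_left (sgn_ne_zero _)
  exact key N n (by omega)

namespace Laurent

variable {M : Type*} [AddCommGroup M] [Module ℂ M]

/-- The part of a Laurent series in `z⁻¹` that is polynomial in `z`. -/
def posPart (x : Laurent M) : Laurent M :=
  ⟨fun n => if 0 ≤ n then x.1 n else 0, by
    obtain ⟨N, hN⟩ := x.2
    exact ⟨N, fun n hn => by simp [hN n hn]⟩⟩

theorem posPart_of_nonneg (x : Laurent M) {n : ℤ} (hn : 0 ≤ n) : (posPart x).1 n = x.1 n :=
  if_pos hn

theorem posPart_of_neg (x : Laurent M) {n : ℤ} (hn : n < 0) : (posPart x).1 n = 0 :=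
  if_neg (not_le.2 hn)

theorem conv_posPart (B : M →ₗ[ℂ] M →ₗ[ℂ] M) {x y : Laurent M} (h : conv B x y = 0) :
    (conv B (posPart x) y).1 (-1) + (conv B x (posPart y)).1 (-1) = 0 := by
  have h1 : conv B (posPart x) y + conv B x (posPart y)
      = conv B x y + conv B (posPart x) (posPart y)
        - conv B (x - posPart x) (y - posPart y) := by
    simp only [map_sub, LinearMap.sub_apply]
    abel
  have h2 : (conv B (posPart x) (posPart y)).1 (-1) = 0 := conv_coeff_eq_zero B fun k => by
    rcases lt_or_ge k 0 with hk | hk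
    · rw [posPart_of_neg x hk, map_zero, LinearMap.zero_apply]
    · rw [posPart_of_neg y (by omega : -1 - k < 0), map_zero]
  have h3 : (conv B (x - posPart x) (y - posPart y)).1 (-1) = 0 := conv_coeff_eq_zero B fun k => by
    have h4 : ∀ (z : Laurent M) n, 0 ≤ n → (z - posPart z).1 n = 0 := fun z n hn =>
      (sub_eq_zero.2 (posPart_of_nonneg z hn).symm :)
    rcases lt_or_ge k 0 with hk | hk
    · rw [h4 y _ (by omega : 0 ≤ -1 - k), map_zero]
    · rw [h4 x _ hk, map_zero, LinearMap.zero_apply]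
  have h5 := congrArg (fun z => z.1 (-1)) h1
  rw [h, zero_add] at h5
  exact h5.trans ((congrArg₂ (· - ·) h2 h3).trans (sub_zero 0))

end Laurent

theorem FLie.obr_zero_right {M : Type*} [AddCommGroup M] [Module ℂ M] {𝓖 : FLie M}
    (p q : ZMod 2) (X : 𝓖.Op) (x : M) :
    𝓖.obr p q X (0, x) = (0, X.1.1 x + 𝓖.br X.2 x) := by
  refine FLie.op_ext (fun v => ?_) ?_
  · rw [FLie.obr_fst]
    change X.1.1 ((0 : M →ₗ[ℂ] M) v) - sgn (p * q) • (0 : M →ₗ[ℂ] M) _ = 0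
    simp
  · rw [FLie.obr_snd]
    change _ - sgn (p * q) • (0 : M →ₗ[ℂ] M) _ + _ = _
    rw [LinearMap.zero_apply, smul_zero, sub_zero]

namespace DSData

variable {𝔤 ι : Type*} [AddCommGroup 𝔤] [Module ℂ 𝔤] [Fintype ι] [DecidableEq ι]
  {S : DSData 𝔤 ι}

theorem W_add {a b : S.Aff} (ha : a ∈ S.W) (hb : b ∈ S.W) : a + b ∈ S.W := by
  rw [mem_W_iff] at ha hb ⊢
  exact ⟨add_mem ha.1 hb.1, fun π n hn hπ k => by
    rw [map_add, ha.2 π n hn hπ k, hb.2 π n hn hπ k, add_zero]⟩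

/-- If a total derivative is gauge invariant, then so is its primitive. -/
theorem mem_W_of_D {g : S.Aff} (hg : g ∈ S.P) (h : S.D g ∈ S.W) : g ∈ S.W :=
  mem_W_iff.2 ⟨hg, fun π n hn hπ => (isChiDer_fam hπ).eq_zero_of_D (fam_eventually hπ g)
    ((mem_W_iff.1 h).2 π n hn hπ)⟩

namespace Dressing

variable (R : S.Dressing) {p q : ZMod 2} {C C' : Laurent 𝔤}

theorem posPart_res_par (hp : S.HasParity p C) :
    S.𝓖.P (Laurent.posPart (R.res C)) = sgn p • Laurent.posPart (R.res C) := by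
  rw [𝓖_par_iff]
  intro n
  rcases lt_or_ge n 0 with hn | hn
  · rw [Laurent.posPart_of_neg _ hn, map_zero, smul_zero]
  · rw [Laurent.posPart_of_nonneg _ hn, R.res_par_coeff hp]

/-- The operator `X_C + E_+`, where `E_+` is the polynomial part of the resolvent of `C`. -/
def flowOp (p : ZMod 2) (C : Laurent 𝔤) : S.𝓖.Op :=
  S.opOf p (R.flowDer p C) (Laurent.posPart (R.res C))

theorem flowOp_isOp (hp : S.HasParity p C) : R.flowOp p C ∈ S.𝓖.isOp p :=
  opOf_isOp (R.isEvol_flowDer hp).der (R.posPart_res_par hp)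

/-- The zero curvature equation of the flow of `C`. -/
theorem obr_flowOp_lax (hC : C ∈ S.Z) (hp : S.HasParity p C) :
    S.𝓖.obr p 1 (R.flowOp p C) (S.toOp (1, 0, lax S)) = 0 := by
  have hX := R.isEvol_flowDer hp
  rw [flowOp, obr_evol_lax hX, lDer_lax hX.der, R.flowDer_Qu hC hp]
  refine congrArg (Prod.mk 0) (Laurent.ext' fun n => ?_)
  change (Laurent.single 0 (S.gBr ((R.res C).1 (-1)) (S.s ⊗ₜ 1))).1 n
    - sgn p • (S.lD (Laurent.posPart (R.res C))).1 n
    + (S.lBr (Laurent.posPart (R.res C)) (lax S)).1 n = 0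
  have h := R.lax_res_coeff hC hp n
  rw [lBr_lax_coeff, S.lD_eq, lDer_coeff, Laurent.single_coeff]
  rcases lt_trichotomy n 0 with hn | rfl | hn
  · rw [if_neg hn.ne, Laurent.posPart_of_neg _ hn, Laurent.posPart_of_neg _ (by omega : n - 1 < 0)]
    simp
  · rw [if_pos rfl, Laurent.posPart_of_nonneg _ le_rfl, Laurent.posPart_of_neg _ (by omega)]
    rw [zero_sub] at h
    rw [map_zero, LinearMap.zero_apply, add_zero, sub_add_eq_add_sub, add_sub_assoc, h,
      add_neg_cancel]
  · rw [if_neg hn.ne', Laurent.posPart_of_nonneg _ hn.le, Laurent.posPart_of_nonneg _ (by omega),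
      zero_sub, ← add_assoc, neg_add_eq_sub, h, neg_add_cancel]

/-- The matrix part of the dressed operator `X_C + E_+`. -/
def flowRes (p : ZMod 2) (C : Laurent 𝔤) : S.LGA := (R.conj (R.flowOp p C)).2

theorem conj_flowOp : R.conj (R.flowOp p C) = S.opOf p (R.flowDer p C) (R.flowRes p C) :=
  R.conj_opOf (Laurent.posPart (R.res C))

theorem flowRes_par (hp : S.HasParity p C) :
    S.𝓖.P (R.flowRes p C) = sgn p • R.flowRes p C := (R.conj_isOp (R.flowOp_isOp hp)).2

theorem obr_flowRes (hC : C ∈ S.Z) (hp : S.HasParity p C) :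
    S.𝓖.obr p 1 (S.opOf p (R.flowDer p C) (R.flowRes p C)) (S.toOp (1, 0, R.KΛ)) = 0 := by
  have h := (congrArg R.conj (R.obr_flowOp_lax hC hp)).trans (LinearMap.map_zero R.conj)
  exact (congrArg₂ (fun X Y => S.𝓖.obr p 1 X Y) R.conj_flowOp R.conj_toOp_lax).symm.trans
    ((R.conj_obr (R.flowOp_isOp hp) (lax_isOp (S := S))).symm.trans h)

theorem mem_kerSub_of_evol {d : S.Aff →ₗ[ℂ] S.Aff} (hd : IsEvol p d) {y : S.LGA}
    (hy : S.𝓖.P y = sgn p • y)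
    (h : S.𝓖.obr p 1 (S.opOf p d y) (S.toOp (1, 0, R.KΛ)) = 0) : y ∈ S.kerSub :=
  R.mem_kerSub_of_commute (opOf_isOp hd.der hy) (S.lDer_tensorOne hd.der _) h

theorem flowRes_mem (hC : C ∈ S.Z) (hp : S.HasParity p C) : R.flowRes p C ∈ S.kerSub :=
  R.mem_kerSub_of_evol (R.isEvol_flowDer hp) (R.flowRes_par hp) (R.obr_flowRes hC hp)

/-- If the dressings of `X` and of the resolvent of `C` commute, then so do `X` and the
resolvent. -/
theorem act_res_eq_zero {X Y : S.𝓖.Op} (hX : X ∈ S.𝓖.isOp p) (hq : S.HasParity q C)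
    (hXY : R.conj X = Y) (h : Y.1.1 (S.tensorOne C) + S.𝓖.br Y.2 (S.tensorOne C) = 0) :
    X.1.1 (R.res C) + S.𝓖.br X.2 (R.res C) = 0 := by
  refine R.conj_injective ?_
  have h2 := (R.conj_obr hX (zero_isOp (R.res_par hq))).trans
    (congrArg₂ (fun X Y => S.𝓖.obr p q X Y) hXY (R.conj_res C))
  have h3 := (congrArg R.conj (FLie.obr_zero_right p q X (R.res C))).symm.trans
    (h2.trans (FLie.obr_zero_right p q Y (S.tensorOne C)))
  exact (congrArg Prod.snd h3).trans h

theorem evol_res {d : S.Aff →ₗ[ℂ] S.Aff} (hd : IsSDer p d) {y y' : S.LGA}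
    (hy : S.𝓖.P y = sgn p • y) (hq : S.HasParity q C)
    (hyy' : R.conj (S.opOf p d y) = S.opOf p d y') (h : S.lBr y' (S.tensorOne C) = 0) :
    S.lDer p d (R.res C) + S.lBr y (R.res C) = 0 := by
  have h1 : S.lDer p d (S.tensorOne C) + S.lBr y' (S.tensorOne C) = 0 := by
    rw [S.lDer_tensorOne hd, h, add_zero]
  have h2 := R.act_res_eq_zero (X := S.opOf p d y) (Y := S.opOf p d y') (opOf_isOp hd hy) hq hyy' h1
  exact h2

/-- The resolvents evolve by `X_C E' = -[E_+, E']`. -/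
theorem flowDer_res (hC : C ∈ S.Z) (hp : S.HasParity p C) (hC' : C' ∈ S.Z)
    (hq : S.HasParity q C') :
    S.lDer p (R.flowDer p C) (R.res C') + S.lBr (Laurent.posPart (R.res C)) (R.res C') = 0 :=
  R.evol_res (R.isEvol_flowDer hp).der (R.posPart_res_par hp) hq R.conj_flowOp
    (lBr_center' hC' hq (R.flowRes_mem hC hp) (R.flowRes_par hp))

theorem lBr_res_res (hC : C ∈ S.Z) (hp : S.HasParity p C) (hC' : C' ∈ S.Z)
    (hq : S.HasParity q C') : S.lBr (R.res C) (R.res C') = 0 := by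
  have h0 : Laurent.conv S.br C C' = 0 := hC.2 C' hC'.1
  have h1 : S.lBr (S.tensorOne C) (S.tensorOne C') = 0 := by rw [← S.tensorOne_conv, h0, map_zero]
  have h := R.act_res_eq_zero (zero_isOp (R.res_par hp)) hq (R.conj_res C)
    ((zero_add _).trans h1)
  exact (zero_add _).symm.trans h

/-- The derivations `X_C` supercommute on `𝒫`: on the universal Lax operator this is the
antisymmetry of the coefficient of `z⁻¹` in `[E_+, E']`, a consequence of `[E, E'] = 0`. -/
theorem flowDer_comm (hC : C ∈ S.Z) (hp : S.HasParity p C) (hC' : C' ∈ S.Z)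
    (hq : S.HasParity q C') {φ : S.Aff} (hφ : φ ∈ S.P) :
    R.flowDer p C (R.flowDer q C' φ) = sgn (p * q) • R.flowDer q C' (R.flowDer p C φ) := by
  have hX := R.isEvol_flowDer hp
  have hY := R.isEvol_flowDer hq
  have hev : IsEvol (p + q) (R.flowDer p C ∘ₗ R.flowDer q C'
      - sgn (p * q) • R.flowDer q C' ∘ₗ R.flowDer p C) := by
    refine ⟨hX.der.supercomm hY.der, fun b => ?_⟩
    simp only [LinearMap.sub_apply, LinearMap.smul_apply, LinearMap.comp_apply, hX.map_D, hY.map_D,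
      map_smul, map_sub, smul_sub, smul_smul, sgn_add]
    congr 2 <;> ring
  have hcoeff : ∀ {p q : ZMod 2} {C C' : Laurent 𝔤}, C ∈ S.Z → S.HasParity p C → C' ∈ S.Z →
      S.HasParity q C' → S.gDer p (R.flowDer p C) (S.gDer q (R.flowDer q C') S.Qu)
        = -S.gBr ((S.lBr (Laurent.posPart (R.res C)) (R.res C')).1 (-1)) (S.s ⊗ₜ 1) := by
    intro p q C C' hC hp hC' hq
    have hX := (R.isEvol_flowDer hp).der
    have h1 : S.gDer p (R.flowDer p C) ((R.res C').1 (-1))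
        + (S.lBr (Laurent.posPart (R.res C)) (R.res C')).1 (-1) = 0 :=
      congrArg (fun z => z.1 (-1)) (R.flowDer_res hC hp hC' hq)
    rw [R.flowDer_Qu hC' hq, gDer_gBr hX (R.res_par_coeff hq _), gDer_tmul_one hX, map_zero,
      smul_zero, add_zero, eq_neg_of_add_eq_zero_left h1, map_neg, LinearMap.neg_apply]
  have hskew : sgn (p * q) • (S.lBr (Laurent.posPart (R.res C')) (R.res C)).1 (-1)
      = -(S.lBr (R.res C) (Laurent.posPart (R.res C'))).1 (-1) := by
    have h := congrArg (fun z => z.1 (-1))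
      (S.𝓖.skew p q _ _ (R.res_par hp) (R.posPart_res_par hq))
    change (S.lBr (R.res C) (Laurent.posPart (R.res C'))).1 (-1)
      = -(sgn (p * q) • (S.lBr (Laurent.posPart (R.res C')) (R.res C)).1 (-1)) at h
    rw [h, neg_neg]
  have hQ : S.gDer (p + q) (R.flowDer p C ∘ₗ R.flowDer q C'
      - sgn (p * q) • R.flowDer q C' ∘ₗ R.flowDer p C) S.Qu = 0 := by
    have h := Laurent.conv_posPart _ (R.lBr_res_res hC hp hC' hq)
    rw [gDer_supercomm, hcoeff hC hp hC' hq, hcoeff hC' hq hC hp, smul_neg, sub_neg_eq_add,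
      ← LinearMap.smul_apply, ← map_smul, hskew, map_neg, LinearMap.neg_apply, ← neg_add,
      ← LinearMap.add_apply, ← map_add]
    rw [show (S.lBr (Laurent.posPart (R.res C)) (R.res C')).1 (-1)
      + (S.lBr (R.res C) (Laurent.posPart (R.res C'))).1 (-1) = 0 from h, map_zero,
      LinearMap.zero_apply, neg_zero]
  have h0 : S.gDer (p + q) (0 : S.Aff →ₗ[ℂ] S.Aff) S.Qu = 0 := by
    rw [gDer, TensorProduct.map_zero_right, LinearMap.zero_apply]
  have h := evol_eq_on_P hev (IsChiDer.zero _).isEvol (hQ.trans h0.symm) hφ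
  exact sub_eq_zero.1 h

/-- `X_C h_{C'}` is the total derivative of `±(R_C | C' ⊗ 1)`, where `R_C` is the matrix part of
the dressed operator `X_C + E_+`. -/
theorem flowDer_h (hC : C ∈ S.Z) (hp : S.HasParity p C) (hC' : C' ∈ S.Z)
    (hq : S.HasParity q C') :
    R.flowDer p C (R.h C') = sgn p • S.D (S.lFormL (R.flowRes p C) (S.tensorOne C')) := by
  have hX := R.isEvol_flowDer hp
  have h := R.obr_flowRes hC hp
  rw [obr_evol_lax hX] at h
  have h1 : S.lDer p (R.flowDer p C) R.KΛ - sgn p • S.lD (R.flowRes p C)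
      + S.lBr (R.flowRes p C) R.KΛ = 0 := congrArg Prod.snd h
  have h2 := congrArg (fun z => S.lFormL z (S.tensorOne C')) h1
  simp only [map_add, map_sub, map_smul, LinearMap.add_apply, LinearMap.sub_apply,
    LinearMap.smul_apply, map_zero, LinearMap.zero_apply, R.lFormL_lDer_KΛ hX.der,
    lFormL_lD_tensorOne (R.flowRes_par hp), R.lFormL_lBr_KΛ hC' hq, add_zero] at h2
  exact sub_eq_zero.1 h2

theorem exists_flow_h (hC : C ∈ S.Z) (hp : S.HasParity p C) (hC' : C' ∈ S.Z)
    (hq : S.HasParity q C') : ∃ g ∈ S.W, R.flow₁ C (R.h C') = S.D g := by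
  have hW := R.flowDer_mem_W hC hp (R.h_mem_W C')
  have h : R.flowDer p C (R.h C')
      = S.D (S.reduce (sgn p • S.lFormL (R.flowRes p C) (S.tensorOne C'))) := by
    rw [← reduce_D, map_smul, ← R.flowDer_h hC hp hC' hq, reduce_of_mem_P _ hW.1]
  exact ⟨_, mem_W_of_D (S.reduce_mem_P _) (h ▸ hW), by rw [R.flow₁_eq hp (R.h_mem_W C'), h]⟩

/-! ### Arbitrary elements of the center -/

variable (S) in
/-- The component of parity `p` of an element of `𝔤((z⁻¹))`. -/
def parPart (p : ZMod 2) : Laurent 𝔤 →ₗ[ℂ] Laurent 𝔤 := Laurent.map (gradeComp S.internal p)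

theorem hasParity_parPart (p : ZMod 2) (C : Laurent 𝔤) : S.HasParity p (parPart S p C) :=
  fun _ => gradeComp_mem _ _ _

theorem parPart_add (C : Laurent 𝔤) : parPart S 0 C + parPart S 1 C = C :=
  Laurent.ext' fun n => S.gradeComp_add (C.1 n)

theorem parPart_eq (C : Laurent 𝔤) (p : ZMod 2) :
    parPart S p C = (1 / 2 : ℂ) • (C + sgn p • Laurent.map S.gParity C) := by
  have h : Laurent.map S.gParity C = parPart S 0 C - parPart S 1 C := rfl
  have h2 : (1 / 2 : ℂ) • (parPart S p C + parPart S p C) = parPart S p C := by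
    rw [← two_smul ℂ, smul_smul]
    norm_num
  rw [h]
  nth_rw 2 [← parPart_add (S := S) C]
  rw [← h2]
  congr 1
  rcases zmod2_cases p with rfl | rfl
  · rw [sgn_zero, one_smul]; abel
  · rw [sgn_one]; module

theorem parPart_mem_Z {C : Laurent 𝔤} (hC : C ∈ S.Z) (p : ZMod 2) : parPart S p C ∈ S.Z := by
  have hker : ∀ x ∈ S.kerΛ, Laurent.map S.gParity x ∈ S.kerΛ := fun x hx => by
    have h : Laurent.conv S.br S.Λsq x = 0 := hx
    change Laurent.conv S.br S.Λsq (Laurent.map S.gParity x) = 0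
    rw [← S.gParity_Λsq, ← S.gParity_conv, h, map_zero]
  have hinv : ∀ x : Laurent 𝔤, Laurent.map S.gParity (Laurent.map S.gParity x) = x := fun x =>
    Laurent.ext' fun n => S.gParity_gParity (x.1 n)
  rw [parPart_eq]
  refine ⟨S.kerΛ.smul_mem _ (add_mem hC.1 (S.kerΛ.smul_mem _ (hker C hC.1))), fun x hx => ?_⟩
  have h : Laurent.conv S.br (Laurent.map S.gParity C) x = 0 := by
    rw [← hinv x, ← S.gParity_conv, hC.2 _ (hker x hx), map_zero]
  rw [map_smul, map_add, map_smul, LinearMap.smul_apply, LinearMap.add_apply, LinearMap.smul_apply,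
    hC.2 x hx, h, smul_zero, add_zero, smul_zero]

theorem chiBracket_h (c : ι → ι → ℕ → S.Aff) (C : Laurent 𝔤) (φ : S.Aff) :
    chiBracket S.barPar c (R.h C) φ 0 = chiBracket S.barPar c (R.h (parPart S 0 C)) φ 0
      + chiBracket S.barPar c (R.h (parPart S 1 C)) φ 0 := by
  have h : R.h C = R.h (parPart S 0 C) + R.h (parPart S 1 C) := by
    rw [h_eq, h_eq, h_eq, ← map_add, ← map_add, parPart_add]
  have h0 := R.h_par (hasParity_parPart (S := S) 0 C)
  have h1 := R.h_par (hasParity_parPart (S := S) 1 C)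
  rw [chiBracket_eq_add, h, map_add, map_add, component_of_isPar h0, component_of_isPar h0,
    component_of_isPar h1, component_of_isPar h1, if_neg (by decide), if_pos (by decide),
    if_pos (by decide), if_neg (by decide), zero_add, add_zero, add_comm]

theorem flow₁_add (C : Laurent 𝔤) (φ : S.Aff) :
    R.flow₁ C φ = R.flow₁ (parPart S 0 C) φ + R.flow₁ (parPart S 1 C) φ :=
  (congrArg S.reduce (R.chiBracket_h S.c₁ C φ)).trans (map_add _ _ _)

theorem flow₂_add (C : Laurent 𝔤) (φ : S.Aff) :
    R.flow₂ C φ = R.flow₂ (parPart S 0 C) φ + R.flow₂ (parPart S 1 C) φ :=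
  (congrArg S.reduce (R.chiBracket_h S.c₂ C φ)).trans (map_add _ _ _)

theorem flow₁_mem_W {C : Laurent 𝔤} (hC : C ∈ S.Z) {φ : S.Aff} (hφ : φ ∈ S.W) :
    R.flow₁ C φ ∈ S.W := by
  have h : ∀ p, R.flow₁ (parPart S p C) φ ∈ S.W := fun p => by
    rw [R.flow₁_eq (hasParity_parPart p C) hφ]
    exact R.flowDer_mem_W (parPart_mem_Z hC p) (hasParity_parPart p C) hφ
  rw [flow₁_add]
  exact W_add (h 0) (h 1)

theorem flow₁_comm {C C' : Laurent 𝔤} (hC : C ∈ S.Z) (hC' : C' ∈ S.Z) (hp : S.HasParity p C)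
    (hq : S.HasParity q C') {φ : S.Aff} (hφ : φ ∈ S.W) :
    R.flow₁ C (R.flow₁ C' φ) = sgn (p * q) • R.flow₁ C' (R.flow₁ C φ) := by
  rw [R.flow₁_eq hp (R.flow₁_mem_W hC' hφ), R.flow₁_eq hq (R.flow₁_mem_W hC hφ),
    R.flow₁_eq hq hφ, R.flow₁_eq hp hφ, R.flowDer_comm hC hp hC' hq hφ.1]

theorem exists_flow₁_h {C C' : Laurent 𝔤} (hC : C ∈ S.Z) (hC' : C' ∈ S.Z) :
    ∃ g ∈ S.W, R.flow₁ C (R.h C') = S.D g := by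
  have key : ∀ p, ∃ g ∈ S.W, R.flow₁ (parPart S p C) (R.h C') = S.D g := by
    intro p
    have hp := hasParity_parPart (S := S) p C
    obtain ⟨g, hg, h⟩ := R.exists_flow_h (parPart_mem_Z hC p) hp (parPart_mem_Z hC' 0)
      (hasParity_parPart 0 C')
    obtain ⟨g', hg', h'⟩ := R.exists_flow_h (parPart_mem_Z hC p) hp (parPart_mem_Z hC' 1)
      (hasParity_parPart 1 C')
    refine ⟨g + g', W_add hg hg', ?_⟩
    rw [map_add, ← h, ← h', R.flow₁_eq hp (R.h_mem_W _), R.flow₁_eq hp (R.h_mem_W _),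
      R.flow₁_eq hp (R.h_mem_W _), ← map_add]
    rw [h_eq, h_eq, h_eq, ← map_add, ← map_add, parPart_add]
  obtain ⟨g, hg, h⟩ := key 0
  obtain ⟨g', hg', h'⟩ := key 1
  exact ⟨g + g', W_add hg hg', by rw [flow₁_add, h, h', map_add]⟩

theorem flow₁_eq_flow₂ {C : Laurent 𝔤} (hC : C ∈ S.Z) {φ : S.Aff} (hφ : φ ∈ S.W) :
    R.flow₁ C φ = R.flow₂ (Laurent.zMul C) φ := by
  have h : ∀ p, R.flow₁ (parPart S p C) φ = R.flow₂ (parPart S p (Laurent.zMul C)) φ := fun p =>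
    (R.flow₁_eq (hasParity_parPart p C) hφ).trans
      (R.flow₂_zMul_eq (parPart_mem_Z hC p) (hasParity_parPart p C) hφ.1).symm
  rw [flow₁_add, flow₂_add, h, h]

end Dressing

end DSData

end SuperDS

end

theorem mainTheorem2 {𝔤 ι : Type*} [AddCommGroup 𝔤] [Module ℂ 𝔤] [Fintype ι] [DecidableEq ι]
    (S : SuperDS.DSData 𝔤 ι) :
    -- the canonical form and its dressing exist
    Nonempty S.Dressing ∧ ∀ R : S.Dressing,
      -- the variables, the Hamiltonian densities and the flows live on the W-algebra
      (∀ t ∈ S.I \ S.J, R.w t ∈ S.W) ∧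
      (∀ C ∈ S.Z, R.h C ∈ S.W ∧ ∀ φ ∈ S.W, R.flow₁ C φ ∈ S.W) ∧
      -- pairwise compatibility: the derivations `d/dt_C` of the W-algebra supercommute
      (∀ p q : ZMod 2, ∀ C ∈ S.Z, ∀ C' ∈ S.Z, S.HasParity p C → S.HasParity q C' → ∀ φ ∈ S.W,
        R.flow₁ C (R.flow₁ C' φ) = SuperDS.sgn (p * q) • R.flow₁ C' (R.flow₁ C φ)) ∧
      -- integrals of motion: `{∫ h_C, ∫ h_C'}_1 = 0` modulo total derivatives of the W-algebra
      (∀ C ∈ S.Z, ∀ C' ∈ S.Z, ∃ g ∈ S.W, R.flow₁ C (R.h C') = S.D g) ∧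
      -- the bi-Hamiltonian property, for the generators `w_t` and on the whole W-algebra
      (∀ C ∈ S.Z, SuperDS.Laurent.zMul C ∈ S.Z ∧
        (∀ t ∈ S.I \ S.J, R.flow₁ C (R.w t) = R.flow₂ (SuperDS.Laurent.zMul C) (R.w t)) ∧
        ∀ φ ∈ S.W, R.flow₁ C φ = R.flow₂ (SuperDS.Laurent.zMul C) φ) := by
  refine ⟨S.nonempty_dressing, fun R => ⟨fun t ht => R.w_mem_W ht,
    fun C hC => ⟨R.h_mem_W C, fun φ hφ => R.flow₁_mem_W hC hφ⟩,
    fun p q C hC C' hC' hp hq φ hφ => R.flow₁_comm hC hC' hp hq hφ,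
    fun C hC C' hC' => R.exists_flow₁_h hC hC', fun C hC => ⟨?_, ?_, ?_⟩⟩⟩
  · exact SuperDS.DSData.Dressing.zMul_mem_Z hC
  · exact fun t ht => R.flow₁_eq_flow₂ hC (R.w_mem_W ht)
  · exact fun φ hφ => R.flow₁_eq_flow₂ hC hφ
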